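/- \textbf{Setting.} Let $I=[0,1]$ or $I=\mathbb{S}^1=\mathbb{R}/\mathbb{Z}$. Let $E(I)=\mathcal{C}^\infty(I,\mathbb{R}^2)/\mathbb{R}^2$ be the space of smooth curves $\gamma\colon I\to\mathbb{R}^2$ modulo translations, graded by the seminorms $\|\gamma\|_{\mathcal{C}^n}=\sum_{j=1}^n\max_{s\in I}|\gamma^{(j)}(s)|$, $n\ge 0$, and with the topology that they define. Let $$\mathcal{C}(I)=\{\gamma\in E(I):\gamma'(s)\neq 0\ \ \forall s\in I\},\qquad \mathcal{C}_1(I)=\Big\{\gamma\in\mathcal{C}(I):\int_0^1|\gamma'(s)|\,ds=1\Big\},$$ $$\mathcal{A}_1(I)=\{\gamma\in\mathcal{C}(I):|\gamma'(s)|=1\ \ \forall s\in I\};$$ $\mathcal{C}(I)$ is an open subset of $E(I)$ and carries the atlas whose only chart is the inclusion $\mathcal{C}(I)\hookrightarrow E(I)$. \textbf{Definitions.} A linear map $L$ between graded spaces is tame if for some $r,b$ one has $\|Lf\|_n\le C_n\|f\|_{n+r}$ for all $n\ge b$. A graded Fréchet space $F$ is tame if there are a Banach space $B$ and tame linear maps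 $L\colon F\to\Sigma(B)$, $M\colon\Sigma(B)\to F$ with $M\circ L=\mathrm{id}$, where $\Sigma(B)$ is the space of sequences $(f_k)_{k\ge 0}$ in $B$ with $\|(f_k)\|_n=\sum_k e^{nk}\|f_k\|_B<\infty$ for all $n$. A map on an open set is tame if it is continuous and near each point satisfies $\|P(f)\|_n\le C_n(1+\|f\|_{n+r})$ for all $n\ge b$ (with $r,b,C_n$ depending on the neighbourhood); it is smooth tame if all its iterated directional derivatives $D^kP(f)\{h_1,\dots,h_k\}$ exist and are tame maps of $(f,h_1,\dots,h_k)$. A tame Fréchet manifold is a Hausdorff space with an atlas of charts in tame Fréchet spaces with smooth tame coordinate changes. A tame $\mathcal{C}^\infty$-submanifold of a tame Fréchet manifold $N$ is a closed subset $S$ such that every point of $S$ lies in the domain $U$ of a chart of the maximal atlas of $N$, with values in a product $F\times G$ of tame Fréchet spaces, for which $S\cap U$ is the set of points mapped into $F\times 0$ (a slice chart); $S$ carries the atlas of the restrictions $S\cap U\to F$ of the slice charts, and its tangent space at a point consists of the vectors that the derivative of a slice chart maps into $F\times 0$. \textbf{Theorem.} $\mathcal{C}(I)$ is a tame Fréchet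 manifold, and $\mathcal{A}_1(I)$ is a tame $\mathcal{C}^\infty$-submanifold of $\mathcal{C}(I)$. Moreover $\mathcal{C}_1(I)$ is a tame $\mathcal{C}^\infty$-submanifold of $\mathcal{C}(I)$, its induced atlas makes it a tame Fréchet manifold, and $\mathcal{A}_1(I)\subseteq\mathcal{C}_1(I)$ is also a tame $\mathcal{C}^\infty$-submanifold of $\mathcal{C}_1(I)$. The tangent space of $\mathcal{A}_1(I)$ at $\gamma\in\mathcal{A}_1(I)$, as a subspace of $T_\gamma\mathcal{C}(I)=E(I)$, is $$T_\gamma\mathcal{A}_1(I)=\{w\in\mathcal{C}^\infty(I,\mathbb{R}^2)/\mathbb{R}^2 : w'(s)\cdot\gamma'(s)=0\ \ \forall s\in I\}.$$ -/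

import Mathlib

open Set Filter Topology
open scoped ContDiff

noncomputable section

/-! ## Graded spaces, Fréchet spaces and tame Fréchet spaces -/

/-- A grading of a real vector space: an increasing sequence of seminorms `‖·‖₀ ≤ ‖·‖₁ ≤ …`.
That it induces the topology is part of `IsFrechetSpace`. -/
class Grading (E : Type*) [AddCommGroup E] [Module ℝ E] where
  seminorm : SeminormFamily ℝ E ℕ
  mono : Monotone seminorm

/-- The `n`-th seminorm of the grading. -/
def gnorm {E : Type*} [AddCommGroup E] [Module ℝ E] [Grading E] (n : ℕ) (f : E) : ℝ :=
  Grading.seminorm (E := E) n f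

/-- The product grading `‖(f, g)‖ₙ = ‖f‖ₙ + ‖g‖ₙ`. -/
instance Grading.instProd {E F : Type*} [AddCommGroup E] [Module ℝ E] [Grading E]
    [AddCommGroup F] [Module ℝ F] [Grading F] : Grading (E × F) where
  seminorm n := (Grading.seminorm (E := E) n).comp (LinearMap.fst ℝ E F) +
    (Grading.seminorm (E := F) n).comp (LinearMap.snd ℝ E F)
  mono _ _ h x := add_le_add (Grading.mono (E := E) h x.1) (Grading.mono (E := F) h x.2)

/-- The grading `‖h‖ₙ = ∑ i, ‖h i‖ₙ` of a finite power. -/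
instance Grading.instPi {ι : Type*} [Fintype ι] {E : Type*} [AddCommGroup E] [Module ℝ E]
    [Grading E] : Grading (ι → E) where
  seminorm n := ∑ i, (Grading.seminorm (E := E) n).comp (LinearMap.proj i)
  mono _ _ h x := by
    simp only [FunLike.coe_sum, Finset.sum_apply, Seminorm.comp_apply]
    exact Finset.sum_le_sum fun i _ => Grading.mono (E := E) h (x i)

/-- A graded Fréchet space: the topology is the one defined by the grading, it is Hausdorff, and
every Cauchy sequence converges. -/
structure IsFrechetSpace (E : Type*) [AddCommGroup E] [Module ℝ E] [TopologicalSpace E]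
    [Grading E] : Prop where
  withSeminorms : WithSeminorms (Grading.seminorm (E := E))
  t2 : T2Space E
  complete : ∀ u : ℕ → E,
    (∀ n : ℕ, ∀ ε > 0, ∃ N : ℕ, ∀ i ≥ N, ∀ j ≥ N, gnorm n (u i - u j) < ε) →
    ∃ x, Tendsto u atTop (𝓝 x)

/-- A tame linear map between graded spaces: there are a degree `r` and a base `b` such that
`‖L f‖ₙ ≤ Cₙ ‖f‖ₙ₊ᵣ` for all `n ≥ b`. -/
def IsTameLinear {E F : Type*} [AddCommGroup E] [Module ℝ E] [Grading E]
    [AddCommGroup F] [Module ℝ F] [Grading F] (L : E →ₗ[ℝ] F) : Prop :=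
  ∃ r b : ℕ, ∀ n ≥ b, ∃ C : ℝ, ∀ f : E, gnorm n (L f) ≤ C * gnorm (n + r) f

/-- The space `Σ(B)` of exponentially decreasing sequences in `B`, i.e. sequences such that
`∑ₖ exp(n k) ‖f k‖ < ∞` for all `n`. -/
def ExpDecreasing (B : Type*) [NormedAddCommGroup B] [NormedSpace ℝ B] : Submodule ℝ (ℕ → B) where
  carrier := {f | ∀ n : ℕ, Summable fun k : ℕ => Real.exp (n * k) * ‖f k‖}
  zero_mem' n := by simp
  add_mem' {f g} hf hg n := by
    refine Summable.of_nonneg_of_le (fun k => by positivity) (fun k => ?_) ((hf n).add (hg n))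
    rw [← mul_add]
    exact mul_le_mul_of_nonneg_left (norm_add_le _ _) (Real.exp_pos _).le
  smul_mem' c f hf n := by
    refine ((hf n).mul_left ‖c‖).congr fun k => ?_
    simp only [Pi.smul_apply, norm_smul]
    ring

/-- The grading `‖f‖ₙ = ∑ₖ exp(n k) ‖f k‖` of `Σ(B)`. -/
instance ExpDecreasing.instGrading (B : Type*) [NormedAddCommGroup B] [NormedSpace ℝ B] :
    Grading (ExpDecreasing B) where
  seminorm n := Seminorm.of (fun f => ∑' k : ℕ, Real.exp (n * k) * ‖f.1 k‖)
    (fun f g => by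
      rw [← (f.2 n).tsum_add (g.2 n)]
      refine ((f + g).2 n).tsum_le_tsum (fun k => ?_) ((f.2 n).add (g.2 n))
      rw [← mul_add]
      exact mul_le_mul_of_nonneg_left (norm_add_le _ _) (Real.exp_pos _).le)
    (fun c f => by
      rw [← tsum_mul_left]
      refine tsum_congr fun k => ?_
      simp only [Submodule.coe_smul, Pi.smul_apply, norm_smul]
      ring)
  mono n m h f := by
    refine (f.2 n).tsum_le_tsum (fun k => ?_) (f.2 m)
    have : (n : ℝ) ≤ m := by exact_mod_cast h
    gcongr

/-- A tame Fréchet space: a graded Fréchet space that is a tame direct summand of `Σ(B)` for some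
Banach space `B`. -/
def IsTameFrechetSpace (E : Type) [AddCommGroup E] [Module ℝ E] [TopologicalSpace E]
    [Grading E] : Prop :=
  IsFrechetSpace E ∧
    ∃ (B : Type) (_ : NormedAddCommGroup B) (_ : NormedSpace ℝ B) (_ : CompleteSpace B)
      (L : E →ₗ[ℝ] ExpDecreasing B) (M : ExpDecreasing B →ₗ[ℝ] E),
      IsTameLinear L ∧ IsTameLinear M ∧ ∀ f, M (L f) = f

/-! ## Smooth tame maps -/

/-- `P` is a tame map on the open set `U`: it is continuous and satisfies a tame estimate
`‖P f‖ₙ ≤ Cₙ (1 + ‖f‖ₙ₊ᵣ)`, `n ≥ b`, in a neighbourhood of each point of `U`. -/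
def IsTameOn {E F : Type*} [AddCommGroup E] [Module ℝ E] [TopologicalSpace E] [Grading E]
    [AddCommGroup F] [Module ℝ F] [TopologicalSpace F] [Grading F]
    (P : E → F) (U : Set E) : Prop :=
  ContinuousOn P U ∧
    ∀ x ∈ U, ∃ V ∈ 𝓝 x, ∃ r b : ℕ, ∀ n ≥ b, ∃ C : ℝ, ∀ f ∈ V ∩ U,
      gnorm n (P f) ≤ C * (1 + gnorm (n + r) f)

/-- `y` is the directional derivative of `P` at `f` in the direction `h`. -/
def HasDirDeriv {E F : Type*} [AddCommGroup E] [Module ℝ E]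
    [AddCommGroup F] [Module ℝ F] [TopologicalSpace F] (P : E → F) (f h : E) (y : F) : Prop :=
  Tendsto (fun t : ℝ => t⁻¹ • (P (f + t • h) - P f)) (𝓝[≠] 0) (𝓝 y)

/-- `P` is a smooth tame map on the open set `U`: the iterated directional derivatives
`D k f (h₁, …, hₖ)` of `P` exist at all `f ∈ U` and all of them are tame (in particular
continuous) maps of `(f, (h₁, …, hₖ))`. -/
def IsSmoothTameOn {E F : Type*} [AddCommGroup E] [Module ℝ E] [TopologicalSpace E] [Grading E]
    [AddCommGroup F] [Module ℝ F] [TopologicalSpace F] [Grading F]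
    (P : E → F) (U : Set E) : Prop :=
  ∃ D : (k : ℕ) → E → (Fin k → E) → F,
    (∀ f ∈ U, D 0 f Fin.elim0 = P f) ∧
    (∀ (k : ℕ), ∀ f ∈ U, ∀ (h : Fin k → E) (v : E),
      HasDirDeriv (fun g => D k g h) f v (D (k + 1) f (Fin.snoc h v))) ∧
    ∀ k : ℕ, IsTameOn (fun p : E × (Fin k → E) => D k p.1 p.2) (U ×ˢ univ)

/-! ## Tame Fréchet manifolds and their submanifolds -/

/-- A homeomorphism from an open subset of `M` onto an open subset of a graded space. -/
structure FrechetChart (M : Type) [TopologicalSpace M] where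
  Model : Type
  [addCommGroup : AddCommGroup Model]
  [module : Module ℝ Model]
  [topologicalSpace : TopologicalSpace Model]
  [grading : Grading Model]
  homeo : OpenPartialHomeomorph M Model

attribute [instance] FrechetChart.addCommGroup FrechetChart.module
  FrechetChart.topologicalSpace FrechetChart.grading

/-- The coordinate changes between the two charts are smooth tame maps in both directions. -/
def FrechetChart.Compatible {M : Type} [TopologicalSpace M] (c d : FrechetChart M) : Prop :=
  IsSmoothTameOn (fun f => d.homeo (c.homeo.symm f)) (c.homeo.symm.trans d.homeo).source ∧
  IsSmoothTameOn (fun f => c.homeo (d.homeo.symm f)) (d.homeo.symm.trans c.homeo).source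

/-- `M` with the atlas `𝒜` is a (smooth) tame Fréchet manifold. -/
structure IsTameFrechetManifold {M : Type} [TopologicalSpace M] (𝒜 : Set (FrechetChart M)) :
    Prop where
  t2 : T2Space M
  tame_model : ∀ c ∈ 𝒜, IsTameFrechetSpace c.Model
  covers : ∀ x : M, ∃ c ∈ 𝒜, x ∈ c.homeo.source
  compatible : ∀ c ∈ 𝒜, ∀ d ∈ 𝒜, c.Compatible d

/-- All charts, modelled on tame Fréchet spaces, that are compatible with the atlas. -/
def maximalAtlas {M : Type} [TopologicalSpace M] (𝒜 : Set (FrechetChart M)) :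
    Set (FrechetChart M) :=
  {c | IsTameFrechetSpace c.Model ∧ ∀ d ∈ 𝒜, c.Compatible d}

/-- A chart with values in a product `F × G` of graded spaces. -/
structure ProductChart (M : Type) [TopologicalSpace M] where
  F : Type
  G : Type
  [addCommGroupF : AddCommGroup F]
  [moduleF : Module ℝ F]
  [topologicalSpaceF : TopologicalSpace F]
  [gradingF : Grading F]
  [addCommGroupG : AddCommGroup G]
  [moduleG : Module ℝ G]
  [topologicalSpaceG : TopologicalSpace G]
  [gradingG : Grading G]
  homeo : OpenPartialHomeomorph M (F × G)

attribute [instance] ProductChart.addCommGroupF ProductChart.moduleF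
  ProductChart.topologicalSpaceF ProductChart.gradingF ProductChart.addCommGroupG
  ProductChart.moduleG ProductChart.topologicalSpaceG ProductChart.gradingG

/-- The underlying chart with model `F × G`. -/
def ProductChart.toChart {M : Type} [TopologicalSpace M] (c : ProductChart M) : FrechetChart M :=
  ⟨c.F × c.G, c.homeo⟩

/-- A chart `U → F × G` of the maximal atlas, with `F` and `G` tame Fréchet spaces, is a slice
chart for `S` if `S ∩ U` is the set of points of `U` that are mapped to `F × 0`. -/
structure IsSliceChart {M : Type} [TopologicalSpace M] (𝒜 : Set (FrechetChart M)) (S : Set M)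
    (c : ProductChart M) : Prop where
  mem_maximalAtlas : c.toChart ∈ maximalAtlas 𝒜
  tame_fst : IsTameFrechetSpace c.F
  tame_snd : IsTameFrechetSpace c.G
  slice : ∀ x ∈ c.homeo.source, x ∈ S ↔ (c.homeo x).2 = 0

/-- `S` is a smooth tame submanifold of the tame Fréchet manifold `(M, 𝒜)`: it is closed and each
of its points lies in the domain of a slice chart. -/
structure IsTameSubmanifold {M : Type} [TopologicalSpace M] (𝒜 : Set (FrechetChart M))
    (S : Set M) : Prop where
  isClosed : IsClosed S
  exists_slice : ∀ x ∈ S, ∃ c : ProductChart M, IsSliceChart 𝒜 S c ∧ x ∈ c.homeo.source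

/-- The atlas that a submanifold `S` inherits from `(M, 𝒜)`: it consists of the restrictions
`ψ : S ∩ U → F` of the slice charts `U → F × G`. -/
def inducedAtlas {M : Type} [TopologicalSpace M] (𝒜 : Set (FrechetChart M)) (S : Set M) :
    Set (FrechetChart S) :=
  {d | ∃ c : ProductChart M, IsSliceChart 𝒜 S c ∧
    ∃ ψ : OpenPartialHomeomorph S c.F, ψ.source = Subtype.val ⁻¹' c.homeo.source ∧
      (∀ x ∈ ψ.source, c.homeo x.1 = (ψ x, 0)) ∧ d = ⟨c.F, ψ⟩}

/-- The tangent space at `x` of a submanifold `S` of `(M, 𝒜)`, read in a chart `c₀` of the ambient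
manifold around `x`: the vectors that the derivative at `c₀ x` of the coordinate change from `c₀`
to a slice chart of `S` around `x` maps into `F × 0`. -/
def submanifoldTangent {M : Type} [TopologicalSpace M] (𝒜 : Set (FrechetChart M)) (S : Set M)
    (c₀ : FrechetChart M) (x : M) : Set c₀.Model :=
  {w | ∃ c : ProductChart M, IsSliceChart 𝒜 S c ∧ x ∈ c.homeo.source ∧
    ∃ y : c.F, HasDirDeriv (fun f => c.homeo (c₀.homeo.symm f)) (c₀.homeo x) w (y, 0)}

/-- The inclusion of a (nonempty) open subset of a graded space, as a chart. -/
def inclusionChart {E : Type} [AddCommGroup E] [Module ℝ E] [TopologicalSpace E] [Grading E]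
    {U : TopologicalSpace.Opens E} (x : U) : FrechetChart U :=
  ⟨E, U.openPartialHomeomorphSubtypeCoe ⟨x⟩⟩

/-- The atlas of an open subset of a graded space; its only chart is the inclusion. -/
def openAtlas {E : Type} [AddCommGroup E] [Module ℝ E] [TopologicalSpace E] [Grading E]
    (U : TopologicalSpace.Opens E) : Set (FrechetChart U) :=
  Set.range fun x : U => inclusionChart x

/-! ## Smooth plane curves modulo translations -/

/-- The two possible parameter spaces `I`: the interval `[0, 1]` and the circle `ℝ / ℤ`. -/
inductive CurveDomain
  | interval
  | circle

namespace CurveDomain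

/-- The points of `I`. -/
def Pt : CurveDomain → Type
  | interval => Set.Icc (0 : ℝ) 1
  | circle => UnitAddCircle

/-- The set on which the standard parameter of `I` lives. -/
def paramSet : CurveDomain → Set ℝ
  | interval => Set.Icc (0 : ℝ) 1
  | circle => Set.univ

/-- The point of `I` with parameter `t`; for `I = [0, 1]` only its values on `[0, 1]` matter. -/
def param : (I : CurveDomain) → ℝ → I.Pt
  | interval => Set.projIcc 0 1 zero_le_one
  | circle => fun t => (t : UnitAddCircle)

theorem uniqueDiffOn_paramSet : (I : CurveDomain) → UniqueDiffOn ℝ I.paramSet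
  | interval => uniqueDiffOn_Icc zero_lt_one
  | circle => uniqueDiffOn_univ

theorem Icc_subset_paramSet : (I : CurveDomain) → Set.Icc (0 : ℝ) 1 ⊆ I.paramSet
  | interval => subset_rfl
  | circle => Set.subset_univ _

end CurveDomain

/-- The Euclidean plane `ℝ²`. -/
abbrev Plane : Type := EuclideanSpace ℝ (Fin 2)

/-- The vector space `C^∞(I, ℝ²)`. For `I = [0, 1]`, derivatives at the end points are
one-sided. -/
def SmoothCurve (I : CurveDomain) : Submodule ℝ (I.Pt → Plane) where
  carrier := {γ | ContDiffOn ℝ ∞ (fun t => γ (I.param t)) I.paramSet}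
  zero_mem' := contDiffOn_const
  add_mem' hf hg := ContDiffOn.add hf hg
  smul_mem' c _ hf := ContDiffOn.const_smul c hf

/-- The `j`-th derivative of a smooth curve, as a continuous function of the parameter
`s ∈ [0, 1]`. -/
def SmoothCurve.derivCurve (I : CurveDomain) (j : ℕ) :
    SmoothCurve I →ₗ[ℝ] C(Set.Icc (0 : ℝ) 1, Plane) where
  toFun γ := ⟨fun s => iteratedDerivWithin j (fun t => γ.1 (I.param t)) I.paramSet s,
    ContinuousOn.comp_continuous
      (ContDiffOn.continuousOn_iteratedDerivWithin γ.2 (by exact_mod_cast le_top)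
        I.uniqueDiffOn_paramSet)
      continuous_subtype_val fun s => I.Icc_subset_paramSet s.2⟩
  map_add' γ η := by
    ext1 s
    have hs := I.Icc_subset_paramSet s.2
    exact iteratedDerivWithin_fun_add hs I.uniqueDiffOn_paramSet
      ((γ.2 s hs).of_le (by exact_mod_cast le_top)) ((η.2 s hs).of_le (by exact_mod_cast le_top))
  map_smul' c γ := by
    ext1 s
    exact iteratedDerivWithin_fun_const_smul_field c _

/-- The constant curves, i.e. the translations of the plane. -/
def SmoothCurve.constants (I : CurveDomain) : Submodule ℝ (SmoothCurve I) where
  carrier := {γ | ∃ z : Plane, ∀ p, γ.1 p = z}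
  zero_mem' := ⟨0, fun _ => rfl⟩
  add_mem' := by
    rintro γ η ⟨z, hz⟩ ⟨w, hw⟩
    exact ⟨z + w, fun p => congrArg₂ (· + ·) (hz p) (hw p)⟩
  smul_mem' := by
    rintro c γ ⟨z, hz⟩
    exact ⟨c • z, fun p => congrArg (c • ·) (hz p)⟩

/-- The space `C^∞(I, ℝ²) / ℝ²` of smooth curves modulo translations. -/
def CurveSpace (I : CurveDomain) : Type := SmoothCurve I ⧸ SmoothCurve.constants I

namespace CurveSpace

instance (I : CurveDomain) : AddCommGroup (CurveSpace I) :=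
  inferInstanceAs (AddCommGroup (SmoothCurve I ⧸ SmoothCurve.constants I))

instance (I : CurveDomain) : Module ℝ (CurveSpace I) :=
  inferInstanceAs (Module ℝ (SmoothCurve I ⧸ SmoothCurve.constants I))

/-- The derivative of order `j + 1` of a curve modulo translations. -/
def derivSucc (I : CurveDomain) (j : ℕ) :
    CurveSpace I →ₗ[ℝ] C(Set.Icc (0 : ℝ) 1, Plane) :=
  (SmoothCurve.constants I).liftQ (SmoothCurve.derivCurve I (j + 1)) (by
    rintro γ ⟨z, hz⟩
    rw [LinearMap.mem_ker]
    ext1 s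
    have : (fun t => γ.1 (I.param t)) = fun _ => z := funext fun t => hz _
    change iteratedDerivWithin (j + 1) (fun t => γ.1 (I.param t)) I.paramSet s = 0
    rw [this, iteratedDerivWithin_const]
    simp)

/-- The first derivative `γ'`. -/
abbrev deriv {I : CurveDomain} (γ : CurveSpace I) : C(Set.Icc (0 : ℝ) 1, Plane) :=
  derivSucc I 0 γ

/-- The grading `‖γ‖_{C^n} = ∑_{j = 1}^n max_s |γ^{(j)}(s)|`. -/
instance (I : CurveDomain) : Grading (CurveSpace I) where
  seminorm n := ∑ j ∈ Finset.range n,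
    (normSeminorm ℝ C(Set.Icc (0 : ℝ) 1, Plane)).comp (derivSucc I j)
  mono n m h γ := by
    simp only [FunLike.coe_sum, Finset.sum_apply]
    exact Finset.sum_le_sum_of_subset_of_nonneg
      (Finset.range_mono h) fun _ _ _ => apply_nonneg _ _

/-- The topology defined by the norms `‖·‖_{C^n}`. -/
instance (I : CurveDomain) : TopologicalSpace (CurveSpace I) :=
  (Grading.seminorm (E := CurveSpace I)).moduleFilterBasis.topology

theorem withSeminorms (I : CurveDomain) : WithSeminorms (Grading.seminorm (E := CurveSpace I)) :=
  ⟨rfl⟩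

theorem continuous_deriv (I : CurveDomain) :
    Continuous (deriv : CurveSpace I → C(Set.Icc (0 : ℝ) 1, Plane)) := by
  refine (withSeminorms I).continuous_of_isBounded (norm_withSeminorms ℝ _) (derivSucc I 0) ?_
  refine fun _ => ⟨{1}, 1, fun γ => ?_⟩
  simp [Grading.seminorm]

end CurveSpace

/-- The space `C(I)` of smooth immersions `I → ℝ²` modulo translations, as an open subset of
`C^∞(I, ℝ²) / ℝ²`. -/
def Immersions (I : CurveDomain) : TopologicalSpace.Opens (CurveSpace I) where
  carrier := {γ | ∀ s, γ.deriv s ≠ 0}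
  is_open' := by
    have h := (ContinuousMap.isOpen_setOfPred_mapsTo (X := Set.Icc (0 : ℝ) 1) (Y := Plane)
      isCompact_univ (isOpen_compl_singleton (x := 0))).preimage (CurveSpace.continuous_deriv I)
    convert h using 1
    ext γ
    simp [Set.MapsTo]

/-- The tame Fréchet manifold structure of `C(I)`. -/
def immersionAtlas (I : CurveDomain) : Set (FrechetChart (Immersions I)) :=
  openAtlas (Immersions I)

/-- The subset `C₁(I) ⊆ C(I)` of curves of length one. -/
def LengthOne (I : CurveDomain) : Set (Immersions I) :=
  {γ | ∫ s : Set.Icc (0 : ℝ) 1, ‖γ.1.deriv s‖ = 1}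

/-- The subset `A₁(I) ⊆ C(I)` of curves parameterized by arc length. -/
def ArcLength (I : CurveDomain) : Set (Immersions I) :=
  {γ | ∀ s, ‖γ.1.deriv s‖ = 1}

/-- The tangent space at `γ` of a submanifold `S` of `C(I)`, as a subset of
`T_γ C(I) = C^∞(I, ℝ²) / ℝ²`. -/
def curveTangent (I : CurveDomain) (S : Set (Immersions I)) (γ : Immersions I) :
    Set (CurveSpace I) :=
  submanifoldTangent (immersionAtlas I) S (inclusionChart γ) γ

end

set_option linter.unusedSectionVars false

/-! A curve modulo translations is the same thing as its velocity: a pair of smooth functions on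
`I`, subject on the circle to periodicity and to the closing condition that the integral vanishes.
Subtracting means makes `CurveSpace I` a tame direct summand of two copies of the function space
`Jet I.bc`. The theorem therefore rests on three facts: that this function space is tame, that the
pointwise operations on it are smooth tame, and that the two submanifolds can be straightened by
explicit charts.

Tameness of the function space. Let a function on `[0, 1]` be extended to the half line by `f (x +
1) = c f (x)`, and let it be averaged over the points to the right of `x` at scale `ε`, against a
rapidly decreasing kernel with integral one whose higher moments all vanish. By Taylor's formula the
error is `O(ε ^ n)` for every `n`, and derivatives commute with the averaging. Smoothing the
successive errors at the scales `exp (-k)` writes `f` as a series of smoothed pieces of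
exponentially small size, which is a tame embedding into `Σ(B)` with a tame left inverse
(`isTameFrechetSpace_of_decomposition`, `Jet.isTameFrechetSpace_some`). The value `c = 1` is the
circle. The value `c = 0` gives functions flat at `1`, and a function on the interval is a sum of
one that is flat at `1` and one that is flat at `0` (`Jet.isTameFrechetSpace_none`).

Smooth tame maps. Iterated directional derivatives compose badly, iterated tangent maps compose
well; the two notions agree (`TameSmooth.isSmoothTameOn`, `IsSmoothTameOn.tameSmooth`). Derivatives
are produced by `TameC.of_increment`: if the increment of `P` is a tame expression, linear in `x' -
x`, which involves `P` itself, then `n` tame derivatives of `P` give `n + 1`. Products, inverses,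
square roots and the implicit function below are all treated in this way. Their tame estimates come
from interpolation, used in the form that all norms up to order `n` grow at most geometrically with
one common ratio (`IsTameFrechetSpace.interpolation`).

The charts. The curves of length one are straightened by scaling: a curve near `γ₀` is described by
its ray and its length. Near a unit speed curve with velocity `e`, write `γ' = a e + b e^⊥`, so that
`a` is the positive square root of `|γ'|² - b²`. On the circle the closing condition consists of two
real equations. The map `κ : b ↦ ∫ b e^⊥` is onto the plane because a closed curve has non-constant
direction (`Jet.exists_integral_section`). Hence `b = b₀ + σ p` with `b₀` in `ker κ`, and `p` is the
fixed point of a contraction of a small ball in the plane; it depends on the data in a smooth tame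
way by Cramer's rule (`ArcFrame.tameC_fix`). The pair `(b₀, |γ'| - 1)` is a chart in which the arc
length condition is the vanishing of the second coordinate. Splitting `|γ'| - 1` into its mean,
which is the length minus one, and a part of mean zero straightens both submanifolds at once.

The tangent space. A curve inside a slice satisfies `|γ'|² = 1`, whose derivative is the
orthogonality relation. Conversely, in an orthogonal direction the speed varies only to second
order, so the derivative of the second coordinate vanishes. -/

noncomputable section

/-! ## Graded locally convex spaces -/

/-- A graded space whose topology is Hausdorff and defined by the grading. -/
class GradedLC (E : Type*) [AddCommGroup E] [Module ℝ E] [TopologicalSpace E] [Grading E] :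
    Prop where
  withSeminorms : WithSeminorms (Grading.seminorm (E := E))
  t2 : T2Space E

section gnorm

variable {E F : Type*} [AddCommGroup E] [Module ℝ E] [Grading E]
  [AddCommGroup F] [Module ℝ F] [Grading F]

theorem gnorm_nonneg (n : ℕ) (f : E) : 0 ≤ gnorm n f := apply_nonneg _ _

theorem gnorm_zero (n : ℕ) : gnorm n (0 : E) = 0 := map_zero _

theorem gnorm_add_le (n : ℕ) (f g : E) : gnorm n (f + g) ≤ gnorm n f + gnorm n g :=
  map_add_le_add _ _ _

theorem gnorm_smul (n : ℕ) (c : ℝ) (f : E) : gnorm n (c • f) = |c| * gnorm n f :=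
  map_smul_eq_mul _ _ _

theorem gnorm_neg (n : ℕ) (f : E) : gnorm n (-f) = gnorm n f := map_neg_eq_map _ _

theorem gnorm_sub_le (n : ℕ) (f g : E) : gnorm n (f - g) ≤ gnorm n f + gnorm n g :=
  map_sub_le_add _ _ _

theorem gnorm_sub_rev (n : ℕ) (f g : E) : gnorm n (f - g) = gnorm n (g - f) :=
  map_sub_rev _ _ _

theorem gnorm_mono {n m : ℕ} (h : n ≤ m) (f : E) : gnorm n f ≤ gnorm m f :=
  Grading.mono (E := E) h f

theorem gnorm_le_add_sub (n : ℕ) (f g : E) : gnorm n f ≤ gnorm n g + gnorm n (f - g) := by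
  simpa using gnorm_add_le n g (f - g)

theorem gnorm_sum_le {ι : Type*} (n : ℕ) (s : Finset ι) (f : ι → E) :
    gnorm n (∑ i ∈ s, f i) ≤ ∑ i ∈ s, gnorm n (f i) :=
  Finset.le_sum_of_subadditive _ (gnorm_zero n).le (fun f g => gnorm_add_le n f g) s f

theorem gnorm_prod (n : ℕ) (p : E × F) : gnorm n p = gnorm n p.1 + gnorm n p.2 := rfl

theorem gnorm_pi {ι : Type*} [Fintype ι] (n : ℕ) (h : ι → E) : gnorm n h = ∑ i, gnorm n (h i) := by
  change (∑ i, (Grading.seminorm (E := E) n).comp (LinearMap.proj i)) h = _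
  simp only [FunLike.coe_sum, Finset.sum_apply, Seminorm.comp_apply]
  rfl

theorem gnorm_fst_le (n : ℕ) (p : E × F) : gnorm n p.1 ≤ gnorm n p := by
  rw [gnorm_prod]; linarith [gnorm_nonneg n p.2]

theorem gnorm_snd_le (n : ℕ) (p : E × F) : gnorm n p.2 ≤ gnorm n p := by
  rw [gnorm_prod]; linarith [gnorm_nonneg n p.1]

theorem gnorm_apply_le {ι : Type*} [Fintype ι] (n : ℕ) (h : ι → E) (i : ι) :
    gnorm n (h i) ≤ gnorm n h := by
  rw [gnorm_pi]
  exact Finset.single_le_sum (f := fun i => gnorm n (h i)) (fun j _ => gnorm_nonneg n (h j))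
    (Finset.mem_univ i)

/-- The grading that a subspace inherits. -/
instance Grading.instSubmodule (p : Submodule ℝ E) : Grading p where
  seminorm n := (Grading.seminorm (E := E) n).comp p.subtype
  mono _ _ h x := Grading.mono (E := E) h x.1

end gnorm

section topology

variable {E F : Type*} [AddCommGroup E] [Module ℝ E] [TopologicalSpace E] [Grading E]
  [AddCommGroup F] [Module ℝ F] [TopologicalSpace F] [Grading F]

instance (priority := 50) GradedLC.topologicalAddGroup [GradedLC E] : IsTopologicalAddGroup E :=
  (GradedLC.withSeminorms (E := E)).topologicalAddGroup

instance (priority := 50) GradedLC.continuousSMul [GradedLC E] : ContinuousSMul ℝ E :=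
  (GradedLC.withSeminorms (E := E)).continuousSMul

instance (priority := 50) GradedLC.t2Space [GradedLC E] : T2Space E := GradedLC.t2

theorem IsFrechetSpace.gradedLC (h : IsFrechetSpace E) : GradedLC E := ⟨h.1, h.2⟩

/-- Because the grading increases, a finite supremum of seminorms is dominated by a single one, so
balls of single seminorms form a basis. -/
theorem nhds_basis_gnorm [GradedLC E] (x : E) :
    (𝓝 x).HasBasis (fun p : ℕ × ℝ => 0 < p.2) fun p => {y | gnorm p.1 (y - x) < p.2} := by
  refine (GradedLC.withSeminorms (E := E)).hasBasis_ball.to_hasBasis ?_ ?_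
  · rintro ⟨s, r⟩ hr
    refine ⟨⟨s.sup id, r⟩, hr, fun y hy => ?_⟩
    rw [Seminorm.mem_ball]
    refine lt_of_le_of_lt (Seminorm.finset_sup_apply_le (gnorm_nonneg (s.sup id) (y - x)) ?_) hy
    exact fun i hi => gnorm_mono (Finset.le_sup (f := id) hi) _
  · rintro ⟨n, r⟩ hr
    refine ⟨⟨{n}, r⟩, hr, fun y hy => ?_⟩
    rw [Finset.sup_singleton, Seminorm.mem_ball] at hy
    exact hy

theorem gnorm_ball_mem_nhds [GradedLC E] (x : E) (n : ℕ) {ε : ℝ} (hε : 0 < ε) :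
    {y | gnorm n (y - x) < ε} ∈ 𝓝 x :=
  (nhds_basis_gnorm x).mem_of_mem (i := (n, ε)) hε

theorem tendsto_iff_gnorm [GradedLC E] {ι : Type*} {l : Filter ι} {u : ι → E} {y : E} :
    Tendsto u l (𝓝 y) ↔ ∀ n, ∀ ε > 0, ∀ᶠ i in l, gnorm n (u i - y) < ε := by
  rw [(nhds_basis_gnorm y).tendsto_right_iff]
  exact ⟨fun h n ε hε => h (n, ε) hε, fun h p hp => h p.1 p.2 hp⟩

theorem continuous_gnorm [GradedLC E] (n : ℕ) : Continuous (gnorm (E := E) n) :=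
  (GradedLC.withSeminorms (E := E)).continuous_seminorm n

/-- Used to recognise the topologies of products, finite powers and the real line as those of their
gradings: for a group topology it is enough to compare the neighbourhoods of zero. -/
theorem withSeminorms_of_nhds [IsTopologicalAddGroup E]
    (h : ∀ n, ∀ ε > 0, {y : E | gnorm n y < ε} ∈ 𝓝 0)
    (h' : ∀ U ∈ 𝓝 (0 : E), ∃ n, ∃ ε > 0, {y | gnorm n y < ε} ⊆ U) :
    WithSeminorms (Grading.seminorm (E := E)) := by
  rw [SeminormFamily.withSeminorms_iff_nhds_eq_iInf]
  apply le_antisymm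
  · refine le_iInf fun n => ?_
    rw [← tendsto_iff_comap, Metric.tendsto_nhds]
    intro ε hε
    filter_upwards [h n ε hε] with y hy
    rw [Real.dist_eq, sub_zero]
    exact (abs_of_nonneg (gnorm_nonneg n y)).trans_lt hy
  · intro U hU
    obtain ⟨n, ε, hε, hs⟩ := h' U hU
    refine mem_iInf_of_mem n (mem_comap.2 ⟨Iio ε, Iio_mem_nhds hε, fun y hy => hs hy⟩)

instance GradedLC.instProd [GradedLC E] [GradedLC F] : GradedLC (E × F) where
  withSeminorms := by
    refine withSeminorms_of_nhds (fun n ε hε => ?_) fun U hU => ?_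
    · have hc : Continuous fun y : E × F => gnorm n y.1 + gnorm n y.2 :=
        ((continuous_gnorm n).comp continuous_fst).add ((continuous_gnorm n).comp continuous_snd)
      exact (isOpen_Iio.preimage hc).mem_nhds (by simpa [gnorm_zero] using hε)
    · obtain ⟨V, hV, W, hW, hs⟩ := mem_nhds_prod_iff.1 (show U ∈ 𝓝 ((0 : E), (0 : F)) from hU)
      obtain ⟨⟨n, ε⟩, hε, hn⟩ := (nhds_basis_gnorm (0 : E)).mem_iff.1 hV
      obtain ⟨⟨m, δ⟩, hδ, hm⟩ := (nhds_basis_gnorm (0 : F)).mem_iff.1 hW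
      refine ⟨max n m, min ε δ, lt_min hε hδ, fun y hy => hs ⟨hn ?_, hm ?_⟩⟩
      · change gnorm n (y.1 - 0) < ε
        rw [sub_zero]
        exact ((gnorm_mono (le_max_left n m) _).trans (gnorm_fst_le _ y)).trans_lt
          (lt_of_lt_of_le hy (min_le_left _ _))
      · change gnorm m (y.2 - 0) < δ
        rw [sub_zero]
        exact ((gnorm_mono (le_max_right n m) _).trans (gnorm_snd_le _ y)).trans_lt
          (lt_of_lt_of_le hy (min_le_right _ _))
  t2 := inferInstance

instance GradedLC.instPi {ι : Type*} [Fintype ι] [GradedLC E] : GradedLC (ι → E) where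
  withSeminorms := by
    refine withSeminorms_of_nhds (fun n ε hε => ?_) fun U hU => ?_
    · have hc : Continuous fun y : ι → E => ∑ i, gnorm n (y i) :=
        continuous_finsetSum _ fun i _ => (continuous_gnorm n).comp (continuous_apply i)
      have := (isOpen_Iio (a := ε)).preimage hc |>.mem_nhds (x := (0 : ι → E))
        (by simpa [gnorm_zero] using hε)
      filter_upwards [this] with y hy
      exact (gnorm_pi n y).trans_lt hy
    · rw [nhds_pi, Filter.mem_pi] at hU
      obtain ⟨I, hI, V, hV, hs⟩ := hU
      choose p hp hpV using fun i => (nhds_basis_gnorm (0 : E)).mem_iff.1 (hV i)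
      let N := Finset.univ.sup fun i => (p i).1
      obtain ⟨ε, hε, hεp⟩ : ∃ ε > 0, ∀ i, ε ≤ (p i).2 := by
        rcases isEmpty_or_nonempty ι with h | h
        · exact ⟨1, one_pos, fun i => h.elim i⟩
        · obtain ⟨i, hi⟩ := Finite.exists_min fun i => (p i).2
          exact ⟨_, hp i, hi⟩
      refine ⟨N, ε, hε, fun y hy => hs fun i _ => hpV i ?_⟩
      change gnorm (p i).1 (y i - 0) < _
      rw [sub_zero]
      exact ((gnorm_mono (Finset.le_sup (f := fun i => (p i).1) (Finset.mem_univ i)) _).trans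
        (gnorm_apply_le _ y i)).trans_lt (lt_of_lt_of_le hy (hεp i))
  t2 := inferInstance

/-- The constant grading of the real line. -/
instance Grading.instReal : Grading ℝ where
  seminorm _ := normSeminorm ℝ ℝ
  mono _ _ _ _ := le_rfl

theorem gnorm_real (n : ℕ) (x : ℝ) : gnorm n x = |x| := rfl

instance GradedLC.instReal : GradedLC ℝ where
  withSeminorms := by
    refine withSeminorms_of_nhds (fun n ε hε => ?_) fun U hU => ?_
    · filter_upwards [Metric.ball_mem_nhds (0 : ℝ) hε] with y hy
      simpa [gnorm_real] using hy
    · obtain ⟨ε, hε, h⟩ := Metric.mem_nhds_iff.1 hU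
      exact ⟨0, ε, hε, fun y hy => h (by simpa [gnorm_real] using hy)⟩
  t2 := inferInstance

instance GradedLC.instSubmodule [GradedLC E] (p : Submodule ℝ E) : GradedLC p where
  withSeminorms :=
    LinearMap.withSeminorms_induced (GradedLC.withSeminorms (E := E)) p.subtype
  t2 := inferInstance

end topology

/-! ## Tame linear maps -/

section tamelinear

variable {E F G : Type*} [AddCommGroup E] [Module ℝ E] [Grading E]
  [AddCommGroup F] [Module ℝ F] [Grading F] [AddCommGroup G] [Module ℝ G] [Grading G]

/-- The base `b` can be traded for a larger degree, since `‖·‖ₙ ≤ ‖·‖ₙ₊ᵦ`. Working with base `0` and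
nonnegative constants simplifies every later composition. -/
theorem IsTameLinear.bound {L : E →ₗ[ℝ] F} (h : IsTameLinear L) :
    ∃ r : ℕ, ∀ n, ∃ C, 0 ≤ C ∧ ∀ f, gnorm n (L f) ≤ C * gnorm (n + r) f := by
  obtain ⟨r, b, h⟩ := h
  refine ⟨b + r, fun n => ?_⟩
  obtain ⟨C, hC⟩ := h (n + b) (Nat.le_add_left _ _)
  refine ⟨|C|, abs_nonneg _, fun f => ?_⟩
  calc gnorm n (L f) ≤ gnorm (n + b) (L f) := gnorm_mono (Nat.le_add_right _ _) _
    _ ≤ C * gnorm (n + b + r) f := hC f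
    _ ≤ |C| * gnorm (n + (b + r)) f := by
      rw [add_assoc]
      exact mul_le_mul_of_nonneg_right (le_abs_self C) (gnorm_nonneg _ _)

theorem IsTameLinear.comp {M : F →ₗ[ℝ] G} {L : E →ₗ[ℝ] F} (hM : IsTameLinear M)
    (hL : IsTameLinear L) : IsTameLinear (M ∘ₗ L) := by
  obtain ⟨r, hr⟩ := hM.bound
  obtain ⟨s, hs⟩ := hL.bound
  refine ⟨r + s, 0, fun n _ => ?_⟩
  obtain ⟨C, hC, hCb⟩ := hr n
  obtain ⟨D, hD, hDb⟩ := hs (n + r)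
  refine ⟨C * D, fun f => ?_⟩
  rw [mul_assoc, ← add_assoc]
  exact (hCb (L f)).trans (mul_le_mul_of_nonneg_left (hDb f) hC)

theorem IsTameLinear.prod {L : E →ₗ[ℝ] F} {M : E →ₗ[ℝ] G} (hL : IsTameLinear L)
    (hM : IsTameLinear M) : IsTameLinear (L.prod M) := by
  obtain ⟨r, hr⟩ := hL.bound
  obtain ⟨s, hs⟩ := hM.bound
  refine ⟨r + s, 0, fun n _ => ?_⟩
  obtain ⟨C, hC, hCb⟩ := hr n
  obtain ⟨D, hD, hDb⟩ := hs n
  refine ⟨C + D, fun f => ?_⟩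
  rw [gnorm_prod, add_mul]
  refine add_le_add ((hCb f).trans ?_) ((hDb f).trans ?_)
  · exact mul_le_mul_of_nonneg_left (gnorm_mono (by omega) f) hC
  · exact mul_le_mul_of_nonneg_left (gnorm_mono (by omega) f) hD

theorem IsTameLinear.add {L M : E →ₗ[ℝ] F} (hL : IsTameLinear L)
    (hM : IsTameLinear M) : IsTameLinear (L + M) := by
  obtain ⟨r, hr⟩ := hL.bound
  obtain ⟨s, hs⟩ := hM.bound
  refine ⟨r + s, 0, fun n _ => ?_⟩
  obtain ⟨C, hC, hCb⟩ := hr n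
  obtain ⟨D, hD, hDb⟩ := hs n
  refine ⟨C + D, fun f => (gnorm_add_le n _ _).trans ?_⟩
  rw [add_mul]
  refine add_le_add ((hCb f).trans ?_) ((hDb f).trans ?_)
  · exact mul_le_mul_of_nonneg_left (gnorm_mono (by omega) f) hC
  · exact mul_le_mul_of_nonneg_left (gnorm_mono (by omega) f) hD

theorem isTameLinear_of_le {L : E →ₗ[ℝ] F} (h : ∀ n f, gnorm n (L f) ≤ gnorm n f) :
    IsTameLinear L :=
  ⟨0, 0, fun n _ => ⟨1, fun f => by simpa using h n f⟩⟩

theorem isTameLinear_id : IsTameLinear (LinearMap.id : E →ₗ[ℝ] E) :=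
  isTameLinear_of_le fun _ _ => le_rfl

theorem isTameLinear_fst : IsTameLinear (LinearMap.fst ℝ E F) :=
  isTameLinear_of_le fun n p => gnorm_fst_le n p

theorem isTameLinear_snd : IsTameLinear (LinearMap.snd ℝ E F) :=
  isTameLinear_of_le fun n p => gnorm_snd_le n p

theorem isTameLinear_proj {ι : Type*} [Fintype ι] (i : ι) :
    IsTameLinear (LinearMap.proj i : (ι → E) →ₗ[ℝ] E) :=
  isTameLinear_of_le fun n p => gnorm_apply_le n p i

theorem isTameLinear_subtype (p : Submodule ℝ E) :
    IsTameLinear p.subtype :=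
  isTameLinear_of_le fun _ _ => le_rfl

theorem IsTameLinear.codRestrict {L : E →ₗ[ℝ] F} (hL : IsTameLinear L)
    (p : Submodule ℝ F) (h : ∀ x, L x ∈ p) : IsTameLinear (L.codRestrict p h) := hL

theorem IsTameLinear.smul_const {l : E →ₗ[ℝ] ℝ} (hl : IsTameLinear l) (v : F) :
    IsTameLinear (l.smulRight v) := by
  obtain ⟨r, hr⟩ := hl.bound
  refine ⟨r, 0, fun n _ => ?_⟩
  obtain ⟨C, hC, hCb⟩ := hr n
  refine ⟨C * gnorm n v, fun f => ?_⟩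
  rw [LinearMap.smulRight_apply, gnorm_smul]
  calc |l f| * gnorm n v ≤ (C * gnorm (n + r) f) * gnorm n v :=
        mul_le_mul_of_nonneg_right (hCb f) (gnorm_nonneg _ _)
    _ = _ := by ring

end tamelinear

section tamelinear_continuous

variable {E F : Type*} [AddCommGroup E] [Module ℝ E] [TopologicalSpace E] [Grading E]
  [AddCommGroup F] [Module ℝ F] [TopologicalSpace F] [Grading F]

theorem IsTameLinear.continuous [GradedLC E] [GradedLC F] {L : E →ₗ[ℝ] F} (hL : IsTameLinear L) :
    Continuous L := by
  refine (GradedLC.withSeminorms (E := E)).continuous_of_isBounded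
    (GradedLC.withSeminorms (E := F)) L fun n => ?_
  obtain ⟨r, hr⟩ := hL.bound
  obtain ⟨C, hC, hCb⟩ := hr n
  refine ⟨{n + r}, ⟨C, hC⟩, fun f => ?_⟩
  rw [Finset.sup_singleton]
  exact hCb f

end tamelinear_continuous

/-! ## Tame Fréchet spaces -/

theorem IsTameFrechetSpace.gradedLC {E : Type} [AddCommGroup E] [Module ℝ E] [TopologicalSpace E]
    [Grading E] (h : IsTameFrechetSpace E) : GradedLC E := h.1.gradedLC

/-- A retract of a tame Fréchet space, by tame linear maps, is a tame Fréchet space. -/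
theorem IsTameFrechetSpace.of_retract {E F : Type} [AddCommGroup E] [Module ℝ E]
    [TopologicalSpace E] [Grading E] [AddCommGroup F] [Module ℝ F] [TopologicalSpace F] [Grading F]
    (hE : IsTameFrechetSpace E) (hF : WithSeminorms (Grading.seminorm (E := F)))
    {T : F →ₗ[ℝ] E} {P : E →ₗ[ℝ] F} (hT : IsTameLinear T) (hP : IsTameLinear P)
    (hPT : ∀ f, P (T f) = f) : IsTameFrechetSpace F := by
  have := hE.gradedLC
  have hinj : Function.Injective T := Function.LeftInverse.injective hPT
  have hTc : Continuous T := by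
    refine hF.continuous_of_isBounded (GradedLC.withSeminorms (E := E)) T fun n => ?_
    obtain ⟨r, hr⟩ := hT.bound
    obtain ⟨C, hC, hCb⟩ := hr n
    refine ⟨{n + r}, ⟨C, hC⟩, fun f => ?_⟩
    rw [Finset.sup_singleton]
    exact hCb f
  have hF' : GradedLC F := ⟨hF, T2Space.of_injective_continuous hinj hTc⟩
  refine ⟨⟨hF, hF'.t2, fun u hu => ?_⟩, ?_⟩
  · obtain ⟨x, hx⟩ := hE.1.complete (fun i => T (u i)) fun n ε hε => by
      obtain ⟨r, hr⟩ := hT.bound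
      obtain ⟨C, hC, hCb⟩ := hr n
      obtain ⟨N, hN⟩ := hu (n + r) (ε / (C + 1)) (by positivity)
      refine ⟨N, fun i hi j hj => ?_⟩
      rw [← map_sub]
      refine (hCb _).trans_lt ?_
      calc C * gnorm (n + r) (u i - u j) ≤ (C + 1) * gnorm (n + r) (u i - u j) := by
            gcongr
            · exact gnorm_nonneg _ _
            · linarith
        _ < (C + 1) * (ε / (C + 1)) := by
            gcongr
            exact hN i hi j hj
        _ = ε := by field_simp
    refine ⟨P x, ?_⟩
    have := (hP.continuous.tendsto x).comp hx
    simpa [Function.comp_def, hPT] using this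
  · obtain ⟨B, _, _, _, L, M, hL, hM, hML⟩ := hE.2
    exact ⟨B, _, _, ‹_›, L ∘ₗ T, P ∘ₗ M, hL.comp hT, hP.comp hM, fun f => by simp [hML, hPT]⟩

theorem gnorm_expDecreasing {B : Type*} [NormedAddCommGroup B] [NormedSpace ℝ B] (n : ℕ)
    (f : ExpDecreasing B) : gnorm n f = ∑' k : ℕ, Real.exp (n * k) * ‖f.1 k‖ := rfl

theorem exp_mul_norm_le_gnorm {B : Type*} [NormedAddCommGroup B] [NormedSpace ℝ B] (n k : ℕ)
    (f : ExpDecreasing B) : Real.exp (n * k) * ‖f.1 k‖ ≤ gnorm n f :=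
  (f.2 n).le_tsum k fun _ _ => by positivity

/-- Termwise pairing identifies `Σ(B) × Σ(B')` with `Σ(B × B')`, and the maximum norm lies between
each of the two norms and their sum. -/
theorem IsTameFrechetSpace.prod {E F : Type} [AddCommGroup E] [Module ℝ E]
    [TopologicalSpace E] [Grading E] [AddCommGroup F] [Module ℝ F] [TopologicalSpace F] [Grading F]
    (hE : IsTameFrechetSpace E) (hF : IsTameFrechetSpace F) : IsTameFrechetSpace (E × F) := by
  have := hE.gradedLC
  have := hF.gradedLC
  refine ⟨⟨GradedLC.withSeminorms, GradedLC.t2, fun u hu => ?_⟩, ?_⟩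
  · obtain ⟨x, hx⟩ := hE.1.complete (fun i => (u i).1) fun n ε hε => by
      obtain ⟨N, hN⟩ := hu n ε hε
      exact ⟨N, fun i hi j hj => (gnorm_fst_le n (u i - u j)).trans_lt (hN i hi j hj)⟩
    obtain ⟨y, hy⟩ := hF.1.complete (fun i => (u i).2) fun n ε hε => by
      obtain ⟨N, hN⟩ := hu n ε hε
      exact ⟨N, fun i hi j hj => (gnorm_snd_le n (u i - u j)).trans_lt (hN i hi j hj)⟩
    exact ⟨(x, y), hx.prodMk_nhds hy⟩
  · obtain ⟨B, _, _, _, L, M, hL, hM, hML⟩ := hE.2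
    obtain ⟨B', _, _, _, L', M', hL', hM', hML'⟩ := hF.2
    let p₁ : ExpDecreasing (B × B') →ₗ[ℝ] ExpDecreasing B :=
      { toFun := fun f => ⟨fun k => (f.1 k).1, fun n => Summable.of_nonneg_of_le
          (fun k => by positivity) (fun k => by gcongr; exact norm_fst_le _) (f.2 n)⟩
        map_add' := fun _ _ => rfl
        map_smul' := fun _ _ => rfl }
    let p₂ : ExpDecreasing (B × B') →ₗ[ℝ] ExpDecreasing B' :=
      { toFun := fun f => ⟨fun k => (f.1 k).2, fun n => Summable.of_nonneg_of_le
          (fun k => by positivity) (fun k => by gcongr; exact norm_snd_le _) (f.2 n)⟩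
        map_add' := fun _ _ => rfl
        map_smul' := fun _ _ => rfl }
    have hle : ∀ (f : ExpDecreasing B) (g : ExpDecreasing B') (n k : ℕ),
        Real.exp (n * k) * ‖(f.1 k, g.1 k)‖ ≤
          Real.exp (n * k) * ‖f.1 k‖ + Real.exp (n * k) * ‖g.1 k‖ := fun f g n k => by
      rw [← mul_add]
      gcongr
      exact max_le_add_of_nonneg (norm_nonneg _) (norm_nonneg _)
    let j : ExpDecreasing B × ExpDecreasing B' →ₗ[ℝ] ExpDecreasing (B × B') :=
      { toFun := fun f => ⟨fun k => (f.1.1 k, f.2.1 k), fun n => Summable.of_nonneg_of_le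
          (fun k => by positivity) (hle f.1 f.2 n) ((f.1.2 n).add (f.2.2 n))⟩
        map_add' := fun _ _ => rfl
        map_smul' := fun _ _ => rfl }
    have h₁ : IsTameLinear p₁ := isTameLinear_of_le fun n f =>
      ((p₁ f).2 n).tsum_le_tsum (fun k => by gcongr; exact norm_fst_le _) (f.2 n)
    have h₂ : IsTameLinear p₂ := isTameLinear_of_le fun n f =>
      ((p₂ f).2 n).tsum_le_tsum (fun k => by gcongr; exact norm_snd_le _) (f.2 n)
    have hj : IsTameLinear j := isTameLinear_of_le fun n f => by
      rw [gnorm_prod, gnorm_expDecreasing, gnorm_expDecreasing, gnorm_expDecreasing,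
        ← (f.1.2 n).tsum_add (f.2.2 n)]
      exact ((j f).2 n).tsum_le_tsum (hle f.1 f.2 n) ((f.1.2 n).add (f.2.2 n))
    refine ⟨B × B', _, _, inferInstance, j ∘ₗ ((L ∘ₗ LinearMap.fst ℝ E F).prod
      (L' ∘ₗ LinearMap.snd ℝ E F)), (M ∘ₗ p₁).prod (M' ∘ₗ p₂),
      hj.comp ((hL.comp isTameLinear_fst).prod (hL'.comp isTameLinear_snd)),
      (hM.comp h₁).prod (hM'.comp h₂), fun f => ?_⟩
    exact Prod.ext (hML f.1) (hML' f.2)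

/-- A real number is placed in the term of index `0`, where all the weights `exp (n k)` are one. -/
theorem isTameFrechetSpace_real : IsTameFrechetSpace ℝ := by
  refine ⟨⟨GradedLC.withSeminorms, GradedLC.t2, fun u hu => ?_⟩, ℝ, inferInstance, inferInstance,
    inferInstance, ?_⟩
  · refine cauchySeq_tendsto_of_complete (Metric.cauchySeq_iff.2 fun ε hε => ?_)
    obtain ⟨N, hN⟩ := hu 0 ε hε
    exact ⟨N, fun i hi j hj => hN i hi j hj⟩
  · have hs : ∀ (x : ℝ) (n k : ℕ), k ≠ 0 →
        Real.exp (n * k) * ‖if k = 0 then x else 0‖ = 0 := fun x n k hk => by simp [hk]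
    let L : ℝ →ₗ[ℝ] ExpDecreasing ℝ :=
      { toFun := fun x => ⟨fun k => if k = 0 then x else 0, fun n =>
          summable_of_ne_finset_zero (s := {0}) fun k hk => hs x n k (by simpa using hk)⟩
        map_add' := fun x y => by ext k; by_cases hk : k = 0 <;> simp [hk]
        map_smul' := fun c x => by ext k; by_cases hk : k = 0 <;> simp [hk] }
    let M : ExpDecreasing ℝ →ₗ[ℝ] ℝ :=
      { toFun := fun f => f.1 0
        map_add' := fun _ _ => rfl
        map_smul' := fun _ _ => rfl }
    refine ⟨L, M, isTameLinear_of_le fun n x => ?_, isTameLinear_of_le fun n f => ?_, fun x => ?_⟩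
    · refine (tsum_eq_single 0 fun k hk => hs x n k hk).le.trans ?_
      simp [gnorm_real]
    · have := exp_mul_norm_le_gnorm n 0 f
      simpa [gnorm_real, M] using this
    · simp [L, M]

/-- A closed complement of a tame retraction: the kernel of a tame linear map into a graded space
with a tame linear right inverse on its range. -/
theorem IsTameFrechetSpace.of_projection {E : Type} [AddCommGroup E] [Module ℝ E]
    [TopologicalSpace E] [Grading E] (hE : IsTameFrechetSpace E) (p : Submodule ℝ E)
    {Q : E →ₗ[ℝ] E} (hQ : IsTameLinear Q) (hQp : ∀ x, Q x ∈ p) (hQid : ∀ x ∈ p, Q x = x) :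
    IsTameFrechetSpace p := by
  have := hE.gradedLC
  exact hE.of_retract GradedLC.withSeminorms (isTameLinear_subtype p) (hQ.codRestrict p hQp)
    fun f => Subtype.ext (hQid f.1 f.2)

/-- A graded Fréchet space is tame if the identity is a sum `∑ₖ Tₖ Lₖ` of operators that factor
through a Banach space, with `Lₖ` rapidly decreasing and `Tₖ` of exponential growth. -/
theorem isTameFrechetSpace_of_decomposition {E B : Type} [AddCommGroup E] [Module ℝ E]
    [TopologicalSpace E] [Grading E] [NormedAddCommGroup B] [NormedSpace ℝ B] [CompleteSpace B]
    (hE : IsFrechetSpace E) (L : ℕ → E →ₗ[ℝ] B) (T : ℕ → B →ₗ[ℝ] E) (r : ℕ)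
    (hL : ∀ n : ℕ, ∃ C, 0 ≤ C ∧ ∀ k : ℕ, ∀ f, Real.exp (n * k) * ‖L k f‖ ≤ C * gnorm (n + r) f)
    (hT : ∀ n : ℕ, ∃ C, 0 ≤ C ∧ ∀ k : ℕ, ∀ b, gnorm n (T k b) ≤ C * (Real.exp (n * k) * ‖b‖))
    (hsum : ∀ f, Tendsto (fun N => ∑ k ∈ Finset.range N, T k (L k f)) atTop (𝓝 f)) :
    IsTameFrechetSpace E := by
  have := hE.gradedLC
  have hgeo : Summable fun k : ℕ => Real.exp (-(k : ℝ)) := Real.summable_exp_neg_nat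
  -- The hypothesis at `n + 1` leaves a spare factor `exp (-k)`, which makes the series summable at
  -- the price of one more derivative.
  have hLb : ∀ n : ℕ, ∃ C, 0 ≤ C ∧ ∀ k : ℕ, ∀ f,
      Real.exp (n * k) * ‖L k f‖ ≤ C * gnorm (n + (r + 1)) f * Real.exp (-(k : ℝ)) := by
    intro n
    obtain ⟨C, hC, h⟩ := hL (n + 1)
    refine ⟨C, hC, fun k f => ?_⟩
    have h1 := mul_le_mul_of_nonneg_right (h k f) (Real.exp_pos (-(k : ℝ))).le
    have h2 : Real.exp (n * k) = Real.exp ((n + 1 : ℕ) * k) * Real.exp (-(k : ℝ)) := by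
      rw [← Real.exp_add]; congr 1; push_cast; ring
    rw [h2, show n + (r + 1) = n + 1 + r by ring]
    calc _ = Real.exp ((n + 1 : ℕ) * k) * ‖L k f‖ * Real.exp (-(k : ℝ)) := by ring
      _ ≤ _ := h1
  have hLs : ∀ f (n : ℕ), Summable fun k : ℕ => Real.exp (n * k) * ‖L k f‖ := fun f n => by
    obtain ⟨C, hC, h⟩ := hLb n
    exact Summable.of_nonneg_of_le (fun k => by positivity) (fun k => h k f) (hgeo.mul_left _)
  let Lm : E →ₗ[ℝ] ExpDecreasing B :=
    { toFun := fun f => ⟨fun k => L k f, hLs f⟩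
      map_add' := fun f g => by ext k; simp
      map_smul' := fun c f => by ext k; simp }
  have hLm : IsTameLinear Lm := by
    refine ⟨r + 1, 0, fun n _ => ?_⟩
    obtain ⟨C, hC, h⟩ := hLb n
    refine ⟨C * ∑' k : ℕ, Real.exp (-(k : ℝ)), fun f => ?_⟩
    calc gnorm n (Lm f) ≤ ∑' k : ℕ, C * gnorm (n + (r + 1)) f * Real.exp (-(k : ℝ)) :=
          (hLs f n).tsum_le_tsum (fun k => h k f) (hgeo.mul_left _)
      _ = _ := by rw [tsum_mul_left]; ring
  have hTb : ∀ n : ℕ, ∃ C, 0 ≤ C ∧ ∀ (u : ExpDecreasing B) (s : Finset ℕ),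
      gnorm n (∑ k ∈ s, T k (u.1 k)) ≤ C * ∑ k ∈ s, Real.exp (n * k) * ‖u.1 k‖ := fun n => by
    obtain ⟨C, hC, h⟩ := hT n
    refine ⟨C, hC, fun u s => (gnorm_sum_le n s _).trans ?_⟩
    rw [Finset.mul_sum]
    exact Finset.sum_le_sum fun k _ => h k _
  have hlim : ∀ u : ExpDecreasing B, ∃ x,
      Tendsto (fun N => ∑ k ∈ Finset.range N, T k (u.1 k)) atTop (𝓝 x) := fun u => by
    refine hE.complete _ fun n ε hε => ?_
    obtain ⟨C, hC, h⟩ := hTb n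
    have hcs := (u.2 n).hasSum.tendsto_sum_nat.cauchySeq
    obtain ⟨N, hN⟩ := Metric.cauchySeq_iff.1 hcs (ε / (C + 1)) (by positivity)
    have key : ∀ i ≥ N, ∀ j ≥ i, gnorm n (∑ k ∈ Finset.range j, T k (u.1 k) -
        ∑ k ∈ Finset.range i, T k (u.1 k)) < ε := fun i hi j hij => by
      rw [← Finset.sum_Ico_eq_sub _ hij]
      refine (h u _).trans_lt ?_
      have h3 := hN j (hi.trans hij) i hi
      rw [Real.dist_eq, ← Finset.sum_Ico_eq_sub _ hij] at h3
      have h4 := (le_abs_self _).trans_lt h3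
      have h5 : 0 ≤ ∑ k ∈ Finset.Ico i j, Real.exp (n * k) * ‖u.1 k‖ :=
        Finset.sum_nonneg fun k _ => by positivity
      calc C * ∑ k ∈ Finset.Ico i j, Real.exp (n * k) * ‖u.1 k‖
          ≤ (C + 1) * ∑ k ∈ Finset.Ico i j, Real.exp (n * k) * ‖u.1 k‖ := by gcongr; linarith
        _ < (C + 1) * (ε / (C + 1)) := by gcongr
        _ = ε := by field_simp
    refine ⟨N, fun i hi j hj => ?_⟩
    rcases le_total i j with hij | hij
    · rw [gnorm_sub_rev]; exact key i hi j hij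
    · exact key j hj i hij
  choose Mf hMf using hlim
  let Mm : ExpDecreasing B →ₗ[ℝ] E :=
    { toFun := Mf
      map_add' := fun u v => by
        refine tendsto_nhds_unique (hMf (u + v)) (((hMf u).add (hMf v)).congr fun N => ?_)
        rw [← Finset.sum_add_distrib]
        exact Finset.sum_congr rfl fun k _ => (map_add (T k) _ _).symm
      map_smul' := fun c u => by
        refine tendsto_nhds_unique (hMf (c • u)) (((hMf u).const_smul c).congr fun N => ?_)
        rw [Finset.smul_sum]
        exact Finset.sum_congr rfl fun k _ => (map_smul (T k) _ _).symm }
  refine ⟨hE, B, _, _, ‹_›, Lm, Mm, hLm, ⟨0, 0, fun n _ => ?_⟩, fun f => ?_⟩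
  · obtain ⟨C, hC, h⟩ := hTb n
    refine ⟨C, fun u => le_of_tendsto ((continuous_gnorm n).tendsto _ |>.comp (hMf u)) ?_⟩
    refine Eventually.of_forall fun N => (h u _).trans ?_
    gcongr
    exact (u.2 n).sum_le_tsum _ fun k _ => by positivity
  · exact tendsto_nhds_unique (hMf (Lm f)) (hsum f)

/-- Interpolation in a tame Fréchet space: on sets that are bounded for a fixed norm, the norms
`‖f‖ⱼ`, `j ≤ n`, grow at most geometrically, with ratio controlled by `‖f‖ₙ₊R`. -/
theorem IsTameFrechetSpace.interpolation {E : Type} [AddCommGroup E] [Module ℝ E]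
    [TopologicalSpace E] [Grading E] (hE : IsTameFrechetSpace E) :
    ∃ R : ℕ, ∀ (n : ℕ) (ρ : ℝ), ∃ C, 0 ≤ C ∧ ∀ f : E, gnorm R f ≤ ρ →
      ∃ K : ℝ, 1 ≤ K ∧ K ^ n ≤ C * (1 + gnorm (n + R) f) ∧ ∀ j ≤ n, gnorm j f ≤ C * K ^ j := by
  obtain ⟨B, _, _, _, L, M, hL, hM, hML⟩ := hE.2
  obtain ⟨s, hs⟩ := hL.bound
  obtain ⟨t, ht⟩ := hM.bound
  choose A hA hAb using hs
  choose D hD hDb using ht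
  refine ⟨t + s, fun n ρ => ?_⟩
  set C := 1 + A (n + t) + ∑ j ∈ Finset.range (n + 1), D j * (A t * |ρ| + 1) with hC
  have hsum : ∀ j ≤ n, D j * (A t * |ρ| + 1) ≤ C := fun j hj => by
    have h1 := Finset.single_le_sum (f := fun j => D j * (A t * |ρ| + 1))
      (fun j _ => by have := hD j; have := hA t; positivity)
      (Finset.mem_range.2 (Nat.lt_succ_of_le hj))
    have := hA (n + t)
    linarith
  have hC0 : 1 + A (n + t) ≤ C := by
    have : 0 ≤ ∑ j ∈ Finset.range (n + 1), D j * (A t * |ρ| + 1) :=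
      Finset.sum_nonneg fun j _ => by have := hD j; have := hA t; positivity
    linarith
  have hA' := hA (n + t)
  refine ⟨C, by linarith, fun f hf => ?_⟩
  have hft : gnorm t (L f) ≤ A t * |ρ| := (hAb t f).trans
    (mul_le_mul_of_nonneg_left (hf.trans (le_abs_self ρ)) (hA t))
  have hfn : gnorm (n + t) (L f) ≤ A (n + t) * gnorm (n + (t + s)) f := by
    rw [← add_assoc]; exact hAb _ f
  have hg0 := gnorm_nonneg (n + (t + s)) f
  -- The ratio is the `n`-th root of `1 + ‖L f‖ₙ₊ₜ`. For `n = 0` there is no such root, `K = 1` is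
  -- taken, and only the low norm is needed.
  obtain ⟨K, hK1, hKn, hKle⟩ : ∃ K : ℝ, 1 ≤ K ∧ K ^ n ≤ 1 + gnorm (n + t) (L f) ∧
      (n ≠ 0 → gnorm (n + t) (L f) ≤ K ^ n) := by
    rcases eq_or_ne n 0 with h | h
    · exact ⟨1, le_rfl, by simpa using gnorm_nonneg _ _, fun h' => (h' h).elim⟩
    · have h0 := gnorm_nonneg (n + t) (L f)
      have hpow : ((1 + gnorm (n + t) (L f)) ^ ((n : ℝ)⁻¹)) ^ n = 1 + gnorm (n + t) (L f) :=
        Real.rpow_inv_natCast_pow (by linarith) h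
      refine ⟨(1 + gnorm (n + t) (L f)) ^ ((n : ℝ)⁻¹), Real.one_le_rpow (by linarith)
        (by positivity), hpow.le, fun _ => by rw [hpow]; linarith⟩
  have hK0 : 0 < K := by linarith
  refine ⟨K, hK1, ?_, fun j hj => ?_⟩
  · calc K ^ n ≤ 1 + A (n + t) * gnorm (n + (t + s)) f := by linarith
      _ ≤ (1 + A (n + t)) * (1 + gnorm (n + (t + s)) f) := by nlinarith
      _ ≤ C * (1 + gnorm (n + (t + s)) f) := by gcongr
  · have hkey : gnorm (j + t) (L f) ≤ K ^ j * (A t * |ρ| + 1) := by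
      rcases hj.eq_or_lt with rfl | hjn
      · rcases eq_or_ne j 0 with rfl | h
        · simp only [zero_add, pow_zero, one_mul]; linarith
        · have : 0 ≤ K ^ j * (A t * |ρ|) := by have := hA t; positivity
          linarith [hKle h]
      · have hn : n ≠ 0 := by omega
        have hterm : ∀ k : ℕ, Real.exp ((j + t : ℕ) * k) * ‖(L f).1 k‖ ≤
            K ^ j * (Real.exp (t * k) * ‖(L f).1 k‖) +
              K ^ j / K ^ n * (Real.exp ((n + t : ℕ) * k) * ‖(L f).1 k‖) := fun k => by
          have he : ∀ m : ℕ, Real.exp ((m + t : ℕ) * k) =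
              Real.exp k ^ m * Real.exp (t * k) := fun m => by
            rw [← Real.exp_nat_mul, ← Real.exp_add]; congr 1; push_cast; ring
          -- For frequencies with `exp k ≤ K` the first term suffices; for `exp k ≥ K` the second
          -- one does, because `j < n`. Summed over `k`, this bounds the norm of index `j + t` by
          -- the norms of index `t` and `n + t`.
          have hmain : Real.exp (k : ℝ) ^ j ≤ K ^ j + K ^ j / K ^ n * Real.exp (k : ℝ) ^ n := by
            rcases le_total (Real.exp (k : ℝ)) K with h | h
            · have : 0 ≤ K ^ j / K ^ n * Real.exp (k : ℝ) ^ n := by positivity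
              have := pow_le_pow_left₀ (Real.exp_pos (k : ℝ)).le h j
              linarith
            · obtain ⟨d, rfl⟩ := Nat.exists_eq_add_of_le hjn.le
              have h1 : K ^ d ≤ Real.exp (k : ℝ) ^ d := pow_le_pow_left₀ hK0.le h d
              have h2 : Real.exp (k : ℝ) ^ j ≤
                  K ^ j / K ^ (j + d) * Real.exp (k : ℝ) ^ (j + d) := by
                rw [pow_add, pow_add, div_mul_eq_mul_div, le_div_iff₀ (by positivity)]
                calc Real.exp (k : ℝ) ^ j * (K ^ j * K ^ d)
                    = (K ^ j * Real.exp (k : ℝ) ^ j) * K ^ d := by ring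
                  _ ≤ (K ^ j * Real.exp (k : ℝ) ^ j) * Real.exp (k : ℝ) ^ d := by gcongr
                  _ = _ := by ring
              have : 0 ≤ K ^ j := by positivity
              linarith
          rw [he j, he n]
          have h3 : 0 ≤ Real.exp (t * k) * ‖(L f).1 k‖ := by positivity
          nlinarith [mul_le_mul_of_nonneg_right hmain h3]
        have hs1 := ((L f).2 t).mul_left (K ^ j)
        have hs2 := ((L f).2 (n + t)).mul_left (K ^ j / K ^ n)
        have := ((L f).2 (j + t)).tsum_le_tsum hterm (hs1.add hs2)
        rw [hs1.tsum_add hs2, tsum_mul_left, tsum_mul_left] at this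
        calc gnorm (j + t) (L f) ≤ K ^ j * gnorm t (L f) + K ^ j / K ^ n * gnorm (n + t) (L f) :=
              this
          _ ≤ K ^ j * (A t * |ρ|) + K ^ j / K ^ n * K ^ n := by
              gcongr
              exact hKle hn
          _ = _ := by field_simp
    calc gnorm j f = gnorm j (M (L f)) := by rw [hML]
      _ ≤ D j * gnorm (j + t) (L f) := hDb j _
      _ ≤ D j * (K ^ j * (A t * |ρ| + 1)) := mul_le_mul_of_nonneg_left hkey (hD j)
      _ = (D j * (A t * |ρ| + 1)) * K ^ j := by ring
      _ ≤ C * K ^ j := by gcongr; exact hsum j hj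

/-! ## Calculus of directional derivatives -/

section calculus

variable {E F G : Type} [AddCommGroup E] [Module ℝ E] [TopologicalSpace E] [Grading E]
  [AddCommGroup F] [Module ℝ F] [TopologicalSpace F] [Grading F]
  [AddCommGroup G] [Module ℝ G] [TopologicalSpace G] [Grading G]

/-- A norming functional for a seminorm of the grading. -/
theorem exists_norming_functional (n : ℕ) (z : E) :
    ∃ φ : E →ₗ[ℝ] ℝ, (∀ x, |φ x| ≤ gnorm n x) ∧ φ z = gnorm n z := by
  rcases eq_or_ne z 0 with rfl | hz
  · exact ⟨0, fun x => by simpa using gnorm_nonneg n x, by simp [gnorm_zero]⟩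
  obtain ⟨φ, hφ, hb⟩ := exists_extension_of_le_sublinear
    (LinearPMap.mkSpanSingleton z (gnorm n z) hz) (gnorm n)
    (fun c hc x => by rw [gnorm_smul, abs_of_pos hc]) (fun x y => gnorm_add_le n x y) (by
      rintro ⟨x, hx⟩
      obtain ⟨c, rfl⟩ := Submodule.mem_span_singleton.1 hx
      rw [LinearPMap.mkSpanSingleton'_apply, gnorm_smul, smul_eq_mul]
      exact mul_le_mul_of_nonneg_right (le_abs_self c) (gnorm_nonneg _ _))
  refine ⟨φ, fun x => abs_le.2 ⟨?_, hb x⟩, ?_⟩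
  · have := hb (-x)
    rw [map_neg, gnorm_neg] at this
    linarith
  · have h := hφ ⟨z, Submodule.mem_span_singleton_self z⟩
    rw [h]
    exact LinearPMap.mkSpanSingleton_apply ℝ ℝ hz (gnorm n z)

/-- Mean value inequality for curves in a graded space. -/
theorem gnorm_sub_le_of_slope [GradedLC F] {c c' : ℝ → F} {n : ℕ} {t ε : ℝ} {y : F}
    (hc : ∀ s ∈ uIcc 0 t, Tendsto (fun u : ℝ => u⁻¹ • (c (s + u) - c s)) (𝓝[≠] 0) (𝓝 (c' s)))
    (hb : ∀ s ∈ uIcc 0 t, gnorm n (c' s - y) ≤ ε) :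
    gnorm n (c t - c 0 - t • y) ≤ ε * |t| := by
  -- A functional that attains the seminorm on the vector to be estimated reduces the claim to the
  -- mean value inequality for real functions.
  obtain ⟨φ, hφ, hz⟩ := exists_norming_functional n (c t - c 0 - t • y)
  have hφc : Tendsto φ (𝓝 0) (𝓝 0) := by
    rw [Metric.tendsto_nhds]
    intro δ hδ
    filter_upwards [gnorm_ball_mem_nhds (0 : F) n hδ] with x hx
    rw [Real.dist_eq, sub_zero]
    have hx' : gnorm n (x - 0) < δ := hx
    rw [sub_zero] at hx'
    exact (hφ x).trans_lt hx'
  have hd : ∀ s ∈ uIcc 0 t, HasDerivWithinAt (fun s => φ (c s) - s * φ y)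
      (φ (c' s) - φ y) (uIcc 0 t) s := by
    intro s hs
    have h1 : HasDerivAt (fun s => φ (c s)) (φ (c' s)) s := by
      rw [hasDerivAt_iff_tendsto_slope_zero]
      have h2 : Tendsto (fun u : ℝ => u⁻¹ • (c (s + u) - c s) - c' s) (𝓝[≠] 0) (𝓝 0) := by
        simpa using (hc s hs).sub_const (c' s)
      have h3 := (hφc.comp h2).add_const (φ (c' s))
      rw [zero_add] at h3
      refine h3.congr fun u => ?_
      simp
    have h4 := (h1.sub ((hasDerivAt_id s).mul_const (φ y))).hasDerivWithinAt (s := uIcc 0 t)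
    rw [one_mul] at h4
    exact h4
  have hbd : ∀ s ∈ uIcc 0 t, ‖φ (c' s) - φ y‖ ≤ ε := fun s hs => by
    rw [← map_sub, Real.norm_eq_abs]
    exact (hφ _).trans (hb s hs)
  have hm := (convex_uIcc (0 : ℝ) t).norm_image_sub_le_of_norm_hasDerivWithin_le hd hbd
    left_mem_uIcc right_mem_uIcc
  rw [← hz]
  refine (le_abs_self _).trans ?_
  have he : φ (c t - c 0 - t • y) = φ (c t) - t * φ y - (φ (c 0) - 0 * φ y) := by
    simp only [map_sub, map_smul, smul_eq_mul]; ring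
  rw [he]
  simpa using hm

/-- Difference quotients with moving base point and direction converge to the directional
derivative when the latter is continuous. -/
theorem tendsto_slope [GradedLC E] [GradedLC F] {P : E → F} {DP : E × E → F} {V : Set E}
    (hV : IsOpen V) (hP : ∀ g ∈ V, ∀ h, HasDirDeriv P g h (DP (g, h)))
    (hDP : ContinuousOn DP (V ×ˢ univ)) {g k : E} (hg : g ∈ V) {γ q : ℝ → E}
    (hγ : Tendsto γ (𝓝[≠] 0) (𝓝 g)) (hq : Tendsto q (𝓝[≠] 0) (𝓝 k)) :
    Tendsto (fun t : ℝ => t⁻¹ • (P (γ t + t • q t) - P (γ t))) (𝓝[≠] 0) (𝓝 (DP (g, k))) := by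
  rw [tendsto_iff_gnorm]
  intro n ε hε
  have hc : ContinuousAt DP (g, k) :=
    hDP.continuousAt ((hV.prod isOpen_univ).mem_nhds ⟨hg, mem_univ _⟩)
  have hO : {p : E × E | p.1 ∈ V ∧ gnorm n (DP p - DP (g, k)) < ε / 2} ∈ 𝓝 (g, k) := by
    have h1 := hc (gnorm_ball_mem_nhds (DP (g, k)) n (half_pos hε))
    have h2 : {p : E × E | p.1 ∈ V} ∈ 𝓝 (g, k) :=
      continuousAt_fst.preimage_mem_nhds (hV.mem_nhds hg)
    exact Filter.inter_mem h2 h1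
  obtain ⟨⟨m, δ⟩, hδ, hs⟩ := (nhds_basis_gnorm ((g, k) : E × E)).mem_iff.1 hO
  have hδ' : 0 < δ := hδ
  -- The radius `δ` is shared between the distance from `γ t` to `g`, the displacement `s • q t`
  -- along the segment, and the distance from `q t` to `k`.
  have e1 := tendsto_iff_gnorm.1 hγ m (δ / 3) (by linarith)
  have e2 := tendsto_iff_gnorm.1 hq m (δ / 3) (by linarith)
  have e3 : ∀ᶠ t : ℝ in 𝓝[≠] 0, |t| * (gnorm m k + δ / 3) < δ / 3 := by
    have : Tendsto (fun t : ℝ => |t| * (gnorm m k + δ / 3)) (𝓝 0) (𝓝 (|0| * (gnorm m k + δ / 3))) :=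
      (continuous_abs.tendsto 0).mul_const _
    rw [abs_zero, zero_mul] at this
    exact (this.eventually (Iio_mem_nhds (by linarith : 0 < δ / 3))).filter_mono
      nhdsWithin_le_nhds
  filter_upwards [e1, e2, e3, self_mem_nhdsWithin] with t h1 h2 h3 ht
  have ht0 : t ≠ 0 := ht
  have hmem : ∀ s ∈ uIcc 0 t, γ t + s • q t ∈ V ∧
      gnorm n (DP (γ t + s • q t, q t) - DP (g, k)) < ε / 2 := fun s hst => by
    refine hs (show gnorm m ((γ t + s • q t, q t) - (g, k)) < δ from ?_)
    rw [gnorm_prod]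
    have hsabs : |s| ≤ |t| := by simpa using abs_sub_left_of_mem_uIcc hst
    have hqn : gnorm m (q t) ≤ gnorm m k + δ / 3 :=
      (gnorm_le_add_sub m (q t) k).trans (by linarith)
    have h4 : gnorm m (s • q t) < δ / 3 := by
      rw [gnorm_smul]
      refine lt_of_le_of_lt ?_ h3
      exact mul_le_mul hsabs hqn (gnorm_nonneg _ _) (abs_nonneg _)
    have h5 : gnorm m (γ t + s • q t - g) ≤ gnorm m (γ t - g) + gnorm m (s • q t) := by
      rw [add_sub_right_comm]; exact gnorm_add_le _ _ _
    simp only [Prod.fst_sub, Prod.snd_sub]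
    linarith
  have hmv := gnorm_sub_le_of_slope (c := fun s => P (γ t + s • q t))
    (c' := fun s => DP (γ t + s • q t, q t)) (n := n) (t := t) (ε := ε / 2) (y := DP (g, k))
    (fun s hst => by
      have := hP _ (hmem s hst).1 (q t)
      unfold HasDirDeriv at this
      simpa only [add_smul, add_assoc] using this) (fun s hst => (hmem s hst).2.le)
  have he : t⁻¹ • (P (γ t + t • q t) - P (γ t)) - DP (g, k) =
      t⁻¹ • (P (γ t + t • q t) - P (γ t) - t • DP (g, k)) := by
    rw [smul_sub t⁻¹ (_ - _), inv_smul_smul₀ ht0]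
  rw [he, gnorm_smul, abs_inv]
  simp only [zero_smul, add_zero] at hmv
  have htp : 0 < |t| := abs_pos.2 ht0
  calc |t|⁻¹ * gnorm n (P (γ t + t • q t) - P (γ t) - t • DP (g, k)) ≤ |t|⁻¹ * (ε / 2 * |t|) := by
        gcongr
    _ = ε / 2 := by field_simp
    _ < ε := by linarith

theorem HasDirDeriv.tendsto_line [GradedLC E] (f h : E) :
    Tendsto (fun t : ℝ => f + t • h) (𝓝[≠] 0) (𝓝 f) := by
  have : Tendsto (fun t : ℝ => f + t • h) (𝓝 0) (𝓝 (f + (0 : ℝ) • h)) :=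
    ((continuous_id.smul continuous_const).const_add f).tendsto 0
  rw [zero_smul, add_zero] at this
  exact this.mono_left nhdsWithin_le_nhds

/-- The chain rule for directional derivatives. -/
theorem HasDirDeriv.comp [GradedLC F] [GradedLC G] {P : F → G} {DP : F × F → G} {V : Set F}
    (hV : IsOpen V) (hP : ∀ g ∈ V, ∀ h, HasDirDeriv P g h (DP (g, h)))
    (hDP : ContinuousOn DP (V ×ˢ univ)) {Q : E → F} {f h : E} {k : F} (hf : Q f ∈ V)
    (hQ : HasDirDeriv Q f h k) : HasDirDeriv (fun x => P (Q x)) f h (DP (Q f, k)) := by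
  -- With `q t` the difference quotient of `Q`, one has `Q (f + t h) = Q f + t • q t`: a fixed base
  -- point and a moving direction.
  refine (tendsto_slope hV hP hDP hf tendsto_const_nhds hQ).congr' ?_
  filter_upwards [self_mem_nhdsWithin] with t ht
  have ht0 : t ≠ 0 := ht
  rw [smul_inv_smul₀ ht0, add_sub_cancel]

theorem HasDirDeriv.unique [GradedLC F] {P : E → F} {f h : E} {y z : F} (hy : HasDirDeriv P f h y)
    (hz : HasDirDeriv P f h z) : y = z := tendsto_nhds_unique hy hz

theorem HasDirDeriv.congr [GradedLC E] {P Q : E → F} {U : Set E} (hU : IsOpen U) {f h : E} {y : F}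
    (hf : f ∈ U) (hP : HasDirDeriv P f h y) (hPQ : ∀ x ∈ U, P x = Q x) : HasDirDeriv Q f h y := by
  refine Tendsto.congr' ?_ hP
  filter_upwards [(HasDirDeriv.tendsto_line f h).eventually (hU.mem_nhds hf)] with t ht
  rw [hPQ _ ht, hPQ _ hf]

theorem hasDirDeriv_linear [GradedLC F] (L : E →ₗ[ℝ] F) (f h : E) : HasDirDeriv L f h (L h) := by
  refine tendsto_const_nhds.congr' ?_
  filter_upwards [self_mem_nhdsWithin] with t ht
  have ht0 : t ≠ 0 := ht
  rw [map_add, map_smul, add_sub_cancel_left, inv_smul_smul₀ ht0]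

theorem HasDirDeriv.prodMk {P : E → F} {Q : E → G} {f h : E} {y : F} {z : G}
    (hP : HasDirDeriv P f h y) (hQ : HasDirDeriv Q f h z) :
    HasDirDeriv (fun x => (P x, Q x)) f h (y, z) :=
  Tendsto.prodMk_nhds hP hQ

theorem HasDirDeriv.add [GradedLC F] {P Q : E → F} {f h : E} {y z : F} (hP : HasDirDeriv P f h y)
    (hQ : HasDirDeriv Q f h z) : HasDirDeriv (fun x => P x + Q x) f h (y + z) := by
  refine (Tendsto.add hP hQ).congr fun t => ?_
  rw [← smul_add, add_sub_add_comm]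

/-! ## Tame maps -/

theorem IsTameOn.mono {P : E → F} {U V : Set E} (h : IsTameOn P V) (hUV : U ⊆ V) :
    IsTameOn P U := by
  refine ⟨h.1.mono hUV, fun x hx => ?_⟩
  obtain ⟨W, hW, r, b, hb⟩ := h.2 x (hUV hx)
  refine ⟨W, hW, r, b, fun n hn => ?_⟩
  obtain ⟨C, hC⟩ := hb n hn
  exact ⟨C, fun f hf => hC f ⟨hf.1, hUV hf.2⟩⟩

theorem IsTameOn.congr {P Q : E → F} {U : Set E} (h : IsTameOn P U) (hPQ : ∀ x ∈ U, P x = Q x) :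
    IsTameOn Q U := by
  refine ⟨h.1.congr fun x hx => (hPQ x hx).symm, fun x hx => ?_⟩
  obtain ⟨W, hW, r, b, hb⟩ := h.2 x hx
  refine ⟨W, hW, r, b, fun n hn => ?_⟩
  obtain ⟨C, hC⟩ := hb n hn
  exact ⟨C, fun f hf => by rw [← hPQ f hf.2]; exact hC f hf⟩

/-- The tame estimate with base `0` and nonnegative constants. -/
theorem IsTameOn.bound {P : E → F} {U : Set E} (h : IsTameOn P U) {x : E} (hx : x ∈ U) :
    ∃ V ∈ 𝓝 x, ∃ r : ℕ, ∀ n, ∃ C, 0 ≤ C ∧ ∀ f ∈ V ∩ U,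
      gnorm n (P f) ≤ C * (1 + gnorm (n + r) f) := by
  obtain ⟨W, hW, r, b, hb⟩ := h.2 x hx
  refine ⟨W, hW, b + r, fun n => ?_⟩
  obtain ⟨C, hC⟩ := hb (n + b) (Nat.le_add_left _ _)
  refine ⟨|C|, abs_nonneg C, fun f hf => (gnorm_mono (Nat.le_add_right n b) _).trans
    ((hC f hf).trans ?_)⟩
  rw [add_assoc]
  exact mul_le_mul_of_nonneg_right (le_abs_self C)
    (by have := gnorm_nonneg (n + (b + r)) f; linarith)

theorem isTameOn_of_bound {P : E → F} {U : Set E} (hc : ContinuousOn P U)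
    (h : ∀ x ∈ U, ∃ V ∈ 𝓝 x, ∃ r : ℕ, ∀ n, ∃ C : ℝ, ∀ f ∈ V ∩ U,
      gnorm n (P f) ≤ C * (1 + gnorm (n + r) f)) : IsTameOn P U :=
  ⟨hc, fun x hx => by
    obtain ⟨V, hV, r, hr⟩ := h x hx
    exact ⟨V, hV, r, 0, fun n _ => hr n⟩⟩

/-- Continuity of `Q` brings a neighbourhood of `x` into the region where the estimate for `P`
holds; the degrees add up. -/
theorem IsTameOn.comp {P : F → G} {Q : E → F} {U : Set E} {V : Set F} (hP : IsTameOn P V)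
    (hQ : IsTameOn Q U) (hQV : ∀ x ∈ U, Q x ∈ V) : IsTameOn (fun x => P (Q x)) U := by
  refine isTameOn_of_bound (hP.1.comp hQ.1 hQV) fun x hx => ?_
  obtain ⟨W, hW, r, hr⟩ := hP.bound (hQV x hx)
  obtain ⟨W', hW', s, hs⟩ := hQ.bound hx
  obtain ⟨W'', hW'', hsub⟩ := mem_nhdsWithin_iff_exists_mem_nhds_inter.1 (hQ.1 x hx hW)
  refine ⟨W' ∩ W'', inter_mem hW' hW'', r + s, fun n => ?_⟩
  obtain ⟨C, hC, hCb⟩ := hr n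
  obtain ⟨D, hD, hDb⟩ := hs (n + r)
  refine ⟨C * (1 + D), fun f hf => ?_⟩
  have h1 := hCb (Q f) ⟨hsub ⟨hf.1.2, hf.2⟩, hQV f hf.2⟩
  have h2 := hDb f ⟨hf.1.1, hf.2⟩
  rw [← add_assoc]
  have h3 := gnorm_nonneg (n + r + s) f
  calc gnorm n (P (Q f)) ≤ C * (1 + gnorm (n + r) (Q f)) := h1
    _ ≤ C * ((1 + D) * (1 + gnorm (n + r + s) f)) := by gcongr; nlinarith
    _ = _ := by ring

theorem IsTameOn.prodMk {P : E → F} {Q : E → G} {U : Set E} (hP : IsTameOn P U)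
    (hQ : IsTameOn Q U) : IsTameOn (fun x => (P x, Q x)) U := by
  refine isTameOn_of_bound (hP.1.prodMk hQ.1) fun x hx => ?_
  obtain ⟨W, hW, r, hr⟩ := hP.bound hx
  obtain ⟨W', hW', s, hs⟩ := hQ.bound hx
  refine ⟨W ∩ W', inter_mem hW hW', r + s, fun n => ?_⟩
  obtain ⟨C, hC, hCb⟩ := hr n
  obtain ⟨D, hD, hDb⟩ := hs n
  refine ⟨C + D, fun f hf => ?_⟩
  rw [gnorm_prod, add_mul]
  have h1 : gnorm (n + r) f ≤ gnorm (n + (r + s)) f := gnorm_mono (by omega) f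
  have h2 : gnorm (n + s) f ≤ gnorm (n + (r + s)) f := gnorm_mono (by omega) f
  refine add_le_add ((hCb f ⟨hf.1.1, hf.2⟩).trans ?_) ((hDb f ⟨hf.1.2, hf.2⟩).trans ?_)
  · gcongr
  · gcongr

theorem IsTameLinear.isTameOn [GradedLC E] [GradedLC F] {L : E →ₗ[ℝ] F} (hL : IsTameLinear L)
    (U : Set E) : IsTameOn L U := by
  obtain ⟨r, hr⟩ := hL.bound
  refine isTameOn_of_bound hL.continuous.continuousOn fun x _ => ⟨univ, univ_mem, r, fun n => ?_⟩
  obtain ⟨C, hC, hCb⟩ := hr n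
  refine ⟨C, fun f _ => (hCb f).trans ?_⟩
  gcongr
  linarith

theorem isTameOn_const (y : F) (U : Set E) : IsTameOn (fun _ : E => y) U := by
  refine isTameOn_of_bound continuousOn_const fun x _ => ⟨univ, univ_mem, 0, fun n => ?_⟩
  refine ⟨gnorm n y, fun f _ => ?_⟩
  nlinarith [gnorm_nonneg n y, gnorm_nonneg (n + 0) f]

/-- Real functions are tame as soon as they are continuous. -/
theorem isTameOn_real {P : E → ℝ} {U : Set E} (hc : ContinuousOn P U) : IsTameOn P U := by
  refine isTameOn_of_bound hc fun x hx => ?_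
  have h1 := (continuous_abs.continuousAt.comp_continuousWithinAt (hc x hx))
    (Iio_mem_nhds (lt_add_one |P x|))
  obtain ⟨V, hV, hsub⟩ := mem_nhdsWithin_iff_exists_mem_nhds_inter.1 h1
  refine ⟨V, hV, 0, fun n => ⟨|P x| + 1, fun f hf => ?_⟩⟩
  have h2 : |P f| < |P x| + 1 := hsub hf
  rw [gnorm_real]
  nlinarith [abs_nonneg (P x), gnorm_nonneg (n + 0) f]

end calculus

/-! ## Maps with finitely many tame derivatives -/

/-- `P` has `n` iterated tangent maps on `U`, all of them tame. -/
def TameC : ℕ → ∀ {E F : Type} [AddCommGroup E] [Module ℝ E] [TopologicalSpace E] [Grading E]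
    [AddCommGroup F] [Module ℝ F] [TopologicalSpace F] [Grading F], (E → F) → Set E → Prop
  | 0, _, _, _, _, _, _, _, _, _, _, P, U => IsTameOn P U
  | n + 1, E, F, _, _, _, _, _, _, _, _, P, U => IsTameOn P U ∧ ∃ DP : E × E → F,
      (∀ f ∈ U, ∀ h, HasDirDeriv P f h (DP (f, h))) ∧ TameC n DP (U ×ˢ univ)

section tamec

variable {E F G : Type} [AddCommGroup E] [Module ℝ E] [TopologicalSpace E] [Grading E]
  [AddCommGroup F] [Module ℝ F] [TopologicalSpace F] [Grading F]
  [AddCommGroup G] [Module ℝ G] [TopologicalSpace G] [Grading G]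

theorem TameC.isTameOn {n : ℕ} {P : E → F} {U : Set E} (h : TameC n P U) : IsTameOn P U := by
  cases n with
  | zero => exact h
  | succ n => exact h.1

/-- As in all the inductions on `TameC`, the spaces have to vary, since the derivative of a map on
`E` is a map on `E × E`. -/
theorem TameC.of_succ {n : ℕ} {E F : Type} [AddCommGroup E] [Module ℝ E] [TopologicalSpace E]
    [Grading E] [AddCommGroup F] [Module ℝ F] [TopologicalSpace F] [Grading F]
    {P : E → F} {U : Set E} (h : TameC (n + 1) P U) : TameC n P U := by
  induction n generalizing E F with
  | zero => exact h.1
  | succ n ih =>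
    obtain ⟨h1, DP, h2, h3⟩ := h
    exact ⟨h1, DP, h2, ih h3⟩

theorem TameC.mono {n : ℕ} {E F : Type} [AddCommGroup E] [Module ℝ E] [TopologicalSpace E]
    [Grading E] [AddCommGroup F] [Module ℝ F] [TopologicalSpace F] [Grading F]
    {P : E → F} {U V : Set E} (h : TameC n P V) (hUV : U ⊆ V) : TameC n P U := by
  induction n generalizing E F with
  | zero => exact IsTameOn.mono h hUV
  | succ n ih =>
    obtain ⟨h1, DP, h2, h3⟩ := h
    exact ⟨h1.mono hUV, DP, fun f hf => h2 f (hUV hf), ih h3 (prod_mono hUV le_rfl)⟩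

theorem TameC.congr {n : ℕ} [GradedLC E] {P Q : E → F} {U : Set E} (hU : IsOpen U)
    (h : TameC n P U) (hPQ : ∀ x ∈ U, P x = Q x) : TameC n Q U := by
  cases n with
  | zero => exact IsTameOn.congr h hPQ
  | succ n =>
    obtain ⟨h1, DP, h2, h3⟩ := h
    exact ⟨h1.congr hPQ, DP, fun f hf k => (h2 f hf k).congr hU hf hPQ, h3⟩

theorem TameC.linear {n : ℕ} {E F : Type} [AddCommGroup E] [Module ℝ E] [TopologicalSpace E]
    [Grading E] [AddCommGroup F] [Module ℝ F] [TopologicalSpace F] [Grading F]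
    [GradedLC E] [GradedLC F] {L : E →ₗ[ℝ] F} (hL : IsTameLinear L) (U : Set E) :
    TameC n L U := by
  induction n generalizing E F with
  | zero => exact hL.isTameOn U
  | succ n ih =>
    exact ⟨hL.isTameOn U, fun p => (L ∘ₗ LinearMap.snd ℝ E E) p,
      fun f _ h => hasDirDeriv_linear L f h, ih (hL.comp isTameLinear_snd) _⟩

theorem TameC.const {n : ℕ} {E : Type} [AddCommGroup E] [Module ℝ E] [TopologicalSpace E]
    [Grading E] (y : F) (U : Set E) : TameC n (fun _ : E => y) U := by
  induction n generalizing E y with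
  | zero => exact isTameOn_const y U
  | succ n ih =>
    refine ⟨isTameOn_const y U, fun _ => 0, fun f _ h => ?_, ih 0 _⟩
    simpa [HasDirDeriv] using tendsto_const_nhds

theorem TameC.prodMk {n : ℕ} {E F G : Type} [AddCommGroup E] [Module ℝ E] [TopologicalSpace E]
    [Grading E] [AddCommGroup F] [Module ℝ F] [TopologicalSpace F] [Grading F]
    [AddCommGroup G] [Module ℝ G] [TopologicalSpace G] [Grading G]
    {P : E → F} {Q : E → G} {U : Set E} (hP : TameC n P U) (hQ : TameC n Q U) :
    TameC n (fun x => (P x, Q x)) U := by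
  induction n generalizing E F G with
  | zero => exact IsTameOn.prodMk hP hQ
  | succ n ih =>
    obtain ⟨h1, DP, h2, h3⟩ := hP
    obtain ⟨k1, DQ, k2, k3⟩ := hQ
    exact ⟨h1.prodMk k1, fun p => (DP p, DQ p), fun f hf h => (h2 f hf h).prodMk (k2 f hf h),
      ih h3 k3⟩

/-- The composite of maps with `n` tame derivatives. -/
theorem TameC.comp {n : ℕ} {E F G : Type} [AddCommGroup E] [Module ℝ E] [TopologicalSpace E]
    [Grading E] [AddCommGroup F] [Module ℝ F] [TopologicalSpace F] [Grading F]
    [AddCommGroup G] [Module ℝ G] [TopologicalSpace G] [Grading G]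
    [GradedLC E] [GradedLC F] [GradedLC G] {P : F → G} {Q : E → F} {U : Set E} {V : Set F}
    (hU : IsOpen U) (hV : IsOpen V) (hP : TameC n P V) (hQ : TameC n Q U)
    (hQV : ∀ x ∈ U, Q x ∈ V) : TameC n (fun x => P (Q x)) U := by
  induction n generalizing E F G with
  | zero => exact IsTameOn.comp hP hQ hQV
  | succ n ih =>
    have hQn := hQ.of_succ
    obtain ⟨h1, DP, h2, h3⟩ := hP
    obtain ⟨k1, DQ, k2, k3⟩ := hQ
    -- The tangent map is functorial: the derivative of the composite is `DP` composed with `(Q,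
    -- DQ)`, again a composite, now of maps with one derivative fewer.
    refine ⟨h1.comp k1 hQV, fun p => DP (Q p.1, DQ p), fun f hf h =>
      HasDirDeriv.comp hV h2 h3.isTameOn.1 (hQV f hf) (k2 f hf h), ?_⟩
    have hfst : TameC n (fun p : E × E => p.1) (U ×ˢ univ) :=
      TameC.linear (L := LinearMap.fst ℝ E E) isTameLinear_fst _
    have hQf : TameC n (fun p : E × E => Q p.1) (U ×ˢ univ) :=
      ih (hU.prod isOpen_univ) hU hQn hfst fun p hp => hp.1
    exact ih (hU.prod isOpen_univ) (hV.prod isOpen_univ) h3 (hQf.prodMk k3)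
      fun p hp => ⟨hQV _ hp.1, mem_univ _⟩

/-- Smooth tame maps, by iterated tangent maps. -/
def TameSmooth (P : E → F) (U : Set E) : Prop := ∀ n, TameC n P U

theorem TameSmooth.comp [GradedLC E] [GradedLC F] [GradedLC G] {P : F → G} {Q : E → F} {U : Set E}
    {V : Set F} (hU : IsOpen U) (hV : IsOpen V) (hP : TameSmooth P V) (hQ : TameSmooth Q U)
    (hQV : ∀ x ∈ U, Q x ∈ V) : TameSmooth (fun x => P (Q x)) U :=
  fun n => (hP n).comp hU hV (hQ n) hQV

/-- Postcomposition with a tame linear map. -/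
theorem TameC.linear_comp {n : ℕ} [GradedLC E] [GradedLC F] [GradedLC G] {L : F →ₗ[ℝ] G}
    (hL : IsTameLinear L) {Q : E → F} {U : Set E} (hU : IsOpen U) (hQ : TameC n Q U) :
    TameC n (fun x => L (Q x)) U :=
  (TameC.linear (n := n) hL univ).comp hU isOpen_univ hQ fun _ _ => mem_univ _

/-- Precomposition with a tame linear map. -/
theorem TameC.comp_linear {n : ℕ} [GradedLC E] [GradedLC F] [GradedLC G] {L : E →ₗ[ℝ] F}
    (hL : IsTameLinear L) {P : F → G} {V : Set F} (hV : IsOpen V) (hP : TameC n P V) {U : Set E}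
    (hU : IsOpen U) (hUV : ∀ x ∈ U, L x ∈ V) : TameC n (fun x => P (L x)) U :=
  hP.comp hU hV (TameC.linear (n := n) hL U) hUV

theorem TameC.fst {n : ℕ} [GradedLC E] [GradedLC F] [GradedLC G] {P : E → F × G} {U : Set E}
    (hU : IsOpen U) (h : TameC n P U) : TameC n (fun x => (P x).1) U :=
  h.linear_comp (L := LinearMap.fst ℝ F G) isTameLinear_fst hU

theorem TameC.snd {n : ℕ} [GradedLC E] [GradedLC F] [GradedLC G] {P : E → F × G} {U : Set E}
    (hU : IsOpen U) (h : TameC n P U) : TameC n (fun x => (P x).2) U :=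
  h.linear_comp (L := LinearMap.snd ℝ F G) isTameLinear_snd hU

theorem TameC.id {n : ℕ} [GradedLC E] (U : Set E) : TameC n (fun x : E => x) U :=
  TameC.linear (L := LinearMap.id) isTameLinear_id U

theorem TameC.add {n : ℕ} [GradedLC E] [GradedLC F] {P Q : E → F} {U : Set E} (hU : IsOpen U)
    (hP : TameC n P U) (hQ : TameC n Q U) : TameC n (fun x => P x + Q x) U :=
  (hP.prodMk hQ).linear_comp (L := LinearMap.fst ℝ F F + LinearMap.snd ℝ F F)
    (isTameLinear_fst.add isTameLinear_snd) hU

theorem TameC.smul_const {n : ℕ} [GradedLC E] [GradedLC F] {P : E → F} {U : Set E} (hU : IsOpen U)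
    (c : ℝ) (hP : TameC n P U) : TameC n (fun x => c • P x) U :=
  hP.linear_comp (L := c • (LinearMap.id : F →ₗ[ℝ] F)) ⟨0, 0, fun n _ => ⟨|c|, fun f => by
    simp [gnorm_smul]⟩⟩ hU

theorem TameC.neg {n : ℕ} [GradedLC E] [GradedLC F] {P : E → F} {U : Set E} (hU : IsOpen U)
    (hP : TameC n P U) : TameC n (fun x => -P x) U := by
  simpa using hP.smul_const hU (-1)

theorem TameC.sub {n : ℕ} [GradedLC E] [GradedLC F] {P Q : E → F} {U : Set E} (hU : IsOpen U)
    (hP : TameC n P U) (hQ : TameC n Q U) : TameC n (fun x => P x - Q x) U := by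
  simpa [sub_eq_add_neg] using hP.add hU (hQ.neg hU)

theorem TameC.sum {n : ℕ} [GradedLC E] [GradedLC F] {ι : Type} {s : Finset ι} {P : ι → E → F}
    {U : Set E} (hU : IsOpen U) (hP : ∀ i ∈ s, TameC n (P i) U) :
    TameC n (fun x => ∑ i ∈ s, P i x) U := by
  classical
  induction s using Finset.induction_on with
  | empty => simpa using TameC.const (0 : F) U
  | insert a s ha ih =>
    simp only [Finset.sum_insert ha]
    exact (hP a (Finset.mem_insert_self _ _)).add hU
      (ih fun i hi => hP i (Finset.mem_insert_of_mem hi))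

/-- A map whose increments are `P x' - P x = Q (x', x, x' - x)`, with `Q` homogeneous in the last
variable, has one more tame derivative than `Q`. -/
theorem TameC.of_increment {n : ℕ} [GradedLC E] [GradedLC F] {P : E → F} {Q : E × E × E → F}
    {U : Set E} (hU : IsOpen U) (hP : IsTameOn P U)
    (hPQ : ∀ x' ∈ U, ∀ x ∈ U, P x' - P x = Q (x', x, x' - x))
    (hQh : ∀ x' ∈ U, ∀ x ∈ U, ∀ (t : ℝ) (h : E), Q (x', x, t • h) = t • Q (x', x, h))
    (hQ : TameC n Q (U ×ˢ U ×ˢ univ)) : TameC (n + 1) P U := by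
  refine ⟨hP, fun p => Q (p.1, p.1, p.2), fun f hf h => ?_, ?_⟩
  · have hc : ContinuousAt Q (f, f, h) := hQ.isTameOn.1.continuousAt
      ((hU.prod (hU.prod isOpen_univ)).mem_nhds ⟨hf, hf, mem_univ _⟩)
    have hl := HasDirDeriv.tendsto_line f h
    have h1 : Tendsto (fun t : ℝ => Q (f + t • h, f, h)) (𝓝[≠] 0) (𝓝 (Q (f, f, h))) :=
      hc.tendsto.comp (hl.prodMk_nhds (tendsto_const_nhds.prodMk_nhds tendsto_const_nhds))
    -- By homogeneity the difference quotient is exactly `Q (f + t h, f, h)`, so continuity of `Q`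
    -- alone yields the derivative `Q (f, f, h)`.
    refine h1.congr' ?_
    filter_upwards [self_mem_nhdsWithin, hl.eventually (hU.mem_nhds hf)] with t ht htU
    have ht0 : t ≠ 0 := ht
    rw [hPQ _ htU _ hf, add_sub_cancel_left, hQh _ htU _ hf, inv_smul_smul₀ ht0]
  · exact hQ.comp_linear
      (L := (LinearMap.fst ℝ E E).prod ((LinearMap.fst ℝ E E).prod (LinearMap.snd ℝ E E)))
      (isTameLinear_fst.prod (isTameLinear_fst.prod isTameLinear_snd))
      (hU.prod (hU.prod isOpen_univ)) (hU.prod isOpen_univ) fun p hp => ⟨hp.1, hp.1, mem_univ _⟩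

/-- A bilinear map that is tame. -/
theorem TameC.bilinear {n : ℕ} [GradedLC E] [GradedLC F] [GradedLC G] (B : E →ₗ[ℝ] F →ₗ[ℝ] G)
    (hB : IsTameOn (fun p : E × F => B p.1 p.2) univ) :
    TameC n (fun p : E × F => B p.1 p.2) univ := by
  induction n with
  | zero => exact hB
  | succ n ih =>
    -- The increment of `B` from `x` to `x'` is `B (x'₁ - x₁, x'₂) + B (x₁, x'₂ - x₂)`, built from
    -- `B` itself, so the induction closes.
    refine TameC.of_increment (Q := fun q => B q.2.2.1 q.1.2 + B q.2.1.1 q.2.2.2) isOpen_univ hB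
      (fun x' _ x _ => ?_) (fun x' _ x _ t h => by simp) ?_
    · simp only [Prod.fst_sub, Prod.snd_sub, map_sub, LinearMap.sub_apply]
      abel
    · have hid := TameC.id (n := n) (univ ×ˢ univ ×ˢ univ : Set ((E × F) × (E × F) × (E × F)))
      have hO : IsOpen (univ ×ˢ univ ×ˢ univ : Set ((E × F) × (E × F) × (E × F))) := by simp
      have a1 := (hid.fst hO).snd hO
      have a2 := ((hid.snd hO).fst hO).fst hO
      have a3 := ((hid.snd hO).snd hO)
      exact (ih.comp hO isOpen_univ ((a3.fst hO).prodMk a1) fun _ _ => mem_univ _).add hO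
        (ih.comp hO isOpen_univ (a2.prodMk (a3.snd hO)) fun _ _ => mem_univ _)

/-- The scalar is bounded near each point and all its norms are equal, so the estimate is linear in
the norm of the vector and no interpolation is needed. -/
theorem isTameOn_smul [GradedLC E] : IsTameOn (fun p : ℝ × E => p.1 • p.2) univ := by
  refine isTameOn_of_bound (continuous_fst.smul continuous_snd).continuousOn fun x _ =>
    ⟨{p | gnorm 0 (p - x) < 1}, gnorm_ball_mem_nhds x 0 one_pos, 0, fun n => ⟨|x.1| + 1,
      fun p hp => ?_⟩⟩
  have h1 : gnorm 0 (p - x).1 < 1 := (gnorm_fst_le 0 (p - x)).trans_lt hp.1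
  rw [gnorm_real, Prod.fst_sub] at h1
  have h2 : |p.1| ≤ |x.1| + 1 := by
    have := abs_add_le (p.1 - x.1) x.1
    rw [sub_add_cancel] at this
    linarith
  rw [gnorm_smul]
  have h3 := gnorm_snd_le n p
  have h4 := gnorm_nonneg n p.2
  rw [add_zero]
  calc |p.1| * gnorm n p.2 ≤ (|x.1| + 1) * (1 + gnorm n p) := by
        gcongr
        linarith

theorem TameC.smul {n : ℕ} [GradedLC E] [GradedLC F] {c : E → ℝ} {P : E → F} {U : Set E}
    (hU : IsOpen U) (hc : TameC n c U) (hP : TameC n P U) : TameC n (fun x => c x • P x) U :=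
  (TameC.bilinear (LinearMap.lsmul ℝ F) isTameOn_smul).comp hU isOpen_univ (hc.prodMk hP)
    fun _ _ => mem_univ _

theorem TameC.mul_real {n : ℕ} [GradedLC E] {c d : E → ℝ} {U : Set E}
    (hU : IsOpen U) (hc : TameC n c U) (hd : TameC n d U) : TameC n (fun x => c x * d x) U :=
  hc.smul hU hd

/-- The increment formula is `x'⁻¹ - x⁻¹ = -x'⁻¹ x⁻¹ (x' - x)`. -/
theorem TameC.real_inv {n : ℕ} : TameC n (fun x : ℝ => x⁻¹) {0}ᶜ := by
  have hc : IsTameOn (fun x : ℝ => x⁻¹) {0}ᶜ :=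
    isTameOn_real continuousOn_inv₀
  induction n with
  | zero => exact hc
  | succ n ih =>
    have hO : IsOpen ({0}ᶜ : Set ℝ) := isOpen_compl_singleton
    refine TameC.of_increment (Q := fun q => -(q.1⁻¹ * q.2.1⁻¹ * q.2.2)) hO hc
      (fun x' hx' x hx => ?_) (fun x' _ x _ t h => by simp only [smul_eq_mul]; ring) ?_
    · have h1 : x' ≠ 0 := hx'
      have h2 : x ≠ 0 := hx
      field_simp
      ring
    · have hO' : IsOpen (({0}ᶜ : Set ℝ) ×ˢ ({0}ᶜ : Set ℝ) ×ˢ (univ : Set ℝ)) :=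
        hO.prod (hO.prod isOpen_univ)
      have hid := TameC.id (n := n) (({0}ᶜ : Set ℝ) ×ˢ ({0}ᶜ : Set ℝ) ×ˢ (univ : Set ℝ))
      exact (((ih.comp hO' hO (hid.fst hO') fun x hx => hx.1).mul_real hO'
        (ih.comp hO' hO ((hid.snd hO').fst hO') fun x hx => hx.2.1)).mul_real hO'
        ((hid.snd hO').snd hO')).neg hO'

theorem TameC.inv_real {n : ℕ} [GradedLC E] {c : E → ℝ} {U : Set E}
    (hU : IsOpen U) (hc : TameC n c U) (h0 : ∀ x ∈ U, c x ≠ 0) : TameC n (fun x => (c x)⁻¹) U :=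
  TameC.real_inv.comp hU isOpen_compl_singleton hc h0

theorem TameC.div_real {n : ℕ} [GradedLC E] {c d : E → ℝ} {U : Set E}
    (hU : IsOpen U) (hc : TameC n c U) (hd : TameC n d U) (h0 : ∀ x ∈ U, d x ≠ 0) :
    TameC n (fun x => c x / d x) U := by
  simpa only [div_eq_mul_inv] using hc.mul_real hU (hd.inv_real hU h0)

end tamec

section smooth

variable {E F G : Type} [AddCommGroup E] [Module ℝ E] [TopologicalSpace E] [Grading E]
  [AddCommGroup F] [Module ℝ F] [TopologicalSpace F] [Grading F]
  [AddCommGroup G] [Module ℝ G] [TopologicalSpace G] [Grading G]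

theorem TameC.pi {n : ℕ} [GradedLC E] [GradedLC F] {ι : Type} [Fintype ι] {P : E → ι → F}
    {U : Set E} (hU : IsOpen U) (hP : ∀ i, TameC n (fun x => P x i) U) : TameC n P U := by
  classical
  have h1 : TameC n (fun x => ∑ i, LinearMap.single ℝ (fun _ : ι => F) i (P x i)) U := by
    refine TameC.sum hU fun i _ => (hP i).linear_comp (isTameLinear_of_le fun n x => ?_) hU
    rw [gnorm_pi, Finset.sum_eq_single i]
    · simp
    · intro j _ hj
      simp [Pi.single_eq_of_ne hj, gnorm_zero]
    · simp
  have h2 : (fun x => ∑ i, LinearMap.single ℝ (fun _ : ι => F) i (P x i)) = P := by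
    funext x
    simp only [LinearMap.coe_single]
    exact Finset.univ_sum_single (P x)
  rwa [h2] at h1

theorem TameC.apply {n : ℕ} [GradedLC E] [GradedLC F] {ι : Type} [Fintype ι] {P : E → ι → F}
    {U : Set E} (hU : IsOpen U) (hP : TameC n P U) (i : ι) : TameC n (fun x => P x i) U :=
  hP.linear_comp (isTameLinear_proj i) hU

/-! ### From iterated tangent maps to iterated directional derivatives -/

/-- The hypothesis allows a different derivative for each order `n`. By uniqueness of limits they
agree on `U ×ˢ univ`, so one function serves all orders. -/
theorem TameSmooth.exists_deriv [GradedLC E] [GradedLC F] {P : E → F} {U : Set E} (hU : IsOpen U)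
    (h : TameSmooth P U) : ∃ DP : E × E → F, (∀ f ∈ U, ∀ v, HasDirDeriv P f v (DP (f, v))) ∧
      TameSmooth DP (U ×ˢ univ) := by
  obtain ⟨-, DP, hDP, -⟩ := h 1
  refine ⟨DP, hDP, fun n => ?_⟩
  obtain ⟨-, DQ, hDQ, hDQn⟩ := h (n + 1)
  exact hDQn.congr (hU.prod isOpen_univ) fun p hp =>
    (hDQ p.1 hp.1 p.2).unique (hDP p.1 hp.1 p.2)

/-- The iterated directional derivatives of a smooth tame map. -/
def TameSmooth.iter [GradedLC E] [GradedLC F] {P : E → F} {U : Set E} (hU : IsOpen U)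
    (h : TameSmooth P U) :
    (k : ℕ) → {D : E × (Fin k → E) → F // TameSmooth D (U ×ˢ univ)}
  | 0 => ⟨fun p => P p.1, fun n => (h n).comp_linear (L := LinearMap.fst ℝ E (Fin 0 → E))
      isTameLinear_fst hU (hU.prod isOpen_univ) fun _ hp => hp.1⟩
  | k + 1 =>
    let DD := (TameSmooth.iter hU h k).2.exists_deriv (hU.prod isOpen_univ)
    -- The full derivative of `(f, h) ↦ D k f h` is evaluated in the direction `(v, 0)`: the base
    -- point moves along the last vector and the earlier directions stay fixed.
    ⟨fun p => DD.choose ((p.1, Fin.init p.2), (p.2 (Fin.last k), 0)), fun n => by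
      have hO : IsOpen (U ×ˢ (univ : Set (Fin (k + 1) → E))) := hU.prod isOpen_univ
      have hid := TameC.id (n := n) (U ×ˢ (univ : Set (Fin (k + 1) → E)))
      have hinit : TameC n (fun p : E × (Fin (k + 1) → E) => (Fin.init p.2 : Fin k → E))
          (U ×ˢ univ) := TameC.pi hO fun i => (hid.snd hO).apply hO i.castSucc
      exact (DD.choose_spec.2 n).comp hO ((hU.prod isOpen_univ).prod isOpen_univ)
        (((hid.fst hO).prodMk hinit).prodMk
          (((hid.snd hO).apply hO (Fin.last k)).prodMk (TameC.const 0 _)))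
        fun p hp => ⟨⟨hp.1, mem_univ _⟩, mem_univ _⟩⟩

theorem TameSmooth.isSmoothTameOn [GradedLC E] [GradedLC F] {P : E → F} {U : Set E}
    (hU : IsOpen U) (h : TameSmooth P U) : IsSmoothTameOn P U := by
  refine ⟨fun k f v => (h.iter hU k).1 (f, v), fun f _ => rfl, fun k f hf v w => ?_,
    fun k => (h.iter hU k).2 0⟩
  have h1 := ((h.iter hU k).2.exists_deriv (hU.prod isOpen_univ)).choose_spec.1 (f, v)
    ⟨hf, mem_univ _⟩ (w, 0)
  have h2 : (h.iter hU (k + 1)).1 (f, Fin.snoc v w) =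
      ((h.iter hU k).2.exists_deriv (hU.prod isOpen_univ)).choose ((f, v), (w, 0)) := by
    simp only [TameSmooth.iter, Fin.init_snoc, Fin.snoc_last]
  have h3 : HasDirDeriv (fun g => (h.iter hU k).1 (g, v)) f w
      ((h.iter hU (k + 1)).1 (f, Fin.snoc v w)) := by
    rw [h2]
    refine Tendsto.congr (fun t => ?_) h1
    simp
  exact h3

/-! ### From iterated directional derivatives to iterated tangent maps -/

section converse

variable [GradedLC E] [GradedLC F] {U : Set E} {D : (k : ℕ) → E → (Fin k → E) → F}

theorem continuousOn_snoc {k : ℕ} (hD : IsTameOn (fun p : E × (Fin (k + 1) → E) => D (k + 1) p.1 p.2)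
    (U ×ˢ univ)) (h : Fin k → E) :
    ContinuousOn (fun p : E × E => D (k + 1) p.1 (Fin.snoc h p.2)) (U ×ˢ univ) := by
  have hc : Continuous fun p : E × E => (p.1, (Fin.snoc h p.2 : Fin (k + 1) → E)) :=
    continuous_fst.prodMk (Continuous.finSnoc continuous_const continuous_snd)
  exact ContinuousOn.comp (g := fun p : E × (Fin (k + 1) → E) => D (k + 1) p.1 p.2) hD.1
    hc.continuousOn fun p hp => ⟨hp.1, mem_univ _⟩

variable (hU : IsOpen U)
  (hD : ∀ (k : ℕ), ∀ f ∈ U, ∀ (h : Fin k → E) (v : E),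
    HasDirDeriv (fun g => D k g h) f v (D (k + 1) f (Fin.snoc h v)))
  (hT : ∀ k : ℕ, IsTameOn (fun p : E × (Fin k → E) => D k p.1 p.2) (U ×ˢ univ))

include hU hD hT in
-- The increment by `t (v + w)` at `f` is the increment by `t v` at `f` plus the increment by `t w`
-- at the moving point `f + t v`; the latter is covered by `tendsto_slope`.
theorem iteratedDirDeriv_snoc_add {k : ℕ} {f : E} (hf : f ∈ U) (h : Fin k → E) (v w : E) :
    D (k + 1) f (Fin.snoc h (v + w)) =
      D (k + 1) f (Fin.snoc h v) + D (k + 1) f (Fin.snoc h w) := by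
  have h1 := tendsto_slope (P := fun g => D k g h)
    (DP := fun p : E × E => D (k + 1) p.1 (Fin.snoc h p.2)) hU (fun g hg v => hD k g hg h v)
    (continuousOn_snoc (hT (k + 1)) h) hf (HasDirDeriv.tendsto_line f v)
    (tendsto_const_nhds (x := w))
  have h2 := Tendsto.add (hD k f hf h v) h1
  refine tendsto_nhds_unique (hD k f hf h (v + w)) (h2.congr fun t => ?_)
  rw [← smul_add, smul_add t v w, ← add_assoc f]
  congr 1
  abel

include hU hD hT in
-- For `c ≠ 0` substitute `t c` for `t` in the limit; the case `c = 0` follows from additivity.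
theorem iteratedDirDeriv_snoc_smul {k : ℕ} {f : E} (hf : f ∈ U) (h : Fin k → E) (c : ℝ) (v : E) :
    D (k + 1) f (Fin.snoc h (c • v)) = c • D (k + 1) f (Fin.snoc h v) := by
  rcases eq_or_ne c 0 with rfl | hc
  · have := iteratedDirDeriv_snoc_add hU hD hT hf h 0 0
    rw [add_zero, left_eq_add] at this
    rw [zero_smul, zero_smul, this]
  · have ht : Tendsto (fun t : ℝ => t * c) (𝓝[≠] 0) (𝓝[≠] 0) := by
      refine tendsto_nhdsWithin_iff.2 ⟨?_, ?_⟩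
      · have : Tendsto (fun t : ℝ => t * c) (𝓝 0) (𝓝 (0 * c)) := (continuous_mul_const c).tendsto 0
        rw [zero_mul] at this
        exact this.mono_left nhdsWithin_le_nhds
      · filter_upwards [self_mem_nhdsWithin] with t ht
        exact mul_ne_zero ht hc
    refine tendsto_nhds_unique (hD k f hf h (c • v))
      (((Tendsto.comp (hD k f hf h v) ht).const_smul c).congr fun t => ?_)
    simp only [Function.comp, smul_smul, mul_inv]
    congr 1
    field_simp

include hU hD hT in
-- In the last slot this is the previous additivity. In an earlier slot the identity holds for `D k`
-- at all base points of `U`, and it is differentiated in the base point.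
theorem iteratedDirDeriv_update_add {k : ℕ} {f : E} (hf : f ∈ U) (h : Fin k → E) (i : Fin k)
    (x y : E) : D k f (Function.update h i (x + y)) =
      D k f (Function.update h i x) + D k f (Function.update h i y) := by
  induction k generalizing f with
  | zero => exact i.elim0
  | succ k ih =>
    obtain ⟨p, v, rfl⟩ : ∃ (p : Fin k → E) (v : E), h = Fin.snoc p v :=
      ⟨Fin.init h, h (Fin.last k), (Fin.snoc_init_self h).symm⟩
    induction i using Fin.lastCases with
    | last =>
      simp only [Fin.update_snoc_last]
      exact iteratedDirDeriv_snoc_add hU hD hT hf p x y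
    | cast i =>
      simp only [← Fin.snoc_update]
      refine (hD k f hf (Function.update p i (x + y)) v).unique
        (HasDirDeriv.congr hU hf ((hD k f hf (Function.update p i x) v).add
          (hD k f hf (Function.update p i y) v)) fun g hg => ?_)
      exact (ih hg p i).symm

include hU hD hT in
theorem iteratedDirDeriv_update_smul {k : ℕ} {f : E} (hf : f ∈ U) (h : Fin k → E) (i : Fin k)
    (c : ℝ) (x : E) : D k f (Function.update h i (c • x)) =
      c • D k f (Function.update h i x) := by
  induction k generalizing f with
  | zero => exact i.elim0
  | succ k ih =>
    obtain ⟨p, v, rfl⟩ : ∃ (p : Fin k → E) (v : E), h = Fin.snoc p v :=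
      ⟨Fin.init h, h (Fin.last k), (Fin.snoc_init_self h).symm⟩
    induction i using Fin.lastCases with
    | last =>
      simp only [Fin.update_snoc_last]
      exact iteratedDirDeriv_snoc_smul hU hD hT hf p c x
    | cast i =>
      simp only [← Fin.snoc_update]
      have h1 : HasDirDeriv (fun g => c • D k g (Function.update p i x)) f v
          (c • D (k + 1) f (Fin.snoc (Function.update p i x) v)) := by
        refine ((hD k f hf (Function.update p i x) v).const_smul c).congr fun t => ?_
        rw [smul_comm, smul_sub c]
      exact (hD k f hf (Function.update p i (c • x)) v).unique
        (HasDirDeriv.congr hU hf h1 fun g hg => (ih hg p i).symm)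

include hU hD hT in
/-- The derivative of an iterated directional derivative in all its variables. -/
theorem hasDirDeriv_iteratedDirDeriv {k : ℕ} {f : E} (hf : f ∈ U) (h : Fin k → E) (v : E)
    (w : Fin k → E) :
    HasDirDeriv (fun p : E × (Fin k → E) => D k p.1 p.2) (f, h) (v, w)
      (D (k + 1) f (Fin.snoc h v) + ∑ i, D k f (Function.update h i (w i))) := by
  have hline := HasDirDeriv.tendsto_line f v
  have hlineU := hline.eventually (hU.mem_nhds hf)
  -- The directions are changed one slot at a time: `s` is the set of slots already moved to `h i +
  -- t w i`. By linearity in the slot `a`, each further move contributes exactly `t` times a value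
  -- of `D k`.
  have key : ∀ s : Finset (Fin k), Tendsto (fun t : ℝ => t⁻¹ •
      (D k (f + t • v) (s.piecewise (h + t • w) h) - D k (f + t • v) h)) (𝓝[≠] 0)
      (𝓝 (∑ i ∈ s, D k f (Function.update h i (w i)))) := by
    intro s
    induction s using Finset.induction_on with
    | empty => simp
    | insert a s ha ih =>
      rw [Finset.sum_insert ha, add_comm]
      have hpw : Tendsto (fun t : ℝ => s.piecewise (h + t • w) h) (𝓝[≠] 0) (𝓝 h) := by
        rw [tendsto_pi_nhds]
        intro i
        by_cases hi : i ∈ s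
        · simpa [hi] using HasDirDeriv.tendsto_line (h i) (w i)
        · simp [hi]
      have h1 : Tendsto (fun t : ℝ => D k (f + t • v)
          (Function.update (s.piecewise (h + t • w) h) a (w a))) (𝓝[≠] 0)
          (𝓝 (D k f (Function.update h a (w a)))) := by
        have hc : ContinuousAt (fun p : E × (Fin k → E) => D k p.1 p.2)
            (f, Function.update h a (w a)) :=
          (hT k).1.continuousAt ((hU.prod isOpen_univ).mem_nhds ⟨hf, mem_univ _⟩)
        exact hc.tendsto.comp (hline.prodMk_nhds (hpw.update a tendsto_const_nhds))
      refine (ih.add h1).congr' ?_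
      filter_upwards [self_mem_nhdsWithin, hlineU] with t ht htU
      have ht0 : t ≠ 0 := ht
      have e1 : (insert a s).piecewise (h + t • w) h =
          Function.update (s.piecewise (h + t • w) h) a (h a + t • w a) :=
        Finset.piecewise_insert ..
      have e2 : Function.update (s.piecewise (h + t • w) h) a (h a) =
          s.piecewise (h + t • w) h := by
        rw [Function.update_eq_self_iff, Finset.piecewise_eq_of_notMem _ _ _ ha]
      rw [e1, iteratedDirDeriv_update_add hU hD hT htU, iteratedDirDeriv_update_smul hU hD hT htU,
        e2, add_sub_right_comm, smul_add t⁻¹, inv_smul_smul₀ ht0]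
  refine (Tendsto.add (hD k f hf h v) (key Finset.univ)).congr fun t => ?_
  rw [Finset.piecewise_univ, ← smul_add]
  congr 1
  simp only [Prod.smul_mk, Prod.mk_add_mk]
  abel

include hU hD hT in
-- All `k` are treated together: the derivative of `D k` in all its variables is a sum of values of
-- `D (k + 1)` and `D k`, so the induction on `n` closes.
theorem tameC_iteratedDirDeriv (n k : ℕ) :
    TameC n (fun p : E × (Fin k → E) => D k p.1 p.2) (U ×ˢ univ) := by
  induction n generalizing k with
  | zero => exact hT k
  | succ n ih =>
    refine ⟨hT k, fun q => D (k + 1) q.1.1 (Fin.snoc q.1.2 q.2.1) +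
      ∑ i, D k q.1.1 (Function.update q.1.2 i (q.2.2 i)), fun p hp q =>
      hasDirDeriv_iteratedDirDeriv hU hD hT hp.1 p.2 q.1 q.2, ?_⟩
    have hO : IsOpen ((U ×ˢ univ) ×ˢ univ : Set ((E × (Fin k → E)) × (E × (Fin k → E)))) :=
      (hU.prod isOpen_univ).prod isOpen_univ
    have hid := TameC.id (n := n)
      ((U ×ˢ univ) ×ˢ univ : Set ((E × (Fin k → E)) × (E × (Fin k → E))))
    have hf := (hid.fst hO).fst hO
    have hh := fun i => ((hid.fst hO).snd hO).apply hO i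
    have hv := (hid.snd hO).fst hO
    have hw := fun i => ((hid.snd hO).snd hO).apply hO i
    refine TameC.add hO ?_ (TameC.sum hO fun i _ => ?_)
    · refine (ih (k + 1)).comp
        (Q := fun q => (q.1.1, (Fin.snoc q.1.2 q.2.1 : Fin (k + 1) → E))) hO (hU.prod isOpen_univ) (hf.prodMk (TameC.pi hO fun j => ?_))
        fun q hq => ⟨hq.1.1, mem_univ _⟩
      induction j using Fin.lastCases with
      | last => simpa only [Fin.snoc_last] using hv
      | cast j => simpa only [Fin.snoc_castSucc] using hh j
    · refine (ih k).comp (Q := fun q => (q.1.1, Function.update q.1.2 i (q.2.2 i))) hO (hU.prod isOpen_univ) (hf.prodMk (TameC.pi hO fun j => ?_))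
        fun q hq => ⟨hq.1.1, mem_univ _⟩
      rcases eq_or_ne j i with rfl | hj
      · simpa only [Function.update_self] using hw j
      · simpa only [Function.update_of_ne hj] using hh j

end converse

theorem IsSmoothTameOn.tameSmooth [GradedLC E] [GradedLC F] {P : E → F} {U : Set E}
    (hU : IsOpen U) (h : IsSmoothTameOn P U) : TameSmooth P U := by
  obtain ⟨D, h0, hD, hT⟩ := h
  intro n
  have h1 := (tameC_iteratedDirDeriv hU hD hT n 0).comp hU (hU.prod isOpen_univ)
    ((TameC.id (n := n) U).prodMk (TameC.const (Fin.elim0 : Fin 0 → E) U))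
    fun f hf => ⟨hf, mem_univ _⟩
  exact h1.congr hU h0

end smooth

/-! ## A kernel on the half line with vanishing moments -/

/-- Coefficients of the entire function `h (z) = ∏ (1 - z / 2 ^ j)`, `j ≥ 0`. -/
def eulerCoeff : ℕ → ℝ
  | 0 => 1
  | k + 1 => -(eulerCoeff k * (1 / 2) ^ k / (1 - (1 / 2) ^ (k + 1)))

theorem one_sub_half_pow_pos (k : ℕ) : (1 : ℝ) / 2 ≤ 1 - (1 / 2) ^ (k + 1) := by
  have : ((1 : ℝ) / 2) ^ (k + 1) ≤ (1 / 2) ^ 1 :=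
    pow_le_pow_of_le_one (by norm_num) (by norm_num) (by omega)
  linarith

theorem eulerCoeff_succ (k : ℕ) :
    eulerCoeff (k + 1) * (1 - (1 / 2) ^ (k + 1)) = -(eulerCoeff k * (1 / 2) ^ k) := by
  have := one_sub_half_pow_pos k
  rw [eulerCoeff]
  field_simp

/-- Ratio test: consecutive terms have ratio at most `2 |z| / 2 ^ k`, which tends to zero. -/
theorem summable_eulerCoeff (z : ℝ) : Summable fun k => eulerCoeff k * z ^ k := by
  refine summable_of_ratio_norm_eventually_le (r := 1 / 2) (by norm_num) ?_
  have h1 : Tendsto (fun k : ℕ => 2 * |z| * ((1 : ℝ) / 2) ^ k) atTop (𝓝 (2 * |z| * 0)) :=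
    (tendsto_pow_atTop_nhds_zero_of_lt_one (by norm_num) (by norm_num)).const_mul _
  rw [mul_zero] at h1
  filter_upwards [h1.eventually (Iic_mem_nhds (by norm_num : (0 : ℝ) < 1 / 2))] with k hk
  have h2 := one_sub_half_pow_pos k
  have h3 : |eulerCoeff (k + 1)| ≤ 2 * (|eulerCoeff k| * (1 / 2) ^ k) := by
    rw [eulerCoeff, abs_neg, abs_div, abs_mul, abs_of_pos (by linarith : (0 : ℝ) < 1 - _),
      abs_of_pos (by positivity : (0 : ℝ) < (1 / 2) ^ k), div_le_iff₀ (by linarith)]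
    have : 0 ≤ |eulerCoeff k| * (1 / 2) ^ k := by positivity
    nlinarith
  rw [Real.norm_eq_abs, Real.norm_eq_abs, abs_mul, abs_mul, pow_succ, abs_mul]
  calc |eulerCoeff (k + 1)| * (|z ^ k| * |z|)
      ≤ 2 * (|eulerCoeff k| * (1 / 2) ^ k) * (|z ^ k| * |z|) := by gcongr
    _ = (2 * |z| * (1 / 2) ^ k) * (|eulerCoeff k| * |z ^ k|) := by ring
    _ ≤ 1 / 2 * (|eulerCoeff k| * |z ^ k|) := by gcongr

/-- The entire function `∏ (1 - z / 2 ^ j)`. -/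
def eulerFun (z : ℝ) : ℝ := ∑' k, eulerCoeff k * z ^ k

/-- The recursion of `eulerCoeff` is the comparison of coefficients in `h (z) - h (z / 2) = -z h (z
/ 2)`. -/
theorem eulerFun_eq (z : ℝ) : eulerFun z = (1 - z) * eulerFun (z / 2) := by
  have h1 := summable_eulerCoeff z
  have h2 := summable_eulerCoeff (z / 2)
  have h3 : eulerFun z - eulerFun (z / 2) = -(z * eulerFun (z / 2)) := by
    rw [eulerFun, eulerFun, ← h1.tsum_sub h2, (h1.sub h2).tsum_eq_zero_add, ← tsum_mul_left,
      ← tsum_neg]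
    simp only [pow_zero, sub_self, zero_add]
    refine tsum_congr fun k => ?_
    have := eulerCoeff_succ k
    have e : eulerCoeff (k + 1) * z ^ (k + 1) - eulerCoeff (k + 1) * (z / 2) ^ (k + 1) =
        (eulerCoeff (k + 1) * (1 - (1 / 2) ^ (k + 1))) * z ^ (k + 1) := by
      rw [div_eq_mul_one_div z 2, mul_pow]; ring
    rw [e, this, div_eq_mul_one_div z 2, mul_pow]
    ring
  linarith

theorem eulerFun_two_pow (n : ℕ) : eulerFun (2 ^ n) = 0 := by
  induction n with
  | zero => rw [eulerFun_eq]; simp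
  | succ n ih =>
    rw [eulerFun_eq, pow_succ, mul_div_cancel_right₀ _ (two_ne_zero), ih, mul_zero]

/-- A zero at `1 / 2` would propagate through the functional equation to all `2⁻ⁿ`, whose factors `1
- 2⁻ⁿ` do not vanish, and contradict `h (0) = 1` by continuity. -/
theorem eulerFun_half_ne_zero : eulerFun (1 / 2) ≠ 0 := by
  intro h
  have h1 : ∀ n : ℕ, eulerFun ((1 / 2) ^ (n + 1)) = 0 := fun n => by
    induction n with
    | zero => simpa using h
    | succ n ih =>
      rw [eulerFun_eq] at ih
      rcases mul_eq_zero.1 ih with h' | h'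
      · linarith [one_sub_half_pow_pos n]
      · rw [pow_succ, mul_one_div]; exact h'
  have hc : ContinuousOn eulerFun (Icc (-1) 1) := by
    refine continuousOn_tsum (u := fun k => ‖eulerCoeff k‖) (fun k => by fun_prop) ?_ ?_
    · simpa using (summable_eulerCoeff 1).norm
    · intro k z hz
      rw [norm_mul, norm_pow]
      exact mul_le_of_le_one_right (norm_nonneg _)
        (pow_le_one₀ (norm_nonneg _) (abs_le.2 hz))
  have hca : ContinuousAt eulerFun 0 := hc.continuousAt (Icc_mem_nhds (by norm_num) (by norm_num))
  have ht : Tendsto (fun n : ℕ => ((1 : ℝ) / 2) ^ (n + 1)) atTop (𝓝 0) :=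
    (tendsto_add_atTop_iff_nat 1).2
      (tendsto_pow_atTop_nhds_zero_of_lt_one (by norm_num) (by norm_num))
  have h2 := tendsto_nhds_unique ((hca.tendsto.comp ht).congr h1) tendsto_const_nhds
  have h3 : eulerFun 0 = 1 := by
    rw [eulerFun, tsum_eq_single 0 fun k hk => by simp [hk]]
    simp [eulerCoeff]
  rw [h3] at h2
  exact one_ne_zero h2

/-- With `h = eulerFun` and `c k` the `k`-th term of the series of `h (1 / 2)` divided by its sum,
`∑ c k 2 ^ (k m)` equals `h (2 ^ (m - 1)) / h (1 / 2)`. The zeros of `h` at the powers of two give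
the vanishing for `m ≥ 1`. -/
theorem exists_moment_coefficients : ∃ c : ℕ → ℝ,
    (∀ m : ℕ, Summable fun k => |c k| * 2 ^ (k * m)) ∧ ∑' k, c k = 1 ∧
      ∀ m : ℕ, 1 ≤ m → ∑' k, c k * 2 ^ (k * m) = 0 := by
  have hne := eulerFun_half_ne_zero
  have he : ∀ k m : ℕ, eulerCoeff k * (1 / 2) ^ k / eulerFun (1 / 2) * 2 ^ (k * m) =
      (eulerFun (1 / 2))⁻¹ * (eulerCoeff k * ((1 / 2) * 2 ^ m) ^ k) := fun k m => by
    rw [mul_pow, mul_comm k m, pow_mul]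
    field_simp
  refine ⟨fun k => eulerCoeff k * (1 / 2) ^ k / eulerFun (1 / 2), fun m => ?_, ?_, fun m hm => ?_⟩
  · have h1 := ((summable_eulerCoeff ((1 / 2) * 2 ^ m)).mul_left (eulerFun (1 / 2))⁻¹).abs
    refine h1.congr fun k => ?_
    rw [← he k m, abs_mul, abs_of_pos (by positivity : (0 : ℝ) < 2 ^ (k * m))]
  · rw [tsum_div_const]
    exact div_self hne
  · simp only [he]
    obtain ⟨d, rfl⟩ := Nat.exists_eq_add_of_le' hm
    rw [tsum_mul_left, show (1 : ℝ) / 2 * 2 ^ (d + 1) = 2 ^ d by rw [pow_succ]; ring]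
    have := eulerFun_two_pow d
    rw [eulerFun] at this
    rw [this, mul_zero]

/-- A sequence `κ 0, κ 1 = (κ 0)', …` of derivatives of a rapidly decreasing smooth function that
vanishes on the negative half line. -/
structure IsKernel (κ : ℕ → ℝ → ℝ) : Prop where
  hasDerivAt : ∀ j y, HasDerivAt (κ j) (κ (j + 1) y) y
  eq_zero : ∀ j, ∀ y < 0, κ j y = 0
  decay : ∀ j m : ℕ, ∃ C, 0 ≤ C ∧ ∀ y, |κ j y| * (1 + |y|) ^ m ≤ C

theorem exists_bump : ∃ φ : ℝ → ℝ, ContDiff ℝ ∞ φ ∧ ∫ y, φ y = 1 ∧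
    ∀ j, ∀ y ∉ Icc (0 : ℝ) 1, iteratedDeriv j φ y = 0 := by
  let b : ContDiffBump (1 / 2 : ℝ) := ⟨1 / 8, 1 / 4, by norm_num, by norm_num⟩
  refine ⟨b.normed MeasureTheory.volume, b.contDiff_normed, b.integral_normed, fun j y hy => ?_⟩
  have h1 : b.normed MeasureTheory.volume =ᶠ[𝓝 y] fun _ => (0 : ℝ) := by
    filter_upwards [isClosed_Icc.isOpen_compl.mem_nhds hy] with z hz
    have : z ∉ Function.support (b.normed MeasureTheory.volume) := by
      rw [b.support_normed_eq, Real.ball_eq_Ioo]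
      intro hz'
      refine hz ⟨?_, ?_⟩
      · have := hz'.1; norm_num [b] at this; linarith
      · have := hz'.2; norm_num [b] at this; linarith
    simpa using this
  rw [h1.iteratedDeriv_eq]
  simp

/-- Rescaling `y` shows that the `k`-th dilate contributes `c k 2 ^ (k n)` times the moment of `φ`.
The absolute moments are summable by `hc`, so sum and integral may be exchanged. -/
theorem integral_dilation_sum {φ : ℝ → ℝ} {c : ℕ → ℝ} (hφ : Continuous φ)
    (hφ0 : ∀ y ∉ Icc (0 : ℝ) 1, φ y = 0) (hc : ∀ m : ℕ, Summable fun k => |c k| * 2 ^ (k * m))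
    (n : ℕ) : ∫ y, (∑' k, c k * (1 / 2) ^ k * φ ((1 / 2) ^ k * y)) * y ^ n =
      (∑' k, c k * 2 ^ (k * n)) * ∫ y, φ y * y ^ n := by
  let g : ℕ → ℝ → ℝ := fun k y => c k * (1 / 2) ^ k * φ ((1 / 2) ^ k * y)
  have hcomp : ∀ k y, g k y * y ^ n =
      c k * (1 / 2) ^ k * 2 ^ (k * n) * (φ ((1 / 2) ^ k * y) * ((1 / 2) ^ k * y) ^ n) := by
    intro k y
    have e : ((1 : ℝ) / 2) ^ (k * n) * 2 ^ (k * n) = 1 := by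
      rw [← mul_pow]; norm_num
    simp only [g, mul_pow, ← pow_mul]
    linear_combination (-(c k * (1 / 2) ^ k * φ ((1 / 2) ^ k * y) * y ^ n)) * e
  have hφc : Continuous fun y => φ y * y ^ n := by
    fun_prop
  have hφs : HasCompactSupport fun y => φ y * y ^ n :=
    HasCompactSupport.intro (K := Icc 0 1) isCompact_Icc fun y hy => by
      simp [hφ0 y hy]
  have hφi := hφc.integrable_of_hasCompactSupport hφs (μ := MeasureTheory.volume)
  have hint : ∀ k, MeasureTheory.Integrable fun y => g k y * y ^ n := fun k => by
    simp only [hcomp]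
    exact (hφi.comp_mul_left' (by positivity)).const_mul _
  have hval : ∀ (f : ℝ → ℝ) (k : ℕ), ∫ y, f ((1 / 2) ^ k * y) = 2 ^ k * ∫ y, f y := fun f k => by
    rw [MeasureTheory.Measure.integral_comp_mul_left f, smul_eq_mul, ← inv_pow]
    norm_num
  have hpow : ∀ k : ℕ, ((1 : ℝ) / 2) ^ k * 2 ^ k = 1 := fun k => by rw [← mul_pow]; norm_num
  have hnorm : ∀ k, ∫ y, ‖g k y * y ^ n‖ = |c k| * 2 ^ (k * n) * ∫ y, ‖φ y * y ^ n‖ := by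
    intro k
    simp only [hcomp, norm_mul (c k * (1 / 2) ^ k * 2 ^ (k * n))]
    rw [MeasureTheory.integral_const_mul, hval (fun y => ‖φ y * y ^ n‖)]
    simp only [norm_mul, norm_pow, Real.norm_eq_abs, abs_of_pos (by norm_num : (0 : ℝ) < 1 / 2),
      abs_of_pos (by norm_num : (0 : ℝ) < 2)]
    linear_combination (|c k| * 2 ^ (k * n) * ∫ y, |φ y| * |y| ^ n) * hpow k
  have hsum := MeasureTheory.hasSum_integral_of_summable_integral_norm hint
    (by simp only [hnorm]; exact (hc n).mul_right _)
  have h1 : ∀ k, ∫ y, g k y * y ^ n = c k * 2 ^ (k * n) * ∫ y, φ y * y ^ n := fun k => by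
    simp only [hcomp]
    rw [MeasureTheory.integral_const_mul, hval (fun y => φ y * y ^ n)]
    linear_combination (c k * 2 ^ (k * n) * ∫ y, φ y * y ^ n) * hpow k
  simp only [h1] at hsum
  have h2 := hsum.tsum_eq
  rw [tsum_mul_right] at h2
  rw [h2]
  exact MeasureTheory.integral_congr_ae (Eventually.of_forall fun y => tsum_mul_right.symm)

/-- The kernel is `∑ c k 2⁻ᵏ φ (2⁻ᵏ y)` for a bump `φ` supported in `[0, 1]`; the coefficients
cancel every moment of positive order. A continuous kernel of compact support cannot have this
property, hence the infinitely many dilates. -/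
theorem exists_kernel : ∃ κ : ℕ → ℝ → ℝ, IsKernel κ ∧ ∫ y, κ 0 y = 1 ∧
    ∀ n : ℕ, 1 ≤ n → ∫ y, κ 0 y * y ^ n = 0 := by
  obtain ⟨φ, hφ, hφ1, hφ0⟩ := exists_bump
  obtain ⟨c, hc, hc1, hc0⟩ := exists_moment_coefficients
  have hcont : ∀ j, Continuous (iteratedDeriv j φ) := fun j =>
    hφ.continuous_iteratedDeriv j (by exact_mod_cast le_top)
  have hderiv : ∀ j y, HasDerivAt (iteratedDeriv j φ) (iteratedDeriv (j + 1) φ y) y := fun j y => by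
    rw [iteratedDeriv_succ]
    exact (hφ.differentiable_iteratedDeriv j (by exact_mod_cast WithTop.coe_lt_top _) y).hasDerivAt
  have hbound : ∀ j, ∃ C, 0 ≤ C ∧ ∀ y, |iteratedDeriv j φ y| ≤ C := fun j => by
    obtain ⟨C, hC⟩ := isCompact_Icc.exists_bound_of_continuousOn
      (s := Icc (0 : ℝ) 1) (hcont j).continuousOn
    refine ⟨max C 0, le_max_right _ _, fun y => ?_⟩
    by_cases hy : y ∈ Icc (0 : ℝ) 1
    · exact (hC y hy).trans (le_max_left _ _)
    · rw [hφ0 j y hy, abs_zero]; exact le_max_right _ _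
  choose A hA hAb using hbound
  let g : ℕ → ℕ → ℝ → ℝ := fun j k y =>
    c k * (1 / 2) ^ (k * (j + 1)) * iteratedDeriv j φ ((1 / 2) ^ k * y)
  have hhalf : ∀ m : ℕ, ((1 : ℝ) / 2) ^ m ≤ 1 := fun m =>
    pow_le_one₀ (by norm_num) (by norm_num)
  -- Where the `k`-th term is nonzero `|y| ≤ 2 ^ k`, so the weight is at most `2 ^ m * 2 ^ (k m)`,
  -- which the decay of `c k` absorbs.
  have hg : ∀ j k y m, |g j k y| * (1 + |y|) ^ m ≤ |c k| * 2 ^ (k * m) * (A j * 2 ^ m) := by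
    intro j k y m
    by_cases hy : (1 / 2) ^ k * y ∈ Icc (0 : ℝ) 1
    · have hy1 : |y| ≤ 2 ^ k := by
        have h0 : 0 ≤ y := by
          by_contra! h
          have : ((1 : ℝ) / 2) ^ k * y < 0 := mul_neg_of_pos_of_neg (by positivity) h
          linarith [hy.1]
        rw [abs_of_nonneg h0]
        have := hy.2
        rw [one_div, inv_pow, inv_mul_le_iff₀ (by positivity), mul_one] at this
        exact this
      have hk : (1 : ℝ) ≤ 2 ^ k := one_le_pow₀ (by norm_num)
      have h1 : (1 + |y|) ^ m ≤ (2 * 2 ^ k) ^ m := by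
        gcongr
        linarith
      have h2 : |g j k y| ≤ |c k| * A j := by
        simp only [g, abs_mul, abs_pow, abs_of_pos (by norm_num : (0 : ℝ) < 1 / 2)]
        calc |c k| * (1 / 2) ^ (k * (j + 1)) * |iteratedDeriv j φ ((1 / 2) ^ k * y)|
            ≤ |c k| * 1 * A j := by
              gcongr
              · exact hhalf _
              · exact hAb j _
          _ = _ := by ring
      calc |g j k y| * (1 + |y|) ^ m ≤ |c k| * A j * (2 * 2 ^ k) ^ m := by
            have := hA j
            gcongr
        _ = _ := by rw [mul_pow, ← pow_mul]; ring
    · simp only [g, hφ0 j _ hy, mul_zero, abs_zero, zero_mul]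
      have := hA j
      positivity
  have hg0 : ∀ j k y, |g j k y| ≤ |c k| * A j := fun j k y => by
    simpa using hg j k y 0
  have hcs : Summable fun k => |c k| := by simpa using hc 0
  have hgs : ∀ j y, Summable fun k => g j k y := fun j y =>
    Summable.of_norm_bounded (hcs.mul_right (A j)) fun k => hg0 j k y
  refine ⟨fun j y => ∑' k, g j k y, ⟨fun j y => ?_, fun j y hy => ?_, fun j m => ?_⟩, ?_⟩
  · refine hasDerivAt_tsum (g := fun k y => g j k y) (g' := fun k y => g (j + 1) k y)
      (hcs.mul_right (A (j + 1))) (fun k y => ?_) (fun k y => hg0 (j + 1) k y) (hgs j 0) y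
    have h1 : HasDerivAt (fun y : ℝ => (1 / 2) ^ k * y) ((1 / 2) ^ k) y := by
      simpa using (hasDerivAt_id y).const_mul (((1 : ℝ) / 2) ^ k)
    have h2 := ((hderiv j ((1 / 2) ^ k * y)).comp y h1).const_mul (c k * (1 / 2) ^ (k * (j + 1)))
    refine h2.congr_deriv ?_
    simp only [g, mul_add, mul_one, pow_add]
    ring
  · have : ∀ k, g j k y = 0 := fun k => by
      have : (1 / 2) ^ k * y ∉ Icc (0 : ℝ) 1 := fun h => by
        have : ((1 : ℝ) / 2) ^ k * y < 0 := mul_neg_of_pos_of_neg (by positivity) hy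
        linarith [h.1]
      simp only [g, hφ0 j _ this, mul_zero]
    simp [this]
  · refine ⟨(∑' k, |c k| * 2 ^ (k * m)) * (A j * 2 ^ m), ?_, fun y => ?_⟩
    · have := hA j
      have : 0 ≤ ∑' k, |c k| * 2 ^ (k * m) := tsum_nonneg fun k => by positivity
      positivity
    · have h1 : |∑' k, g j k y| ≤ ∑' k, |g j k y| := by
        simpa only [Real.norm_eq_abs] using norm_tsum_le_tsum_norm (hgs j y).norm
      calc |∑' k, g j k y| * (1 + |y|) ^ m ≤ (∑' k, |g j k y|) * (1 + |y|) ^ m := by gcongr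
        _ = ∑' k, |g j k y| * (1 + |y|) ^ m := tsum_mul_right.symm
        _ ≤ ∑' k, |c k| * 2 ^ (k * m) * (A j * 2 ^ m) :=
            ((hgs j y).abs.mul_right _).tsum_le_tsum (fun k => hg j k y m) ((hc m).mul_right _)
        _ = _ := tsum_mul_right
  · have hmom := integral_dilation_sum (by simpa using hcont 0) (by simpa using hφ0 0) hc
    have hg00 : ∀ y, ∑' k, g 0 k y = ∑' k, c k * (1 / 2) ^ k * φ ((1 / 2) ^ k * y) := fun y => by
      simp only [g, zero_add, mul_one, iteratedDeriv_zero]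
    simp only [hg00]
    refine ⟨?_, fun n hn => ?_⟩
    · have := hmom 0
      simpa [hc1, hφ1] using this
    · rw [hmom n, hc0 n hn, zero_mul]

/-! ## Jets of smooth functions on the unit interval -/

/-- The constant extension to the line of a function on `[0, 1]`. -/
def lineExtend (f : C(Icc (0 : ℝ) 1, ℝ)) : ℝ → ℝ := IccExtend zero_le_one f

theorem lineExtend_apply (f : C(Icc (0 : ℝ) 1, ℝ)) (x : Icc (0 : ℝ) 1) : lineExtend f x = f x :=
  IccExtend_val _ _ x

theorem lineExtend_zero (f : C(Icc (0 : ℝ) 1, ℝ)) : lineExtend f 0 = f 0 := lineExtend_apply f 0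

theorem lineExtend_of_mem (f : C(Icc (0 : ℝ) 1, ℝ)) {x : ℝ} (hx : x ∈ Icc (0 : ℝ) 1) :
    lineExtend f x = f ⟨x, hx⟩ := IccExtend_of_mem _ _ hx

theorem continuous_lineExtend (f : C(Icc (0 : ℝ) 1, ℝ)) : Continuous (lineExtend f) :=
  f.continuous.Icc_extend'

theorem abs_lineExtend_le (f : C(Icc (0 : ℝ) 1, ℝ)) (x : ℝ) : |lineExtend f x| ≤ ‖f‖ :=
  f.norm_coe_le_norm _

theorem lineExtend_add (f g : C(Icc (0 : ℝ) 1, ℝ)) (x : ℝ) :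
    lineExtend (f + g) x = lineExtend f x + lineExtend g x := rfl

theorem lineExtend_smul (c : ℝ) (f : C(Icc (0 : ℝ) 1, ℝ)) (x : ℝ) :
    lineExtend (c • f) x = c * lineExtend f x := rfl

/-- Sequences `f, f', f'', …` of continuous functions on `[0, 1]`, with the boundary condition
`f⁽ʲ⁾ (1) = c f⁽ʲ⁾ (0)` if `bc = some c`. -/
def JetSpace (bc : Option ℝ) : Submodule ℝ (ℕ → C(Icc (0 : ℝ) 1, ℝ)) where
  carrier := {F | (∀ j, ∀ x : Icc (0 : ℝ) 1,
      HasDerivWithinAt (lineExtend (F j)) (F (j + 1) x) (Icc 0 1) x) ∧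
    ∀ c ∈ bc, ∀ j, F j 1 = c * F j 0}
  zero_mem' := ⟨fun j x => hasDerivWithinAt_const _ _ _, fun c _ j => by simp⟩
  add_mem' := fun {F G} hF hG => ⟨fun j x => (hF.1 j x).add (hG.1 j x), fun c hc j => by
    simp [hF.2 c hc j, hG.2 c hc j, mul_add]⟩
  smul_mem' := fun a F hF => ⟨fun j x => (hF.1 j x).const_mul a, fun c hc j => by
    simp [hF.2 c hc j]; ring⟩

/-- The space of smooth functions on `[0, 1]` with boundary condition `bc`. -/
def Jet (bc : Option ℝ) : Type := JetSpace bc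

namespace Jet

instance (bc : Option ℝ) : AddCommGroup (Jet bc) := inferInstanceAs (AddCommGroup (JetSpace bc))

instance (bc : Option ℝ) : Module ℝ (Jet bc) := inferInstanceAs (Module ℝ (JetSpace bc))

variable {bc : Option ℝ}

/-- The `j`-th derivative. -/
def d (j : ℕ) : Jet bc →ₗ[ℝ] C(Icc (0 : ℝ) 1, ℝ) where
  toFun f := f.1 j
  map_add' _ _ := rfl
  map_smul' _ _ := rfl

/-- A jet from its derivatives. -/
def mk (F : ℕ → C(Icc (0 : ℝ) 1, ℝ))
    (h : ∀ j, ∀ x : Icc (0 : ℝ) 1, HasDerivWithinAt (lineExtend (F j)) (F (j + 1) x) (Icc 0 1) x)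
    (hbc : ∀ c ∈ bc, ∀ j, F j 1 = c * F j 0) : Jet bc := ⟨F, h, hbc⟩

theorem d_mk (F : ℕ → C(Icc (0 : ℝ) 1, ℝ)) (h) (hbc) (j : ℕ) :
    d j (mk (bc := bc) F h hbc) = F j := rfl

theorem hasDerivWithinAt (f : Jet bc) (j : ℕ) (x : Icc (0 : ℝ) 1) :
    HasDerivWithinAt (lineExtend (d j f)) (d (j + 1) f x) (Icc 0 1) x := f.2.1 j x

theorem boundary (f : Jet bc) {c : ℝ} (hc : c ∈ bc) (j : ℕ) : d j f 1 = c * d j f 0 :=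
  f.2.2 c hc j

theorem ext_d {f g : Jet bc} (h : ∀ j, d j f = d j g) : f = g := Subtype.ext (funext h)

/-- Derivatives within `[0, 1]` are unique, so each entry of a jet determines the next one; the
boundary conditions play no role. -/
theorem d_succ_congr {bc' : Option ℝ} {f : Jet bc} {g : Jet bc'} {i j : ℕ} (h : d i f = d j g) :
    d (i + 1) f = d (j + 1) g := by
  ext x
  have h1 := f.hasDerivWithinAt i x
  rw [h] at h1
  exact (uniqueDiffOn_Icc_zero_one x x.2).eq_deriv _ h1 (g.hasDerivWithinAt j x)

theorem d_congr {bc' : Option ℝ} {f : Jet bc} {g : Jet bc'} (h : d 0 f = d 0 g) (j : ℕ) :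
    d j f = d j g := by
  induction j with
  | zero => exact h
  | succ j ih => exact d_succ_congr ih

/-- A smooth function is determined by its values. -/
theorem ext_zero {f g : Jet bc} (h : ∀ x, d 0 f x = d 0 g x) : f = g :=
  ext_d fun j => d_congr (ContinuousMap.ext h) j

/-- The norms `‖f‖ₙ = ∑ j ≤ n, max |f⁽ʲ⁾|`. -/
instance instGrading : Grading (Jet bc) where
  seminorm n := ∑ j ∈ Finset.range (n + 1),
    (normSeminorm ℝ C(Icc (0 : ℝ) 1, ℝ)).comp (d j)
  mono n m h f := by
    simp only [FunLike.coe_sum, Finset.sum_apply]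
    exact Finset.sum_le_sum_of_subset_of_nonneg
      (Finset.range_mono (Nat.succ_le_succ h)) fun _ _ _ => apply_nonneg _ _

instance instTopologicalSpace : TopologicalSpace (Jet bc) :=
  (Grading.seminorm (E := Jet bc)).moduleFilterBasis.topology

theorem withSeminorms : WithSeminorms (Grading.seminorm (E := Jet bc)) := ⟨rfl⟩

theorem gnorm_eq (n : ℕ) (f : Jet bc) : gnorm n f = ∑ j ∈ Finset.range (n + 1), ‖d j f‖ := by
  change (∑ j ∈ Finset.range (n + 1),
    (normSeminorm ℝ C(Icc (0 : ℝ) 1, ℝ)).comp (d j)) f = _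
  simp only [FunLike.coe_sum, Finset.sum_apply, Seminorm.comp_apply, coe_normSeminorm]

theorem gnorm_zero_eq (f : Jet bc) : gnorm 0 f = ‖d 0 f‖ := by simp [gnorm_eq]

theorem norm_d_le {j n : ℕ} (h : j ≤ n) (f : Jet bc) : ‖d j f‖ ≤ gnorm n f := by
  rw [gnorm_eq]
  exact Finset.single_le_sum (f := fun j => ‖d j f‖) (fun _ _ => norm_nonneg _)
    (Finset.mem_range.2 (Nat.lt_succ_of_le h))

theorem gnorm_le {n : ℕ} {f : Jet bc} {C : ℝ} (h : ∀ j ≤ n, ‖d j f‖ ≤ C) :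
    gnorm n f ≤ (n + 1) * C := by
  rw [gnorm_eq]
  refine (Finset.sum_le_sum fun j hj =>
    h j (Nat.lt_succ_iff.1 (Finset.mem_range.1 hj))).trans ?_
  simp

instance instT2Space : T2Space (Jet bc) := by
  have : IsTopologicalAddGroup (Jet bc) := (withSeminorms (bc := bc)).topologicalAddGroup
  have : T1Space (Jet bc) := by
    refine (withSeminorms (bc := bc)).T1_of_separating fun f hf => ?_
    by_contra! h
    refine hf (ext_d fun j => ?_)
    rw [map_zero, ← norm_eq_zero]
    exact le_antisymm ((norm_d_le le_rfl f).trans (h j).le) (norm_nonneg _)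
  infer_instance

instance instGradedLC : GradedLC (Jet bc) := ⟨withSeminorms, inferInstance⟩

/-- The integral form of `f' = g` is stable under uniform limits, which is what completeness of the
jet space requires. -/
theorem hasDerivWithinAt_iff_integral {f g : C(Icc (0 : ℝ) 1, ℝ)} :
    (∀ x : Icc (0 : ℝ) 1, HasDerivWithinAt (lineExtend f) (g x) (Icc 0 1) x) ↔
      ∀ x : Icc (0 : ℝ) 1, f x = f 0 + ∫ t in (0 : ℝ)..x, lineExtend g t := by
  constructor
  · intro h x
    have h1 := intervalIntegral.integral_eq_sub_of_hasDeriv_right_of_le (a := 0) (b := x) x.2.1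
      (f := lineExtend f) (f' := lineExtend g) (continuous_lineExtend f).continuousOn
      (fun t ht => by
        have ht' : t ∈ Icc (0 : ℝ) 1 := ⟨ht.1.le, ht.2.le.trans x.2.2⟩
        have h2 := h ⟨t, ht'⟩
        rw [← lineExtend_of_mem g ht'] at h2
        refine h2.mono_of_mem_nhdsWithin ?_
        exact mem_nhdsWithin_of_mem_nhds (Icc_mem_nhds ht.1 (ht.2.trans_le x.2.2)))
      ((continuous_lineExtend g).intervalIntegrable _ _)
    rw [h1, lineExtend_apply f x, show lineExtend f 0 = f 0 from lineExtend_apply f 0]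
    ring
  · intro h x
    have h1 : HasDerivAt (fun y => f 0 + ∫ t in (0 : ℝ)..y, lineExtend g t) (lineExtend g x) x :=
      ((continuous_lineExtend g).integral_hasStrictDerivAt 0 x).hasDerivAt.const_add _
    rw [lineExtend_apply] at h1
    refine h1.hasDerivWithinAt.congr (fun y hy => ?_) ?_
    · rw [lineExtend_of_mem f hy, h]
    · rw [lineExtend_apply, h]

theorem isFrechetSpace : IsFrechetSpace (Jet bc) := by
  refine ⟨withSeminorms, inferInstance, fun u hu => ?_⟩
  have hlim : ∀ j, ∃ g, Tendsto (fun i => d j (u i)) atTop (𝓝 g) := fun j => by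
    refine cauchySeq_tendsto_of_complete (Metric.cauchySeq_iff.2 fun ε hε => ?_)
    obtain ⟨N, hN⟩ := hu j ε hε
    refine ⟨N, fun m hm k hk => ?_⟩
    rw [dist_eq_norm, ← map_sub]
    exact (norm_d_le le_rfl _).trans_lt (hN m hm k hk)
  choose F hF using hlim
  have hpt : ∀ j x, Tendsto (fun i => d j (u i) x) atTop (𝓝 (F j x)) := fun j x =>
    ((continuous_eval_const x).tendsto (F j)).comp (hF j)
  have hint : ∀ j (x : Icc (0 : ℝ) 1), Tendsto (fun i => ∫ t in (0 : ℝ)..x, lineExtend (d j (u i)) t)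
      atTop (𝓝 (∫ t in (0 : ℝ)..x, lineExtend (F j) t)) := fun j x => by
    rw [tendsto_iff_norm_sub_tendsto_zero]
    refine squeeze_zero (fun _ => norm_nonneg _) (fun i => ?_)
      (tendsto_iff_norm_sub_tendsto_zero.1 (hF j))
    rw [← intervalIntegral.integral_sub ((continuous_lineExtend _).intervalIntegrable _ _)
      ((continuous_lineExtend _).intervalIntegrable _ _)]
    have := intervalIntegral.norm_integral_le_of_norm_le_const (a := 0) (b := x)
      (f := fun t => lineExtend (d j (u i)) t - lineExtend (F j) t)
      (C := ‖d j (u i) - F j‖) fun t _ => abs_lineExtend_le (d j (u i) - F j) t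
    refine this.trans (mul_le_of_le_one_right (norm_nonneg _) ?_)
    rw [sub_zero, abs_of_nonneg x.2.1]
    exact x.2.2
  refine ⟨mk F (fun j => hasDerivWithinAt_iff_integral.2 fun x => ?_) fun c hc j => ?_, ?_⟩
  · refine tendsto_nhds_unique (hpt j x) (((hpt j 0).add (hint (j + 1) x)).congr fun i => ?_)
    exact (hasDerivWithinAt_iff_integral.1 ((u i).hasDerivWithinAt j) x).symm
  · exact tendsto_nhds_unique (hpt j 1) (((hpt j 0).const_mul c).congr fun i =>
      ((u i).boundary hc j).symm)
  · rw [tendsto_iff_gnorm]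
    intro n
    have h1 : Tendsto (fun i => ∑ j ∈ Finset.range (n + 1), ‖d j (u i) - F j‖) atTop (𝓝 0) := by
      have := tendsto_finsetSum (Finset.range (n + 1)) fun j _ =>
        tendsto_iff_norm_sub_tendsto_zero.1 (hF j)
      simpa using this
    intro ε hε
    filter_upwards [h1.eventually (Iio_mem_nhds hε)] with i hi
    rw [gnorm_eq]
    exact hi

/-! ### Jets of smooth functions -/

theorem contDiffOn_and_iteratedDerivWithin {s : Set ℝ} (hs : UniqueDiffOn ℝ s) {F : ℕ → ℝ → ℝ}
    (h : ∀ j, ∀ x ∈ s, HasDerivWithinAt (F j) (F (j + 1) x) s x) :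
    ContDiffOn ℝ ∞ (F 0) s ∧ ∀ j, ∀ x ∈ s, iteratedDerivWithin j (F 0) s x = F j x := by
  have h1 : ∀ j, ∀ x ∈ s, iteratedDerivWithin j (F 0) s x = F j x := fun j => by
    induction j with
    | zero => intro x _; rw [iteratedDerivWithin_zero]
    | succ j ih =>
      intro x hx
      rw [iteratedDerivWithin_succ, derivWithin_congr ih (ih x hx)]
      exact (h j x hx).derivWithin (hs x hx)
  refine ⟨contDiffOn_of_differentiableOn_deriv fun j _ x hx => ?_, h1⟩
  exact ((h j x hx).congr (h1 j) (h1 j x hx)).differentiableWithinAt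

theorem contDiffOn_d (f : Jet bc) : ContDiffOn ℝ ∞ (lineExtend (d 0 f)) (Icc 0 1) :=
  (contDiffOn_and_iteratedDerivWithin uniqueDiffOn_Icc_zero_one
    (F := fun j => lineExtend (d j f)) fun j x hx => by
      have := f.hasDerivWithinAt j ⟨x, hx⟩
      rwa [← lineExtend_of_mem _ hx] at this).1

theorem iteratedDerivWithin_d (f : Jet bc) (j : ℕ) (x : Icc (0 : ℝ) 1) :
    iteratedDerivWithin j (lineExtend (d 0 f)) (Icc 0 1) x = d j f x := by
  rw [(contDiffOn_and_iteratedDerivWithin uniqueDiffOn_Icc_zero_one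
    (F := fun j => lineExtend (d j f)) fun j x hx => by
      have := f.hasDerivWithinAt j ⟨x, hx⟩
      rwa [← lineExtend_of_mem _ hx] at this).2 j x x.2, lineExtend_apply]

/-- The jet of a smooth function on `[0, 1]`. -/
def ofFun (φ : ℝ → ℝ) (hφ : ContDiffOn ℝ ∞ φ (Icc 0 1))
    (hbc : ∀ c ∈ bc, ∀ j, iteratedDerivWithin j φ (Icc 0 1) 1 =
      c * iteratedDerivWithin j φ (Icc 0 1) 0) : Jet bc :=
  mk (fun j => ⟨fun x => iteratedDerivWithin j φ (Icc 0 1) x,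
      (hφ.continuousOn_iteratedDerivWithin (by exact_mod_cast le_top)
        uniqueDiffOn_Icc_zero_one).comp_continuous continuous_subtype_val fun x => x.2⟩)
    (fun j x => by
      have h1 := (hφ.differentiableOn_iteratedDerivWithin (m := j)
        (by exact_mod_cast WithTop.coe_lt_top _) uniqueDiffOn_Icc_zero_one x x.2).hasDerivWithinAt
      rw [← iteratedDerivWithin_succ] at h1
      exact h1.congr (fun y hy => lineExtend_of_mem _ hy) (lineExtend_apply _ x))
    (fun c hc j => hbc c hc j)

theorem d_ofFun (φ : ℝ → ℝ) (hφ) (hbc) (j : ℕ) (x : Icc (0 : ℝ) 1) :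
    d j (ofFun (bc := bc) φ hφ hbc) x = iteratedDerivWithin j φ (Icc 0 1) x := rfl

end Jet

/-! ## Smoothing operators -/

namespace IsKernel

variable {κ : ℕ → ℝ → ℝ} (hκ : IsKernel κ)

include hκ

theorem continuous (j : ℕ) : Continuous (κ j) :=
  continuous_iff_continuousAt.2 fun y => (hκ.hasDerivAt j y).continuousAt

/-- Continuity from the left, where the kernel is zero. This removes the boundary term at `0` in the
integration by parts. -/
theorem apply_zero (j : ℕ) : κ j 0 = 0 := by
  have h1 : Tendsto (κ j) (𝓝[<] 0) (𝓝 (κ j 0)) := (hκ.continuous j).continuousWithinAt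
  refine tendsto_nhds_unique h1 (tendsto_const_nhds.congr' ?_)
  filter_upwards [self_mem_nhdsWithin] with y hy using (hκ.eq_zero j y hy).symm

theorem exists_le_inv (j n : ℕ) : ∃ C, 0 ≤ C ∧ ∀ y, |κ j y| * |y| ^ n ≤ C * (1 + y ^ 2)⁻¹ := by
  obtain ⟨C, hC, h⟩ := hκ.decay j (n + 2)
  refine ⟨C, hC, fun y => ?_⟩
  rw [← div_eq_mul_inv, le_div_iff₀ (by positivity)]
  have h1 : |y| ^ n ≤ (1 + |y|) ^ n := by gcongr; linarith
  have h2 : 1 + y ^ 2 ≤ (1 + |y|) ^ 2 := by nlinarith [abs_nonneg y, sq_abs y]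
  calc |κ j y| * |y| ^ n * (1 + y ^ 2) ≤ |κ j y| * (1 + |y|) ^ n * (1 + |y|) ^ 2 := by gcongr
    _ = |κ j y| * (1 + |y|) ^ (n + 2) := by ring
    _ ≤ C := h y

theorem integrable_mul_pow (j n : ℕ) : MeasureTheory.Integrable fun y => κ j y * y ^ n := by
  obtain ⟨C, hC, h⟩ := hκ.exists_le_inv j n
  refine (integrable_inv_one_add_sq.const_mul C).mono'
    ((hκ.continuous j).mul (continuous_pow n)).aestronglyMeasurable (Eventually.of_forall fun y => ?_)
  rw [norm_mul, norm_pow]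
  exact h y

theorem integrable (j : ℕ) : MeasureTheory.Integrable (κ j) := by
  simpa using hκ.integrable_mul_pow j 0

theorem integrable_mul (j : ℕ) {g : ℝ → ℝ} {M : ℝ} (hg : Measurable g) (hM : ∀ y, |g y| ≤ M) :
    MeasureTheory.Integrable fun y => κ j y * g y :=
  (hκ.integrable j).mul_bdd (c := M) hg.aestronglyMeasurable (Eventually.of_forall hM)

theorem abs_integral_mul_le (j : ℕ) {g : ℝ → ℝ} {M : ℝ} (hM : ∀ y, 0 ≤ y → |g y| ≤ M) :
    |∫ y, κ j y * g y| ≤ (∫ y, |κ j y|) * M := by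
  rw [← MeasureTheory.integral_mul_const, ← Real.norm_eq_abs]
  refine MeasureTheory.norm_integral_le_of_norm_le ((hκ.integrable j).abs.mul_const M)
    (Eventually.of_forall fun y => ?_)
  rw [norm_mul]
  rcases lt_or_ge y 0 with h | h
  · simp [hκ.eq_zero j y h]
  · exact mul_le_mul_of_nonneg_left (hM y h) (abs_nonneg _)

/-- Since `g` is only bounded and measurable, the derivative is put on the kernel. For `|w' - w| <
1` the differentiated integrand is dominated by a fixed multiple of `(1 + (u - w)²)⁻¹`. -/
theorem hasDerivAt_convolution (j : ℕ) {g : ℝ → ℝ} {M : ℝ} (hg : Measurable g)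
    (hM : ∀ y, |g y| ≤ M) (w : ℝ) :
    HasDerivAt (fun w => ∫ u, κ j (u - w) * g u) (-∫ u, κ (j + 1) (u - w) * g u) w := by
  obtain ⟨C, hC, h⟩ := hκ.decay (j + 1) 2
  have hM0 : 0 ≤ M := (abs_nonneg _).trans (hM 0)
  have hmeas : ∀ i w', MeasureTheory.AEStronglyMeasurable (fun u => κ i (u - w') * g u) := fun i w' =>
    (((hκ.continuous i).comp (continuous_id.sub continuous_const)).measurable.mul hg).aestronglyMeasurable
  have hint : ∀ i, MeasureTheory.Integrable fun u => κ i (u - w) * g u := fun i =>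
    ((hκ.integrable i).comp_sub_right w).mul_bdd (c := M) hg.aestronglyMeasurable
      (Eventually.of_forall hM)
  have key := (hasDerivAt_integral_of_dominated_loc_of_deriv_le (𝕜 := ℝ)
    (μ := MeasureTheory.volume) (F := fun w u => κ j (u - w) * g u)
    (F' := fun w u => -κ (j + 1) (u - w) * g u) (x₀ := w) (s := Metric.ball w 1)
    (bound := fun u => 4 * C * M * (1 + (u - w) ^ 2)⁻¹) (Metric.ball_mem_nhds w one_pos)
    (Eventually.of_forall fun w' => hmeas j w') (hint j)
    ((hmeas (j + 1) w).neg.congr (Eventually.of_forall fun u => (neg_mul _ _).symm)) ?_ ?_ ?_).2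
  · simp only [neg_mul] at key
    rwa [MeasureTheory.integral_neg] at key
  · refine Eventually.of_forall fun u w' hw' => ?_
    rw [norm_mul, norm_neg]
    have hw : |w' - w| < 1 := hw'
    have h1 := h (u - w')
    have h2 : 1 + |u - w| ≤ 2 * (1 + |u - w'|) := by
      have := abs_sub_le u w' w
      linarith [abs_nonneg (u - w')]
    have h3 : 1 + (u - w) ^ 2 ≤ 4 * (1 + |u - w'|) ^ 2 := by
      have h4 : 1 + (u - w) ^ 2 ≤ (1 + |u - w|) ^ 2 := by
        nlinarith [abs_nonneg (u - w), sq_abs (u - w)]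
      calc 1 + (u - w) ^ 2 ≤ (1 + |u - w|) ^ 2 := h4
        _ ≤ (2 * (1 + |u - w'|)) ^ 2 := by gcongr
        _ = _ := by ring
    have h5 : |κ (j + 1) (u - w')| ≤ 4 * C * (1 + (u - w) ^ 2)⁻¹ := by
      rw [← div_eq_mul_inv, le_div_iff₀ (by positivity)]
      calc |κ (j + 1) (u - w')| * (1 + (u - w) ^ 2)
          ≤ |κ (j + 1) (u - w')| * (4 * (1 + |u - w'|) ^ 2) := by gcongr
        _ = 4 * (|κ (j + 1) (u - w')| * (1 + |u - w'|) ^ 2) := by ring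
        _ ≤ 4 * C := by gcongr
    calc ‖κ (j + 1) (u - w')‖ * ‖g u‖ ≤ 4 * C * (1 + (u - w) ^ 2)⁻¹ * M := by
          gcongr
          · exact h5
          · exact hM u
      _ = _ := by ring
  · exact (integrable_inv_one_add_sq.comp_sub_right w).const_mul (4 * C * M)
  · refine Eventually.of_forall fun u w' _ => ?_
    have h1 : HasDerivAt (fun w : ℝ => u - w) (-1) w' := by
      simpa using (hasDerivAt_id w').const_sub u
    have h2 := ((hκ.hasDerivAt j (u - w')).comp w' h1).mul_const (g u)
    simpa using h2

end IsKernel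

/-! ### Quasiperiodic extension -/

/-- The extension of a function on `[0, 1)` to the half line with `f (x + 1) = c f (x)`. -/
def quasiExtend (c : ℝ) (f : C(Icc (0 : ℝ) 1, ℝ)) (z : ℝ) : ℝ :=
  c ^ ⌊z⌋₊ * lineExtend f (Int.fract z)

section quasi

variable {c : ℝ}

theorem measurable_quasiExtend (c : ℝ) (f : C(Icc (0 : ℝ) 1, ℝ)) : Measurable (quasiExtend c f) := by
  refine Measurable.mul ?_ ((continuous_lineExtend f).measurable.comp measurable_fract)
  exact (measurable_from_nat (f := fun n => c ^ n)).comp Nat.measurable_floor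

theorem abs_quasiExtend_le (hc : |c| ≤ 1) (f : C(Icc (0 : ℝ) 1, ℝ)) (z : ℝ) :
    |quasiExtend c f z| ≤ ‖f‖ := by
  rw [quasiExtend, abs_mul, abs_pow]
  calc |c| ^ ⌊z⌋₊ * |lineExtend f (Int.fract z)| ≤ 1 * ‖f‖ := by
        gcongr
        · exact pow_le_one₀ (abs_nonneg c) hc
        · exact abs_lineExtend_le f _
    _ = _ := one_mul _

theorem quasiExtend_add_one (f : C(Icc (0 : ℝ) 1, ℝ)) {z : ℝ} (hz : 0 ≤ z) :
    quasiExtend c f (1 + z) = c * quasiExtend c f z := by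
  rw [add_comm, quasiExtend, quasiExtend, Nat.floor_add_one hz, Int.fract_add_one, pow_succ]
  ring

theorem quasiExtend_add (f g : C(Icc (0 : ℝ) 1, ℝ)) (z : ℝ) :
    quasiExtend c (f + g) z = quasiExtend c f z + quasiExtend c g z := by
  simp only [quasiExtend, lineExtend_add, mul_add]

theorem quasiExtend_smul (a : ℝ) (f : C(Icc (0 : ℝ) 1, ℝ)) (z : ℝ) :
    quasiExtend c (a • f) z = a * quasiExtend c f z := by
  simp only [quasiExtend, lineExtend_smul]
  ring

/-- At the right end point the floor has already jumped to `m + 1`; the boundary condition `f⁽ʲ⁾ (1)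
= c f⁽ʲ⁾ (0)` makes the two formulas agree there. This is what glues the translates smoothly. -/
theorem Jet.quasiExtend_eq (f : Jet (some c)) (j m : ℕ) {z : ℝ} (hz : z ∈ Icc (m : ℝ) (m + 1)) :
    quasiExtend c (Jet.d j f) z = c ^ m * lineExtend (Jet.d j f) (z - m) := by
  rcases hz.2.eq_or_lt with h | h
  · have h1 : ⌊z⌋₊ = m + 1 := by
      rw [h]; exact_mod_cast Nat.floor_natCast (m + 1)
    have h2 : Int.fract z = 0 := by
      rw [h]; exact_mod_cast Int.fract_natCast (m + 1)
    have h3 : z - m = ((1 : Icc (0 : ℝ) 1) : ℝ) := by rw [h]; simp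
    rw [quasiExtend, h1, h2, h3, lineExtend_apply, lineExtend_zero,
      f.boundary (c := c) rfl j, pow_succ]
    ring
  · have h1 : ⌊z⌋₊ = m := by
      rw [Nat.floor_eq_iff ((Nat.cast_nonneg m).trans hz.1)]
      exact ⟨hz.1, h⟩
    have h2 : Int.fract z = z - m := by
      rw [Int.fract_eq_iff]
      exact ⟨by linarith [hz.1], by linarith, m, by simp⟩
    rw [quasiExtend, h1, h2]

theorem Jet.hasDerivWithinAt_quasiExtend_Icc (f : Jet (some c)) (j m : ℕ) {z : ℝ}
    (hz : z ∈ Icc (m : ℝ) (m + 1)) :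
    HasDerivWithinAt (quasiExtend c (Jet.d j f)) (quasiExtend c (Jet.d (j + 1) f) z)
      (Icc (m : ℝ) (m + 1)) z := by
  have hmem : ∀ y ∈ Icc (m : ℝ) (m + 1), y - m ∈ Icc (0 : ℝ) 1 := fun y hy =>
    ⟨by linarith [hy.1], by linarith [hy.2]⟩
  have h1 := f.hasDerivWithinAt j ⟨z - m, hmem z hz⟩
  have h2 : HasDerivWithinAt (fun y : ℝ => y - m) 1 (Icc (m : ℝ) (m + 1)) z :=
    ((hasDerivAt_id z).sub_const _).hasDerivWithinAt
  have h3 := (h1.comp z h2 hmem).const_mul (c ^ m)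
  rw [mul_one, ← lineExtend_of_mem _ (hmem z hz), ← f.quasiExtend_eq (j + 1) m hz] at h3
  exact h3.congr (fun y hy => f.quasiExtend_eq j m hy) (f.quasiExtend_eq j m hz)

/-- One-sided because `z = 0` is allowed, where the extension is meaningful only to the right. -/
theorem Jet.hasDerivWithinAt_quasiExtend_Ici (f : Jet (some c)) (j : ℕ) {z : ℝ} (hz : 0 ≤ z) :
    HasDerivWithinAt (quasiExtend c (Jet.d j f)) (quasiExtend c (Jet.d (j + 1) f) z)
      (Ici z) z := by
  have h1 : z ∈ Icc (⌊z⌋₊ : ℝ) (⌊z⌋₊ + 1) := ⟨Nat.floor_le hz, (Nat.lt_floor_add_one z).le⟩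
  refine (f.hasDerivWithinAt_quasiExtend_Icc j _ h1).mono_of_mem_nhdsWithin ?_
  exact mem_of_superset (Icc_mem_nhdsGE (Nat.lt_floor_add_one z)) (Icc_subset_Icc_left h1.1)

theorem Jet.hasDerivAt_quasiExtend (f : Jet (some c)) (j : ℕ) {z : ℝ} (hz : 0 < z) :
    HasDerivAt (quasiExtend c (Jet.d j f)) (quasiExtend c (Jet.d (j + 1) f) z) z := by
  obtain ⟨m, hm⟩ : ∃ m, ⌈z⌉₊ = m + 1 := Nat.exists_eq_succ_of_ne_zero (Nat.ceil_pos.2 hz).ne'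
  have h0 : (m : ℝ) < z := Nat.lt_ceil.1 (by omega)
  have h1 : z ∈ Icc (m : ℝ) (m + 1) := ⟨h0.le, by have := Nat.le_ceil z; rw [hm] at this;
                                                    exact_mod_cast this⟩
  have h2 : HasDerivWithinAt (quasiExtend c (Jet.d j f)) (quasiExtend c (Jet.d (j + 1) f) z)
      (Iic z) z := by
    refine (f.hasDerivWithinAt_quasiExtend_Icc j _ h1).mono_of_mem_nhdsWithin ?_
    exact mem_of_superset (Icc_mem_nhdsLE h0) (Icc_subset_Icc_right h1.2)
  have h3 := h2.union (f.hasDerivWithinAt_quasiExtend_Ici j hz.le)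
  rwa [Iic_union_Ici, hasDerivWithinAt_univ] at h3

/-- Taylor's formula, with a crude remainder. -/
theorem Jet.abs_quasiExtend_sub_taylor_le (hc : |c| ≤ 1) (f : Jet (some c)) (n j : ℕ) {x y : ℝ}
    (hx : 0 ≤ x) (hy : 0 ≤ y) :
    |quasiExtend c (Jet.d j f) (x + y) - ∑ i ∈ Finset.range n,
      y ^ i / i.factorial * quasiExtend c (Jet.d (j + i) f) x| ≤ ‖Jet.d (j + n) f‖ * y ^ n := by
  induction n generalizing j y with
  | zero => simpa using abs_quasiExtend_le hc _ _
  | succ n ih =>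
    let G : ℝ → ℝ := fun h => quasiExtend c (Jet.d j f) (x + h) - ∑ i ∈ Finset.range (n + 1),
      h ^ i / i.factorial * quasiExtend c (Jet.d (j + i) f) x
    -- The derivative of the remainder `G` is the remainder of order `n` for `f⁽ʲ⁺¹⁾`, to which the
    -- induction hypothesis applies.
    let G' : ℝ → ℝ := fun h => quasiExtend c (Jet.d (j + 1) f) (x + h) - ∑ i ∈ Finset.range n,
      h ^ i / i.factorial * quasiExtend c (Jet.d (j + 1 + i) f) x
    have hpoly : ∀ h : ℝ, HasDerivAt (fun h : ℝ => ∑ i ∈ Finset.range (n + 1),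
        h ^ i / i.factorial * quasiExtend c (Jet.d (j + i) f) x) (∑ i ∈ Finset.range n,
        h ^ i / i.factorial * quasiExtend c (Jet.d (j + 1 + i) f) x) h := by
      intro h
      simp only [Finset.sum_range_succ' _ n, pow_zero]
      refine HasDerivAt.add_const _ (HasDerivAt.fun_sum fun i _ => ?_)
      have h1 := ((hasDerivAt_pow (i + 1) h).div_const ((i + 1).factorial : ℝ)).mul_const
        (quasiExtend c (Jet.d (j + (i + 1)) f) x)
      refine h1.congr_deriv ?_
      rw [show j + (i + 1) = j + 1 + i by ring, Nat.factorial_succ, Nat.add_sub_cancel]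
      have := Nat.factorial_ne_zero i
      push_cast
      field_simp
    have hder : ∀ h ∈ Icc 0 y, HasDerivWithinAt G (G' h) (Ici h) h := fun h hh => by
      have hxh : 0 ≤ x + h := add_nonneg hx hh.1
      have h1 : HasDerivWithinAt (fun h : ℝ => x + h) 1 (Ici h) h :=
        ((hasDerivAt_id h).const_add x).hasDerivWithinAt
      have h2 := (f.hasDerivWithinAt_quasiExtend_Ici j hxh).comp h h1
        fun t ht => add_le_add_right ht x
      rw [mul_one] at h2
      exact h2.sub (hpoly h).hasDerivWithinAt
    have hcontG : ContinuousOn G (Icc 0 y) := by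
      intro h hh
      rcases hh.1.eq_or_lt with h0 | h0
      · subst h0
        exact (hder 0 hh).continuousWithinAt.mono fun t ht => ht.1
      · have h1 : HasDerivAt (fun h : ℝ => x + h) 1 h := (hasDerivAt_id h).const_add x
        have h2 := (f.hasDerivAt_quasiExtend j (z := x + h) (by linarith)).comp h h1
        exact (h2.sub (hpoly h)).continuousAt.continuousWithinAt
    have hG0 : G 0 = 0 := by
      simp only [G, Finset.sum_range_succ' _ n]
      simp
    have := norm_image_sub_le_of_norm_deriv_right_le_segment (f := G) (f' := G')
      (C := ‖Jet.d (j + (n + 1)) f‖ * y ^ n) hcontG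
      (fun h hh => hder h ⟨hh.1, hh.2.le⟩)
      (fun h hh => by
        have h1 := ih (j + 1) hh.1
        rw [show j + 1 + n = j + (n + 1) by ring] at h1
        refine h1.trans ?_
        gcongr
        · exact hh.1
        · exact hh.2.le)
      y ⟨hy, le_rfl⟩
    rw [hG0, sub_zero, sub_zero, Real.norm_eq_abs] at this
    refine this.trans (le_of_eq ?_)
    ring

end quasi

/-! ### The smoothing operators on jets -/

section smoothing

variable {κ : ℕ → ℝ → ℝ} {c : ℝ}

/-- The `j`-th derivative of `x ↦ ∫ κ 0 y * f (x + ε y)`. -/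
def smoothingDeriv (κ : ℕ → ℝ → ℝ) (c ε : ℝ) (j : ℕ) (f : C(Icc (0 : ℝ) 1, ℝ)) (x : ℝ) : ℝ :=
  (-ε⁻¹) ^ j * ∫ y, κ j y * quasiExtend c f (x + ε * y)

theorem measurable_quasiExtend_affine (f : C(Icc (0 : ℝ) 1, ℝ)) (x ε : ℝ) :
    Measurable fun y => quasiExtend c f (x + ε * y) :=
  (measurable_quasiExtend c f).comp (by fun_prop)

variable (hκ : IsKernel κ) (hc : |c| ≤ 1) {ε : ℝ} (hε : 0 < ε)

include hκ hc hε

/-- A translation of the integration variable moves `x` from the rough function into the kernel. -/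
theorem hasDerivAt_smoothingDeriv (j : ℕ) (f : C(Icc (0 : ℝ) 1, ℝ)) (x : ℝ) :
    HasDerivAt (smoothingDeriv κ c ε j f) (smoothingDeriv κ c ε (j + 1) f x) x := by
  have hg : Measurable fun u => quasiExtend c f (ε * u) := by
    simpa using measurable_quasiExtend_affine (c := c) f 0 ε
  have he : ∀ i x, ∫ y, κ i y * quasiExtend c f (x + ε * y) =
      ∫ u, κ i (u - x / ε) * quasiExtend c f (ε * u) := fun i x => by
    have h := MeasureTheory.integral_add_right_eq_self (μ := MeasureTheory.volume)
      (fun u => κ i (u - x / ε) * quasiExtend c f (ε * u)) (x / ε)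
    rw [← h]
    refine MeasureTheory.integral_congr_ae (Eventually.of_forall fun y => ?_)
    have e : ε * (y + x / ε) = x + ε * y := by field_simp; ring
    simp only [add_sub_cancel_right, e]
  have h1 : HasDerivAt (fun x : ℝ => x / ε) (1 / ε) x := (hasDerivAt_id x).div_const ε
  have h2 := ((hκ.hasDerivAt_convolution j hg (fun u => abs_quasiExtend_le hc f _)
    (x / ε)).comp x h1).const_mul ((-ε⁻¹) ^ j)
  have h3 : smoothingDeriv κ c ε j f = fun x => (-ε⁻¹) ^ j *
      ((fun w => ∫ u, κ j (u - w) * quasiExtend c f (ε * u)) ∘ fun x => x / ε) x := by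
    funext x
    rw [smoothingDeriv, he]
    rfl
  rw [h3]
  refine h2.congr_deriv ?_
  rw [smoothingDeriv, he, pow_succ]
  ring

theorem abs_smoothingDeriv_le (j : ℕ) (f : C(Icc (0 : ℝ) 1, ℝ)) (x : ℝ) :
    |smoothingDeriv κ c ε j f x| ≤ ε⁻¹ ^ j * ((∫ y, |κ j y|) * ‖f‖) := by
  rw [smoothingDeriv, abs_mul, abs_pow, abs_neg, abs_of_pos (inv_pos.2 hε)]
  gcongr
  exact hκ.abs_integral_mul_le j fun y _ => abs_quasiExtend_le hc f _

/-- Only `y ≥ 0` contributes, and there the extension satisfies `f (1 + z) = c f (z)`. The one-sided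
kernel is what makes smoothing preserve the boundary condition. -/
theorem smoothingDeriv_one (j : ℕ) (f : C(Icc (0 : ℝ) 1, ℝ)) :
    smoothingDeriv κ c ε j f 1 = c * smoothingDeriv κ c ε j f 0 := by
  have h := MeasureTheory.integral_const_mul (μ := MeasureTheory.volume) c
    fun y => κ j y * quasiExtend c f (0 + ε * y)
  rw [smoothingDeriv, smoothingDeriv, mul_left_comm, ← h]
  congr 1
  refine MeasureTheory.integral_congr_ae (Eventually.of_forall fun y => ?_)
  rcases lt_or_ge y 0 with h | h
  · simp [hκ.eq_zero j y h]
  · simp only [zero_add]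
    rw [quasiExtend_add_one f (by positivity)]
    ring

/-- Integration by parts: derivatives commute with smoothing. -/
theorem smoothingDeriv_succ_d (i j : ℕ) (f : Jet (some c)) {x : ℝ} (hx : 0 ≤ x) :
    smoothingDeriv κ c ε (i + 1) (Jet.d j f) x = smoothingDeriv κ c ε i (Jet.d (j + 1) f) x := by
  -- The integration by parts takes place on the half line. Its boundary terms vanish because `κ i`
  -- is zero at `0` and decays at infinity, while the extended function is bounded.
  have hset : ∀ i (g : ℝ → ℝ), ∫ y, κ i y * g y = ∫ y in Ioi 0, κ i y * g y := fun i g => by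
    refine (MeasureTheory.setIntegral_eq_integral_of_forall_compl_eq_zero fun y hy => ?_).symm
    rcases (not_lt.1 (show ¬ 0 < y from hy)).eq_or_lt with h | h
    · rw [h, hκ.apply_zero, zero_mul]
    · rw [hκ.eq_zero i y h, zero_mul]
  have hbd : ∀ j y, ‖quasiExtend c (Jet.d j f) (x + ε * y)‖ ≤ ‖Jet.d j f‖ := fun j y =>
    abs_quasiExtend_le hc _ _
  have hlim : ∀ l : Filter ℝ, Tendsto (κ i) l (𝓝 0) →
      Tendsto (κ i * fun y => quasiExtend c (Jet.d j f) (x + ε * y)) l (𝓝 0) := fun l hl =>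
    hl.zero_mul_isBoundedUnder_le (isBoundedUnder_of ⟨‖Jet.d j f‖, fun y => hbd j y⟩)
  have hinf : Tendsto (κ i) atTop (𝓝 0) := by
    obtain ⟨C, hC, h⟩ := hκ.decay i 1
    refine squeeze_zero_norm' (a := fun y => C * y⁻¹) ?_ ?_
    · filter_upwards [eventually_gt_atTop 0] with y hy
      have := h y
      rw [← div_eq_mul_inv, le_div_iff₀ hy, Real.norm_eq_abs]
      rw [pow_one, abs_of_pos hy] at this
      nlinarith [abs_nonneg (κ i y)]
    · simpa using tendsto_inv_atTop_zero.const_mul C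
  have h0 : Tendsto (κ i) (𝓝[>] 0) (𝓝 0) := by
    have : Tendsto (κ i) (𝓝 0) (𝓝 0) := by
      simpa [hκ.apply_zero] using (hκ.continuous i).tendsto 0
    exact this.mono_left nhdsWithin_le_nhds
  have key := MeasureTheory.integral_Ioi_mul_deriv_eq_deriv_mul (a := 0) (u := κ i)
    (u' := κ (i + 1)) (v := fun y => quasiExtend c (Jet.d j f) (x + ε * y))
    (v' := fun y => ε * quasiExtend c (Jet.d (j + 1) f) (x + ε * y))
    (fun y _ => hκ.hasDerivAt i y) (fun y hy => ?_) ?_ ?_ (hlim _ h0) (hlim _ hinf)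
  · rw [smoothingDeriv, smoothingDeriv, hset, hset, pow_succ]
    have e : ∫ y in Ioi 0, κ i y * (ε * quasiExtend c (Jet.d (j + 1) f) (x + ε * y)) =
        ε * ∫ y in Ioi 0, κ i y * quasiExtend c (Jet.d (j + 1) f) (x + ε * y) := by
      rw [← MeasureTheory.integral_const_mul]
      exact MeasureTheory.integral_congr_ae (Eventually.of_forall fun y => mul_left_comm _ _ _)
    rw [e, sub_zero, zero_sub] at key
    rw [← neg_eq_iff_eq_neg.2 key]
    field_simp
  · have hy0 : 0 < y := hy
    have h1 : HasDerivAt (fun y : ℝ => x + ε * y) ε y := by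
      simpa using ((hasDerivAt_id y).const_mul ε).const_add x
    have h2 := (f.hasDerivAt_quasiExtend j (z := x + ε * y) (by positivity)).comp y h1
    rwa [mul_comm] at h2
  · have h1 := (hκ.integrable_mul i (measurable_quasiExtend_affine (c := c) (Jet.d (j + 1) f) x ε)
      (hbd (j + 1))).const_mul ε
    refine (h1.congr (Eventually.of_forall fun y => ?_)).integrableOn
    simp only [Pi.mul_apply]
    ring
  · exact (hκ.integrable_mul (i + 1) (measurable_quasiExtend_affine (c := c) (Jet.d j f) x ε)
      (hbd j)).integrableOn

theorem smoothingDeriv_d (i j : ℕ) (f : Jet (some c)) {x : ℝ} (hx : 0 ≤ x) :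
    smoothingDeriv κ c ε i (Jet.d j f) x = smoothingDeriv κ c ε 0 (Jet.d (j + i) f) x := by
  induction i generalizing j with
  | zero => rfl
  | succ i ih =>
    rw [smoothingDeriv_succ_d hκ hc hε i j f hx, ih (j + 1), add_right_comm, add_assoc]

/-- Smoothing reproduces smooth functions up to any order in `ε`. -/
theorem abs_sub_smoothingDeriv_le (hκ1 : ∫ y, κ 0 y = 1)
    (hκ0 : ∀ n : ℕ, 1 ≤ n → ∫ y, κ 0 y * y ^ n = 0) (n j : ℕ) (f : Jet (some c)) {x : ℝ}
    (hx : 0 ≤ x) : |quasiExtend c (Jet.d j f) x - smoothingDeriv κ c ε 0 (Jet.d j f) x| ≤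
      (∫ y, |κ 0 y * y ^ (n + 1)|) * ε ^ (n + 1) * ‖Jet.d (j + (n + 1)) f‖ := by
  let T : ℝ → ℝ := fun y => ∑ i ∈ Finset.range (n + 1),
    (ε * y) ^ i / i.factorial * quasiExtend c (Jet.d (j + i) f) x
  have hTi : ∀ i ∈ Finset.range (n + 1), MeasureTheory.Integrable fun y => κ 0 y *
      ((ε * y) ^ i / i.factorial * quasiExtend c (Jet.d (j + i) f) x) := fun i _ => by
    refine ((hκ.integrable_mul_pow 0 i).mul_const
      (ε ^ i / i.factorial * quasiExtend c (Jet.d (j + i) f) x)).congr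
      (Eventually.of_forall fun y => ?_)
    simp only [mul_pow]
    ring
  have hTint : MeasureTheory.Integrable fun y => κ 0 y * T y := by
    simp only [T, Finset.mul_sum]
    exact MeasureTheory.integrable_finsetSum _ hTi
  -- The vanishing moments kill every term of the Taylor polynomial except the constant one, so only
  -- the Taylor remainder is left to integrate.
  have hT : ∫ y, κ 0 y * T y = quasiExtend c (Jet.d j f) x := by
    simp only [T, Finset.mul_sum]
    rw [MeasureTheory.integral_finsetSum _ hTi, Finset.sum_eq_single 0]
    · simp only [pow_zero, Nat.factorial_zero, Nat.cast_one, div_one, one_mul, add_zero]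
      rw [MeasureTheory.integral_mul_const, hκ1, one_mul]
    · intro i _ hi
      have e : ∀ y, κ 0 y * ((ε * y) ^ i / i.factorial * quasiExtend c (Jet.d (j + i) f) x) =
          κ 0 y * y ^ i * (ε ^ i / i.factorial * quasiExtend c (Jet.d (j + i) f) x) := fun y => by
        rw [mul_pow]; ring
      simp only [e]
      rw [MeasureTheory.integral_mul_const, hκ0 i (Nat.one_le_iff_ne_zero.2 hi), zero_mul]
    · simp
  have hf := hκ.integrable_mul 0 (measurable_quasiExtend_affine (c := c) (Jet.d j f) x ε)
    fun y => abs_quasiExtend_le hc _ _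
  rw [smoothingDeriv, pow_zero, one_mul, ← hT, abs_sub_comm, ← MeasureTheory.integral_sub hf hTint,
    mul_assoc, ← MeasureTheory.integral_mul_const, ← Real.norm_eq_abs]
  refine MeasureTheory.norm_integral_le_of_norm_le
    ((hκ.integrable_mul_pow 0 (n + 1)).abs.mul_const _) (Eventually.of_forall fun y => ?_)
  rw [← mul_sub, norm_mul]
  rcases lt_or_ge y 0 with h | h
  · rw [hκ.eq_zero 0 y h]; simp
  · have h1 := f.abs_quasiExtend_sub_taylor_le hc (n + 1) j hx (by positivity : 0 ≤ ε * y)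
    rw [abs_mul, abs_of_nonneg (by positivity : 0 ≤ y ^ (n + 1)), mul_assoc]
    refine mul_le_mul_of_nonneg_left (h1.trans (le_of_eq ?_)) (abs_nonneg _)
    rw [mul_pow]
    ring

end smoothing

/-- The smoothing operators, from continuous functions to jets. -/
def smoothing {κ : ℕ → ℝ → ℝ} {c : ℝ} (hκ : IsKernel κ) (hc : |c| ≤ 1) {ε : ℝ} (hε : 0 < ε) :
    C(Icc (0 : ℝ) 1, ℝ) →ₗ[ℝ] Jet (some c) where
  toFun f := Jet.mk (fun j => ⟨fun x => smoothingDeriv κ c ε j f x,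
      (continuous_iff_continuousAt.2 fun x =>
        (hasDerivAt_smoothingDeriv hκ hc hε j f x).continuousAt).comp continuous_subtype_val⟩)
    (fun j x => (hasDerivAt_smoothingDeriv hκ hc hε j f x).hasDerivWithinAt.congr
      (fun y hy => lineExtend_of_mem _ hy) (lineExtend_apply _ x))
    (fun a ha j => by
      obtain rfl : c = a := Option.some_injective _ ha
      exact smoothingDeriv_one hκ hc hε j f)
  map_add' f g := by
    refine Jet.ext_d fun j => ContinuousMap.ext fun x => ?_
    change smoothingDeriv κ c ε j (f + g) x =
      smoothingDeriv κ c ε j f x + smoothingDeriv κ c ε j g x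
    simp only [smoothingDeriv, quasiExtend_add, mul_add]
    rw [MeasureTheory.integral_add, mul_add]
    · exact hκ.integrable_mul j (measurable_quasiExtend_affine f x ε)
        fun y => abs_quasiExtend_le hc _ _
    · exact hκ.integrable_mul j (measurable_quasiExtend_affine g x ε)
        fun y => abs_quasiExtend_le hc _ _
  map_smul' a f := by
    refine Jet.ext_d fun j => ContinuousMap.ext fun x => ?_
    change smoothingDeriv κ c ε j (a • f) x = a * smoothingDeriv κ c ε j f x
    simp only [smoothingDeriv, quasiExtend_smul]
    have h := MeasureTheory.integral_const_mul (μ := MeasureTheory.volume) a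
      fun y => κ j y * quasiExtend c f (x + ε * y)
    rw [mul_left_comm, ← h]
    congr 1
    refine MeasureTheory.integral_congr_ae (Eventually.of_forall fun y => ?_)
    simp only []
    ring

section tame

variable {κ : ℕ → ℝ → ℝ} {c : ℝ} (hκ : IsKernel κ) (hc : |c| ≤ 1)

theorem Jet.quasiExtend_coe (f : Jet (some c)) (j : ℕ) (x : Icc (0 : ℝ) 1) :
    quasiExtend c (Jet.d j f) x = Jet.d j f x := by
  rw [f.quasiExtend_eq j 0 (by simp)]
  simp [lineExtend_apply]

theorem norm_d_smoothing_le {ε : ℝ} (hε : 0 < ε) (f : C(Icc (0 : ℝ) 1, ℝ)) (j : ℕ) :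
    ‖Jet.d j (smoothing hκ hc hε f)‖ ≤ ε⁻¹ ^ j * ((∫ y, |κ j y|) * ‖f‖) := by
  rw [ContinuousMap.norm_le _ (by positivity)]
  exact fun x => abs_smoothingDeriv_le hκ hc hε j f x

/-- What smoothing leaves over. -/
def smoothingRest {ε : ℝ} (hε : 0 < ε) : Jet (some c) →ₗ[ℝ] Jet (some c) :=
  LinearMap.id - smoothing hκ hc hε ∘ₗ Jet.d 0

/-- Derivatives commute with smoothing, so each order is controlled by itself, uniformly in `ε`.
Iteration thus costs constants but no derivatives. -/
theorem norm_d_smoothingRest_le {ε : ℝ} (hε : 0 < ε) (f : Jet (some c)) (j : ℕ) :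
    ‖Jet.d j (smoothingRest hκ hc hε f)‖ ≤ (1 + ∫ y, |κ 0 y|) * ‖Jet.d j f‖ := by
  have h0 : 0 ≤ ∫ y, |κ 0 y| := MeasureTheory.integral_nonneg fun y => abs_nonneg _
  rw [ContinuousMap.norm_le _ (by positivity)]
  intro x
  change |Jet.d j f x - smoothingDeriv κ c ε j (Jet.d 0 f) x| ≤ _
  rw [smoothingDeriv_d hκ hc hε j 0 f x.2.1, zero_add]
  have h1 := abs_smoothingDeriv_le hκ hc hε 0 (Jet.d j f) x
  have h2 : |Jet.d j f x| ≤ ‖Jet.d j f‖ := (Jet.d j f).norm_coe_le_norm x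
  have h3 := abs_sub (Jet.d j f x) (smoothingDeriv κ c ε 0 (Jet.d j f) x)
  rw [pow_zero, one_mul] at h1
  linarith

theorem norm_d_smoothingRest_le_pow (hκ1 : ∫ y, κ 0 y = 1)
    (hκ0 : ∀ n : ℕ, 1 ≤ n → ∫ y, κ 0 y * y ^ n = 0) {ε : ℝ} (hε : 0 < ε) (f : Jet (some c))
    (n j : ℕ) : ‖Jet.d j (smoothingRest hκ hc hε f)‖ ≤
      (∫ y, |κ 0 y * y ^ (n + 1)|) * ε ^ (n + 1) * ‖Jet.d (j + (n + 1)) f‖ := by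
  have h0 : 0 ≤ ∫ y, |κ 0 y * y ^ (n + 1)| := MeasureTheory.integral_nonneg fun y => abs_nonneg _
  rw [ContinuousMap.norm_le _ (by positivity)]
  intro x
  change |Jet.d j f x - smoothingDeriv κ c ε j (Jet.d 0 f) x| ≤ _
  rw [smoothingDeriv_d hκ hc hε j 0 f x.2.1, zero_add, ← f.quasiExtend_coe]
  exact abs_sub_smoothingDeriv_le hκ hc hε hκ1 hκ0 n j f x.2.1

/-- What is left over after smoothing at the scales `1, e⁻¹, …, e⁻ᵏ⁺¹`. -/
def iteratedRest : ℕ → Jet (some c) →ₗ[ℝ] Jet (some c)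
  | 0 => LinearMap.id
  | k + 1 => smoothingRest hκ hc (Real.exp_pos (-(k : ℝ))) ∘ₗ iteratedRest k

theorem norm_d_iteratedRest_le (k j : ℕ) (f : Jet (some c)) :
    ‖Jet.d j (iteratedRest hκ hc k f)‖ ≤ (1 + ∫ y, |κ 0 y|) ^ k * ‖Jet.d j f‖ := by
  induction k with
  | zero => simp [iteratedRest]
  | succ k ih =>
    have h0 : 0 ≤ ∫ y, |κ 0 y| := MeasureTheory.integral_nonneg fun y => abs_nonneg _
    refine (norm_d_smoothingRest_le hκ hc _ _ j).trans ?_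
    rw [pow_succ', mul_assoc]
    gcongr

/-- After `k + 1` steps, the smoothing at scale `exp (-k)` gains `exp (-k (m + 1))` from `m + 1`
derivatives, while the `k` earlier ones cost at most `(1 + ∫ |κ 0|) ^ k ≤ exp (r k)`. The choice `m
= n + r` pays for both this loss and the weight `exp (n (k + 1))`. -/
theorem exists_iteratedRest_bound (hκ1 : ∫ y, κ 0 y = 1)
    (hκ0 : ∀ n : ℕ, 1 ≤ n → ∫ y, κ 0 y * y ^ n = 0) :
    ∃ r : ℕ, ∀ n : ℕ, ∃ C, 0 ≤ C ∧ ∀ (k j : ℕ) (f : Jet (some c)),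
      Real.exp (n * k) * ‖Jet.d j (iteratedRest hκ hc k f)‖ ≤ C * gnorm (j + n + r) f := by
  obtain ⟨r, hr⟩ := exists_nat_ge (Real.log (1 + ∫ y, |κ 0 y|))
  have h0 : 0 ≤ ∫ y, |κ 0 y| := MeasureTheory.integral_nonneg fun y => abs_nonneg _
  have hA : 1 + ∫ y, |κ 0 y| ≤ Real.exp r := by
    rw [← Real.exp_log (by linarith : 0 < 1 + ∫ y, |κ 0 y|)]
    exact Real.exp_le_exp.2 hr
  refine ⟨r + 1, fun n => ?_⟩
  set m := n + r with hm
  set D := ∫ y, |κ 0 y * y ^ (m + 1)|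
  have hD : 0 ≤ D := MeasureTheory.integral_nonneg fun y => abs_nonneg _
  refine ⟨1 + Real.exp n * D, by positivity, fun k j f => ?_⟩
  have hidx : j + n + (r + 1) = j + (m + 1) := by omega
  rw [hidx]
  have hg := gnorm_nonneg (j + (m + 1)) f
  rcases k with _ | k
  · have h1 : ‖Jet.d j f‖ ≤ gnorm (j + (m + 1)) f := Jet.norm_d_le (by omega) f
    have h2 : 0 ≤ Real.exp n * D := by positivity
    simp only [iteratedRest, Nat.cast_zero, mul_zero, Real.exp_zero, one_mul, LinearMap.id_apply]
    nlinarith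
  · have h1 := norm_d_smoothingRest_le_pow hκ hc hκ1 hκ0 (Real.exp_pos (-(k : ℝ)))
      (iteratedRest hκ hc k f) m j
    have h2 := norm_d_iteratedRest_le hκ hc k (j + (m + 1)) f
    have h3 : ‖Jet.d (j + (m + 1)) f‖ ≤ gnorm (j + (m + 1)) f := Jet.norm_d_le le_rfl f
    have h4 : (1 + ∫ y, |κ 0 y|) ^ k ≤ Real.exp (r * k) := by
      rw [mul_comm, Real.exp_nat_mul]
      gcongr
    have h5 : Real.exp (n * (k + 1 : ℕ)) * (Real.exp (-(k : ℝ)) ^ (m + 1) * Real.exp (r * k)) ≤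
        Real.exp n := by
      rw [← Real.exp_nat_mul, ← Real.exp_add, ← Real.exp_add, Real.exp_le_exp, hm]
      push_cast
      nlinarith [Nat.cast_nonneg (α := ℝ) k]
    calc Real.exp (n * (k + 1 : ℕ)) * ‖Jet.d j (iteratedRest hκ hc (k + 1) f)‖
        ≤ Real.exp (n * (k + 1 : ℕ)) * (D * Real.exp (-(k : ℝ)) ^ (m + 1) *
            (Real.exp (r * k) * gnorm (j + (m + 1)) f)) := by
          gcongr
          refine h1.trans ?_
          gcongr
          exact h2.trans (by gcongr)
      _ = (Real.exp (n * (k + 1 : ℕ)) * (Real.exp (-(k : ℝ)) ^ (m + 1) * Real.exp (r * k))) *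
            (D * gnorm (j + (m + 1)) f) := by ring
      _ ≤ Real.exp n * (D * gnorm (j + (m + 1)) f) := by gcongr
      _ ≤ (1 + Real.exp n * D) * gnorm (j + (m + 1)) f := by nlinarith

/-- Smooth functions on `[0, 1]` with a quasiperiodic boundary condition form a tame Fréchet
space. -/
theorem Jet.isTameFrechetSpace_some (hc : |c| ≤ 1) : IsTameFrechetSpace (Jet (some c)) := by
  obtain ⟨κ, hκ, hκ1, hκ0⟩ := exists_kernel
  obtain ⟨r, hr⟩ := exists_iteratedRest_bound hκ hc hκ1 hκ0
  refine isTameFrechetSpace_of_decomposition Jet.isFrechetSpace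
    (fun k => Jet.d 0 ∘ₗ iteratedRest hκ hc k)
    (fun k => smoothing hκ hc (Real.exp_pos (-(k : ℝ)))) r (fun n => ?_) (fun n => ?_) fun f => ?_
  · obtain ⟨C, hC, h⟩ := hr n
    exact ⟨C, hC, fun k f => by simpa using h k 0 f⟩
  · refine ⟨∑ j ∈ Finset.range (n + 1), ∫ y, |κ j y|, Finset.sum_nonneg fun j _ =>
      MeasureTheory.integral_nonneg fun y => abs_nonneg _, fun k b => ?_⟩
    rw [Jet.gnorm_eq, Finset.sum_mul]
    refine Finset.sum_le_sum fun j hj => (norm_d_smoothing_le hκ hc _ b j).trans ?_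
    have hj' : (j : ℝ) ≤ n := by exact_mod_cast Nat.lt_succ_iff.1 (Finset.mem_range.1 hj)
    have h1 : (Real.exp (-(k : ℝ)))⁻¹ ^ j ≤ Real.exp (n * k) := by
      rw [← Real.exp_neg, neg_neg, ← Real.exp_nat_mul]
      gcongr
    have h2 : 0 ≤ ∫ y, |κ j y| := MeasureTheory.integral_nonneg fun y => abs_nonneg _
    calc _ ≤ Real.exp (n * k) * ((∫ y, |κ j y|) * ‖b‖) := by gcongr
      _ = _ := by ring
  -- The sum telescopes: each smoothed piece is the difference of two consecutive rests, and the
  -- rests tend to zero.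
  · have hsum : ∀ N, ∑ k ∈ Finset.range N, smoothing hκ hc (Real.exp_pos (-(k : ℝ)))
        ((Jet.d 0 ∘ₗ iteratedRest hκ hc k) f) = f - iteratedRest hκ hc N f := fun N => by
      induction N with
      | zero => simp [iteratedRest]
      | succ N ih =>
        rw [Finset.sum_range_succ, ih]
        simp only [iteratedRest, smoothingRest, LinearMap.comp_apply, LinearMap.sub_apply,
          LinearMap.id_apply]
        abel
    simp only [hsum]
    have h0 : Tendsto (fun N => iteratedRest hκ hc N f) atTop (𝓝 0) := by
      rw [tendsto_iff_gnorm]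
      intro n δ hδ
      obtain ⟨C, hC, h⟩ := hr 1
      have hb : ∀ N : ℕ, gnorm n (iteratedRest hκ hc N f - 0) ≤
          (n + 1) * (C * gnorm (n + 1 + r) f * Real.exp (-(N : ℝ))) := fun N => by
        rw [sub_zero]
        refine Jet.gnorm_le fun j hj => ?_
        have h1 := h N j f
        rw [Nat.cast_one, one_mul] at h1
        have h2 : gnorm (j + 1 + r) f ≤ gnorm (n + 1 + r) f := gnorm_mono (by omega) f
        rw [Real.exp_neg, ← div_eq_mul_inv, le_div_iff₀ (Real.exp_pos _), mul_comm]
        exact h1.trans (by gcongr)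
      have ht : Tendsto (fun N : ℕ => ((n : ℝ) + 1) *
          (C * gnorm (n + 1 + r) f * Real.exp (-(N : ℝ)))) atTop (𝓝 0) := by
        have : Tendsto (fun N : ℕ => Real.exp (-(N : ℝ))) atTop (𝓝 0) :=
          Real.tendsto_exp_neg_atTop_nhds_zero.comp tendsto_natCast_atTop_atTop
        simpa using (this.const_mul (C * gnorm (n + 1 + r) f)).const_mul ((n : ℝ) + 1)
      filter_upwards [ht.eventually (Iio_mem_nhds hδ)] with N hN
      exact (hb N).trans_lt hN
    simpa using h0.const_sub f

end tame

/-! ## Products of jets -/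

namespace Jet

variable {bc bc₁ bc₂ : Option ℝ}

theorem iteratedDerivWithin_mul_d (f : Jet bc₁) (g : Jet bc₂) (j : ℕ) (x : Icc (0 : ℝ) 1) :
    iteratedDerivWithin j (fun t => lineExtend (d 0 f) t * lineExtend (d 0 g) t) (Icc 0 1) x =
      ∑ i ∈ Finset.range (j + 1), (j.choose i : ℝ) * d i f x * d (j - i) g x := by
  have h := iteratedDerivWithin_mul (n := j) x.2 uniqueDiffOn_Icc_zero_one
    ((f.contDiffOn_d x x.2).of_le (by exact_mod_cast le_top))
    ((g.contDiffOn_d x x.2).of_le (by exact_mod_cast le_top))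
  simp only [iteratedDerivWithin_d] at h
  exact h

/-- The product of two smooth functions, if it has the boundary condition `bc`. -/
def mulOf (f : Jet bc₁) (g : Jet bc₂)
    (hbc : ∀ c ∈ bc, ∀ j, ∑ i ∈ Finset.range (j + 1), (j.choose i : ℝ) * d i f 1 * d (j - i) g 1 =
      c * ∑ i ∈ Finset.range (j + 1), (j.choose i : ℝ) * d i f 0 * d (j - i) g 0) : Jet bc :=
  ofFun (fun t => lineExtend (d 0 f) t * lineExtend (d 0 g) t)
    (f.contDiffOn_d.mul g.contDiffOn_d) fun c hc j => by
      have h1 := iteratedDerivWithin_mul_d f g j 1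
      have h0 := iteratedDerivWithin_mul_d f g j 0
      simp only [Icc.coe_one, Icc.coe_zero] at h1 h0
      rw [h1, h0, hbc c hc j]

theorem d_mulOf (f : Jet bc₁) (g : Jet bc₂) (hbc) (j : ℕ) (x : Icc (0 : ℝ) 1) :
    d j (mulOf (bc := bc) f g hbc) x =
      ∑ i ∈ Finset.range (j + 1), (j.choose i : ℝ) * d i f x * d (j - i) g x := by
  rw [mulOf, d_ofFun, iteratedDerivWithin_mul_d]

theorem norm_d_mulOf_le (f : Jet bc₁) (g : Jet bc₂) (hbc) (j : ℕ) :
    ‖d j (mulOf (bc := bc) f g hbc)‖ ≤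
      ∑ i ∈ Finset.range (j + 1), (j.choose i : ℝ) * ‖d i f‖ * ‖d (j - i) g‖ := by
  rw [ContinuousMap.norm_le _ (by positivity)]
  intro x
  rw [d_mulOf]
  refine (norm_sum_le _ _).trans (Finset.sum_le_sum fun i _ => ?_)
  rw [norm_mul, norm_mul, Real.norm_natCast]
  gcongr
  · exact (d i f).norm_coe_le_norm x
  · exact (d (j - i) g).norm_coe_le_norm x

/-- Geometric bounds with a common ratio survive Leibniz' formula, since `K ^ i * K ^ (j - i) = K ^
j`. Interpolation supplies such bounds. -/
theorem norm_d_mulOf_le_of_pow (f : Jet bc₁) (g : Jet bc₂) (hbc) {j : ℕ} {A B K : ℝ}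
    (hf : ∀ i ≤ j, ‖d i f‖ ≤ A * K ^ i) (hg : ∀ i ≤ j, ‖d i g‖ ≤ B * K ^ i) :
    ‖d j (mulOf (bc := bc) f g hbc)‖ ≤ 2 ^ j * (A * B) * K ^ j := by
  refine (norm_d_mulOf_le f g hbc j).trans ?_
  have h2 : (2 : ℝ) ^ j = ∑ i ∈ Finset.range (j + 1), (j.choose i : ℝ) := by
    exact_mod_cast (Nat.sum_range_choose j).symm
  rw [h2, Finset.sum_mul, Finset.sum_mul]
  refine Finset.sum_le_sum fun i hi => ?_
  have hi' : i ≤ j := Nat.lt_succ_iff.1 (Finset.mem_range.1 hi)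
  calc (j.choose i : ℝ) * ‖d i f‖ * ‖d (j - i) g‖
      = (j.choose i : ℝ) * (‖d i f‖ * ‖d (j - i) g‖) := by ring
    _ ≤ (j.choose i : ℝ) * ((A * K ^ i) * (B * K ^ (j - i))) := by
        have := hf i hi'
        have := hg (j - i) (Nat.sub_le _ _)
        have h0 : 0 ≤ A * K ^ i := (norm_nonneg _).trans (hf i hi')
        gcongr
    _ = (j.choose i : ℝ) * (A * B) * K ^ j := by
        rw [← Nat.add_sub_cancel' hi', pow_add, Nat.add_sub_cancel_left]
        ring

theorem gnorm_mulOf_le (f : Jet bc₁) (g : Jet bc₂) (hbc) (n : ℕ) :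
    gnorm n (mulOf (bc := bc) f g hbc) ≤ (n + 1) * 2 ^ n * (gnorm n f * gnorm n g) := by
  have hf := gnorm_nonneg n f
  have hg := gnorm_nonneg n g
  rw [mul_assoc]
  refine gnorm_le fun j hj => ?_
  have h := norm_d_mulOf_le_of_pow f g hbc (j := j) (A := gnorm n f) (B := gnorm n g) (K := 1)
    (fun i hi => by simpa using norm_d_le (hi.trans hj) f)
    (fun i hi => by simpa using norm_d_le (hi.trans hj) g)
  rw [one_pow, mul_one] at h
  refine h.trans ?_
  gcongr
  norm_num

/-! ### Smooth functions without boundary condition -/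

/-- A smooth function that is `1 - x` up to reparameterization and flat at `1`. -/
def cutoff : Jet none :=
  ofFun (fun x => Real.smoothTransition (1 - x))
    (Real.smoothTransition.contDiff.comp (by fun_prop)).contDiffOn (by simp)

theorem d_zero_cutoff (x : Icc (0 : ℝ) 1) : d 0 cutoff x = Real.smoothTransition (1 - x) := by
  rw [cutoff, d_ofFun, iteratedDerivWithin_zero]

/-- The cutoff is defined and smooth on the whole line and vanishes to the right of `1`; its
derivatives are continuous. -/
theorem d_cutoff_one (j : ℕ) : d j cutoff 1 = 0 := by
  have hs : ContDiff ℝ ∞ fun x : ℝ => Real.smoothTransition (1 - x) :=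
    Real.smoothTransition.contDiff.comp (by fun_prop)
  rw [cutoff, d_ofFun, iteratedDerivWithin_eq_iteratedDeriv uniqueDiffOn_Icc_zero_one
    ((hs.of_le (by exact_mod_cast le_top)).contDiffAt) (by simp)]
  have hc : Continuous (iteratedDeriv j fun x : ℝ => Real.smoothTransition (1 - x)) :=
    hs.continuous_iteratedDeriv j (by exact_mod_cast le_top)
  have h1 : Tendsto (iteratedDeriv j fun x : ℝ => Real.smoothTransition (1 - x)) (𝓝[>] 1)
      (𝓝 (iteratedDeriv j (fun x : ℝ => Real.smoothTransition (1 - x)) 1)) :=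
    (hc.tendsto 1).mono_left nhdsWithin_le_nhds
  refine tendsto_nhds_unique h1 (tendsto_const_nhds.congr' ?_)
  filter_upwards [self_mem_nhdsWithin] with x hx
  have he : (fun x : ℝ => Real.smoothTransition (1 - x)) =ᶠ[𝓝 x] fun _ => 0 := by
    filter_upwards [Ioi_mem_nhds hx] with y hy
    exact Real.smoothTransition.zero_of_nonpos (by linarith [mem_Ioi.1 hy])
  rw [he.iteratedDeriv_eq, iteratedDeriv_const]
  simp

theorem smoothTransition_add (x : ℝ) :
    Real.smoothTransition (1 - x) + Real.smoothTransition x = 1 := by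
  have h := Real.smoothTransition.pos_denom x
  rw [Real.smoothTransition, Real.smoothTransition, sub_sub_cancel, add_comm (expNegInvGlue (1 - x)),
    ← add_div, add_comm (expNegInvGlue (1 - x)), div_self h.ne']

theorem cutoff_boundary (f : Jet none) (c : ℝ) (hc : c ∈ some (0 : ℝ)) (j : ℕ) :
    ∑ i ∈ Finset.range (j + 1), (j.choose i : ℝ) * d i cutoff 1 * d (j - i) f 1 =
      c * ∑ i ∈ Finset.range (j + 1), (j.choose i : ℝ) * d i cutoff 0 * d (j - i) f 0 := by
  obtain rfl : 0 = c := Option.some_injective _ hc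
  rw [zero_mul]
  exact Finset.sum_eq_zero fun i _ => by rw [d_cutoff_one]; ring

/-- Multiplication by the cutoff function. -/
def mulCutoff : Jet none →ₗ[ℝ] Jet (some 0) where
  toFun f := mulOf cutoff f (cutoff_boundary f)
  map_add' f g := ext_zero fun x => by simp [d_mulOf, mul_add]
  map_smul' a f := ext_zero fun x => by simp [d_mulOf]; ring

theorem d_zero_mulCutoff (f : Jet none) (x : Icc (0 : ℝ) 1) :
    d 0 (mulCutoff f) x = Real.smoothTransition (1 - x) * d 0 f x := by
  simp [mulCutoff, d_mulOf, d_zero_cutoff]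

/-- Forgetting the boundary condition. -/
def forget : Jet bc →ₗ[ℝ] Jet none where
  toFun f := mk (fun j => d j f) f.hasDerivWithinAt (by simp)
  map_add' _ _ := ext_d fun j => by simp [d_mk]
  map_smul' _ _ := ext_d fun j => by simp [d_mk]

theorem d_forget (f : Jet bc) (j : ℕ) : d j (forget f) = d j f := rfl

/-- The reflection `x ↦ 1 - x` of the unit interval. -/
def reflect : C(Icc (0 : ℝ) 1, Icc (0 : ℝ) 1) := ⟨unitInterval.symm, unitInterval.continuous_symm⟩

/-- The reflected function `x ↦ f (1 - x)`. -/
def refl : Jet none →ₗ[ℝ] Jet none where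
  toFun f := mk (fun j => (-1 : ℝ) ^ j • (d j f).comp reflect) (fun j x => by
      have h1 := f.hasDerivWithinAt j (reflect x)
      have h2 : HasDerivWithinAt (fun t : ℝ => 1 - t) (-1) (Icc 0 1) x :=
        (hasDerivWithinAt_id (x : ℝ) _).const_sub 1
      have h3 := (h1.scomp_of_eq (x : ℝ) h2 (fun t ht => ⟨by linarith [ht.2], by linarith [ht.1]⟩)
        rfl).const_mul ((-1 : ℝ) ^ j)
      refine (h3.congr (fun y hy => ?_) ?_).congr_deriv ?_
      · rw [lineExtend_of_mem _ hy, Function.comp_apply,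
          lineExtend_of_mem (d j f) (x := 1 - y) ⟨by linarith [hy.2], by linarith [hy.1]⟩]
        rfl
      · rw [lineExtend_apply, Function.comp_apply,
          lineExtend_of_mem (d j f) (x := 1 - x) ⟨by linarith [x.2.2], by linarith [x.2.1]⟩]
        rfl
      · change _ = (-1 : ℝ) ^ (j + 1) * d (j + 1) f (reflect x)
        rw [pow_succ, smul_eq_mul]
        ring) (by simp)
  map_add' f g := ext_zero fun x => by simp [d_mk]
  map_smul' a f := ext_zero fun x => by simp [d_mk]

theorem d_refl (f : Jet none) (j : ℕ) (x : Icc (0 : ℝ) 1) :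
    d j (refl f) x = (-1) ^ j * d j f (reflect x) := rfl

theorem isTameLinear_of_norm_d_le {f : Jet bc₁ →ₗ[ℝ] Jet bc₂}
    (h : ∀ j x, ‖d j (f x)‖ ≤ ‖d j x‖) : IsTameLinear f :=
  isTameLinear_of_le fun n x => by
    rw [gnorm_eq, gnorm_eq]
    exact Finset.sum_le_sum fun j _ => h j x

theorem isTameLinear_forget : IsTameLinear (forget (bc := bc)) :=
  isTameLinear_of_norm_d_le fun _ _ => le_rfl

theorem isTameLinear_refl : IsTameLinear refl := isTameLinear_of_norm_d_le fun j f => by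
  rw [ContinuousMap.norm_le _ (norm_nonneg _)]
  intro x
  rw [d_refl, norm_mul, norm_pow, norm_neg, norm_one, one_pow, one_mul]
  exact (d j f).norm_coe_le_norm _

theorem isTameLinear_mulCutoff : IsTameLinear mulCutoff :=
  ⟨0, 0, fun n _ => ⟨(n + 1) * 2 ^ n * gnorm n cutoff, fun f => by
    rw [add_zero, mul_assoc]
    exact gnorm_mulOf_le cutoff f (cutoff_boundary f) n⟩⟩

/-- With `χ` the cutoff, `f = χ f + (1 - χ) f`, and `1 - χ` is the reflection of `χ`. Hence `χ f`
and the reflection of `(1 - χ) f` are both flat at `1`, and `Jet none` is a retract of two copies of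
`Jet (some 0)`. -/
theorem isTameFrechetSpace_none : IsTameFrechetSpace (Jet none) := by
  have h0 : IsTameFrechetSpace (Jet (some 0)) := isTameFrechetSpace_some (by simp)
  refine (h0.prod h0).of_retract withSeminorms
    (T := mulCutoff.prod (mulCutoff ∘ₗ refl))
    (P := forget ∘ₗ LinearMap.fst ℝ _ _ + (refl ∘ₗ forget) ∘ₗ LinearMap.snd ℝ _ _)
    (isTameLinear_mulCutoff.prod (isTameLinear_mulCutoff.comp isTameLinear_refl))
    ((isTameLinear_forget.comp isTameLinear_fst).add
      ((isTameLinear_refl.comp isTameLinear_forget).comp isTameLinear_snd)) fun f => ?_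
  refine ext_zero fun x => ?_
  have hx : reflect (reflect x) = x := unitInterval.symm_symm x
  have hx' : ((reflect x : Icc (0 : ℝ) 1) : ℝ) = 1 - x := rfl
  change d 0 (mulCutoff f) x + (-1) ^ 0 * d 0 (mulCutoff (refl f)) (reflect x) = _
  rw [d_zero_mulCutoff, d_zero_mulCutoff, d_refl, hx, hx', sub_sub_cancel, pow_zero, one_mul,
    one_mul]
  rw [← add_mul, smoothTransition_add, one_mul]

/-! ### The algebra of jets -/

/-- The boundary conditions that are preserved by products. -/
class Unital (bc : Option ℝ) : Prop where
  eq_one : ∀ c ∈ bc, c = 1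

instance : Unital none := ⟨by simp⟩

instance : Unital (some 1) := ⟨by simp⟩

variable [Unital bc]

theorem isTameFrechetSpace : IsTameFrechetSpace (Jet bc) := by
  rcases bc with _ | c
  · exact isTameFrechetSpace_none
  · obtain rfl := Unital.eq_one (bc := some c) c rfl
    exact isTameFrechetSpace_some (by simp)

theorem d_one_eq_zero (f : Jet bc) {c : ℝ} (hc : c ∈ bc) (j : ℕ) : d j f 1 = d j f 0 := by
  rw [f.boundary hc, Unital.eq_one c hc, one_mul]

instance : Mul (Jet bc) := ⟨fun f g => mulOf f g fun c hc j => by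
  rw [Unital.eq_one c hc, one_mul]
  simp only [d_one_eq_zero _ hc]⟩

/-- Constant functions. -/
def const (a : ℝ) : Jet bc := ofFun (fun _ => a) contDiffOn_const fun c hc j => by
  rw [Unital.eq_one c hc, one_mul, iteratedDerivWithin_const, iteratedDerivWithin_const]

@[simp] theorem d_zero_const (a : ℝ) (x : Icc (0 : ℝ) 1) : d 0 (const (bc := bc) a) x = a := by
  rw [const, d_ofFun, iteratedDerivWithin_zero]

@[simp] theorem d_zero_mul (f g : Jet bc) (x : Icc (0 : ℝ) 1) :
    d 0 (f * g) x = d 0 f x * d 0 g x := by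
  change d 0 (mulOf f g _) x = _
  simp [d_mulOf]

theorem d_mul (f g : Jet bc) (j : ℕ) (x : Icc (0 : ℝ) 1) : d j (f * g) x =
    ∑ i ∈ Finset.range (j + 1), (j.choose i : ℝ) * d i f x * d (j - i) g x :=
  d_mulOf _ _ _ _ _

theorem gnorm_mul_le (n : ℕ) (f g : Jet bc) :
    gnorm n (f * g) ≤ (n + 1) * 2 ^ n * (gnorm n f * gnorm n g) := gnorm_mulOf_le _ _ _ n

theorem norm_d_mul_le_of_pow (f g : Jet bc) {j : ℕ} {A B K : ℝ}
    (hf : ∀ i ≤ j, ‖d i f‖ ≤ A * K ^ i) (hg : ∀ i ≤ j, ‖d i g‖ ≤ B * K ^ i) :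
    ‖d j (f * g)‖ ≤ 2 ^ j * (A * B) * K ^ j := norm_d_mulOf_le_of_pow f g _ hf hg

/-- Multiplication as a bilinear map. -/
def mulₗ : Jet bc →ₗ[ℝ] Jet bc →ₗ[ℝ] Jet bc :=
  LinearMap.mk₂ ℝ (fun f g => f * g) (fun f g h => ext_zero fun x => by simp [add_mul])
    (fun c f g => ext_zero fun x => by simp [mul_assoc])
    (fun f g h => ext_zero fun x => by simp [mul_add])
    (fun c f g => ext_zero fun x => by simp [mul_left_comm])

theorem continuous_mul : Continuous fun p : Jet bc × Jet bc => p.1 * p.2 := by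
  refine continuous_iff_continuousAt.2 fun p => ?_
  rw [ContinuousAt, tendsto_iff_gnorm]
  intro n ε hε
  have hs : ∀ q : Jet bc × Jet bc, q.1 * q.2 - p.1 * p.2 =
      (q.1 - p.1) * q.2 + p.1 * (q.2 - p.2) := fun q => ext_zero fun x => by simp; ring
  have hb : ∀ q : Jet bc × Jet bc, gnorm n (q.1 * q.2 - p.1 * p.2) ≤ (n + 1) * 2 ^ n *
      (gnorm n (q.1 - p.1) * gnorm n q.2 + gnorm n p.1 * gnorm n (q.2 - p.2)) := fun q => by
    rw [hs, mul_add]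
    exact (gnorm_add_le n _ _).trans (add_le_add (gnorm_mul_le n _ _) (gnorm_mul_le n _ _))
  have hc : Continuous fun q : Jet bc × Jet bc => ((n : ℝ) + 1) * 2 ^ n *
      (gnorm n (q.1 - p.1) * gnorm n q.2 + gnorm n p.1 * gnorm n (q.2 - p.2)) := by
    have h1 : Continuous fun q : Jet bc × Jet bc => gnorm n (q.1 - p.1) :=
      (continuous_gnorm n).comp (continuous_fst.sub continuous_const)
    have h2 : Continuous fun q : Jet bc × Jet bc => gnorm n (q.2 - p.2) :=
      (continuous_gnorm n).comp (continuous_snd.sub continuous_const)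
    have h3 : Continuous fun q : Jet bc × Jet bc => gnorm n q.2 :=
      (continuous_gnorm n).comp continuous_snd
    fun_prop
  have h0 := hc.tendsto p
  simp only [sub_self, gnorm_zero, zero_mul, mul_zero, add_zero] at h0
  filter_upwards [h0.eventually (Iio_mem_nhds hε)] with q hq
  exact (hb q).trans_lt hq

/-- The naive bound `‖f‖ₙ ‖g‖ₙ` is quadratic in high norms and not tame. Interpolation, applied to
the pair so that both factors share the same `K`, bounds the product by a multiple of `K ^ n`, which
is linear in a higher norm. -/
theorem tameC_mul_univ (n : ℕ) : TameC n (fun p : Jet bc × Jet bc => p.1 * p.2) univ := by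
  refine TameC.bilinear mulₗ (isTameOn_of_bound continuous_mul.continuousOn fun p _ => ?_)
  obtain ⟨R, hR⟩ := (isTameFrechetSpace (bc := bc)).prod (isTameFrechetSpace (bc := bc))
    |>.interpolation
  refine ⟨_, gnorm_ball_mem_nhds p R one_pos, R, fun n => ?_⟩
  obtain ⟨C, hC, h⟩ := hR n (gnorm R p + 1)
  refine ⟨(n + 1) * (2 ^ n * (C * C) * C), fun q hq => ?_⟩
  obtain ⟨K, hK1, hK, hj⟩ := h q (by
    have := gnorm_le_add_sub R q p
    have h2 : gnorm R (q - p) < 1 := hq.1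
    linarith)
  have hK0 : 0 ≤ K := by linarith
  have h1 : ∀ j ≤ n, ‖d j q.1‖ ≤ C * K ^ j := fun j hjn =>
    ((norm_d_le le_rfl _).trans (gnorm_fst_le j q)).trans (hj j hjn)
  have h2 : ∀ j ≤ n, ‖d j q.2‖ ≤ C * K ^ j := fun j hjn =>
    ((norm_d_le le_rfl _).trans (gnorm_snd_le j q)).trans (hj j hjn)
  rw [mul_assoc]
  refine gnorm_le fun j hjn => ?_
  refine (norm_d_mul_le_of_pow q.1 q.2 (fun i hi => h1 i (hi.trans hjn))
    fun i hi => h2 i (hi.trans hjn)).trans ?_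
  have h3 : K ^ j ≤ C * (1 + gnorm (n + R) q) := (pow_le_pow_right₀ hK1 hjn).trans hK
  rw [mul_assoc (2 ^ n * (C * C))]
  gcongr
  norm_num

theorem _root_.TameC.mul {E : Type} [AddCommGroup E] [Module ℝ E] [TopologicalSpace E] [Grading E]
    [GradedLC E] {n : ℕ} {P Q : E → Jet bc} {U : Set E} (hU : IsOpen U) (hP : TameC n P U)
    (hQ : TameC n Q U) : TameC n (fun x => P x * Q x) U :=
  (tameC_mul_univ n).comp hU isOpen_univ (hP.prodMk hQ) fun _ _ => mem_univ _

end Jet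

/-! ## Powers of positive functions -/

namespace Jet

variable {bc : Option ℝ}

/-- The derivative, as a smooth function. -/
def shift (f : Jet bc) : Jet bc := mk (fun j => d (j + 1) f) (fun j => f.hasDerivWithinAt (j + 1))
  fun _ hc j => f.boundary hc (j + 1)

theorem d_shift (f : Jet bc) (j : ℕ) : d j (shift f) = d (j + 1) f := rfl

/-- The Leibniz rule for `f u' = α f' u`. -/
theorem sum_eq_of_logDeriv {f u : Jet none} {α : ℝ}
    (h : ∀ x, d 0 f x * d 1 u x = α * (d 1 f x * d 0 u x)) (j : ℕ) (x : Icc (0 : ℝ) 1) :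
    ∑ i ∈ Finset.range (j + 1), (j.choose i : ℝ) * d i f x * d (j - i + 1) u x =
      α * ∑ i ∈ Finset.range (j + 1), (j.choose i : ℝ) * d (i + 1) f x * d (j - i) u x := by
  have e : f * shift u = α • (shift f * u) := ext_zero fun x => by
    rw [map_smul, ContinuousMap.smul_apply, d_zero_mul, d_zero_mul, d_shift, d_shift, smul_eq_mul]
    exact h x
  have e2 := congrArg (fun g => d j g x) e
  simpa only [map_smul, ContinuousMap.smul_apply, smul_eq_mul, d_mul, d_shift] using e2

/-- Isolating the term `i = 0` of the Leibniz relation expresses the next derivative of `u` through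
earlier ones, without reference to the form of `u`. -/
theorem mul_d_succ_of_logDeriv {f u : Jet none} {α : ℝ}
    (h : ∀ x, d 0 f x * d 1 u x = α * (d 1 f x * d 0 u x)) (j : ℕ) (x : Icc (0 : ℝ) 1) :
    d 0 f x * d (j + 1) u x =
      α * (∑ i ∈ Finset.range (j + 1), (j.choose i : ℝ) * d (i + 1) f x * d (j - i) u x) -
      ∑ i ∈ Finset.range j, (j.choose (i + 1) : ℝ) * d (i + 1) f x * d (j - i) u x := by
  rw [← sum_eq_of_logDeriv h j x, Finset.sum_range_succ']
  have : ∀ i ∈ Finset.range j, (j.choose (i + 1) : ℝ) * d (i + 1) f x * d (j - (i + 1) + 1) u x =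
      (j.choose (i + 1) : ℝ) * d (i + 1) f x * d (j - i) u x := fun i hi => by
    rw [show j - (i + 1) + 1 = j - i by have := Finset.mem_range.1 hi; omega]
  rw [Finset.sum_congr rfl this]
  simp

/-- Every product in the recursion for `u⁽ⁿ⁺¹⁾` has total order `n + 1`, so geometric bounds with
ratio `K` reproduce themselves after division by `f ≥ δ`. The constant `B` does not depend on `f`,
`u` or `K`. -/
theorem exists_bound_of_logDeriv (α A δ M : ℝ) (hA : 0 ≤ A) (hδ : 0 < δ) (n : ℕ) :
    ∃ B, 0 ≤ B ∧ ∀ (f u : Jet none) (K : ℝ), 1 ≤ K →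
      (∀ x, d 0 f x * d 1 u x = α * (d 1 f x * d 0 u x)) → (∀ x, δ ≤ d 0 f x) → ‖d 0 u‖ ≤ M →
      (∀ i ≤ n, ‖d i f‖ ≤ A * K ^ i) → ∀ j ≤ n, ‖d j u‖ ≤ B * K ^ j := by
  induction n with
  | zero =>
    refine ⟨|M|, abs_nonneg _, fun f u K _ _ _ hM _ j hj => ?_⟩
    rw [Nat.le_zero.1 hj, pow_zero, mul_one]
    exact hM.trans (le_abs_self M)
  | succ n ih =>
    obtain ⟨B, hB, ih⟩ := ih
    refine ⟨B + δ⁻¹ * ((|α| * (2 ^ n * (A * B))) + 2 ^ n * (A * B)), by positivity,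
      fun f u K hK h hf hM hA' j hj => ?_⟩
    have hK0 : 0 ≤ K := by linarith
    have ih' := ih f u K hK h hf hM fun i hi => hA' i (hi.trans n.le_succ)
    rcases hj.lt_or_eq with hj | rfl
    · refine (ih' j (Nat.lt_succ_iff.1 hj)).trans ?_
      gcongr
      exact le_add_of_nonneg_right (by positivity)
    have hterm : ∀ x, ∀ i ≤ n, |d (i + 1) f x * d (n - i) u x| ≤ A * B * K ^ (n + 1) :=
        fun x i hi => by
      rw [abs_mul]
      have h1 := ((d (i + 1) f).norm_coe_le_norm x).trans (hA' (i + 1) (by omega))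
      have h2 := ((d (n - i) u).norm_coe_le_norm x).trans (ih' (n - i) (Nat.sub_le _ _))
      calc |d (i + 1) f x| * |d (n - i) u x| ≤ (A * K ^ (i + 1)) * (B * K ^ (n - i)) := by
            have : 0 ≤ A * K ^ (i + 1) := by positivity
            exact mul_le_mul h1 h2 (abs_nonneg _) this
        _ = A * B * K ^ (n + 1) := by
          rw [show n + 1 = (i + 1) + (n - i) by omega, pow_add]; ring
    have h2 : (2 : ℝ) ^ n = ∑ i ∈ Finset.range (n + 1), (n.choose i : ℝ) := by
      exact_mod_cast (Nat.sum_range_choose n).symm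
    have hP : 0 ≤ A * B * K ^ (n + 1) := by positivity
    have hs1 : ∀ x, |∑ i ∈ Finset.range (n + 1), (n.choose i : ℝ) * d (i + 1) f x * d (n - i) u x| ≤
        2 ^ n * (A * B * K ^ (n + 1)) := fun x => by
      rw [h2, Finset.sum_mul]
      refine (Finset.abs_sum_le_sum_abs _ _).trans (Finset.sum_le_sum fun i hi => ?_)
      rw [mul_assoc, abs_mul, Nat.abs_cast]
      exact mul_le_mul_of_nonneg_left (hterm x i (Nat.lt_succ_iff.1 (Finset.mem_range.1 hi)))
        (Nat.cast_nonneg _)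
    have hs2 : ∀ x, |∑ i ∈ Finset.range n, (n.choose (i + 1) : ℝ) * d (i + 1) f x * d (n - i) u x| ≤
        2 ^ n * (A * B * K ^ (n + 1)) := fun x => by
      rw [h2, Finset.sum_range_succ', add_mul, Finset.sum_mul]
      refine ((Finset.abs_sum_le_sum_abs _ _).trans (Finset.sum_le_sum fun i hi => ?_)).trans
        (le_add_of_nonneg_right (by positivity))
      rw [mul_assoc, abs_mul, Nat.abs_cast]
      exact mul_le_mul_of_nonneg_left (hterm x i (Finset.mem_range.1 hi).le) (Nat.cast_nonneg _)
    rw [ContinuousMap.norm_le _ (by positivity)]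
    intro x
    have h3 := mul_d_succ_of_logDeriv h n x
    have h4 : |d 0 f x * d (n + 1) u x| ≤
        |α| * (2 ^ n * (A * B * K ^ (n + 1))) + 2 ^ n * (A * B * K ^ (n + 1)) := by
      rw [h3]
      refine (abs_sub _ _).trans (add_le_add ?_ (hs2 x))
      rw [abs_mul]
      exact mul_le_mul_of_nonneg_left (hs1 x) (abs_nonneg _)
    have h5 : δ * |d (n + 1) u x| ≤ |d 0 f x * d (n + 1) u x| := by
      rw [abs_mul]
      exact mul_le_mul_of_nonneg_right ((hf x).trans (le_abs_self _)) (abs_nonneg _)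
    have h6 := h5.trans h4
    rw [← le_div_iff₀' hδ] at h6
    refine h6.trans ?_
    rw [div_eq_inv_mul, add_mul]
    refine le_add_of_nonneg_of_le (by positivity) (le_of_eq (by ring))

theorem contDiffOn_rpow {f : Jet bc} (h : ∀ x, 0 < d 0 f x) (α : ℝ) :
    ContDiffOn ℝ ∞ (fun t => lineExtend (d 0 f) t ^ α) (Icc 0 1) :=
  f.contDiffOn_d.rpow_const_of_ne fun x hx => by
    rw [lineExtend_of_mem _ hx]
    exact (h _).ne'

/-- The power of a positive function. -/
def rpowAux {f : Jet bc} (h : ∀ x, 0 < d 0 f x) (α : ℝ) : Jet none :=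
  ofFun _ (contDiffOn_rpow h α) (by simp)

theorem d_zero_rpowAux {f : Jet bc} (h : ∀ x, 0 < d 0 f x) (α : ℝ) (x : Icc (0 : ℝ) 1) :
    d 0 (rpowAux h α) x = d 0 f x ^ α := by
  rw [rpowAux, d_ofFun, iteratedDerivWithin_zero, lineExtend_apply]

theorem rpowAux_logDeriv {f : Jet bc} (h : ∀ x, 0 < d 0 f x) (α : ℝ) (x : Icc (0 : ℝ) 1) :
    d 0 (forget f) x * d 1 (rpowAux h α) x = α * (d 1 (forget f) x * d 0 (rpowAux h α) x) := by
  have h1 := (rpowAux h α).hasDerivWithinAt 0 x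
  have h2 := (f.hasDerivWithinAt 0 x).rpow_const (p := α)
    (Or.inl (by rw [lineExtend_apply]; exact (h x).ne'))
  have h3 := (uniqueDiffOn_Icc_zero_one x x.2).eq_deriv _ h1 (h2.congr (fun y hy => by
    rw [lineExtend_of_mem _ hy, d_zero_rpowAux, lineExtend_of_mem _ hy])
    (by rw [lineExtend_apply, d_zero_rpowAux, lineExtend_apply]))
  rw [zero_add, lineExtend_apply] at h3
  rw [h3, d_forget, d_forget, d_zero_rpowAux, Real.rpow_sub_one (h x).ne']
  field_simp [(h x).ne']

variable [Unital bc]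

/-- The recursion determines the derivatives at `0` and at `1` from the same data, because those of
`f` agree at the two points. -/
theorem rpowAux_boundary {f : Jet bc} (h : ∀ x, 0 < d 0 f x) (α : ℝ) {c : ℝ} (hc : c ∈ bc)
    (j : ℕ) : d j (rpowAux h α) 1 = d j (rpowAux h α) 0 := by
  induction j using Nat.strong_induction_on with
  | _ j ih =>
    have hf : ∀ j, d j (forget f) 1 = d j (forget f) 0 := fun j => d_one_eq_zero f hc j
    rcases j with _ | j
    · rw [d_zero_rpowAux, d_zero_rpowAux, d_one_eq_zero f hc]
    · have h1 := mul_d_succ_of_logDeriv (rpowAux_logDeriv h α) j 1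
      have h0 := mul_d_succ_of_logDeriv (rpowAux_logDeriv h α) j 0
      have ih' : ∀ i, d (j - i) (rpowAux h α) 1 = d (j - i) (rpowAux h α) 0 := fun i =>
        ih _ (by omega)
      simp only [ih', hf] at h1
      exact mul_left_cancel₀ (h 0).ne' (h1.trans h0.symm)

open Classical in
/-- The power of a positive function (zero for other functions). -/
def rpow (α : ℝ) (f : Jet bc) : Jet bc :=
  if h : ∀ x, 0 < d 0 f x then
    mk (fun j => d j (rpowAux h α)) (rpowAux h α).hasDerivWithinAt
      fun c hc j => by rw [rpowAux_boundary h α hc, Unital.eq_one c hc, one_mul]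
  else 0

theorem d_rpow {f : Jet bc} (h : ∀ x, 0 < d 0 f x) (α : ℝ) (j : ℕ) :
    d j (rpow α f) = d j (rpowAux h α) := by
  rw [rpow, dif_pos h, d_mk]

theorem d_zero_rpow {f : Jet bc} (h : ∀ x, 0 < d 0 f x) (α : ℝ) (x : Icc (0 : ℝ) 1) :
    d 0 (rpow α f) x = d 0 f x ^ α := by rw [d_rpow h, d_zero_rpowAux]

theorem rpow_bound (α : ℝ) : ∃ R : ℕ, ∀ (n : ℕ) (ρ δ : ℝ), 0 < δ → ∃ C, 0 ≤ C ∧ ∀ f : Jet bc,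
    gnorm R f ≤ ρ → (∀ x, δ ≤ d 0 f x) → gnorm n (rpow α f) ≤ C * (1 + gnorm (n + R) f) := by
  obtain ⟨R, hR⟩ := (isTameFrechetSpace (bc := bc)).interpolation
  refine ⟨R, fun n ρ δ hδ => ?_⟩
  obtain ⟨C, hC, h⟩ := hR n ρ
  -- For `δ ≤ f ≤ |ρ|` the sum `δ ^ α + |ρ| ^ α` bounds `f ^ α` whatever the sign of `α`.
  obtain ⟨B, hB, hB'⟩ := exists_bound_of_logDeriv α C δ (δ ^ α + |ρ| ^ α) hC hδ n
  refine ⟨(n + 1) * (B * C), by positivity, fun f hf hδf => ?_⟩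
  obtain ⟨K, hK1, hK, hKj⟩ := h f hf
  have hK0 : 0 ≤ K := by linarith
  have hpos : ∀ x, 0 < d 0 f x := fun x => hδ.trans_le (hδf x)
  have hu : ‖d 0 (rpowAux hpos α)‖ ≤ δ ^ α + |ρ| ^ α := by
    rw [ContinuousMap.norm_le _ (by positivity)]
    intro x
    rw [d_zero_rpowAux, Real.norm_of_nonneg (Real.rpow_nonneg (hpos x).le _)]
    have hx : d 0 f x ≤ |ρ| := (le_abs_self _).trans (((d 0 f).norm_coe_le_norm x).trans
      ((norm_d_le (Nat.zero_le R) f).trans (hf.trans (le_abs_self ρ))))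
    rcases le_total 0 α with h0 | h0
    · exact (Real.rpow_le_rpow (hpos x).le hx h0).trans
        (le_add_of_nonneg_left (Real.rpow_nonneg hδ.le _))
    · exact (Real.rpow_le_rpow_of_nonpos hδ (hδf x) h0).trans
        (le_add_of_nonneg_right (Real.rpow_nonneg (abs_nonneg _) _))
  have hb := hB' (forget f) (rpowAux hpos α) K hK1 (rpowAux_logDeriv hpos α) hδf hu
    fun i hi => (norm_d_le le_rfl f).trans (hKj i hi)
  rw [mul_assoc]
  refine gnorm_le fun j hj => ?_
  rw [d_rpow hpos, mul_assoc]
  refine (hb j hj).trans ?_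
  gcongr
  exact (pow_le_pow_right₀ hK1 hj).trans hK

/-- The positive functions. -/
def positive (bc : Option ℝ) : Set (Jet bc) := {f | ∀ x, 0 < d 0 f x}

theorem exists_lower_bound {f : Jet bc} (hf : f ∈ positive bc) : ∃ δ > 0, ∀ x, δ ≤ d 0 f x := by
  obtain ⟨x, -, hx⟩ := isCompact_univ.exists_isMinOn (univ_nonempty (α := Icc (0 : ℝ) 1))
    (d 0 f).continuous.continuousOn
  exact ⟨d 0 f x, hf x, fun y => hx (mem_univ y)⟩

theorem lower_bound_of_gnorm_sub {f g : Jet bc} {δ : ℝ} (hf : ∀ x, δ ≤ d 0 f x) {n : ℕ}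
    (hg : gnorm n (g - f) ≤ δ / 2) (x : Icc (0 : ℝ) 1) : δ / 2 ≤ d 0 g x := by
  have h1 : |d 0 (g - f) x| ≤ δ / 2 :=
    ((d 0 (g - f)).norm_coe_le_norm x).trans ((norm_d_le (Nat.zero_le n) _).trans hg)
  rw [map_sub, ContinuousMap.sub_apply] at h1
  linarith [(abs_le.1 h1).1, hf x]

theorem isOpen_positive : IsOpen (positive bc) := by
  refine isOpen_iff_mem_nhds.2 fun f hf => ?_
  obtain ⟨δ, hδ, h⟩ := exists_lower_bound hf
  filter_upwards [gnorm_ball_mem_nhds f 0 (half_pos hδ)] with g hg x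
  exact (half_pos hδ).trans_le (lower_bound_of_gnorm_sub h hg.le x)

theorem rpow_bound_nhds (α : ℝ) {f : Jet bc} (hf : f ∈ positive bc) :
    ∃ V ∈ 𝓝 f, ∃ r : ℕ, ∀ n, ∃ C, 0 ≤ C ∧ ∀ g ∈ V,
      gnorm n (rpow α g) ≤ C * (1 + gnorm (n + r) g) := by
  obtain ⟨R, hR⟩ := rpow_bound (bc := bc) α
  obtain ⟨δ, hδ, h⟩ := exists_lower_bound hf
  refine ⟨_, gnorm_ball_mem_nhds f R (half_pos hδ), R, fun n => ?_⟩
  obtain ⟨C, hC, hb⟩ := hR n (gnorm R f + δ / 2) (δ / 2) (half_pos hδ)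
  refine ⟨C, hC, fun g hg => hb g ?_ fun x => lower_bound_of_gnorm_sub h (le_of_lt hg) x⟩
  have := gnorm_le_add_sub R g f
  have hg' : gnorm R (g - f) < δ / 2 := hg
  linarith

/-- Near a positive function, the norms of its powers are bounded. -/
theorem eventually_gnorm_rpow_le (α : ℝ) {f : Jet bc} (hf : f ∈ positive bc) (n : ℕ) :
    ∃ C, 0 ≤ C ∧ ∀ᶠ g in 𝓝 f, gnorm n (rpow α g) ≤ C := by
  obtain ⟨V, hV, r, h⟩ := rpow_bound_nhds α hf
  obtain ⟨C, hC, h⟩ := h n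
  refine ⟨C * (1 + (gnorm (n + r) f + 1)), by have := gnorm_nonneg (n + r) f; positivity, ?_⟩
  filter_upwards [hV, gnorm_ball_mem_nhds f (n + r) one_pos] with g hg hg'
  refine (h g hg).trans ?_
  have := gnorm_le_add_sub (n + r) g f
  have hg'' : gnorm (n + r) (g - f) < 1 := hg'
  gcongr
  linarith

/-- The tame estimate is already known from `rpow_bound_nhds`; the increment formula with locally
bounded quotient supplies the continuity. -/
theorem isTameOn_rpow_of_increment (α : ℝ) (q : Jet bc × Jet bc → Jet bc)
    (hq : ∀ g ∈ positive bc, ∀ f ∈ positive bc, rpow α g - rpow α f = q (g, f) * (g - f))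
    (hb : ∀ f ∈ positive bc, ∀ n, ∃ C, 0 ≤ C ∧ ∀ᶠ g in 𝓝 f, gnorm n (q (g, f)) ≤ C) :
    IsTameOn (rpow (bc := bc) α) (positive bc) := by
  refine isTameOn_of_bound (fun f hf => ContinuousAt.continuousWithinAt ?_) fun f hf => ?_
  · rw [ContinuousAt, tendsto_iff_gnorm]
    intro n ε hε
    obtain ⟨C, hC, h⟩ := hb f hf n
    have hc : Continuous fun g : Jet bc => ((n : ℝ) + 1) * 2 ^ n * (C * gnorm n (g - f)) := by
      have := (continuous_gnorm (E := Jet bc) n).comp (continuous_id.sub (continuous_const (y := f)))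
      exact continuous_const.mul (continuous_const.mul this)
    have h0 := hc.tendsto f
    simp only [sub_self, gnorm_zero, mul_zero] at h0
    filter_upwards [h, h0.eventually (Iio_mem_nhds hε), isOpen_positive.mem_nhds hf] with g hg hg' hgp
    refine lt_of_le_of_lt ?_ hg'
    rw [hq g hgp f hf]
    refine (gnorm_mul_le n _ _).trans ?_
    have := gnorm_nonneg n (g - f)
    gcongr
  · obtain ⟨V, hV, r, h⟩ := rpow_bound_nhds α hf
    refine ⟨V, hV, r, fun n => ?_⟩
    obtain ⟨C, -, h⟩ := h n
    exact ⟨C, fun g hg => h g hg.1⟩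

/-! ### Inverses and square roots as smooth tame maps -/

/-- The inverse of a positive function. -/
def inv (f : Jet bc) : Jet bc := rpow (-1) f

/-- The square root of a positive function. -/
def sqrt (f : Jet bc) : Jet bc := rpow (1 / 2) f

theorem d_zero_inv {f : Jet bc} (hf : f ∈ positive bc) (x : Icc (0 : ℝ) 1) :
    d 0 (inv f) x = (d 0 f x)⁻¹ := by
  rw [inv, d_zero_rpow hf, Real.rpow_neg_one]

theorem d_zero_sqrt {f : Jet bc} (hf : f ∈ positive bc) (x : Icc (0 : ℝ) 1) :
    d 0 (sqrt f) x = √(d 0 f x) := by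
  rw [sqrt, d_zero_rpow hf, Real.sqrt_eq_rpow]

theorem inv_sub_inv {f g : Jet bc} (hg : g ∈ positive bc) (hf : f ∈ positive bc) :
    inv g - inv f = -(inv g * inv f) * (g - f) := ext_zero fun x => by
  have h1 := hg x
  have h2 := hf x
  simp only [map_sub, map_neg, ContinuousMap.sub_apply, ContinuousMap.neg_apply, d_zero_mul,
    d_zero_inv hg, d_zero_inv hf]
  field_simp
  ring

theorem sqrt_mem_positive {f : Jet bc} (hf : f ∈ positive bc) : sqrt f ∈ positive bc := fun x => by
  rw [d_zero_sqrt hf]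
  exact Real.sqrt_pos.2 (hf x)

theorem add_mem_positive {f g : Jet bc} (hf : f ∈ positive bc) (hg : g ∈ positive bc) :
    f + g ∈ positive bc := fun x => by
  simpa using add_pos (hf x) (hg x)

theorem sqrt_sub_sqrt {f g : Jet bc} (hg : g ∈ positive bc) (hf : f ∈ positive bc) :
    sqrt g - sqrt f = inv (sqrt g + sqrt f) * (g - f) := ext_zero fun x => by
  have h1 := sqrt_mem_positive hg x
  have h2 := sqrt_mem_positive hf x
  have h3 := Real.mul_self_sqrt (hg x).le
  have h4 := Real.mul_self_sqrt (hf x).le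
  rw [d_zero_sqrt hg] at h1
  rw [d_zero_sqrt hf] at h2
  simp only [map_sub, map_add, ContinuousMap.sub_apply, ContinuousMap.add_apply, d_zero_mul,
    d_zero_inv (add_mem_positive (sqrt_mem_positive hg) (sqrt_mem_positive hf)), d_zero_sqrt hg,
    d_zero_sqrt hf]
  rw [inv_mul_eq_div, eq_div_iff (by positivity)]
  nlinarith

theorem isTameOn_inv : IsTameOn (inv (bc := bc)) (positive bc) := by
  refine isTameOn_rpow_of_increment (-1) (fun p => -(inv p.1 * inv p.2))
    (fun g hg f hf => inv_sub_inv hg hf) fun f hf n => ?_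
  obtain ⟨C, hC, h⟩ := eventually_gnorm_rpow_le (-1) hf n
  refine ⟨(n + 1) * 2 ^ n * (C * gnorm n (inv f)), by
    have := gnorm_nonneg n (inv f); positivity, ?_⟩
  filter_upwards [h] with g hg
  rw [gnorm_neg]
  refine (gnorm_mul_le n _ _).trans ?_
  have := gnorm_nonneg n (inv f)
  gcongr
  exact hg

/-- The quotient `(√g + √f)⁻¹` stays bounded for `g` near `f`: the norms of `√g` are locally
bounded, and `√g + √f ≥ √f` keeps away from zero. -/
theorem isTameOn_sqrt : IsTameOn (sqrt (bc := bc)) (positive bc) := by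
  refine isTameOn_rpow_of_increment (1 / 2) (fun p => inv (sqrt p.1 + sqrt p.2))
    (fun g hg f hf => sqrt_sub_sqrt hg hf) fun f hf n => ?_
  obtain ⟨R, hR⟩ := rpow_bound (bc := bc) (-1)
  obtain ⟨C₀, hC₀, h₀⟩ := eventually_gnorm_rpow_le (1 / 2) hf R
  obtain ⟨C₁, hC₁, h₁⟩ := eventually_gnorm_rpow_le (1 / 2) hf (n + R)
  obtain ⟨δ, hδ, h⟩ := exists_lower_bound (sqrt_mem_positive hf)
  obtain ⟨C, hC, hb⟩ := hR n (C₀ + gnorm R (sqrt f)) δ hδ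
  refine ⟨C * (1 + (C₁ + gnorm (n + R) (sqrt f))), by
    have := gnorm_nonneg (n + R) (sqrt f); positivity, ?_⟩
  filter_upwards [h₀, h₁, isOpen_positive.mem_nhds hf] with g hg₀ hg₁ hg
  refine (hb _ ((gnorm_add_le _ _ _).trans (add_le_add hg₀ le_rfl)) fun x => ?_).trans ?_
  · rw [map_add, ContinuousMap.add_apply]
    exact (h x).trans (le_add_of_nonneg_left (sqrt_mem_positive hg x).le)
  · gcongr
    exact (gnorm_add_le _ _ _).trans (add_le_add hg₁ le_rfl)

theorem isOpen_increment : IsOpen (positive bc ×ˢ positive bc ×ˢ (univ : Set (Jet bc))) :=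
  isOpen_positive.prod (isOpen_positive.prod isOpen_univ)

/-- The increment formula expresses the derivative through `inv` itself and products, so each order
of differentiability yields the next. -/
theorem tameC_inv (n : ℕ) : TameC n (inv (bc := bc)) (positive bc) := by
  induction n with
  | zero => exact isTameOn_inv
  | succ n ih =>
    refine TameC.of_increment (Q := fun p => -(inv p.1 * inv p.2.1) * p.2.2) isOpen_positive
      isTameOn_inv (fun g hg f hf => inv_sub_inv hg hf)
      (fun g _ f _ t h => ext_zero fun x => by simp; ring) ?_
    have hU := isOpen_increment (bc := bc)
    refine TameC.mul hU (TameC.neg hU (TameC.mul hU ?_ ?_)) ?_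
    · exact TameC.comp (P := inv) (Q := Prod.fst) hU isOpen_positive ih
        (TameC.fst hU (TameC.id _)) fun p hp => hp.1
    · exact TameC.comp (P := inv) (Q := fun p => p.2.1) hU isOpen_positive ih
        (TameC.fst hU (TameC.snd hU (TameC.id _))) fun p hp => hp.2.1
    · exact TameC.snd hU (TameC.snd hU (TameC.id _))

theorem tameC_sqrt (n : ℕ) : TameC n (sqrt (bc := bc)) (positive bc) := by
  induction n with
  | zero => exact isTameOn_sqrt
  | succ n ih =>
    refine TameC.of_increment (Q := fun p => inv (sqrt p.1 + sqrt p.2.1) * p.2.2) isOpen_positive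
      isTameOn_sqrt (fun g hg f hf => sqrt_sub_sqrt hg hf)
      (fun g _ f _ t h => ext_zero fun x => by simp; ring) ?_
    have hU := isOpen_increment (bc := bc)
    refine TameC.mul hU (TameC.comp (P := inv) hU isOpen_positive (tameC_inv n)
      (TameC.add hU ?_ ?_) fun p hp => add_mem_positive (sqrt_mem_positive hp.1)
        (sqrt_mem_positive hp.2.1)) ?_
    · exact TameC.comp (P := sqrt) (Q := fun p => p.1) hU isOpen_positive ih
        (TameC.fst hU (TameC.id _)) fun p hp => hp.1
    · exact TameC.comp (P := sqrt) (Q := fun p => p.2.1) hU isOpen_positive ih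
        (TameC.fst hU (TameC.snd hU (TameC.id _))) fun p hp => hp.2.1
    · exact TameC.snd hU (TameC.snd hU (TameC.id _))

theorem _root_.TameC.inv {E : Type} [AddCommGroup E] [Module ℝ E] [TopologicalSpace E] [Grading E]
    [GradedLC E] {n : ℕ} {P : E → Jet bc} {U : Set E} (hU : IsOpen U) (hP : TameC n P U)
    (h : ∀ x ∈ U, P x ∈ positive bc) : TameC n (fun x => Jet.inv (P x)) U :=
  (tameC_inv n).comp hU isOpen_positive hP h

theorem _root_.TameC.sqrt {E : Type} [AddCommGroup E] [Module ℝ E] [TopologicalSpace E] [Grading E]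
    [GradedLC E] {n : ℕ} {P : E → Jet bc} {U : Set E} (hU : IsOpen U) (hP : TameC n P U)
    (h : ∀ x ∈ U, P x ∈ positive bc) : TameC n (fun x => Jet.sqrt (P x)) U :=
  (tameC_sqrt n).comp hU isOpen_positive hP h

/-! ### The integral -/

theorem integrable_coe (f : C(Icc (0 : ℝ) 1, ℝ)) : MeasureTheory.Integrable f :=
  f.continuous.integrable_of_hasCompactSupport (HasCompactSupport.of_compactSpace _)

/-- The integral over `[0, 1]`. -/
def integral : Jet bc →ₗ[ℝ] ℝ where
  toFun f := ∫ x, d 0 f x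
  map_add' f g := by
    simp only [map_add, ContinuousMap.add_apply]
    exact MeasureTheory.integral_add (integrable_coe _) (integrable_coe _)
  map_smul' a f := by
    simp only [map_smul, ContinuousMap.smul_apply, RingHom.id_apply]
    exact MeasureTheory.integral_smul _ _

theorem integral_apply (f : Jet bc) : integral f = ∫ x, d 0 f x := rfl

theorem abs_integral_le (f : Jet bc) : |integral f| ≤ ‖d 0 f‖ := by
  have h := MeasureTheory.norm_integral_le_of_norm_le_const (μ := MeasureTheory.volume)
    (Eventually.of_forall fun x : Icc (0 : ℝ) 1 => (d 0 f).norm_coe_le_norm x)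
  simpa [integral_apply] using h

theorem isTameLinear_integral : IsTameLinear (integral (bc := bc)) :=
  ⟨0, 0, fun n _ => ⟨1, fun f => by
    rw [gnorm_real, one_mul]
    exact (abs_integral_le f).trans (norm_d_le (Nat.zero_le _) f)⟩⟩

theorem integral_const (a : ℝ) : integral (const (bc := bc) a) = a := by
  simp [integral_apply]

end Jet

/-! ## Plane curves in terms of their velocity -/

/-- The boundary condition of the smooth functions on `I`. -/
def CurveDomain.bc : CurveDomain → Option ℝ
  | interval => none
  | circle => some 1

instance (I : CurveDomain) : Jet.Unital I.bc := by
  cases I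
  · exact inferInstanceAs (Jet.Unital none)
  · exact inferInstanceAs (Jet.Unital (some 1))

/-- The functional on smooth functions that vanishes on the derivatives of functions on `I`. -/
def closing : (I : CurveDomain) → Jet I.bc →ₗ[ℝ] ℝ
  | .interval => 0
  | .circle => Jet.integral

theorem isTameLinear_closing (I : CurveDomain) : IsTameLinear (closing I) := by
  cases I
  · exact ⟨0, 0, fun n _ => ⟨0, fun f => by simp [closing, gnorm_real]⟩⟩
  · exact Jet.isTameLinear_integral

theorem abs_closing_le (I : CurveDomain) (f : Jet I.bc) : |closing I f| ≤ ‖Jet.d 0 f‖ := by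
  cases I
  · simp [closing]
  · exact Jet.abs_integral_le f

theorem closing_sub_const (I : CurveDomain) (f : Jet I.bc) :
    closing I (f - Jet.const (closing I f)) = 0 := by
  cases I
  · rfl
  · change Jet.integral (f - Jet.const (Jet.integral f)) = 0
    rw [map_sub, Jet.integral_const, sub_self]

namespace CurveDomain

variable {I : CurveDomain}

theorem exists_param (p : I.Pt) : ∃ t ∈ Icc (0 : ℝ) 1, I.param t = p := by
  cases I
  · exact ⟨p.1, p.2, projIcc_val zero_le_one p⟩
  · obtain ⟨t, ht, h⟩ := AddCircle.coe_image_Icc_eq (1 : ℝ) 0 ▸ mem_univ (p : UnitAddCircle)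
    exact ⟨t, by simpa using ht, h⟩

theorem exists_param_lift {E : Type} (Γ : ℝ → E) (h : I = circle → Function.Periodic Γ 1) :
    ∃ g : I.Pt → E, ∀ t ∈ I.paramSet, g (I.param t) = Γ t := by
  cases I
  · exact ⟨fun p : Icc (0 : ℝ) 1 => Γ p, fun t ht => by
      change Γ (projIcc 0 1 zero_le_one t) = Γ t
      rw [projIcc_of_mem _ ht]⟩
  · exact ⟨(h rfl).lift, fun t _ => (h rfl).lift_coe t⟩

end CurveDomain

theorem quasiExtend_one_add_int (f : C(Icc (0 : ℝ) 1, ℝ)) (z : ℝ) (n : ℤ) :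
    quasiExtend 1 f (z + n) = quasiExtend 1 f z := by
  simp [quasiExtend]

theorem Jet.hasDerivAt_quasiExtend_one (f : Jet (some 1)) (j : ℕ) (z : ℝ) :
    HasDerivAt (quasiExtend 1 (Jet.d j f)) (quasiExtend 1 (Jet.d (j + 1) f) z) z := by
  obtain ⟨n, hn⟩ := exists_int_gt (-z)
  have h1 := f.hasDerivAt_quasiExtend j (z := z + n) (by linarith)
  have h2 := h1.comp_add_const z n
  rw [quasiExtend_one_add_int] at h2
  simpa only [quasiExtend_one_add_int] using h2

/-- On the interval the extension is constant beyond the end points, and differentiability is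
required only within `[0, 1]`; on the circle it is the periodic one. -/
theorem Jet.exists_extension {I : CurveDomain} (f : Jet I.bc) : ∃ F : ℕ → ℝ → ℝ,
    (∀ j, Continuous (F j)) ∧
    (∀ j, ∀ t ∈ I.paramSet, HasDerivWithinAt (F j) (F (j + 1) t) I.paramSet t) ∧
    (∀ j, ∀ x : Icc (0 : ℝ) 1, F j x = Jet.d j f x) ∧
    (I = .circle → ∀ j, Function.Periodic (F j) 1) := by
  cases I
  · exact ⟨fun j => lineExtend (Jet.d j f), fun j => continuous_lineExtend _, fun j t ht => by
      have := f.hasDerivWithinAt j ⟨t, ht⟩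
      rwa [← lineExtend_of_mem _ ht] at this, fun j x => lineExtend_apply _ x, by simp⟩
  · refine ⟨fun j => quasiExtend 1 (Jet.d (bc := some 1) j f),
      fun j => continuous_iff_continuousAt.2 fun z =>
        (Jet.hasDerivAt_quasiExtend_one f j z).continuousAt,
      fun j t _ => (Jet.hasDerivAt_quasiExtend_one f j t).hasDerivWithinAt,
      fun j x => Jet.quasiExtend_coe (c := 1) f j x, fun _ j z => ?_⟩
    simpa using quasiExtend_one_add_int (Jet.d (bc := some 1) j f) z 1

theorem Jet.integral_eq_intervalIntegral {bc : Option ℝ} [Jet.Unital bc] (f : Jet bc) {F : ℝ → ℝ}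
    (hF : ∀ x : Icc (0 : ℝ) 1, F x = Jet.d 0 f x) : Jet.integral f = ∫ t in (0 : ℝ)..1, F t := by
  rw [Jet.integral_apply, intervalIntegral.integral_of_le zero_le_one,
    ← MeasureTheory.integral_Icc_eq_integral_Ioc,
    ← MeasureTheory.integral_subtype measurableSet_Icc]
  exact MeasureTheory.integral_congr_ae (Eventually.of_forall fun x => (hF x).symm)

/-- A primitive of a smooth function. -/
theorem Jet.exists_primitive {I : CurveDomain} (f : Jet I.bc) (hf : closing I f = 0) :
    ∃ Γ : ℝ → ℝ, ContDiffOn ℝ ∞ Γ I.paramSet ∧ (I = .circle → Function.Periodic Γ 1) ∧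
      ∀ s : Icc (0 : ℝ) 1, HasDerivWithinAt Γ (Jet.d 0 f s) I.paramSet s := by
  obtain ⟨F, hc, hd, hF, hp⟩ := f.exists_extension
  have hΓ : ∀ t, HasDerivAt (fun t => ∫ u in (0 : ℝ)..t, F 0 u) (F 0 t) t := fun t =>
    ((hc 0).integral_hasStrictDerivAt 0 t).hasDerivAt
  refine ⟨fun t => ∫ u in (0 : ℝ)..t, F 0 u, ?_, fun hI t => ?_, fun s => ?_⟩
  -- The primitive is put in front of the sequence of derivatives of `f`, which gives a chain of
  -- successive derivatives.
  · refine (Jet.contDiffOn_and_iteratedDerivWithin I.uniqueDiffOn_paramSet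
      (F := fun j => Nat.casesOn j (fun t => ∫ u in (0 : ℝ)..t, F 0 u) F) fun j t ht => ?_).1
    cases j
    · exact (hΓ t).hasDerivWithinAt
    · exact hd _ t ht
  · have hint : ∀ a b, IntervalIntegrable (F 0) MeasureTheory.volume a b := fun a b =>
      (hc 0).intervalIntegrable a b
    have h0 : ∫ u in (0 : ℝ)..1, F 0 u = 0 := by
      subst hI
      rw [← Jet.integral_eq_intervalIntegral (bc := some 1) f (hF 0)]
      exact hf
    have h1 := (hp hI 0).intervalIntegral_add_eq t 0
    rw [zero_add, h0] at h1
    simp only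
    rw [← intervalIntegral.integral_add_adjacent_intervals (hint 0 t) (hint t (t + 1)), h1, add_zero]
  · rw [← hF]
    exact (hΓ s).hasDerivWithinAt

/-! ### Curves modulo translations as closed velocity fields -/

namespace CurveSpace

variable {I : CurveDomain}

theorem induction_mk {p : CurveSpace I → Prop}
    (h : ∀ g : SmoothCurve I, p ((SmoothCurve.constants I).mkQ g)) (γ : CurveSpace I) : p γ :=
  Submodule.Quotient.induction_on _ γ h

theorem derivSucc_mk (j : ℕ) (g : SmoothCurve I) :
    derivSucc I j ((SmoothCurve.constants I).mkQ g) = SmoothCurve.derivCurve I (j + 1) g := rfl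

theorem derivCurve_apply (j : ℕ) (g : SmoothCurve I) (s : Icc (0 : ℝ) 1) :
    SmoothCurve.derivCurve I j g s =
      iteratedDerivWithin j (fun t => g.1 (I.param t)) I.paramSet s := rfl

theorem hasDerivWithinAt_derivCurve (j : ℕ) (g : SmoothCurve I) (s : Icc (0 : ℝ) 1) :
    HasDerivWithinAt (fun t => iteratedDerivWithin j (fun t => g.1 (I.param t)) I.paramSet t)
      (SmoothCurve.derivCurve I (j + 1) g s) (Icc 0 1) s := by
  have hs := I.Icc_subset_paramSet s.2
  have h1 := (g.2.differentiableOn_iteratedDerivWithin (m := j)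
    (by exact_mod_cast WithTop.coe_lt_top _) I.uniqueDiffOn_paramSet s hs).hasDerivWithinAt
  rw [← iteratedDerivWithin_succ] at h1
  exact h1.mono I.Icc_subset_paramSet

theorem derivCurve_circle (j : ℕ) (g : SmoothCurve .circle) :
    SmoothCurve.derivCurve .circle j g 1 = SmoothCurve.derivCurve .circle j g 0 := by
  rw [derivCurve_apply, derivCurve_apply]
  have hp : Function.Periodic (fun t : ℝ => g.1 (CurveDomain.circle.param t)) 1 := fun t => by
    change g.1 ((t + 1 : ℝ) : UnitAddCircle) = g.1 (t : UnitAddCircle)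
    rw [AddCircle.coe_add, AddCircle.coe_period, add_zero]
  have h : iteratedDeriv j (fun t : ℝ => g.1 (CurveDomain.circle.param (t + 1))) =
      fun t => iteratedDeriv j (fun t : ℝ => g.1 (CurveDomain.circle.param t)) (t + 1) :=
    iteratedDeriv_comp_add_const j (fun t : ℝ => g.1 (CurveDomain.circle.param t)) (1 : ℝ)
  rw [show (fun t : ℝ => g.1 (CurveDomain.circle.param (t + 1))) =
    fun t : ℝ => g.1 (CurveDomain.circle.param t) from funext hp] at h
  simp only [CurveDomain.paramSet, iteratedDerivWithin_univ, Icc.coe_one, Icc.coe_zero]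
  simpa using (congrFun h 0).symm

/-- The coordinates of the velocity. -/
def velocity (k : Fin 2) : CurveSpace I →ₗ[ℝ] Jet I.bc where
  toFun γ := Jet.mk (fun j => ⟨fun s => derivSucc I j γ s k, by fun_prop⟩)
    (fun j x => by
      revert γ
      refine induction_mk fun g => ?_
      have h1 := hasDerivWithinAt_derivCurve (j + 1) g x
      have h2 : HasDerivWithinAt (fun t => iteratedDerivWithin (j + 1)
          (fun t => g.1 (I.param t)) I.paramSet t k) (SmoothCurve.derivCurve I (j + 2) g x k)
          (Icc 0 1) x :=
        ((EuclideanSpace.proj (𝕜 := ℝ) k).hasFDerivAt.comp_hasDerivWithinAt (x : ℝ) h1)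
      exact h2.congr (fun y hy => lineExtend_of_mem _ hy) (lineExtend_apply _ x))
    (fun c hc j => by
      revert γ
      refine induction_mk fun g => ?_
      cases I
      · exact absurd hc (by simp [CurveDomain.bc])
      · obtain rfl : 1 = c := Option.some_injective _ hc
        rw [one_mul]
        exact congrArg (fun v : Plane => v k) (derivCurve_circle (j + 1) g))
  map_add' γ η := Jet.ext_d fun j => ContinuousMap.ext fun s => by
    simp [Jet.d_mk]
  map_smul' c γ := Jet.ext_d fun j => ContinuousMap.ext fun s => by
    simp [Jet.d_mk]

theorem d_velocity (k : Fin 2) (γ : CurveSpace I) (j : ℕ) (s : Icc (0 : ℝ) 1) :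
    Jet.d j (velocity k γ) s = derivSucc I j γ s k := rfl

/-- A curve with zero derivative on `[0, 1]` is constant, hence zero modulo translations. -/
theorem ext_deriv {γ η : CurveSpace I} (h : ∀ s, γ.deriv s = η.deriv s) : γ = η := by
  suffices H : ∀ γ : CurveSpace I, (∀ s, γ.deriv s = 0) → γ = 0 from
    sub_eq_zero.1 (H _ fun s => by
      rw [deriv, map_sub, ContinuousMap.sub_apply]
      exact sub_eq_zero.2 (h s))
  refine induction_mk fun g hg => (Submodule.Quotient.mk_eq_zero _).2 ?_
  have hder : ∀ x ∈ Ico (0 : ℝ) 1, HasDerivWithinAt (fun t => g.1 (I.param t)) 0 (Ici x) x :=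
      fun x hx => by
    have h1 := hasDerivWithinAt_derivCurve 0 g ⟨x, Ico_subset_Icc_self hx⟩
    rw [← derivSucc_mk 0 g, hg] at h1
    simp only [iteratedDerivWithin_zero] at h1
    exact h1.mono_of_mem_nhdsWithin (mem_of_superset (Icc_mem_nhdsGE hx.2)
      (Icc_subset_Icc_left hx.1))
  have hconst := constant_of_has_deriv_right_zero
    (g.2.continuousOn.mono I.Icc_subset_paramSet) hder
  refine ⟨g.1 (I.param 0), fun p => ?_⟩
  obtain ⟨t, ht, rfl⟩ := CurveDomain.exists_param p
  exact hconst t ht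

theorem ext_velocity {γ η : CurveSpace I} (h : ∀ k, velocity k γ = velocity k η) : γ = η :=
  ext_deriv fun s => PiLp.ext fun k => by
    have := congrArg (fun f => Jet.d 0 f s) (h k)
    exact this

/-- Coordinatewise primitives; on the circle the vanishing integral makes them periodic, so that
they descend. -/
theorem exists_of_closing (f : Fin 2 → Jet I.bc) (hf : ∀ k, closing I (f k) = 0) :
    ∃ γ : CurveSpace I, ∀ k, velocity k γ = f k := by
  choose Γ hΓ hp hd using fun k => (f k).exists_primitive (hf k)
  obtain ⟨g, hg⟩ := CurveDomain.exists_param_lift (I := I)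
    (fun t => (WithLp.toLp 2 fun k => Γ k t : Plane)) fun hI t => by
      simp only [hp _ hI t]
  have hs : ContDiffOn ℝ ∞ (fun t => (WithLp.toLp 2 fun k => Γ k t : Plane)) I.paramSet :=
    contDiffOn_euclidean.2 hΓ
  have hgm : g ∈ SmoothCurve I := hs.congr hg
  refine ⟨(SmoothCurve.constants I).mkQ ⟨g, hgm⟩, fun k => Jet.ext_zero fun s => ?_⟩
  have hps := I.Icc_subset_paramSet s.2
  change iteratedDerivWithin (0 + 1) (fun t => g (I.param t)) I.paramSet s k = _
  rw [zero_add, iteratedDerivWithin_one]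
  have h1 : HasDerivWithinAt (fun t => (WithLp.toLp 2 fun k => Γ k t : Plane))
      (WithLp.toLp 2 fun k => Jet.d 0 (f k) s) I.paramSet s :=
    (PiLp.continuousLinearEquiv 2 ℝ fun _ : Fin 2 => ℝ).symm.hasFDerivAt.comp_hasDerivWithinAt
      (s : ℝ) (hasDerivWithinAt_pi.2 fun k => hd k s)
  rw [(h1.congr hg (hg s hps)).derivWithin (I.uniqueDiffOn_paramSet s hps)]

theorem closing_velocity (k : Fin 2) (γ : CurveSpace I) : closing I (velocity k γ) = 0 := by
  cases I
  · rfl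
  · change Jet.integral (velocity k γ) = 0
    revert γ
    refine induction_mk fun g => ?_
    have hG : ContDiff ℝ ∞ fun t => g.1 (CurveDomain.circle.param t) := contDiffOn_univ.1 g.2
    have h1 : ∀ t, HasDerivAt (fun t => g.1 (CurveDomain.circle.param t) k)
        (_root_.deriv (fun t => g.1 (CurveDomain.circle.param t)) t k) t := fun t =>
      (EuclideanSpace.proj (𝕜 := ℝ) k).hasFDerivAt.comp_hasDerivAt t
        ((hG.differentiable (by simp)).differentiableAt.hasDerivAt)
    rw [Jet.integral_eq_intervalIntegral (F := fun t =>
      _root_.deriv (fun t => g.1 (CurveDomain.circle.param t)) t k),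
      intervalIntegral.integral_eq_sub_of_hasDerivAt fun t _ => h1 t]
    · have : CurveDomain.circle.param 1 = CurveDomain.circle.param 0 :=
        AddCircle.coe_period (1 : ℝ)
      rw [this, sub_self]
    · exact ((EuclideanSpace.proj (𝕜 := ℝ) k).continuous.comp
        (hG.continuous_deriv (by simp))).intervalIntegrable _ _
    · intro x
      change _ = iteratedDerivWithin (0 + 1) (fun t => g.1 (CurveDomain.circle.param t)) univ x k
      rw [zero_add, iteratedDerivWithin_one, derivWithin_univ]

/-- The curve with given velocity, corrected so that it closes up. -/
theorem exists_primitive (f : Fin 2 → Jet I.bc) :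
    ∃ γ : CurveSpace I, ∀ k, velocity k γ = f k - Jet.const (closing I (f k)) :=
  exists_of_closing _ fun k => closing_sub_const I (f k)

/-- The curve with velocity `(f 0, f 1)`, up to the constant that makes it close up. -/
def primitive : (Jet I.bc × Jet I.bc) →ₗ[ℝ] CurveSpace I where
  toFun f := (exists_primitive ![f.1, f.2]).choose
  map_add' f g := ext_velocity fun k => Jet.ext_zero fun s => by
    rw [map_add, (exists_primitive _).choose_spec, (exists_primitive _).choose_spec,
      (exists_primitive _).choose_spec]
    fin_cases k <;> simp <;> ring
  map_smul' c f := ext_velocity fun k => Jet.ext_zero fun s => by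
    rw [map_smul, (exists_primitive _).choose_spec, (exists_primitive _).choose_spec]
    fin_cases k <;> simp <;> ring

theorem velocity_zero_primitive (f : Jet I.bc × Jet I.bc) :
    velocity 0 (primitive f) = f.1 - Jet.const (closing I f.1) :=
  (exists_primitive ![f.1, f.2]).choose_spec 0

theorem velocity_one_primitive (f : Jet I.bc × Jet I.bc) :
    velocity 1 (primitive f) = f.2 - Jet.const (closing I f.2) :=
  (exists_primitive ![f.1, f.2]).choose_spec 1

theorem sub_const_closing {f : Jet I.bc} (hf : closing I f = 0) :
    f - Jet.const (closing I f) = f := Jet.ext_zero fun x => by simp [hf]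

/-- A velocity is closed, so the correction in `primitive` disappears. This exhibits `CurveSpace I`
as a retract of a product of two jet spaces. -/
theorem primitive_velocity (γ : CurveSpace I) : primitive (velocity 0 γ, velocity 1 γ) = γ :=
  ext_velocity fun k => by
    fin_cases k
    · exact (velocity_zero_primitive _).trans (sub_const_closing (closing_velocity 0 γ))
    · exact (velocity_one_primitive _).trans (sub_const_closing (closing_velocity 1 γ))

theorem gnorm_eq (n : ℕ) (γ : CurveSpace I) :
    gnorm n γ = ∑ j ∈ Finset.range n, ‖derivSucc I j γ‖ := by
  change (∑ j ∈ Finset.range n,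
    (normSeminorm ℝ C(Icc (0 : ℝ) 1, Plane)).comp (derivSucc I j)) γ = _
  simp only [FunLike.coe_sum, Finset.sum_apply, Seminorm.comp_apply, coe_normSeminorm]

/-- The degree is one because `‖γ‖ₙ` stops at `γ⁽ⁿ⁾`, whereas the `n`-th norm of the velocity
contains `γ⁽ⁿ⁺¹⁾`. -/
theorem isTameLinear_velocity (k : Fin 2) : IsTameLinear (velocity (I := I) k) :=
  ⟨1, 0, fun n _ => ⟨1, fun γ => by
    rw [one_mul, gnorm_eq, Jet.gnorm_eq]
    refine Finset.sum_le_sum fun j _ => ?_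
    rw [ContinuousMap.norm_le _ (norm_nonneg _)]
    exact fun s => (PiLp.norm_apply_le _ k).trans ((derivSucc I j γ).norm_coe_le_norm s)⟩⟩

theorem norm_derivSucc_le (j : ℕ) (γ : CurveSpace I) :
    ‖derivSucc I j γ‖ ≤ ‖Jet.d j (velocity 0 γ)‖ + ‖Jet.d j (velocity 1 γ)‖ := by
  rw [ContinuousMap.norm_le _ (by positivity)]
  intro s
  have h0 := (Jet.d j (velocity 0 γ)).norm_coe_le_norm s
  have h1 := (Jet.d j (velocity 1 γ)).norm_coe_le_norm s
  rw [d_velocity, Real.norm_eq_abs] at h0 h1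
  refine le_trans ?_ (add_le_add h0 h1)
  rw [EuclideanSpace.norm_eq, Fin.sum_univ_two, Real.norm_eq_abs, Real.norm_eq_abs]
  rw [Real.sqrt_le_iff]
  exact ⟨by positivity, by nlinarith [abs_nonneg (derivSucc I j γ s 0), abs_nonneg (derivSucc I j γ s 1)]⟩

theorem gnorm_le (n : ℕ) (γ : CurveSpace I) :
    gnorm n γ ≤ gnorm n (velocity 0 γ) + gnorm n (velocity 1 γ) := by
  rw [gnorm_eq, Jet.gnorm_eq, Jet.gnorm_eq, ← Finset.sum_add_distrib]
  exact (Finset.sum_le_sum fun j _ => norm_derivSucc_le j γ).trans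
    (Finset.sum_le_sum_of_subset_of_nonneg (Finset.range_mono n.le_succ)
      fun _ _ _ => by positivity)

theorem _root_.Jet.gnorm_const_le {bc : Option ℝ} [Jet.Unital bc] (n : ℕ) (a : ℝ) :
    gnorm n (Jet.const (bc := bc) a) ≤ |a| := by
  rw [Jet.gnorm_eq, Finset.sum_range_succ', Finset.sum_eq_zero, zero_add]
  · rw [ContinuousMap.norm_le _ (abs_nonneg a)]
    intro x
    rw [Jet.d_zero_const, Real.norm_eq_abs]
  · intro j _
    rw [norm_eq_zero]
    ext x
    rw [Jet.const, Jet.d_ofFun, iteratedDerivWithin_const]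
    simp

theorem isTameLinear_primitive : IsTameLinear (primitive (I := I)) :=
  ⟨0, 0, fun n _ => ⟨2, fun f => by
    have h : ∀ g : Jet I.bc, gnorm n (g - Jet.const (closing I g)) ≤ 2 * gnorm n g := fun g => by
      refine (gnorm_sub_le n _ _).trans ?_
      rw [two_mul]
      gcongr
      exact (Jet.gnorm_const_le n _).trans <| (abs_closing_le I g).trans (Jet.norm_d_le (Nat.zero_le n) g)
    refine (gnorm_le n _).trans ?_
    rw [velocity_zero_primitive, velocity_one_primitive, gnorm_prod, mul_add, add_zero]
    exact add_le_add (h _) (h _)⟩⟩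

instance instT2Space : T2Space (CurveSpace I) := by
  have : IsTopologicalAddGroup (CurveSpace I) := (withSeminorms I).topologicalAddGroup
  have : T1Space (CurveSpace I) := by
    refine (withSeminorms I).T1_of_separating fun γ hγ => ?_
    by_contra! h
    refine hγ (ext_deriv fun s => ?_)
    have h1 : gnorm 1 γ = 0 := h 1
    rw [gnorm_eq, Finset.sum_range_one, norm_eq_zero] at h1
    change derivSucc I 0 γ s = derivSucc I 0 0 s
    rw [h1, map_zero]
  infer_instance

instance instGradedLC : GradedLC (CurveSpace I) := ⟨withSeminorms I, inferInstance⟩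

theorem isTameFrechetSpace : IsTameFrechetSpace (CurveSpace I) :=
  ((Jet.isTameFrechetSpace (bc := I.bc)).prod (Jet.isTameFrechetSpace (bc := I.bc))).of_retract
    (withSeminorms I) ((isTameLinear_velocity 0).prod (isTameLinear_velocity 1))
    isTameLinear_primitive primitive_velocity

end CurveSpace

/-! ## Open subsets of tame Fréchet spaces and their submanifolds -/

section openSubset

variable {E : Type} [AddCommGroup E] [Module ℝ E] [TopologicalSpace E] [Grading E]
  {U : TopologicalSpace.Opens E}

/-- The inclusion of `U` into `E`. -/
abbrev inclusionHomeo (x : U) : OpenPartialHomeomorph U E := U.openPartialHomeomorphSubtypeCoe ⟨x⟩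

theorem inclusionHomeo_symm_coe (x y : U) : (inclusionHomeo x).symm (y : E) = y :=
  (inclusionHomeo x).left_inv (mem_univ y)

theorem coe_inclusionHomeo_symm (x : U) {f : E} (hf : f ∈ U) :
    ((inclusionHomeo x).symm f : E) = f :=
  (inclusionHomeo x).right_inv (by
    rw [TopologicalSpace.Opens.openPartialHomeomorphSubtypeCoe_target]; exact hf)

theorem mem_symm_trans_source {N : Type} [TopologicalSpace N]
    {x : U} {c : OpenPartialHomeomorph U N} {f : E} :
    f ∈ ((inclusionHomeo x).symm.trans c).source ↔ ∃ h : f ∈ U, ⟨f, h⟩ ∈ c.source := by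
  rw [OpenPartialHomeomorph.trans_source, OpenPartialHomeomorph.symm_source,
    TopologicalSpace.Opens.openPartialHomeomorphSubtypeCoe_target]
  constructor
  · rintro ⟨h1, h2⟩
    refine ⟨h1, ?_⟩
    rw [← inclusionHomeo_symm_coe x ⟨f, h1⟩]
    exact h2
  · rintro ⟨h1, h2⟩
    rw [← inclusionHomeo_symm_coe x ⟨f, h1⟩] at h2
    exact ⟨h1, h2⟩

theorem TameSmooth.mono {F G : Type} [AddCommGroup F] [Module ℝ F] [TopologicalSpace F] [Grading F]
    [AddCommGroup G] [Module ℝ G] [TopologicalSpace G] [Grading G] {P : F → G} {V W : Set F}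
    (h : TameSmooth P W) (hVW : V ⊆ W) : TameSmooth P V := fun n => (h n).mono hVW

theorem TameSmooth.congr {F G : Type} [AddCommGroup F] [Module ℝ F] [TopologicalSpace F] [Grading F]
    [AddCommGroup G] [Module ℝ G] [TopologicalSpace G] [Grading G] [GradedLC F] {P Q : F → G}
    {V : Set F} (hV : IsOpen V) (h : TameSmooth P V) (hPQ : ∀ x ∈ V, P x = Q x) :
    TameSmooth Q V := fun n => (h n).congr hV hPQ

theorem isTameFrechetManifold_openAtlas (hE : IsTameFrechetSpace E) :
    IsTameFrechetManifold (openAtlas U) := by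
  have := hE.gradedLC
  refine ⟨inferInstance, ?_, fun x => ⟨inclusionChart x, ⟨x, rfl⟩, mem_univ x⟩, ?_⟩
  · rintro _ ⟨x, rfl⟩
    exact hE
  · rintro _ ⟨x, rfl⟩ _ ⟨y, rfl⟩
    have h : IsSmoothTameOn (fun f => (inclusionHomeo x) ((inclusionHomeo y).symm f))
        ((inclusionHomeo y).symm.trans (inclusionHomeo x)).source := by
      have ho := ((inclusionHomeo y).symm.trans (inclusionHomeo x)).open_source
      refine TameSmooth.isSmoothTameOn ho
        (TameSmooth.congr (P := fun f : E => f) ho (fun n => TameC.id _) fun f hf => ?_)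
      exact (coe_inclusionHomeo_symm y (mem_symm_trans_source.1 hf).1).symm
    exact ⟨h, h⟩

/-- A chart of an open subset `U` of `E`, from a chart of `E` with domain in `U`. -/
theorem restrict_mem_maximalAtlas [GradedLC E] {N : Type} [AddCommGroup N] [Module ℝ N]
    [TopologicalSpace N] [Grading N] (hN : IsTameFrechetSpace N) (h : OpenPartialHomeomorph E N)
    (hP : TameSmooth h h.source) (hQ : TameSmooth h.symm h.target) (hU : h.source ⊆ U) (x : U) :
    (⟨N, (inclusionHomeo x).trans h⟩ : FrechetChart U) ∈ maximalAtlas (openAtlas U) := by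
  have := hN.gradedLC
  refine ⟨hN, ?_⟩
  rintro _ ⟨y, rfl⟩
  let c := (inclusionHomeo x).trans h
  constructor
  · change IsSmoothTameOn (fun f => (inclusionHomeo y) (c.symm f))
      (c.symm.trans (inclusionHomeo y)).source
    have ho := (c.symm.trans (inclusionHomeo y)).open_source
    have hsub : (c.symm.trans (inclusionHomeo y)).source ⊆ h.target := fun f hf => by
      have h1 : f ∈ c.target := hf.1
      rw [show c.target = _ from OpenPartialHomeomorph.trans_target _ _] at h1
      exact h1.1
    refine TameSmooth.isSmoothTameOn ho (TameSmooth.congr ho (hQ.mono hsub) fun f hf => ?_)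
    exact (coe_inclusionHomeo_symm x (hU (h.map_target (hsub hf)))).symm
  · change IsSmoothTameOn (fun f => c ((inclusionHomeo y).symm f))
      ((inclusionHomeo y).symm.trans c).source
    have ho := ((inclusionHomeo y).symm.trans c).open_source
    have hmem : ∀ f ∈ ((inclusionHomeo y).symm.trans c).source, f ∈ U ∧ f ∈ h.source :=
        fun f hf => by
      obtain ⟨h1, h2⟩ := mem_symm_trans_source.1 hf
      rw [show c.source = _ from OpenPartialHomeomorph.trans_source _ _] at h2
      exact ⟨h1, h2.2⟩
    refine TameSmooth.isSmoothTameOn ho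
      (TameSmooth.congr ho (hP.mono fun f hf => (hmem f hf).2) fun f hf => ?_)
    exact congrArg h (coe_inclusionHomeo_symm y (hmem f hf).1).symm

section maximal

variable [GradedLC E] {c : FrechetChart U} (hc : c ∈ maximalAtlas (openAtlas U))
include hc

/-- Together with `tameSmooth_chart`, this turns charts of the maximal atlas into smooth tame maps
into and out of `E`, where they can be composed. -/
theorem tameSmooth_chart_symm : TameSmooth (fun y => (c.homeo.symm y : E)) c.homeo.target := by
  have := hc.1.gradedLC
  rcases isEmpty_or_nonempty U with hU | ⟨⟨x⟩⟩
  -- The inverse chart is a total function, so an empty `U` would make the model empty; but the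
  -- model contains `0`.
  · have : IsEmpty c.Model := ⟨fun y => hU.elim (c.homeo.symm y)⟩
    exact isEmptyElim (0 : c.Model)
  · refine TameSmooth.mono ((hc.2 _ ⟨x, rfl⟩).1.tameSmooth
      (c.homeo.symm.trans (inclusionHomeo x)).open_source) fun y hy => ?_
    exact ⟨hy, mem_univ _⟩

theorem tameSmooth_chart (x : U) : TameSmooth (fun f => c.homeo ((inclusionHomeo x).symm f))
    ((inclusionHomeo x).symm.trans c.homeo).source := by
  have := hc.1.gradedLC
  exact (hc.2 _ ⟨x, rfl⟩).2.tameSmooth ((inclusionHomeo x).symm.trans c.homeo).open_source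

end maximal

/-- The slice condition says that `F × 0` within the target is exactly the image of `S`, so the
first component restricts to a homeomorphism. The point `x₀` is only a default value of the inverse
outside the target. -/
theorem IsSliceChart.exists_induced {M : Type} [TopologicalSpace M] {𝒜 : Set (FrechetChart M)}
    {S : Set M} {c : ProductChart M} (hc : IsSliceChart 𝒜 S c) (x₀ : S) :
    ∃ ψ : OpenPartialHomeomorph S c.F, ψ.source = Subtype.val ⁻¹' c.homeo.source ∧
      (∀ x ∈ ψ.source, c.homeo x.1 = (ψ x, 0)) := by
  classical
  have hS : ∀ f : c.F, (f, (0 : c.G)) ∈ c.homeo.target → c.homeo.symm (f, 0) ∈ S := fun f hf => by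
    rw [hc.slice _ (c.homeo.map_target hf), c.homeo.right_inv hf]
  have hval : ∀ x : S, x.1 ∈ c.homeo.source → c.homeo x.1 = ((c.homeo x.1).1, 0) := fun x hx =>
    Prod.ext rfl ((hc.slice _ hx).1 x.2)
  let inv : c.F → S := fun f =>
    if h : (f, (0 : c.G)) ∈ c.homeo.target then ⟨c.homeo.symm (f, 0), hS f h⟩ else x₀
  have hinv : ∀ f, (f, (0 : c.G)) ∈ c.homeo.target → (inv f : M) = c.homeo.symm (f, 0) :=
    fun f hf => by simp only [inv, dif_pos hf]
  refine ⟨{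
    toFun := fun x => (c.homeo x.1).1
    invFun := inv
    source := Subtype.val ⁻¹' c.homeo.source
    target := {f | (f, (0 : c.G)) ∈ c.homeo.target}
    map_source' := fun x hx => by
      change ((c.homeo x.1).1, (0 : c.G)) ∈ c.homeo.target
      rw [← hval x hx]
      exact c.homeo.map_source hx
    map_target' := fun f hf => by
      change (inv f : M) ∈ c.homeo.source
      rw [hinv f hf]
      exact c.homeo.map_target hf
    left_inv' := fun x hx => Subtype.ext <| by
      have h1 := c.homeo.map_source hx
      rw [hval x hx] at h1
      rw [hinv _ h1, ← hval x hx, c.homeo.left_inv hx]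
    right_inv' := fun f hf => by
      rw [hinv f hf, c.homeo.right_inv hf]
    open_source := c.homeo.open_source.preimage continuous_subtype_val
    open_target := c.homeo.open_target.preimage (by fun_prop)
    continuousOn_toFun := continuous_fst.comp_continuousOn
      (c.homeo.continuousOn.comp continuous_subtype_val.continuousOn fun x hx => hx)
    continuousOn_invFun := by
      refine Topology.IsInducing.subtypeVal.continuousOn_iff.2 ?_
      refine ContinuousOn.congr ?_ hinv
      exact c.homeo.symm.continuousOn.comp (by fun_prop) fun f hf => hf }, rfl, fun x hx => hval x hx⟩

variable {S : Set U}

/-- A diffeomorphism between open subsets of graded spaces. -/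
def tameHomeo {F G : Type} [AddCommGroup F] [Module ℝ F] [TopologicalSpace F] [Grading F]
    [AddCommGroup G] [Module ℝ G] [TopologicalSpace G] [Grading G] {P : F → G} {Q : G → F}
    {V : Set F} {W : Set G} (hV : IsOpen V) (hW : IsOpen W) (hP : TameSmooth P V)
    (hQ : TameSmooth Q W) (hPW : ∀ x ∈ V, P x ∈ W) (hQV : ∀ y ∈ W, Q y ∈ V)
    (hQP : ∀ x ∈ V, Q (P x) = x) (hPQ : ∀ y ∈ W, P (Q y) = y) : OpenPartialHomeomorph F G where
  toFun := P
  invFun := Q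
  source := V
  target := W
  map_source' := hPW
  map_target' := hQV
  left_inv' := hQP
  right_inv' := hPQ
  open_source := hV
  open_target := hW
  continuousOn_toFun := (hP 0).isTameOn.1
  continuousOn_invFun := (hQ 0).isTameOn.1

theorem isSliceChart_restrict [GradedLC E] {F G : Type} [AddCommGroup F] [Module ℝ F]
    [TopologicalSpace F] [Grading F] [AddCommGroup G] [Module ℝ G] [TopologicalSpace G] [Grading G]
    (hF : IsTameFrechetSpace F) (hG : IsTameFrechetSpace G) (h : OpenPartialHomeomorph E (F × G))
    (hP : TameSmooth h h.source) (hQ : TameSmooth h.symm h.target) (hU : h.source ⊆ U)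
    (hS : ∀ x : U, (x : E) ∈ h.source → (x ∈ S ↔ (h x).2 = 0)) (x : U) :
    IsSliceChart (openAtlas U) S ⟨F, G, (inclusionHomeo x).trans h⟩ := by
  refine ⟨restrict_mem_maximalAtlas (hF.prod hG) h hP hQ hU x, hF, hG, fun y hy => hS y ?_⟩
  rw [OpenPartialHomeomorph.trans_source] at hy
  exact hy.2

/-- A change of induced charts factors through the ambient space: include by `f ↦ (f, 0)`, apply the
inverse of one slice chart, then the other slice chart, and project to the first factor. -/
theorem isTameFrechetManifold_inducedAtlas [GradedLC E] (hS : IsTameSubmanifold (openAtlas U) S) :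
    IsTameFrechetManifold (inducedAtlas (openAtlas U) S) := by
  refine ⟨inferInstance, ?_, fun x => ?_, ?_⟩
  · rintro _ ⟨c, hc, ψ, -, -, rfl⟩
    exact hc.tame_fst
  · obtain ⟨c, hc, hx⟩ := hS.exists_slice x.1 x.2
    obtain ⟨ψ, h1, h2⟩ := hc.exists_induced x
    exact ⟨⟨c.F, ψ⟩, ⟨c, hc, ψ, h1, h2, rfl⟩, by rw [h1]; exact hx⟩
  · suffices H : ∀ (c₁ c₂ : ProductChart U), IsSliceChart (openAtlas U) S c₁ →
        IsSliceChart (openAtlas U) S c₂ → ∀ (ψ₁ : OpenPartialHomeomorph S c₁.F)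
        (ψ₂ : OpenPartialHomeomorph S c₂.F), ψ₁.source = Subtype.val ⁻¹' c₁.homeo.source →
        (∀ x ∈ ψ₁.source, c₁.homeo x.1 = (ψ₁ x, 0)) →
        ψ₂.source = Subtype.val ⁻¹' c₂.homeo.source →
        (∀ x ∈ ψ₂.source, c₂.homeo x.1 = (ψ₂ x, 0)) →
        IsSmoothTameOn (fun f => ψ₂ (ψ₁.symm f)) (ψ₁.symm.trans ψ₂).source by
      rintro _ ⟨c₁, hc₁, ψ₁, h₁, h₁', rfl⟩ _ ⟨c₂, hc₂, ψ₂, h₂, h₂', rfl⟩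
      exact ⟨H c₁ c₂ hc₁ hc₂ ψ₁ ψ₂ h₁ h₁' h₂ h₂', H c₂ c₁ hc₂ hc₁ ψ₂ ψ₁ h₂ h₂' h₁ h₁'⟩
    intro c₁ c₂ hc₁ hc₂ ψ₁ ψ₂ h₁ h₁' h₂ h₂'
    have := hc₁.tame_fst.gradedLC
    have := hc₁.tame_snd.gradedLC
    have := hc₂.tame_fst.gradedLC
    have := hc₂.tame_snd.gradedLC
    have ho := (ψ₁.symm.trans ψ₂).open_source
    rcases isEmpty_or_nonempty U with hU | ⟨⟨x₀⟩⟩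
    · exact hU.elim (ψ₁.symm 0).1
    have hQ : TameSmooth (fun y => (c₁.homeo.symm y : E)) c₁.homeo.target :=
      tameSmooth_chart_symm hc₁.mem_maximalAtlas
    have hP : TameSmooth (fun f => c₂.homeo ((inclusionHomeo x₀).symm f))
      ((inclusionHomeo x₀).symm.trans c₂.homeo).source :=
      tameSmooth_chart hc₂.mem_maximalAtlas x₀
    have hmem : ∀ f ∈ (ψ₁.symm.trans ψ₂).source, (f, (0 : c₁.G)) ∈ c₁.homeo.target ∧
        c₁.homeo.symm (f, 0) = ψ₁.symm f ∧ (ψ₁.symm f).1 ∈ c₂.homeo.source := fun f hf => by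
      have h3 := ψ₁.map_target hf.1
      have h4 := h₁' _ h3
      have h5 : (ψ₁.symm f).1 ∈ c₁.homeo.source := by rw [h₁] at h3; exact h3
      rw [ψ₁.right_inv hf.1] at h4
      refine ⟨h4 ▸ c₁.homeo.map_source h5, by rw [← h4, c₁.homeo.left_inv h5], ?_⟩
      have h6 : ψ₁.symm f ∈ ψ₂.source := hf.2
      rw [h₂] at h6
      exact h6
    have hi : TameSmooth (fun f : c₁.F => (f, (0 : c₁.G))) (ψ₁.symm.trans ψ₂).source := fun n =>
      (TameC.id _).prodMk (TameC.const 0 _)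
    have h6 := TameSmooth.comp ho c₁.homeo.open_target hQ hi fun f hf => (hmem f hf).1
    have h7 := TameSmooth.comp ho
      ((inclusionHomeo x₀).symm.trans c₂.homeo).open_source hP h6 fun f hf => by
        obtain ⟨h8, h9, h10⟩ := hmem f hf
        refine mem_symm_trans_source.2 ⟨(c₁.homeo.symm (f, 0)).2, ?_⟩
        rw [← h9] at h10
        exact h10
    refine TameSmooth.isSmoothTameOn ho (TameSmooth.congr ho (fun n => (h7 n).fst ho)
      fun f hf => ?_)
    obtain ⟨h8, h9, h10⟩ := hmem f hf
    rw [inclusionHomeo_symm_coe, h9, h₂' (ψ₁.symm f) hf.2]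

end openSubset

/-! ## Curves of length one -/

theorem isTameLinear_of_abs_le {E : Type*} [AddCommGroup E] [Module ℝ E] [Grading E]
    {l : E →ₗ[ℝ] ℝ} (m : ℕ) (C : ℝ) (hC : 0 ≤ C) (h : ∀ f, |l f| ≤ C * gnorm m f) : IsTameLinear l :=
  ⟨m, 0, fun n _ => ⟨C, fun f => by
    rw [gnorm_real]
    exact (h f).trans (mul_le_mul_of_nonneg_left (gnorm_mono (by omega) f) hC)⟩⟩

namespace CurveSpace

variable {I : CurveDomain}

/-- The square of the speed. -/
def speedSq (γ : CurveSpace I) : Jet I.bc :=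
  velocity 0 γ * velocity 0 γ + velocity 1 γ * velocity 1 γ

/-- The speed of an immersed curve. -/
def speed (γ : CurveSpace I) : Jet I.bc := Jet.sqrt (speedSq γ)

theorem d_zero_speedSq (γ : CurveSpace I) (s : Icc (0 : ℝ) 1) :
    Jet.d 0 (speedSq γ) s = ‖γ.deriv s‖ ^ 2 := by
  simp only [speedSq, map_add, ContinuousMap.add_apply, Jet.d_zero_mul, d_velocity]
  rw [EuclideanSpace.norm_sq_eq, Fin.sum_univ_two, Real.norm_eq_abs, Real.norm_eq_abs, sq_abs,
    sq_abs]
  ring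

theorem mem_immersions_iff {γ : CurveSpace I} :
    γ ∈ Immersions I ↔ speedSq γ ∈ Jet.positive I.bc := by
  refine forall_congr' fun s => ?_
  rw [d_zero_speedSq]
  constructor
  · intro h; have := norm_pos_iff.2 h; positivity
  · intro h h0; rw [h0] at h; simp at h

theorem d_zero_speed {γ : CurveSpace I} (hγ : γ ∈ Immersions I) (s : Icc (0 : ℝ) 1) :
    Jet.d 0 (speed γ) s = ‖γ.deriv s‖ := by
  rw [speed, Jet.d_zero_sqrt (mem_immersions_iff.1 hγ), d_zero_speedSq,
    Real.sqrt_sq (norm_nonneg _)]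

theorem tameC_velocity (n : ℕ) (k : Fin 2) (U : Set (CurveSpace I)) :
    TameC n (fun γ => velocity k γ) U := TameC.linear (isTameLinear_velocity k) U

theorem tameC_speedSq (n : ℕ) {U : Set (CurveSpace I)} (hU : IsOpen U) :
    TameC n (fun γ => speedSq γ) U :=
  ((tameC_velocity n 0 U).mul hU (tameC_velocity n 0 U)).add hU
    ((tameC_velocity n 1 U).mul hU (tameC_velocity n 1 U))

theorem tameC_speed (n : ℕ) : TameC n (fun γ : CurveSpace I => speed γ) (Immersions I) :=
  (tameC_speedSq n (Immersions I).isOpen).sqrt (Immersions I).isOpen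
    fun _ h => mem_immersions_iff.1 h

/-- The length of an immersed curve. -/
def length (γ : CurveSpace I) : ℝ := Jet.integral (speed γ)

theorem length_eq {γ : CurveSpace I} (hγ : γ ∈ Immersions I) :
    length γ = ∫ s : Icc (0 : ℝ) 1, ‖γ.deriv s‖ := by
  rw [length, Jet.integral_apply]
  exact MeasureTheory.integral_congr_ae (Eventually.of_forall fun s => d_zero_speed hγ s)

theorem mem_lengthOne_iff {γ : Immersions I} : γ ∈ LengthOne I ↔ length γ.1 = 1 := by
  rw [length_eq γ.2]
  rfl

theorem tameC_length (n : ℕ) : TameC n (fun γ : CurveSpace I => length γ) (Immersions I) :=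
  (tameC_speed n).linear_comp Jet.isTameLinear_integral (Immersions I).isOpen

theorem _root_.Jet.integral_pos {bc : Option ℝ} [Jet.Unital bc] {f : Jet bc}
    (hf : f ∈ Jet.positive bc) : 0 < Jet.integral f := by
  obtain ⟨δ, hδ, h⟩ := Jet.exists_lower_bound hf
  refine hδ.trans_le ?_
  rw [← Jet.integral_const (bc := bc) δ, Jet.integral_apply, Jet.integral_apply]
  refine MeasureTheory.integral_mono (Jet.integrable_coe _) (Jet.integrable_coe _) fun x => ?_
  rw [Jet.d_zero_const]
  exact h x

theorem length_pos {γ : CurveSpace I} (hγ : γ ∈ Immersions I) : 0 < length γ :=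
  Jet.integral_pos (Jet.sqrt_mem_positive (mem_immersions_iff.1 hγ))

theorem smul_mem_immersions {γ : CurveSpace I} (hγ : γ ∈ Immersions I) {c : ℝ} (hc : c ≠ 0) :
    c • γ ∈ Immersions I := fun s => by
  rw [deriv, map_smul, ContinuousMap.smul_apply]
  exact smul_ne_zero hc (hγ s)

theorem length_smul {γ : CurveSpace I} (hγ : γ ∈ Immersions I) {c : ℝ} (hc : 0 < c) :
    length (c • γ) = c * length γ := by
  rw [length_eq hγ, length_eq (smul_mem_immersions hγ hc.ne'), ← MeasureTheory.integral_const_mul]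
  refine MeasureTheory.integral_congr_ae (Eventually.of_forall fun s => ?_)
  simp only [map_smul, ContinuousMap.smul_apply, norm_smul, Real.norm_of_nonneg hc.le]

theorem deriv_add (γ η : CurveSpace I) : (γ + η).deriv = γ.deriv + η.deriv :=
  map_add (derivSucc I 0) γ η

theorem deriv_smul (c : ℝ) (γ : CurveSpace I) : (c • γ).deriv = c • γ.deriv :=
  map_smul (derivSucc I 0) c γ

/-- The functional that compares the initial velocity of a curve with that of `γ₀`. -/
def initial (γ₀ : CurveSpace I) : CurveSpace I →ₗ[ℝ] ℝ where
  toFun γ := inner ℝ (γ₀.deriv 0) (γ.deriv 0) / ‖γ₀.deriv 0‖ ^ 2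
  map_add' γ η := by
    rw [deriv_add, ContinuousMap.add_apply, inner_add_right, add_div]
  map_smul' c γ := by
    rw [deriv_smul, ContinuousMap.smul_apply, inner_smul_right, mul_div_assoc]
    rfl

theorem initial_apply (γ₀ γ : CurveSpace I) :
    initial γ₀ γ = inner ℝ (γ₀.deriv 0) (γ.deriv 0) / ‖γ₀.deriv 0‖ ^ 2 := rfl

theorem isTameLinear_initial (γ₀ : CurveSpace I) : IsTameLinear (initial γ₀) := by
  refine isTameLinear_of_abs_le 1 (‖γ₀.deriv 0‖ / ‖γ₀.deriv 0‖ ^ 2) (by positivity) fun γ => ?_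
  rw [initial_apply, abs_div, abs_of_nonneg (by positivity : 0 ≤ ‖γ₀.deriv 0‖ ^ 2), div_mul_eq_mul_div]
  gcongr
  refine (abs_real_inner_le_norm _ _).trans ?_
  gcongr
  rw [gnorm_eq, Finset.sum_range_one]
  exact γ.deriv.norm_coe_le_norm 0

variable {γ₀ : CurveSpace I} (hγ₀ : γ₀ ∈ Immersions I)

include hγ₀ in
theorem initial_self : initial γ₀ γ₀ = 1 := by
  have := norm_pos_iff.2 (hγ₀ 0)
  rw [initial_apply, real_inner_self_eq_norm_sq, div_self (by positivity)]

/-- The projection to the kernel of `initial γ₀` along `γ₀`. -/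
def kerProj (γ₀ : CurveSpace I) : CurveSpace I →ₗ[ℝ] CurveSpace I :=
  LinearMap.id + (-initial γ₀).smulRight γ₀

theorem kerProj_apply (γ : CurveSpace I) : kerProj γ₀ γ = γ - initial γ₀ γ • γ₀ := by
  simp [kerProj, sub_eq_add_neg]

theorem isTameLinear_kerProj (γ₀ : CurveSpace I) : IsTameLinear (kerProj γ₀) := by
  refine isTameLinear_id.add (IsTameLinear.smul_const ?_ γ₀)
  obtain ⟨r, b, h⟩ := isTameLinear_initial γ₀
  refine ⟨r, b, fun n hn => ?_⟩
  obtain ⟨C, hC⟩ := h n hn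
  exact ⟨C, fun f => by rw [LinearMap.neg_apply, gnorm_neg]; exact hC f⟩

include hγ₀ in
theorem kerProj_mem (γ : CurveSpace I) : kerProj γ₀ γ ∈ LinearMap.ker (initial γ₀) := by
  rw [LinearMap.mem_ker, kerProj_apply, map_sub, map_smul, initial_self hγ₀, smul_eq_mul, mul_one,
    sub_self]

include hγ₀ in
theorem isTameFrechetSpace_ker_initial : IsTameFrechetSpace (LinearMap.ker (initial γ₀)) :=
  isTameFrechetSpace.of_projection _ (isTameLinear_kerProj γ₀) (kerProj_mem hγ₀) fun x hx => by
    rw [kerProj_apply, LinearMap.mem_ker.1 hx, zero_smul, sub_zero]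

/-- The direction of a curve relative to `γ₀`, and its length. -/
def toRadial (γ : CurveSpace I) : LinearMap.ker (initial γ₀) × ℝ :=
  ((kerProj γ₀).codRestrict _ (kerProj_mem hγ₀) ((initial γ₀ γ)⁻¹ • γ), length γ - 1)

/-- The inverse of `toRadial`. -/
def ofRadial (γ₀ : CurveSpace I) (p : LinearMap.ker (initial γ₀) × ℝ) : CurveSpace I :=
  ((1 + p.2) * (length (γ₀ + p.1.1))⁻¹) • (γ₀ + p.1.1)

/-- The domain of `toRadial`. -/
def radialSource (γ₀ : CurveSpace I) : Set (CurveSpace I) :=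
  Immersions I ∩ {γ | 0 < initial γ₀ γ}

/-- The image of `toRadial`. -/
def radialTarget (γ₀ : CurveSpace I) : Set (LinearMap.ker (initial γ₀) × ℝ) :=
  {p | γ₀ + p.1.1 ∈ Immersions I ∧ -1 < p.2}

theorem isOpen_radialSource : IsOpen (radialSource γ₀) :=
  (Immersions I).isOpen.inter (isOpen_Ioi.preimage (isTameLinear_initial γ₀).continuous)

theorem isOpen_radialTarget : IsOpen (radialTarget γ₀) := by
  have h : Continuous fun p : LinearMap.ker (initial γ₀) × ℝ => γ₀ + p.1.1 :=
    continuous_const.add (continuous_subtype_val.comp continuous_fst)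
  exact ((Immersions I).isOpen.preimage h).inter (isOpen_Ioi.preimage continuous_snd)

theorem coe_toRadial_fst {γ : CurveSpace I} (hγ : 0 < initial γ₀ γ) :
    ((toRadial hγ₀ γ).1 : CurveSpace I) = (initial γ₀ γ)⁻¹ • γ - γ₀ := by
  change kerProj γ₀ ((initial γ₀ γ)⁻¹ • γ) = _
  rw [kerProj_apply, map_smul, smul_eq_mul, inv_mul_cancel₀ hγ.ne', one_smul]

theorem add_toRadial_fst {γ : CurveSpace I} (hγ : 0 < initial γ₀ γ) :
    γ₀ + ((toRadial hγ₀ γ).1 : CurveSpace I) = (initial γ₀ γ)⁻¹ • γ := by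
  rw [coe_toRadial_fst hγ₀ hγ, add_sub_cancel]

theorem tameSmooth_toRadial : TameSmooth (toRadial hγ₀) (radialSource γ₀) := fun n => by
  have hU := isOpen_radialSource (γ₀ := γ₀)
  refine TameC.prodMk ?_ ?_
  · have h1 : TameC n (fun γ => (initial γ₀ γ)⁻¹) (radialSource γ₀) :=
      (TameC.linear (isTameLinear_initial γ₀) _).inv_real hU fun γ hγ => hγ.2.ne'
    exact (h1.smul hU (TameC.id _)).linear_comp ((isTameLinear_kerProj γ₀).codRestrict _ _) hU
  · exact ((tameC_length n).mono inter_subset_left).sub hU (TameC.const 1 _)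

theorem tameSmooth_ofRadial : TameSmooth (ofRadial γ₀) (radialTarget γ₀) := fun n => by
  have hU := isOpen_radialTarget (γ₀ := γ₀)
  have h1 : TameC n (fun p : LinearMap.ker (initial γ₀) × ℝ => γ₀ + p.1.1) (radialTarget γ₀) :=
    (TameC.const γ₀ _).add hU
      (((TameC.id _).fst hU).linear_comp (isTameLinear_subtype (LinearMap.ker (initial γ₀))) hU)
  have h2 : TameC n (fun p : LinearMap.ker (initial γ₀) × ℝ => (length (γ₀ + p.1.1))⁻¹)
      (radialTarget γ₀) :=
    TameC.inv_real hU (TameC.comp (P := length) hU (Immersions I).isOpen (tameC_length n) h1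
      fun p hp => hp.1) fun p hp => (length_pos hp.1).ne'
  exact (((TameC.const 1 _).add hU ((TameC.id _).snd hU)).mul_real hU h2).smul hU h1

theorem toRadial_mem {γ : CurveSpace I} (hγ : γ ∈ radialSource γ₀) :
    toRadial hγ₀ γ ∈ radialTarget γ₀ := by
  refine ⟨?_, ?_⟩
  · rw [add_toRadial_fst hγ₀ hγ.2]
    exact smul_mem_immersions hγ.1 (inv_ne_zero hγ.2.ne')
  · change -1 < length γ - 1
    linarith [length_pos hγ.1]

include hγ₀ in
theorem initial_add {w : CurveSpace I} (hw : w ∈ LinearMap.ker (initial γ₀)) :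
    initial γ₀ (γ₀ + w) = 1 := by
  rw [map_add, initial_self hγ₀, LinearMap.mem_ker.1 hw, add_zero]

theorem radialFactor_pos {p : LinearMap.ker (initial γ₀) × ℝ} (hp : p ∈ radialTarget γ₀) :
    0 < (1 + p.2) * (length (γ₀ + p.1.1))⁻¹ :=
  mul_pos (by linarith [hp.2]) (inv_pos.2 (length_pos hp.1))

include hγ₀ in
theorem initial_ofRadial (p : LinearMap.ker (initial γ₀) × ℝ) :
    initial γ₀ (ofRadial γ₀ p) = (1 + p.2) * (length (γ₀ + p.1.1))⁻¹ := by
  rw [ofRadial, map_smul, initial_add hγ₀ p.1.2, smul_eq_mul, mul_one]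

include hγ₀ in
theorem ofRadial_mem {p : LinearMap.ker (initial γ₀) × ℝ} (hp : p ∈ radialTarget γ₀) :
    ofRadial γ₀ p ∈ radialSource γ₀ :=
  ⟨smul_mem_immersions hp.1 (radialFactor_pos hp).ne', by
    change 0 < initial γ₀ _
    rw [initial_ofRadial hγ₀]
    exact radialFactor_pos hp⟩

/-- The chart normalises `γ` to the point of its ray on the affine hyperplane `initial γ₀ = 1`;
since length is homogeneous, the length recovers the scale. -/
theorem ofRadial_toRadial {γ : CurveSpace I} (hγ : γ ∈ radialSource γ₀) :
    ofRadial γ₀ (toRadial hγ₀ γ) = γ := by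
  have h1 := length_pos hγ.1
  have h2 : 0 < initial γ₀ γ := hγ.2
  rw [ofRadial, add_toRadial_fst hγ₀ hγ.2, length_smul hγ.1 (inv_pos.2 hγ.2)]
  change ((1 + (length γ - 1)) * _) • _ = _
  rw [smul_smul]
  convert one_smul ℝ γ
  field_simp
  ring

theorem toRadial_ofRadial {p : LinearMap.ker (initial γ₀) × ℝ} (hp : p ∈ radialTarget γ₀) :
    toRadial hγ₀ (ofRadial γ₀ p) = p := by
  have h1 := radialFactor_pos hp
  refine Prod.ext (Subtype.ext ?_) ?_
  · rw [coe_toRadial_fst hγ₀ (ofRadial_mem hγ₀ hp).2, initial_ofRadial hγ₀, ofRadial, smul_smul,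
      inv_mul_cancel₀ h1.ne', one_smul, add_sub_cancel_left]
  · change length (ofRadial γ₀ p) - 1 = p.2
    rw [ofRadial, length_smul hp.1 h1, mul_assoc, inv_mul_cancel₀ (length_pos hp.1).ne']
    ring

/-- The chart given by the direction and the length of a curve. -/
def radialHomeo : OpenPartialHomeomorph (CurveSpace I) (LinearMap.ker (initial γ₀) × ℝ) :=
  tameHomeo isOpen_radialSource isOpen_radialTarget (tameSmooth_toRadial hγ₀) tameSmooth_ofRadial
    (fun _ h => toRadial_mem hγ₀ h) (fun _ h => ofRadial_mem hγ₀ h)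
    (fun _ h => ofRadial_toRadial hγ₀ h) (fun _ h => toRadial_ofRadial hγ₀ h)

end CurveSpace

open CurveSpace

/-- In the radial chart the second coordinate is the length minus one, so no implicit function
theorem is needed. -/
theorem isTameSubmanifold_lengthOne (I : CurveDomain) :
    IsTameSubmanifold (immersionAtlas I) (LengthOne I) := by
  refine ⟨?_, fun γ _ => ?_⟩
  · have hc : Continuous fun γ : Immersions I => length γ.1 :=
      continuousOn_iff_continuous_domRestrict.1 (tameC_length 0).isTameOn.1
    have : LengthOne I = (fun γ : Immersions I => length γ.1) ⁻¹' {1} :=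
      Set.ext fun γ => mem_lengthOne_iff
    rw [this]
    exact isClosed_singleton.preimage hc
  · refine ⟨_, isSliceChart_restrict (isTameFrechetSpace_ker_initial γ.2) isTameFrechetSpace_real
      (radialHomeo γ.2) (tameSmooth_toRadial γ.2) tameSmooth_ofRadial inter_subset_left
      (fun η _ => ?_) γ, ?_⟩
    · rw [mem_lengthOne_iff]
      exact sub_eq_zero.symm
    · refine ⟨mem_univ _, γ.2, ?_⟩
      change 0 < initial γ.1 γ.1
      rw [initial_self γ.2]
      exact one_pos

/-! ## Curves parameterized by arc length -/

theorem isTameLinear_mul {bc : Option ℝ} [Jet.Unital bc] (g : Jet bc) :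
    IsTameLinear (Jet.mulₗ g) :=
  ⟨0, 0, fun n _ => ⟨(n + 1) * 2 ^ n * gnorm n g, fun f => by
    rw [mul_assoc, add_zero]; exact Jet.gnorm_mul_le n g f⟩⟩

theorem IsTameLinear.sub {E F : Type*} [AddCommGroup E] [Module ℝ E] [Grading E]
    [AddCommGroup F] [Module ℝ F] [Grading F] {L M : E →ₗ[ℝ] F} (hL : IsTameLinear L)
    (hM : IsTameLinear M) : IsTameLinear (L - M) := by
  have : IsTameLinear (-M) := by
    obtain ⟨r, b, h⟩ := hM
    refine ⟨r, b, fun n hn => ?_⟩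
    obtain ⟨C, hC⟩ := h n hn
    exact ⟨C, fun f => by rw [LinearMap.neg_apply, gnorm_neg]; exact hC f⟩
  rw [sub_eq_add_neg]
  exact hL.add this

/-- A unit vector field `e` along `I` with closed primitive, together with functions `s₁, s₂` that
parameterize a complement to the kernel of `f ↦ closing (f e^⊥)`, and the radii of the
neighbourhoods in which the closing condition is solved. -/
structure ArcFrame (I : CurveDomain) where
  e₁ : Jet I.bc
  e₂ : Jet I.bc
  s₁ : Jet I.bc
  s₂ : Jet I.bc
  S : ℝ
  ε : ℝ
  η : ℝ
  unit : ∀ x, Jet.d 0 e₁ x ^ 2 + Jet.d 0 e₂ x ^ 2 = 1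
  closed₁ : closing I e₁ = 0
  closed₂ : closing I e₂ = 0
  bound : ∀ x, |Jet.d 0 s₁ x| + |Jet.d 0 s₂ x| ≤ S
  S_nonneg : 0 ≤ S
  η_pos : 0 < η
  -- The inequalities serve the fixed point problem on the ball of radius `ε`. The bound `η_le` maps
  -- the ball into itself, `η_small` and `sum_small` keep the square of the tangential component
  -- above `1 / 4`, and `prod_small` gives the contraction constant `1 / 3`.
  η_le : 8 * η ≤ ε
  η_small : 8 * η ≤ 1
  sum_small : 4 * (η + S * ε) ≤ 1
  prod_small : 6 * (S * (η + S * ε)) ≤ 1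
  -- The right inverse property is demanded only on values of `μ` and `κ`. It thus also holds on the
  -- interval, where both maps are zero, and there `ker κ` is the whole space.
  section_tangent : ∀ a : Jet I.bc,
    (closing I (-e₂ * (closing I (e₁ * a) • s₁ + closing I (e₂ * a) • s₂)),
      closing I (e₁ * (closing I (e₁ * a) • s₁ + closing I (e₂ * a) • s₂))) =
      (closing I (e₁ * a), closing I (e₂ * a))
  section_normal : ∀ b : Jet I.bc,
    (closing I (-e₂ * (closing I (-e₂ * b) • s₁ + closing I (e₁ * b) • s₂)),
      closing I (e₁ * (closing I (-e₂ * b) • s₁ + closing I (e₁ * b) • s₂))) =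
      (closing I (-e₂ * b), closing I (e₁ * b))

namespace ArcFrame

variable {I : CurveDomain} (e : ArcFrame I)

/-- The defect of closing of the tangential component. -/
def μ : Jet I.bc →ₗ[ℝ] ℝ × ℝ :=
  (closing I ∘ₗ Jet.mulₗ e.e₁).prod (closing I ∘ₗ Jet.mulₗ e.e₂)

/-- The defect of closing of the normal component. -/
def κ : Jet I.bc →ₗ[ℝ] ℝ × ℝ :=
  (closing I ∘ₗ Jet.mulₗ (-e.e₂)).prod (closing I ∘ₗ Jet.mulₗ e.e₁)

/-- A partial right inverse of `κ`. -/
def σ : ℝ × ℝ →ₗ[ℝ] Jet I.bc :=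
  (LinearMap.fst ℝ ℝ ℝ).smulRight e.s₁ + (LinearMap.snd ℝ ℝ ℝ).smulRight e.s₂

theorem μ_apply (a : Jet I.bc) : e.μ a = (closing I (e.e₁ * a), closing I (e.e₂ * a)) := rfl

theorem κ_apply (b : Jet I.bc) : e.κ b = (closing I (-e.e₂ * b), closing I (e.e₁ * b)) := rfl

theorem σ_apply (p : ℝ × ℝ) : e.σ p = p.1 • e.s₁ + p.2 • e.s₂ := rfl

theorem κ_σ_μ (a : Jet I.bc) : e.κ (e.σ (e.μ a)) = e.μ a := e.section_tangent a

theorem κ_σ_κ (b : Jet I.bc) : e.κ (e.σ (e.κ b)) = e.κ b := e.section_normal b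

theorem isTameLinear_μ : IsTameLinear e.μ :=
  ((isTameLinear_closing I).comp (isTameLinear_mul _)).prod
    ((isTameLinear_closing I).comp (isTameLinear_mul _))

theorem isTameLinear_κ : IsTameLinear e.κ :=
  ((isTameLinear_closing I).comp (isTameLinear_mul _)).prod
    ((isTameLinear_closing I).comp (isTameLinear_mul _))

theorem isTameLinear_σ : IsTameLinear e.σ :=
  (isTameLinear_fst.smul_const _).add (isTameLinear_snd.smul_const _)

theorem abs_e₁_le (x : Icc (0 : ℝ) 1) : |Jet.d 0 e.e₁ x| ≤ 1 := by
  rw [← sq_le_one_iff_abs_le_one]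
  nlinarith [e.unit x, sq_nonneg (Jet.d 0 e.e₂ x)]

theorem abs_e₂_le (x : Icc (0 : ℝ) 1) : |Jet.d 0 e.e₂ x| ≤ 1 := by
  rw [← sq_le_one_iff_abs_le_one]
  nlinarith [e.unit x, sq_nonneg (Jet.d 0 e.e₁ x)]

/-- The components of a unit vector are at most one in absolute value, and `closing` is bounded by
the maximum norm. -/
theorem norm_μ_le {a : Jet I.bc} {C : ℝ} (h : ∀ x, |Jet.d 0 a x| ≤ C) : ‖e.μ a‖ ≤ C := by
  have hC : 0 ≤ C := (abs_nonneg _).trans (h 0)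
  have key : ∀ g : Jet I.bc, (∀ x, |Jet.d 0 g x| ≤ 1) → |closing I (g * a)| ≤ C := fun g hg => by
    refine (abs_closing_le I _).trans ((ContinuousMap.norm_le _ hC).2 fun x => ?_)
    rw [Jet.d_zero_mul, norm_mul]
    calc |Jet.d 0 g x| * |Jet.d 0 a x| ≤ 1 * C := by
          gcongr
          · exact hg x
          · exact h x
      _ = C := one_mul C
  exact max_le (key _ e.abs_e₁_le) (key _ e.abs_e₂_le)

theorem abs_σ_le (p : ℝ × ℝ) (x : Icc (0 : ℝ) 1) : |Jet.d 0 (e.σ p) x| ≤ e.S * ‖p‖ := by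
  rw [σ_apply]
  simp only [map_add, map_smul, ContinuousMap.add_apply, ContinuousMap.smul_apply, smul_eq_mul]
  refine (abs_add_le _ _).trans ?_
  rw [abs_mul, abs_mul]
  have h1 : |p.1| ≤ ‖p‖ := norm_fst_le p
  have h2 : |p.2| ≤ ‖p‖ := norm_snd_le p
  calc |p.1| * |Jet.d 0 e.s₁ x| + |p.2| * |Jet.d 0 e.s₂ x|
      ≤ ‖p‖ * |Jet.d 0 e.s₁ x| + ‖p‖ * |Jet.d 0 e.s₂ x| := by gcongr
    _ = (|Jet.d 0 e.s₁ x| + |Jet.d 0 e.s₂ x|) * ‖p‖ := by ring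
    _ ≤ e.S * ‖p‖ := by gcongr; exact e.bound x

/-! ### The closing condition as a fixed point equation in the plane -/

/-- The pairs (normal component, relative speed) for which the closing condition is solved. -/
def small : Set (Jet I.bc × Jet I.bc) := {y | gnorm 0 y.1 < e.η ∧ gnorm 0 y.2 < e.η}

theorem isOpen_small : IsOpen e.small :=
  (isOpen_Iio.preimage ((continuous_gnorm 0).comp continuous_fst)).inter
    (isOpen_Iio.preimage ((continuous_gnorm 0).comp continuous_snd))

variable {e}

theorem abs_fst_le {y : Jet I.bc × Jet I.bc} (hy : y ∈ e.small) (x : Icc (0 : ℝ) 1) :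
    |Jet.d 0 y.1 x| ≤ e.η :=
  ((Jet.d 0 y.1).norm_coe_le_norm x).trans (by rw [← Jet.gnorm_zero_eq]; exact hy.1.le)

theorem abs_snd_le {y : Jet I.bc × Jet I.bc} (hy : y ∈ e.small) (x : Icc (0 : ℝ) 1) :
    |Jet.d 0 y.2 x| ≤ e.η :=
  ((Jet.d 0 y.2).norm_coe_le_norm x).trans (by rw [← Jet.gnorm_zero_eq]; exact hy.2.le)

variable (e)

/-- The normal component. -/
def normal (y : Jet I.bc × Jet I.bc) (p : ℝ × ℝ) : Jet I.bc := y.1 + e.σ p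

/-- The square of the tangential component. -/
def tangentSq (y : Jet I.bc × Jet I.bc) (p : ℝ × ℝ) : Jet I.bc :=
  (Jet.const 1 + y.2) * (Jet.const 1 + y.2) - e.normal y p * e.normal y p

variable {e}

theorem d_normal (y : Jet I.bc × Jet I.bc) (p : ℝ × ℝ) (x : Icc (0 : ℝ) 1) :
    Jet.d 0 (e.normal y p) x = Jet.d 0 y.1 x + Jet.d 0 (e.σ p) x := by
  rw [normal, map_add, ContinuousMap.add_apply]

theorem d_tangentSq (y : Jet I.bc × Jet I.bc) (p : ℝ × ℝ) (x : Icc (0 : ℝ) 1) :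
    Jet.d 0 (e.tangentSq y p) x = (1 + Jet.d 0 y.2 x) ^ 2 - Jet.d 0 (e.normal y p) x ^ 2 := by
  rw [tangentSq]
  simp only [map_sub, map_add, ContinuousMap.sub_apply, ContinuousMap.add_apply, Jet.d_zero_mul,
    Jet.d_zero_const]
  ring

theorem abs_normal_le {y : Jet I.bc × Jet I.bc} (hy : y ∈ e.small) {p : ℝ × ℝ} (hp : ‖p‖ ≤ e.ε)
    (x : Icc (0 : ℝ) 1) : |Jet.d 0 (e.normal y p) x| ≤ e.η + e.S * e.ε := by
  rw [d_normal]
  refine (abs_add_le _ _).trans (add_le_add (abs_fst_le hy x) ((e.abs_σ_le p x).trans ?_))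
  exact mul_le_mul_of_nonneg_left hp e.S_nonneg

/-- The relative speed is at least `-1 / 8` and the normal component at most `1 / 4` in absolute
value, which leaves more than `1 / 4`. -/
theorem le_tangentSq {y : Jet I.bc × Jet I.bc} (hy : y ∈ e.small) {p : ℝ × ℝ} (hp : ‖p‖ ≤ e.ε)
    (x : Icc (0 : ℝ) 1) : 1 / 4 ≤ Jet.d 0 (e.tangentSq y p) x := by
  rw [d_tangentSq]
  have h1 := abs_le.1 (abs_normal_le hy hp x)
  have h2 := abs_le.1 (abs_snd_le hy x)
  have h3 := e.sum_small
  have h4 := e.η_small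
  nlinarith

theorem tangentSq_mem {y : Jet I.bc × Jet I.bc} (hy : y ∈ e.small) {p : ℝ × ℝ} (hp : ‖p‖ ≤ e.ε) :
    e.tangentSq y p ∈ Jet.positive I.bc := fun x => by
  linarith [le_tangentSq hy hp x]

/-- Here `√a + √b ≥ 1`, so the square root is `1`-Lipschitz on this range; this is the reason for
the threshold `1 / 4`. -/
theorem abs_sqrt_sub_sqrt_le {a b : ℝ} (ha : 1 / 4 ≤ a) (hb : 1 / 4 ≤ b) :
    |√a - √b| ≤ |a - b| := by
  have h1 : 1 / 2 ≤ √a := Real.le_sqrt_of_sq_le (by linarith)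
  have h2 : 1 / 2 ≤ √b := Real.le_sqrt_of_sq_le (by linarith)
  have h3 : a - b = (√a - √b) * (√a + √b) := by
    have h4 := Real.mul_self_sqrt (by linarith : 0 ≤ a)
    have h5 := Real.mul_self_sqrt (by linarith : 0 ≤ b)
    linear_combination h5 - h4
  rw [h3, abs_mul, abs_of_pos (by linarith : 0 < √a + √b)]
  exact le_mul_of_one_le_right (abs_nonneg _) (by linarith)

variable (e)

/-- The right-hand side of the closing condition `p = Φ p`. -/
def Φ (y : Jet I.bc × Jet I.bc) (p : ℝ × ℝ) : ℝ × ℝ := -e.μ (Jet.sqrt (e.tangentSq y p))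

variable {e}

theorem norm_Φ_sub_le {y y' : Jet I.bc × Jet I.bc} (hy : y ∈ e.small) (hy' : y' ∈ e.small)
    {p q : ℝ × ℝ} (hp : ‖p‖ ≤ e.ε) (hq : ‖q‖ ≤ e.ε) {C : ℝ}
    (h : ∀ x, |Jet.d 0 (e.tangentSq y p) x - Jet.d 0 (e.tangentSq y' q) x| ≤ C) :
    ‖e.Φ y p - e.Φ y' q‖ ≤ C := by
  rw [Φ, Φ, neg_sub_neg, ← map_sub]
  refine e.norm_μ_le fun x => ?_
  rw [map_sub, ContinuousMap.sub_apply, Jet.d_zero_sqrt (tangentSq_mem hy hp),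
    Jet.d_zero_sqrt (tangentSq_mem hy' hq), abs_sub_comm]
  exact (abs_sqrt_sub_sqrt_le (le_tangentSq hy hp x) (le_tangentSq hy' hq x)).trans (h x)

/-- The squares of the normal components differ by `σ (p - q)` times their sum, which is at most `2
S (η + S ε) ‖p - q‖`. -/
theorem norm_Φ_sub_le_third {y : Jet I.bc × Jet I.bc} (hy : y ∈ e.small) {p q : ℝ × ℝ}
    (hp : ‖p‖ ≤ e.ε) (hq : ‖q‖ ≤ e.ε) : ‖e.Φ y p - e.Φ y q‖ ≤ 1 / 3 * ‖p - q‖ := by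
  refine norm_Φ_sub_le hy hy hp hq fun x => ?_
  have h1 : Jet.d 0 (e.tangentSq y p) x - Jet.d 0 (e.tangentSq y q) x =
      -(Jet.d 0 (e.σ (p - q)) x * (Jet.d 0 (e.normal y p) x + Jet.d 0 (e.normal y q) x)) := by
    rw [d_tangentSq, d_tangentSq, d_normal, d_normal, map_sub, map_sub, ContinuousMap.sub_apply]
    ring
  rw [h1, abs_neg, abs_mul]
  have h2 := e.abs_σ_le (p - q) x
  have h3 := (abs_add_le (Jet.d 0 (e.normal y p) x) (Jet.d 0 (e.normal y q) x)).trans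
    (add_le_add (abs_normal_le hy hp x) (abs_normal_le hy hq x))
  have h4 := norm_nonneg (p - q)
  calc _ ≤ (e.S * ‖p - q‖) * ((e.η + e.S * e.ε) + (e.η + e.S * e.ε)) :=
        mul_le_mul h2 h3 (abs_nonneg _) (mul_nonneg e.S_nonneg h4)
    _ = 2 * (e.S * (e.η + e.S * e.ε)) * ‖p - q‖ := by ring
    _ ≤ 1 / 3 * ‖p - q‖ := by
      gcongr
      linarith [e.prod_small]

theorem ε_pos : 0 < e.ε := by linarith [e.η_pos, e.η_le]

/-- Because `e` is closed, `μ 1 = 0`; so only the deviation of the tangential component from `1`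
counts, and it is of size `η`. -/
theorem norm_Φ_zero_le {y : Jet I.bc × Jet I.bc} (hy : y ∈ e.small) : ‖e.Φ y 0‖ ≤ 3 * e.η := by
  have h0 : e.μ (Jet.const 1) = 0 := by
    have h1 : ∀ g : Jet I.bc, g * Jet.const 1 = g := fun g => Jet.ext_zero fun x => by simp
    rw [μ_apply, h1, h1, e.closed₁, e.closed₂]
    rfl
  have hz : ‖(0 : ℝ × ℝ)‖ ≤ e.ε := by rw [norm_zero]; exact ε_pos.le
  have h1 : e.Φ y 0 = -e.μ (Jet.sqrt (e.tangentSq y 0) - Jet.const 1) := by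
    rw [Φ, map_sub, h0, sub_zero]
  rw [h1, norm_neg]
  refine e.norm_μ_le fun x => ?_
  rw [map_sub, ContinuousMap.sub_apply, Jet.d_zero_sqrt (tangentSq_mem hy hz), Jet.d_zero_const]
  have h2 := abs_sqrt_sub_sqrt_le (le_tangentSq hy hz x) (by norm_num : (1 : ℝ) / 4 ≤ 1)
  rw [Real.sqrt_one] at h2
  refine h2.trans ?_
  rw [d_tangentSq, d_normal, map_zero, map_zero, ContinuousMap.zero_apply, add_zero]
  have h3 := abs_le.1 (abs_fst_le hy x)
  have h4 := abs_le.1 (abs_snd_le hy x)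
  have h5 := e.η_small
  have h6 := e.η_pos
  rw [abs_le]
  constructor <;> nlinarith

theorem norm_Φ_le {y : Jet I.bc × Jet I.bc} (hy : y ∈ e.small) {p : ℝ × ℝ} (hp : ‖p‖ ≤ e.ε) :
    ‖e.Φ y p‖ ≤ 1 / 3 * ‖p‖ + 3 * e.η := by
  have h1 := norm_Φ_sub_le_third hy hp (q := 0) (by rw [norm_zero]; exact ε_pos.le)
  rw [sub_zero] at h1
  calc ‖e.Φ y p‖ ≤ ‖e.Φ y p - e.Φ y 0‖ + ‖e.Φ y 0‖ := norm_le_norm_sub_add _ _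
    _ ≤ _ := add_le_add h1 (norm_Φ_zero_le hy)

theorem exists_fixed {y : Jet I.bc × Jet I.bc} (hy : y ∈ e.small) :
    ∃ p, ‖p‖ ≤ e.ε ∧ e.Φ y p = p := by
  have hmaps : MapsTo (e.Φ y) (Metric.closedBall 0 e.ε) (Metric.closedBall 0 e.ε) := fun p hp => by
    rw [mem_closedBall_zero_iff] at hp ⊢
    refine (norm_Φ_le hy hp).trans ?_
    linarith [e.η_le, e.η_pos]
  have hcon : ContractingWith (1 / 3) (hmaps.restrict (e.Φ y) _ _) := by
    refine ⟨by rw [← NNReal.coe_lt_coe]; norm_num, LipschitzWith.of_dist_le_mul fun p q => ?_⟩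
    rw [Subtype.dist_eq, Subtype.dist_eq, dist_eq_norm, dist_eq_norm]
    have := norm_Φ_sub_le_third hy (mem_closedBall_zero_iff.1 p.2) (mem_closedBall_zero_iff.1 q.2)
    simpa using this
  obtain ⟨p, hp, hfix, -⟩ := hcon.exists_fixedPoint' Metric.isClosed_closedBall.isComplete hmaps
    (Metric.mem_closedBall_self ε_pos.le) (edist_ne_top _ _)
  exact ⟨p, mem_closedBall_zero_iff.1 hp, hfix⟩

variable (e) in
open Classical in
/-- The solution of the closing condition. -/
def fix (y : Jet I.bc × Jet I.bc) : ℝ × ℝ :=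
  if h : ∃ p, ‖p‖ ≤ e.ε ∧ e.Φ y p = p then h.choose else 0

theorem norm_fix_le {y : Jet I.bc × Jet I.bc} (hy : y ∈ e.small) : ‖e.fix y‖ ≤ e.ε := by
  rw [fix, dif_pos (exists_fixed hy)]
  exact (exists_fixed hy).choose_spec.1

theorem Φ_fix {y : Jet I.bc × Jet I.bc} (hy : y ∈ e.small) : e.Φ y (e.fix y) = e.fix y := by
  rw [fix, dif_pos (exists_fixed hy)]
  exact (exists_fixed hy).choose_spec.2

theorem norm_fix_lt {y : Jet I.bc × Jet I.bc} (hy : y ∈ e.small) : ‖e.fix y‖ < e.ε := by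
  have h := norm_Φ_le hy (norm_fix_le hy)
  rw [Φ_fix hy] at h
  linarith [e.η_le, e.η_pos]

theorem eq_fix {y : Jet I.bc × Jet I.bc} (hy : y ∈ e.small) {p : ℝ × ℝ} (hp : ‖p‖ ≤ e.ε)
    (h : e.Φ y p = p) : p = e.fix y := by
  have h1 := norm_Φ_sub_le_third hy hp (norm_fix_le hy)
  rw [h, Φ_fix hy] at h1
  rw [← sub_eq_zero, ← norm_eq_zero]
  linarith [norm_nonneg (p - e.fix y)]

/-- Comparison through `Φ y' (fix y)`: the dependence of `Φ` on `y` has Lipschitz constant `3`, and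
the contraction turns it into `3 / (1 - 1 / 3) ≤ 5`. -/
theorem norm_fix_sub_le {y y' : Jet I.bc × Jet I.bc} (hy : y ∈ e.small) (hy' : y' ∈ e.small) :
    ‖e.fix y' - e.fix y‖ ≤ 5 * gnorm 0 (y' - y) := by
  have h1 := norm_Φ_sub_le_third hy' (norm_fix_le hy') (norm_fix_le hy)
  have h2 : ‖e.Φ y' (e.fix y) - e.Φ y (e.fix y)‖ ≤ 3 * gnorm 0 (y' - y) := by
    refine norm_Φ_sub_le hy' hy (norm_fix_le hy) (norm_fix_le hy) fun x => ?_
    have h3 : Jet.d 0 (e.tangentSq y' (e.fix y)) x - Jet.d 0 (e.tangentSq y (e.fix y)) x =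
        Jet.d 0 (y' - y).2 x * (2 + Jet.d 0 y'.2 x + Jet.d 0 y.2 x) - Jet.d 0 (y' - y).1 x *
          (Jet.d 0 (e.normal y' (e.fix y)) x + Jet.d 0 (e.normal y (e.fix y)) x) := by
      rw [d_tangentSq, d_tangentSq, d_normal, d_normal, Prod.fst_sub, Prod.snd_sub, map_sub, map_sub,
        ContinuousMap.sub_apply, ContinuousMap.sub_apply]
      ring
    have h4 : |Jet.d 0 (y' - y).1 x| ≤ gnorm 0 (y' - y).1 := by
      rw [Jet.gnorm_zero_eq]; exact (Jet.d 0 (y' - y).1).norm_coe_le_norm x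
    have h5 : |Jet.d 0 (y' - y).2 x| ≤ gnorm 0 (y' - y).2 := by
      rw [Jet.gnorm_zero_eq]; exact (Jet.d 0 (y' - y).2).norm_coe_le_norm x
    have h6 : |2 + Jet.d 0 y'.2 x + Jet.d 0 y.2 x| ≤ 3 := by
      have h7 := abs_le.1 (abs_snd_le hy x)
      have h8 := abs_le.1 (abs_snd_le hy' x)
      have h9 := e.η_small
      rw [abs_le]
      constructor <;> linarith
    have h7 : |Jet.d 0 (e.normal y' (e.fix y)) x + Jet.d 0 (e.normal y (e.fix y)) x| ≤ 3 := by
      have h8 := abs_normal_le hy (norm_fix_le hy) x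
      have h9 := abs_normal_le hy' (norm_fix_le hy) x
      have h10 := e.sum_small
      refine (abs_add_le _ _).trans ?_
      linarith
    rw [h3, gnorm_prod]
    refine (abs_sub _ _).trans ?_
    rw [abs_mul, abs_mul]
    have := gnorm_nonneg 0 (y' - y).1
    have := gnorm_nonneg 0 (y' - y).2
    calc _ ≤ gnorm 0 (y' - y).2 * 3 + gnorm 0 (y' - y).1 * 3 := by gcongr
      _ = _ := by ring
  rw [Φ_fix hy'] at h1
  rw [Φ_fix hy] at h2
  have h3 := norm_sub_le_norm_sub_add_norm_sub (e.fix y') (e.Φ y' (e.fix y)) (e.fix y)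
  have := gnorm_nonneg 0 (y' - y)
  linarith

/-- The values lie in the plane, where continuity alone gives the tame estimate. -/
theorem isTameOn_fix : IsTameOn e.fix e.small := by
  have hc : ContinuousOn e.fix e.small := fun y hy => by
    rw [ContinuousWithinAt, tendsto_iff_norm_sub_tendsto_zero]
    have h1 : Tendsto (fun y' => 5 * gnorm 0 (y' - y)) (𝓝[e.small] y) (𝓝 0) := by
      have h2 : Continuous fun y' : Jet I.bc × Jet I.bc => 5 * gnorm 0 (y' - y) :=
        continuous_const.mul ((continuous_gnorm 0).comp (continuous_id.sub continuous_const))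
      have h3 := h2.tendsto y
      rw [sub_self, gnorm_zero, mul_zero] at h3
      exact h3.mono_left nhdsWithin_le_nhds
    refine squeeze_zero' (Eventually.of_forall fun _ => norm_nonneg _) ?_ h1
    filter_upwards [self_mem_nhdsWithin] with y' hy'
    exact norm_fix_sub_le hy hy'
  exact (isTameOn_real (P := fun y => (e.fix y).1) (continuous_fst.comp_continuousOn hc)).prodMk
    (isTameOn_real (P := fun y => (e.fix y).2) (continuous_snd.comp_continuousOn hc))

/-! ### Smooth tame dependence of the solution of the closing condition -/

/-- Cramer's rule. -/
def cramer (M N v : ℝ × ℝ) : ℝ × ℝ :=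
  (((1 - N.2) * v.1 + N.1 * v.2) / ((1 - M.1) * (1 - N.2) - N.1 * M.2),
    (M.2 * v.1 + (1 - M.1) * v.2) / ((1 - M.1) * (1 - N.2) - N.1 * M.2))

/-- The diagonal product is at least `4 / 9` and the other one at most `1 / 9`. -/
theorem cramer_det_pos {M N : ℝ × ℝ} (hM : ‖M‖ ≤ 1 / 3) (hN : ‖N‖ ≤ 1 / 3) :
    0 < (1 - M.1) * (1 - N.2) - N.1 * M.2 := by
  have h1 := abs_le.1 ((norm_fst_le M).trans hM)
  have h2 := abs_le.1 ((norm_snd_le M).trans hM)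
  have h3 := abs_le.1 ((norm_fst_le N).trans hN)
  have h4 := abs_le.1 ((norm_snd_le N).trans hN)
  nlinarith

theorem eq_cramer {M N v q : ℝ × ℝ} (hM : ‖M‖ ≤ 1 / 3) (hN : ‖N‖ ≤ 1 / 3)
    (h : q = v + (q.1 • M + q.2 • N)) : q = cramer M N v := by
  have hD := (cramer_det_pos hM hN).ne'
  have h1 := congrArg Prod.fst h
  have h2 := congrArg Prod.snd h
  simp only [Prod.fst_add, Prod.snd_add, Prod.smul_fst, Prod.smul_snd, smul_eq_mul] at h1 h2
  refine Prod.ext ?_ ?_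
  · simp only [cramer]
    rw [eq_div_iff hD]
    linear_combination (1 - N.2) * h1 + N.1 * h2
  · simp only [cramer]
    rw [eq_div_iff hD]
    linear_combination M.2 * h1 + (1 - M.1) * h2

theorem cramer_smul (M N v : ℝ × ℝ) (t : ℝ) : cramer M N (t • v) = t • cramer M N v := by
  refine Prod.ext ?_ ?_ <;> simp [cramer] <;> ring

theorem _root_.TameC.cramer {E : Type} [AddCommGroup E] [Module ℝ E] [TopologicalSpace E]
    [Grading E] [GradedLC E] {n : ℕ} {M N v : E → ℝ × ℝ} {U : Set E} (hU : IsOpen U)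
    (hM : TameC n M U) (hN : TameC n N U) (hv : TameC n v U) (hM' : ∀ x ∈ U, ‖M x‖ ≤ 1 / 3)
    (hN' : ∀ x ∈ U, ‖N x‖ ≤ 1 / 3) : TameC n (fun x => cramer (M x) (N x) (v x)) U := by
  have hM1 : TameC n (fun x => 1 - (M x).1) U := (TameC.const 1 U).sub hU (hM.fst hU)
  have hN2 : TameC n (fun x => 1 - (N x).2) U := (TameC.const 1 U).sub hU (hN.snd hU)
  have hD := (hM1.mul_real hU hN2).sub hU ((hN.fst hU).mul_real hU (hM.snd hU))
  have hD0 := fun x hx => (cramer_det_pos (hM' x hx) (hN' x hx)).ne'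
  exact ((((hN2.mul_real hU (hv.fst hU)).add hU ((hN.fst hU).mul_real hU (hv.snd hU))).div_real
    hU hD hD0).prodMk (((hM.snd hU).mul_real hU (hv.fst hU)).add hU
      (hM1.mul_real hU (hv.snd hU)) |>.div_real hU hD hD0))

variable (e)

/-- The tangential component. -/
def tangent (y : Jet I.bc × Jet I.bc) : Jet I.bc := Jet.sqrt (e.tangentSq y (e.fix y))

/-- The sum of normal components over the sum of tangential components. -/
def ratio (y' y : Jet I.bc × Jet I.bc) : Jet I.bc :=
  Jet.inv (e.tangent y' + e.tangent y) * (e.normal y' (e.fix y') + e.normal y (e.fix y))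

/-- The increment of the closing defect that is caused by an increment of `y`. -/
def defect (y' y h : Jet I.bc × Jet I.bc) : ℝ × ℝ :=
  -e.μ (Jet.inv (e.tangent y' + e.tangent y) * (h.2 * (Jet.const 2 + y'.2 + y.2)) -
    e.ratio y' y * h.1)

variable {e}

theorem tangent_mem {y : Jet I.bc × Jet I.bc} (hy : y ∈ e.small) : e.tangent y ∈ Jet.positive I.bc :=
  Jet.sqrt_mem_positive (tangentSq_mem hy (norm_fix_le hy))

theorem tangent_add_mem {y y' : Jet I.bc × Jet I.bc} (hy' : y' ∈ e.small) (hy : y ∈ e.small) :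
    e.tangent y' + e.tangent y ∈ Jet.positive I.bc :=
  Jet.add_mem_positive (tangent_mem hy') (tangent_mem hy)

/-- Subtract the two fixed point equations and use the increment formula of the square root. The
increment of the normal component contains `σ (fix y' - fix y)`, so the result is a linear system
for `fix y' - fix y` whose right-hand side is linear in `y' - y`. -/
theorem fix_sub_fix {y y' : Jet I.bc × Jet I.bc} (hy' : y' ∈ e.small) (hy : y ∈ e.small) :
    e.fix y' - e.fix y = e.defect y' y (y' - y) +
      ((e.fix y' - e.fix y).1 • e.μ (e.ratio y' y * e.s₁) +
        (e.fix y' - e.fix y).2 • e.μ (e.ratio y' y * e.s₂)) := by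
  have h1 : e.fix y' - e.fix y = -e.μ (e.tangent y' - e.tangent y) := by
    have ha : e.fix y' = -e.μ (e.tangent y') := (Φ_fix hy').symm
    have hb : e.fix y = -e.μ (e.tangent y) := (Φ_fix hy).symm
    rw [map_sub]
    conv_lhs => rw [ha, hb]
    abel
  have h2 : e.tangent y' - e.tangent y =
      Jet.inv (e.tangent y' + e.tangent y) * ((y' - y).2 * (Jet.const 2 + y'.2 + y.2)) -
        e.ratio y' y * (y' - y).1 - ((e.fix y' - e.fix y).1 • (e.ratio y' y * e.s₁) +
          (e.fix y' - e.fix y).2 • (e.ratio y' y * e.s₂)) := by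
    have h3 := Jet.sqrt_sub_sqrt (tangentSq_mem hy' (norm_fix_le hy'))
      (tangentSq_mem hy (norm_fix_le hy))
    change e.tangent y' - e.tangent y = Jet.inv (e.tangent y' + e.tangent y) * _ at h3
    rw [h3]
    refine Jet.ext_zero fun x => ?_
    simp only [ratio, tangentSq, normal, σ_apply, map_add, map_sub, map_smul, Jet.d_zero_mul,
      ContinuousMap.add_apply, ContinuousMap.sub_apply, ContinuousMap.smul_apply, smul_eq_mul,
      Jet.d_zero_const, Prod.fst_sub, Prod.snd_sub]
    ring
  rw [defect, ← map_smul, ← map_smul, ← map_add]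
  conv_lhs => rw [h1, h2, map_sub, neg_sub']
  rw [sub_neg_eq_add]

/-- Both tangential components are at least `1 / 2`, so the inverse of their sum is at most `1`; the
normal components contribute `2 (η + S ε)`, and `prod_small` gives the bound that Cramer's rule
needs. -/
theorem norm_μ_ratio_le {y y' : Jet I.bc × Jet I.bc} (hy' : y' ∈ e.small) (hy : y ∈ e.small)
    {s : Jet I.bc} (hs : ∀ x, |Jet.d 0 s x| ≤ e.S) : ‖e.μ (e.ratio y' y * s)‖ ≤ 1 / 3 := by
  refine e.norm_μ_le fun x => ?_
  rw [ratio]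
  simp only [map_add, Jet.d_zero_mul, ContinuousMap.add_apply]
  rw [Jet.d_zero_inv (tangent_add_mem hy' hy), abs_mul, abs_mul]
  have hhalf : ∀ {y}, y ∈ e.small → 1 / 2 ≤ Jet.d 0 (e.tangent y) x := fun {y} hy => by
    rw [tangent, Jet.d_zero_sqrt (tangentSq_mem hy (norm_fix_le hy))]
    exact Real.le_sqrt_of_sq_le (by linarith [le_tangentSq hy (norm_fix_le hy) x])
  have h1 : |(Jet.d 0 (e.tangent y' + e.tangent y) x)⁻¹| ≤ 1 := by
    rw [map_add, ContinuousMap.add_apply]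
    have h2 := hhalf hy'
    have h3 := hhalf hy
    rw [abs_of_pos (by positivity)]
    exact inv_le_one_of_one_le₀ (by linarith)
  have h4 := (abs_add_le (Jet.d 0 (e.normal y' (e.fix y')) x)
    (Jet.d 0 (e.normal y (e.fix y)) x)).trans
    (add_le_add (abs_normal_le hy' (norm_fix_le hy') x) (abs_normal_le hy (norm_fix_le hy) x))
  have h5 := e.prod_small
  have h6 : 0 ≤ e.η + e.S * e.ε := by
    have := mul_nonneg e.S_nonneg (ε_pos (e := e)).le
    linarith [e.η_pos]
  calc _ ≤ 1 * ((e.η + e.S * e.ε) + (e.η + e.S * e.ε)) * e.S := by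
        gcongr
        exact hs x
    _ ≤ 1 / 3 := by linarith

theorem fix_sub_eq_cramer {y y' : Jet I.bc × Jet I.bc} (hy' : y' ∈ e.small) (hy : y ∈ e.small) :
    e.fix y' - e.fix y = cramer (e.μ (e.ratio y' y * e.s₁)) (e.μ (e.ratio y' y * e.s₂))
      (e.defect y' y (y' - y)) :=
  eq_cramer
    (norm_μ_ratio_le hy' hy fun x => (le_add_of_nonneg_right (abs_nonneg _)).trans (e.bound x))
    (norm_μ_ratio_le hy' hy fun x => (le_add_of_nonneg_left (abs_nonneg _)).trans (e.bound x))
    (fix_sub_fix hy' hy)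

theorem tameC_normal {n : ℕ} {V : Set (Jet I.bc × Jet I.bc)} (hV : IsOpen V)
    (h : TameC n e.fix V) : TameC n (fun y => e.normal y (e.fix y)) V :=
  ((TameC.id _).fst hV).add hV (h.linear_comp e.isTameLinear_σ hV)

theorem tameC_tangent {n : ℕ} (h : TameC n e.fix e.small) : TameC n e.tangent e.small := by
  have hV := e.isOpen_small
  have h1 := tameC_normal hV h
  have h2 : TameC n (fun y : Jet I.bc × Jet I.bc => Jet.const 1 + y.2) e.small :=
    (TameC.const _ _).add hV ((TameC.id _).snd hV)
  exact TameC.sqrt hV ((h2.mul hV h2).sub hV (h1.mul hV h1))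
    fun y hy => tangentSq_mem hy (norm_fix_le hy)

/-- The increment of `fix` is, by Cramer's rule, an expression in `fix y'`, `fix y` and `y' - y`
composed of smooth tame operations and homogeneous in the last variable. So `n` tame derivatives of
`fix` produce `n + 1`. -/
theorem tameC_fix (n : ℕ) : TameC n e.fix e.small := by
  induction n with
  | zero => exact isTameOn_fix
  | succ n ih =>
    have hU : IsOpen (e.small ×ˢ e.small ×ˢ (univ : Set (Jet I.bc × Jet I.bc))) :=
      e.isOpen_small.prod (e.isOpen_small.prod isOpen_univ)
    refine TameC.of_increment (Q := fun q => cramer (e.μ (e.ratio q.1 q.2.1 * e.s₁))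
      (e.μ (e.ratio q.1 q.2.1 * e.s₂)) (e.defect q.1 q.2.1 q.2.2)) e.isOpen_small isTameOn_fix
      (fun y' hy' y hy => fix_sub_eq_cramer hy' hy) (fun y' _ y _ t h => ?_) ?_
    · rw [← cramer_smul]
      congr 1
      rw [defect, defect, smul_neg, ← map_smul]
      congr 2
      refine Jet.ext_zero fun x => ?_
      simp only [map_sub, map_smul, Jet.d_zero_mul, ContinuousMap.sub_apply,
        ContinuousMap.smul_apply, smul_eq_mul, Prod.smul_fst, Prod.smul_snd]
      ring
    · have hf : TameC n (fun q : (Jet I.bc × Jet I.bc) × (Jet I.bc × Jet I.bc) ×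
          (Jet I.bc × Jet I.bc) => q.1) (e.small ×ˢ e.small ×ˢ univ) := (TameC.id _).fst hU
      have hs : TameC n (fun q : (Jet I.bc × Jet I.bc) × (Jet I.bc × Jet I.bc) ×
          (Jet I.bc × Jet I.bc) => q.2.1) (e.small ×ˢ e.small ×ˢ univ) :=
        ((TameC.id _).snd hU).fst hU
      have hh : TameC n (fun q : (Jet I.bc × Jet I.bc) × (Jet I.bc × Jet I.bc) ×
          (Jet I.bc × Jet I.bc) => q.2.2) (e.small ×ˢ e.small ×ˢ univ) :=
        ((TameC.id _).snd hU).snd hU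
      have hn := tameC_normal e.isOpen_small ih
      have ht := tameC_tangent ih
      have hinv := TameC.inv hU ((ht.comp hU e.isOpen_small hf fun q hq => hq.1).add hU
        (ht.comp hU e.isOpen_small hs fun q hq => hq.2.1)) fun q hq => tangent_add_mem hq.1 hq.2.1
      have hr : TameC n (fun q : (Jet I.bc × Jet I.bc) × (Jet I.bc × Jet I.bc) ×
          (Jet I.bc × Jet I.bc) => e.ratio q.1 q.2.1) (e.small ×ˢ e.small ×ˢ univ) :=
        hinv.mul hU ((hn.comp hU e.isOpen_small hf fun q hq => hq.1).add hU
          (hn.comp hU e.isOpen_small hs fun q hq => hq.2.1))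
      refine TameC.cramer hU
        ((hr.mul hU (TameC.const _ _)).linear_comp e.isTameLinear_μ hU)
        ((hr.mul hU (TameC.const _ _)).linear_comp e.isTameLinear_μ hU) ?_
        (fun q hq => norm_μ_ratio_le hq.1 hq.2.1 fun x =>
          (le_add_of_nonneg_right (abs_nonneg _)).trans (e.bound x))
        (fun q hq => norm_μ_ratio_le hq.1 hq.2.1 fun x =>
          (le_add_of_nonneg_left (abs_nonneg _)).trans (e.bound x))
      refine TameC.neg hU (TameC.linear_comp e.isTameLinear_μ hU ?_)
      exact (hinv.mul hU ((hh.snd hU).mul hU (((TameC.const _ _).add hU (hf.snd hU)).add hU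
        (hs.snd hU)))).sub hU (hr.mul hU (hh.fst hU))

end ArcFrame

/-! ### Existence of frames -/

theorem Jet.eq_zero_of_integral_sq {bc : Option ℝ} [Jet.Unital bc] {b : Jet bc}
    (h : Jet.integral (b * b) = 0) (x : Icc (0 : ℝ) 1) : Jet.d 0 b x = 0 := by
  by_contra hx
  have h1 : 0 < ∫ t in (0 : ℝ)..1, lineExtend (Jet.d 0 (b * b)) t :=
    intervalIntegral.integral_pos one_pos (continuous_lineExtend _).continuousOn
      (fun t ht => by
        rw [lineExtend_of_mem _ (Ioc_subset_Icc_self ht), Jet.d_zero_mul]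
        exact mul_self_nonneg _)
      ⟨x, x.2, by rw [lineExtend_apply, Jet.d_zero_mul]; exact mul_self_pos.2 hx⟩
  rw [← Jet.integral_eq_intervalIntegral (b * b) fun x => lineExtend_apply _ x, h] at h1
  exact lt_irrefl _ h1

/-- If `b ↦ ∫ b e^⊥` were not onto the plane, a nonzero linear form `(u, v)` would vanish on its
range. Then `e` would be parallel to `(u, v)` everywhere, hence constant, and its integral could not
be zero. -/
theorem Jet.exists_integral_section {bc : Option ℝ} [Jet.Unital bc] {e₁ e₂ : Jet bc}
    (unit : ∀ x, Jet.d 0 e₁ x ^ 2 + Jet.d 0 e₂ x ^ 2 = 1) (h₁ : Jet.integral e₁ = 0)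
    (h₂ : Jet.integral e₂ = 0) : ∃ s₁ s₂ : Jet bc, ∀ p : ℝ × ℝ,
      (Jet.integral (-e₂ * (p.1 • s₁ + p.2 • s₂)), Jet.integral (e₁ * (p.1 • s₁ + p.2 • s₂))) =
        p := by
  let K : Jet bc →ₗ[ℝ] ℝ × ℝ :=
    (Jet.integral ∘ₗ Jet.mulₗ (-e₂)).prod (Jet.integral ∘ₗ Jet.mulₗ e₁)
  have hK : ∀ b, K b = (Jet.integral (-e₂ * b), Jet.integral (e₁ * b)) := fun b => rfl
  have hsurj : LinearMap.range K = ⊤ := by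
    by_contra hne
    obtain ⟨f, hf, hle⟩ := Submodule.exists_le_ker_of_lt_top _ (lt_top_iff_ne_top.2 hne)
    set u := f (1, 0)
    set v := f (0, 1)
    have hfp : ∀ p : ℝ × ℝ, f p = p.1 * u + p.2 * v := fun p => by
      have : p = p.1 • (1, 0) + p.2 • (0, 1) := by ext <;> simp
      conv_lhs => rw [this, map_add, map_smul, map_smul]
      rfl
    -- This choice makes the linear form applied to `K b` equal to `∫ b²`, so `b` vanishes
    -- identically.
    set b : Jet bc := v • e₁ - u • e₂
    have hb : Jet.integral (b * b) = 0 := by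
      have h3 : f (K b) = 0 := hle ⟨b, rfl⟩
      rw [hfp, hK] at h3
      have h4 : b * b = u • (-e₂ * b) + v • (e₁ * b) := Jet.ext_zero fun x => by
        simp [b]; ring
      rw [h4, map_add, map_smul, map_smul, smul_eq_mul, smul_eq_mul]
      linarith
    have hb0 : ∀ x, v * Jet.d 0 e₁ x - u * Jet.d 0 e₂ x = 0 := fun x => by
      simpa [b] using Jet.eq_zero_of_integral_sq hb x
    have huv : 0 < u ^ 2 + v ^ 2 := by
      by_contra h0
      have hu : u = 0 := by nlinarith [sq_nonneg u, sq_nonneg v]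
      have hv : v = 0 := by nlinarith [sq_nonneg u, sq_nonneg v]
      exact hf (LinearMap.ext fun p => by rw [hfp, hu, hv]; simp)
    set g : Jet bc := u • e₁ + v • e₂
    have hg : ∀ x, Jet.d 0 g x = u * Jet.d 0 e₁ x + v * Jet.d 0 e₂ x := fun x => by simp [g]
    have hgint : Jet.integral g = 0 := by simp [g, h₁, h₂]
    have hpos := Real.sqrt_pos.2 huv
    -- Now `g² = u² + v²` is a nonzero constant, so `g` has constant sign on the connected interval,
    -- against `∫ g = 0`.
    rcases isPreconnected_univ.eq_or_eq_neg_of_sq_eq (f := Jet.d 0 g)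
      (g := fun _ : Icc (0 : ℝ) 1 => √(u ^ 2 + v ^ 2)) (Jet.d 0 g).continuous.continuousOn
      continuousOn_const (fun x _ => by
        simp only [Pi.pow_apply]
        rw [Real.sq_sqrt huv.le, hg]
        linear_combination (u ^ 2 + v ^ 2) * unit x - (v * Jet.d 0 e₁ x - u * Jet.d 0 e₂ x) * hb0 x)
      (fun {x} _ => hpos.ne') with h | h
    · have hp : g ∈ Jet.positive bc := fun x => (h (mem_univ x)).symm ▸ hpos
      exact (Jet.integral_pos hp).ne' hgint
    · have hp : -g ∈ Jet.positive bc := fun x => by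
        rw [map_neg, ContinuousMap.neg_apply, h (mem_univ x), Pi.neg_apply, neg_neg]
        exact hpos
      have h5 := Jet.integral_pos hp
      rw [map_neg, hgint, neg_zero] at h5
      exact lt_irrefl _ h5
  obtain ⟨σ, hσ⟩ := K.exists_rightInverse_of_surjective hsurj
  refine ⟨σ (1, 0), σ (0, 1), fun p => ?_⟩
  rw [← hK, ← map_smul, ← map_smul, ← map_add]
  have : p.1 • ((1, 0) : ℝ × ℝ) + p.2 • (0, 1) = p := by ext <;> simp
  rw [this]
  exact LinearMap.congr_fun hσ p

theorem exists_arcFrame {I : CurveDomain} {e₁ e₂ : Jet I.bc}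
    (unit : ∀ x, Jet.d 0 e₁ x ^ 2 + Jet.d 0 e₂ x ^ 2 = 1) (h₁ : closing I e₁ = 0)
    (h₂ : closing I e₂ = 0) : ∃ e : ArcFrame I, e.e₁ = e₁ ∧ e.e₂ = e₂ := by
  obtain ⟨s₁, s₂, hs⟩ : ∃ s₁ s₂ : Jet I.bc, ∀ f g : Jet I.bc,
      (closing I (-e₂ * (closing I f • s₁ + closing I g • s₂)),
        closing I (e₁ * (closing I f • s₁ + closing I g • s₂))) = (closing I f, closing I g) := by
    cases I
    · exact ⟨0, 0, fun f g => rfl⟩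
    · obtain ⟨s₁, s₂, h⟩ := Jet.exists_integral_section (bc := some 1) unit h₁ h₂
      exact ⟨s₁, s₂, fun f g => h (closing .circle f, closing .circle g)⟩
  set S := ‖Jet.d 0 s₁‖ + ‖Jet.d 0 s₂‖ with hS
  have hS0 : 0 ≤ S := by positivity
  -- The square is needed because `prod_small` contains `S² ε`; `η = ε / 8` is then the largest
  -- value allowed by `η_le`.
  set ε := (16 * (1 + S) ^ 2)⁻¹ with hε
  have hε0 : 0 < ε := by positivity
  have hε1 : 16 * (1 + S) ^ 2 * ε = 1 := mul_inv_cancel₀ (by positivity)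
  have h3 : 0 ≤ S * ε := by positivity
  have h4 : 0 ≤ S * (S * ε) := by positivity
  refine ⟨⟨e₁, e₂, s₁, s₂, S, ε, ε / 8, unit, h₁, h₂, fun x => add_le_add
    ((Jet.d 0 s₁).norm_coe_le_norm x) ((Jet.d 0 s₂).norm_coe_le_norm x), hS0, by positivity,
    by linarith, by nlinarith, by nlinarith, by nlinarith, fun a => hs _ _, fun b => hs _ _⟩,
    rfl, rfl⟩

namespace ArcFrame

variable {I : CurveDomain} (e : ArcFrame I)

open CurveSpace

/-- The projection to the kernel of `κ`. -/
def kerProj : Jet I.bc →ₗ[ℝ] Jet I.bc := LinearMap.id - e.σ ∘ₗ e.κ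

theorem kerProj_apply (b : Jet I.bc) : e.kerProj b = b - e.σ (e.κ b) := rfl

theorem isTameLinear_kerProj : IsTameLinear e.kerProj :=
  isTameLinear_id.sub (e.isTameLinear_σ.comp e.isTameLinear_κ)

theorem kerProj_mem (b : Jet I.bc) : e.kerProj b ∈ LinearMap.ker e.κ := by
  rw [LinearMap.mem_ker, kerProj_apply, map_sub, κ_σ_κ, sub_self]

theorem kerProj_of_mem {b : Jet I.bc} (hb : b ∈ LinearMap.ker e.κ) : e.kerProj b = b := by
  rw [kerProj_apply, LinearMap.mem_ker.1 hb, map_zero, sub_zero]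

theorem isTameFrechetSpace_ker : IsTameFrechetSpace (LinearMap.ker e.κ) :=
  Jet.isTameFrechetSpace.of_projection _ e.isTameLinear_kerProj e.kerProj_mem
    fun _ h => e.kerProj_of_mem h

/-- The tangential component of the velocity. -/
def along : CurveSpace I →ₗ[ℝ] Jet I.bc :=
  Jet.mulₗ e.e₁ ∘ₗ velocity 0 + Jet.mulₗ e.e₂ ∘ₗ velocity 1

/-- The normal component of the velocity. -/
def across : CurveSpace I →ₗ[ℝ] Jet I.bc :=
  Jet.mulₗ e.e₁ ∘ₗ velocity 1 - Jet.mulₗ e.e₂ ∘ₗ velocity 0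

theorem along_apply (γ : CurveSpace I) :
    e.along γ = e.e₁ * velocity 0 γ + e.e₂ * velocity 1 γ := rfl

theorem across_apply (γ : CurveSpace I) :
    e.across γ = e.e₁ * velocity 1 γ - e.e₂ * velocity 0 γ := rfl

theorem isTameLinear_along : IsTameLinear e.along :=
  ((isTameLinear_mul _).comp (isTameLinear_velocity 0)).add
    ((isTameLinear_mul _).comp (isTameLinear_velocity 1))

theorem isTameLinear_across : IsTameLinear e.across :=
  ((isTameLinear_mul _).comp (isTameLinear_velocity 1)).sub
    ((isTameLinear_mul _).comp (isTameLinear_velocity 0))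

theorem velocity_zero_eq (γ : CurveSpace I) :
    velocity 0 γ = e.along γ * e.e₁ - e.across γ * e.e₂ := Jet.ext_zero fun x => by
  rw [along_apply, across_apply]
  simp only [map_sub, map_add, Jet.d_zero_mul, ContinuousMap.sub_apply, ContinuousMap.add_apply]
  linear_combination -Jet.d 0 (velocity 0 γ) x * e.unit x

theorem velocity_one_eq (γ : CurveSpace I) :
    velocity 1 γ = e.along γ * e.e₂ + e.across γ * e.e₁ := Jet.ext_zero fun x => by
  rw [along_apply, across_apply]
  simp only [map_sub, map_add, Jet.d_zero_mul, ContinuousMap.sub_apply, ContinuousMap.add_apply]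
  linear_combination -Jet.d 0 (velocity 1 γ) x * e.unit x

theorem d_speedSq (γ : CurveSpace I) (x : Icc (0 : ℝ) 1) :
    Jet.d 0 (speedSq γ) x = Jet.d 0 (e.along γ) x ^ 2 + Jet.d 0 (e.across γ) x ^ 2 := by
  rw [speedSq, e.velocity_zero_eq γ, e.velocity_one_eq γ]
  simp only [map_sub, map_add, Jet.d_zero_mul, ContinuousMap.sub_apply, ContinuousMap.add_apply]
  linear_combination (Jet.d 0 (e.along γ) x ^ 2 + Jet.d 0 (e.across γ) x ^ 2) * e.unit x

/-- The closing condition in terms of the components of the velocity. -/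
theorem μ_add_κ (a b : Jet I.bc) : e.μ a + e.κ b =
    (closing I (a * e.e₁ - b * e.e₂), closing I (a * e.e₂ + b * e.e₁)) := by
  rw [μ_apply, κ_apply, Prod.mk_add_mk, ← map_add, ← map_add]
  refine congrArg₂ Prod.mk (congrArg (closing I) (Jet.ext_zero fun x => ?_))
    (congrArg (closing I) (Jet.ext_zero fun x => ?_))
  · simp only [map_sub, map_add, map_neg, Jet.d_zero_mul, ContinuousMap.sub_apply,
      ContinuousMap.add_apply, ContinuousMap.neg_apply]
    ring
  · simp only [map_add, Jet.d_zero_mul, ContinuousMap.add_apply]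
    ring

theorem μ_along_add_κ_across (γ : CurveSpace I) : e.μ (e.along γ) + e.κ (e.across γ) = 0 := by
  rw [μ_add_κ, ← velocity_zero_eq, ← velocity_one_eq, closing_velocity, closing_velocity]
  rfl

/-- The curve whose velocity has the given components. -/
def build (a b : Jet I.bc) : CurveSpace I := primitive (a * e.e₁ - b * e.e₂, a * e.e₂ + b * e.e₁)

/-- The hypothesis is the closing condition for `a e + b e^⊥`, under which `primitive` makes no
correction. -/
theorem velocity_build {a b : Jet I.bc} (h : e.μ a + e.κ b = 0) :
    velocity 0 (e.build a b) = a * e.e₁ - b * e.e₂ ∧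
      velocity 1 (e.build a b) = a * e.e₂ + b * e.e₁ := by
  rw [μ_add_κ] at h
  exact ⟨(velocity_zero_primitive _).trans (sub_const_closing (congrArg Prod.fst h)),
    (velocity_one_primitive _).trans (sub_const_closing (congrArg Prod.snd h))⟩

theorem along_build {a b : Jet I.bc} (h : e.μ a + e.κ b = 0) : e.along (e.build a b) = a := by
  rw [along_apply, (e.velocity_build h).1, (e.velocity_build h).2]
  refine Jet.ext_zero fun x => ?_
  simp only [map_sub, map_add, Jet.d_zero_mul, ContinuousMap.sub_apply, ContinuousMap.add_apply]
  linear_combination Jet.d 0 a x * e.unit x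

theorem across_build {a b : Jet I.bc} (h : e.μ a + e.κ b = 0) : e.across (e.build a b) = b := by
  rw [across_apply, (e.velocity_build h).1, (e.velocity_build h).2]
  refine Jet.ext_zero fun x => ?_
  simp only [map_sub, map_add, Jet.d_zero_mul, ContinuousMap.sub_apply, ContinuousMap.add_apply]
  linear_combination Jet.d 0 b x * e.unit x

theorem build_along_across (γ : CurveSpace I) : e.build (e.along γ) (e.across γ) = γ := by
  rw [build, ← velocity_zero_eq, ← velocity_one_eq, primitive_velocity]

/-! ### The chart -/

/-- The closed part of the normal component, and the relative speed. -/
def toArc (γ : CurveSpace I) : LinearMap.ker e.κ × Jet I.bc :=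
  (e.kerProj.codRestrict _ e.kerProj_mem (e.across γ), speed γ - Jet.const 1)

/-- The components as a pair of functions. -/
def pair (y : LinearMap.ker e.κ × Jet I.bc) : Jet I.bc × Jet I.bc := (y.1.1, y.2)

/-- The inverse of `toArc`. -/
def ofArc (y : LinearMap.ker e.κ × Jet I.bc) : CurveSpace I :=
  e.build (e.tangent (e.pair y)) (e.normal (e.pair y) (e.fix (e.pair y)))

/-- The domain of `toArc`. -/
def arcSource : Set (CurveSpace I) :=
  Immersions I ∩ {γ | e.along γ ∈ Jet.positive I.bc ∧ ‖e.κ (e.across γ)‖ < e.ε} ∩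
    (Immersions I ∩ (fun γ => e.pair (e.toArc γ)) ⁻¹' e.small)

/-- The image of `toArc`. -/
def arcTarget : Set (LinearMap.ker e.κ × Jet I.bc) := e.pair ⁻¹' e.small

theorem tameC_pair (n : ℕ) {U : Set (LinearMap.ker e.κ × Jet I.bc)} (hU : IsOpen U) :
    TameC n e.pair U :=
  (((TameC.id _).fst hU).linear_comp (isTameLinear_subtype (LinearMap.ker e.κ)) hU).prodMk
    ((TameC.id _).snd hU)

theorem tameC_toArc (n : ℕ) : TameC n e.toArc (Immersions I) := by
  have hU := (Immersions I).isOpen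
  exact ((TameC.linear e.isTameLinear_across _).linear_comp
    (e.isTameLinear_kerProj.codRestrict _ _) hU).prodMk
    ((tameC_speed n).sub hU (TameC.const _ _))

theorem isOpen_arcSource : IsOpen e.arcSource := by
  refine ((Immersions I).isOpen.inter ((Jet.isOpen_positive.preimage
    e.isTameLinear_along.continuous).inter (isOpen_Iio.preimage
      (continuous_norm.comp (e.isTameLinear_κ.comp e.isTameLinear_across).continuous)))).inter ?_
  have h : TameC 0 (fun γ => e.pair (e.toArc γ)) (Immersions I) :=
    (e.tameC_pair 0 isOpen_univ).comp (Immersions I).isOpen isOpen_univ (e.tameC_toArc 0)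
      fun _ _ => mem_univ _
  exact h.isTameOn.1.isOpen_inter_preimage (Immersions I).isOpen e.isOpen_small

theorem isOpen_arcTarget : IsOpen e.arcTarget :=
  e.isOpen_small.preimage (continuousOn_univ.1 (e.tameC_pair 0 isOpen_univ).isTameOn.1)

theorem tameSmooth_toArc : TameSmooth e.toArc e.arcSource := fun n =>
  (e.tameC_toArc n).mono (inter_subset_left.trans inter_subset_left)

theorem tameSmooth_ofArc : TameSmooth e.ofArc e.arcTarget := fun n => by
  have hU := e.isOpen_arcTarget
  have hp := e.tameC_pair n hU
  have ha := (tameC_tangent (tameC_fix (e := e) n)).comp hU e.isOpen_small hp fun _ h => h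
  have hb := (tameC_normal e.isOpen_small (tameC_fix (e := e) n)).comp hU e.isOpen_small hp
    fun _ h => h
  exact (((ha.mul hU (TameC.const _ _)).sub hU (hb.mul hU (TameC.const _ _))).prodMk
    ((ha.mul hU (TameC.const _ _)).add hU (hb.mul hU (TameC.const _ _)))).linear_comp
    isTameLinear_primitive hU

variable {e}

/-- The fixed point is minus a value of `μ`, and on such values `σ` is a right inverse of `κ`; the
remaining normal component lies in `ker κ`. So the fixed point equation is the closing condition. -/
theorem closing_eq {y : LinearMap.ker e.κ × Jet I.bc} (hy : y ∈ e.arcTarget) :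
    e.κ (e.normal (e.pair y) (e.fix (e.pair y))) = e.fix (e.pair y) ∧
    e.μ (e.tangent (e.pair y)) + e.κ (e.normal (e.pair y) (e.fix (e.pair y))) = 0 := by
  have h1 : e.fix (e.pair y) = -e.μ (e.tangent (e.pair y)) := (Φ_fix hy).symm
  have h2 : e.κ (e.σ (e.fix (e.pair y))) = e.fix (e.pair y) := by
    conv_lhs => rw [h1, ← map_neg, κ_σ_μ, map_neg, ← h1]
  have h3 : e.κ (e.normal (e.pair y) (e.fix (e.pair y))) = e.fix (e.pair y) := by
    rw [normal, map_add, h2]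
    have : e.κ (e.pair y).1 = 0 := y.1.2
    rw [this, zero_add]
  refine ⟨h3, ?_⟩
  rw [h3, add_comm]
  exact eq_neg_iff_add_eq_zero.1 h1

end ArcFrame

namespace ArcFrame

variable {I : CurveDomain} {e : ArcFrame I}

open CurveSpace

theorem along_ofArc {y : LinearMap.ker e.κ × Jet I.bc} (hy : y ∈ e.arcTarget) :
    e.along (e.ofArc y) = e.tangent (e.pair y) := e.along_build (closing_eq hy).2

theorem across_ofArc {y : LinearMap.ker e.κ × Jet I.bc} (hy : y ∈ e.arcTarget) :
    e.across (e.ofArc y) = e.normal (e.pair y) (e.fix (e.pair y)) :=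
  e.across_build (closing_eq hy).2

theorem one_add_pos {y : LinearMap.ker e.κ × Jet I.bc} (hy : y ∈ e.arcTarget)
    (x : Icc (0 : ℝ) 1) : 0 < 1 + Jet.d 0 y.2 x := by
  have h1 : |Jet.d 0 y.2 x| ≤ e.η := abs_snd_le (y := e.pair y) hy x
  linarith [(abs_le.1 h1).1, e.η_small]

/-- The tangential component was defined so that its square and that of the normal component add up
to the prescribed squared speed. -/
theorem d_speedSq_ofArc {y : LinearMap.ker e.κ × Jet I.bc} (hy : y ∈ e.arcTarget)
    (x : Icc (0 : ℝ) 1) : Jet.d 0 (speedSq (e.ofArc y)) x = (1 + Jet.d 0 y.2 x) ^ 2 := by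
  have h1 := tangentSq_mem (y := e.pair y) hy (norm_fix_le hy)
  rw [e.d_speedSq, along_ofArc hy, across_ofArc hy, tangent, Jet.d_zero_sqrt h1,
    Real.sq_sqrt (h1 x).le, d_tangentSq, sub_add_cancel]
  rfl

theorem ofArc_mem_immersions {y : LinearMap.ker e.κ × Jet I.bc} (hy : y ∈ e.arcTarget) :
    e.ofArc y ∈ Immersions I := mem_immersions_iff.2 fun x => by
  rw [d_speedSq_ofArc hy]
  exact pow_pos (one_add_pos hy x) 2

theorem speed_ofArc {y : LinearMap.ker e.κ × Jet I.bc} (hy : y ∈ e.arcTarget) :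
    speed (e.ofArc y) = Jet.const 1 + y.2 := Jet.ext_zero fun x => by
  rw [speed, Jet.d_zero_sqrt (mem_immersions_iff.1 (ofArc_mem_immersions hy)), d_speedSq_ofArc hy,
    Real.sqrt_sq (one_add_pos hy x).le, map_add, ContinuousMap.add_apply, Jet.d_zero_const]

theorem toArc_ofArc {y : LinearMap.ker e.κ × Jet I.bc} (hy : y ∈ e.arcTarget) :
    e.toArc (e.ofArc y) = y := by
  refine Prod.ext (Subtype.ext ?_) ?_
  · change e.kerProj (e.across (e.ofArc y)) = y.1
    rw [kerProj_apply, across_ofArc hy, (closing_eq hy).1, normal, add_sub_cancel_right]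
    rfl
  · change speed (e.ofArc y) - Jet.const 1 = y.2
    rw [speed_ofArc hy, add_sub_cancel_left]

theorem ofArc_mem {y : LinearMap.ker e.κ × Jet I.bc} (hy : y ∈ e.arcTarget) :
    e.ofArc y ∈ e.arcSource := by
  have h1 := ofArc_mem_immersions hy
  refine ⟨⟨h1, ?_, ?_⟩, h1, ?_⟩
  · rw [along_ofArc hy]
    exact tangent_mem hy
  · rw [across_ofArc hy, (closing_eq hy).1]
    exact norm_fix_lt hy
  · change e.pair (e.toArc (e.ofArc y)) ∈ e.small
    rw [toArc_ofArc hy]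
    exact hy

theorem normal_toArc (γ : CurveSpace I) :
    e.normal (e.pair (e.toArc γ)) (e.κ (e.across γ)) = e.across γ := by
  change e.kerProj (e.across γ) + e.σ (e.κ (e.across γ)) = e.across γ
  rw [kerProj_apply, sub_add_cancel]

/-- Positivity of the tangential component in `arcSource` selects the right square root. -/
theorem sqrt_tangentSq_toArc {γ : CurveSpace I} (hγ : γ ∈ e.arcSource) :
    Jet.sqrt (e.tangentSq (e.pair (e.toArc γ)) (e.κ (e.across γ))) = e.along γ := by
  obtain ⟨⟨h1, h2, h3⟩, -, h4⟩ := hγ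
  refine Jet.ext_zero fun x => ?_
  have h5 : Jet.d 0 (e.pair (e.toArc γ)).2 x = Jet.d 0 (speed γ) x - 1 := by
    change Jet.d 0 (speed γ - Jet.const 1) x = _
    rw [map_sub, ContinuousMap.sub_apply, Jet.d_zero_const]
  rw [Jet.d_zero_sqrt (tangentSq_mem h4 (le_of_lt h3)), d_tangentSq, normal_toArc, h5,
    add_sub_cancel, d_zero_speed h1, ← d_zero_speedSq, e.d_speedSq, add_sub_cancel_right,
    Real.sqrt_sq (h2 x).le]

/-- The closing condition of `γ` says that `κ (across γ)` is a fixed point; the bound `ε` in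
`arcSource` places it in the ball where the fixed point is unique. -/
theorem fix_toArc {γ : CurveSpace I} (hγ : γ ∈ e.arcSource) :
    e.fix (e.pair (e.toArc γ)) = e.κ (e.across γ) := by
  refine (eq_fix hγ.2.2 (le_of_lt hγ.1.2.2) ?_).symm
  rw [Φ, sqrt_tangentSq_toArc hγ]
  exact neg_eq_of_add_eq_zero_right (e.μ_along_add_κ_across γ)

theorem ofArc_toArc {γ : CurveSpace I} (hγ : γ ∈ e.arcSource) : e.ofArc (e.toArc γ) = γ := by
  rw [ofArc, tangent, fix_toArc hγ, sqrt_tangentSq_toArc hγ, normal_toArc, build_along_across]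

variable (e)

/-- The chart given by the closed part of the normal component and the relative speed. -/
def arcHomeo : OpenPartialHomeomorph (CurveSpace I) (LinearMap.ker e.κ × Jet I.bc) :=
  tameHomeo e.isOpen_arcSource e.isOpen_arcTarget e.tameSmooth_toArc e.tameSmooth_ofArc
    (fun _ h => h.2.2) (fun _ h => ofArc_mem h) (fun _ h => ofArc_toArc h)
    (fun _ h => toArc_ofArc h)

end ArcFrame

/-! ### Splitting the speed into its mean and a part of mean zero -/

namespace Jet

variable {bc : Option ℝ} [Unital bc]

/-- The projection to the functions with integral zero. -/
def meanFree : Jet bc →ₗ[ℝ] Jet bc := LinearMap.id - integral.smulRight (const 1)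

theorem meanFree_apply (f : Jet bc) : meanFree f = f - integral f • const 1 := rfl

theorem isTameLinear_meanFree : IsTameLinear (meanFree (bc := bc)) :=
  isTameLinear_id.sub (isTameLinear_integral.smul_const _)

theorem meanFree_mem (f : Jet bc) : meanFree f ∈ LinearMap.ker (integral (bc := bc)) := by
  rw [LinearMap.mem_ker, meanFree_apply, map_sub, map_smul, integral_const, smul_eq_mul, mul_one,
    sub_self]

theorem meanFree_of_mem {f : Jet bc} (hf : f ∈ LinearMap.ker (integral (bc := bc))) :
    meanFree f = f := by
  rw [meanFree_apply, LinearMap.mem_ker.1 hf, zero_smul, sub_zero]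

theorem isTameFrechetSpace_ker_integral :
    IsTameFrechetSpace (LinearMap.ker (integral (bc := bc))) :=
  isTameFrechetSpace.of_projection _ isTameLinear_meanFree meanFree_mem
    fun _ h => meanFree_of_mem h

end Jet

namespace ArcFrame

variable {I : CurveDomain} (e : ArcFrame I)

open CurveSpace

/-- The mean of the relative speed as a separate coordinate. -/
def splitMean : LinearMap.ker e.κ × Jet I.bc →ₗ[ℝ]
    (LinearMap.ker e.κ × LinearMap.ker (Jet.integral (bc := I.bc))) × ℝ :=
  ((LinearMap.fst ℝ _ _).prod
    (Jet.meanFree.codRestrict _ Jet.meanFree_mem ∘ₗ LinearMap.snd ℝ _ _)).prod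
    (Jet.integral ∘ₗ LinearMap.snd ℝ _ _)

/-- The inverse of `splitMean`. -/
def joinMean : (LinearMap.ker e.κ × LinearMap.ker (Jet.integral (bc := I.bc))) × ℝ →ₗ[ℝ]
    LinearMap.ker e.κ × Jet I.bc :=
  (LinearMap.fst ℝ _ _ ∘ₗ LinearMap.fst ℝ _ _).prod
    (Submodule.subtype _ ∘ₗ LinearMap.snd ℝ _ _ ∘ₗ LinearMap.fst ℝ _ _ +
      (LinearMap.snd ℝ _ ℝ).smulRight (Jet.const 1))

theorem isTameLinear_splitMean : IsTameLinear e.splitMean :=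
  (isTameLinear_fst.prod ((Jet.isTameLinear_meanFree.codRestrict _ _).comp isTameLinear_snd)).prod
    (Jet.isTameLinear_integral.comp isTameLinear_snd)

theorem isTameLinear_joinMean : IsTameLinear e.joinMean :=
  (isTameLinear_fst.comp isTameLinear_fst).prod
    (((isTameLinear_subtype _).comp (isTameLinear_snd.comp isTameLinear_fst)).add
      (isTameLinear_snd.smul_const _))

theorem joinMean_splitMean (y : LinearMap.ker e.κ × Jet I.bc) : e.joinMean (e.splitMean y) = y := by
  refine Prod.ext rfl ?_
  change Jet.meanFree y.2 + Jet.integral y.2 • Jet.const 1 = y.2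
  rw [Jet.meanFree_apply, sub_add_cancel]

theorem splitMean_joinMean (z : (LinearMap.ker e.κ × LinearMap.ker (Jet.integral (bc := I.bc))) × ℝ) :
    e.splitMean (e.joinMean z) = z := by
  have h : Jet.integral (z.1.2.1 + z.2 • Jet.const 1) = z.2 := by
    rw [map_add, map_smul, Jet.integral_const, LinearMap.mem_ker.1 z.1.2.2, zero_add, smul_eq_mul,
      mul_one]
  refine Prod.ext (Prod.ext rfl (Subtype.ext ?_)) h
  change Jet.meanFree (z.1.2.1 + z.2 • Jet.const 1) = z.1.2.1
  rw [Jet.meanFree_apply, h, add_sub_cancel_right]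

theorem isOpen_meanTarget : IsOpen (e.joinMean ⁻¹' e.arcTarget) :=
  e.isOpen_arcTarget.preimage e.isTameLinear_joinMean.continuous

theorem tameSmooth_toMean : TameSmooth (fun γ => e.splitMean (e.toArc γ)) e.arcSource := fun n =>
  (e.tameSmooth_toArc n).linear_comp e.isTameLinear_splitMean e.isOpen_arcSource

theorem tameSmooth_ofMean :
    TameSmooth (fun z => e.ofArc (e.joinMean z)) (e.joinMean ⁻¹' e.arcTarget) :=
  TameSmooth.comp e.isOpen_meanTarget e.isOpen_arcTarget e.tameSmooth_ofArc
    (fun _ => TameC.linear e.isTameLinear_joinMean _) fun _ h => h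

/-- The chart `arcHomeo` with the mean of the relative speed as a separate coordinate. -/
def meanHomeo : OpenPartialHomeomorph (CurveSpace I)
    ((LinearMap.ker e.κ × LinearMap.ker (Jet.integral (bc := I.bc))) × ℝ) :=
  tameHomeo e.isOpen_arcSource e.isOpen_meanTarget e.tameSmooth_toMean e.tameSmooth_ofMean
    (fun γ h => by
      change e.joinMean (e.splitMean (e.toArc γ)) ∈ e.arcTarget
      rw [joinMean_splitMean]
      exact h.2.2)
    (fun _ h => ofArc_mem h)
    (fun γ h => by rw [joinMean_splitMean, ofArc_toArc h])
    (fun z h => by rw [toArc_ofArc h, splitMean_joinMean])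

end ArcFrame

/-! ### The submanifolds of arc length curves -/

open CurveSpace

theorem mem_arcLength_iff {I : CurveDomain} {γ : Immersions I} :
    γ ∈ ArcLength I ↔ speed γ.1 = Jet.const 1 := by
  refine ⟨fun h => Jet.ext_zero fun s => ?_, fun h s => ?_⟩
  · rw [d_zero_speed γ.2, Jet.d_zero_const, h s]
  · rw [← d_zero_speed γ.2, h, Jet.d_zero_const]

theorem arcLength_subset_lengthOne (I : CurveDomain) : ArcLength I ⊆ LengthOne I := fun γ h => by
  rw [mem_lengthOne_iff, length, mem_arcLength_iff.1 h, Jet.integral_const]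

theorem isClosed_arcLength (I : CurveDomain) : IsClosed (ArcLength I) := by
  have hc : Continuous fun γ : Immersions I => speed γ.1 :=
    continuousOn_iff_continuous_domRestrict.1 (tameC_speed 0).isTameOn.1
  have : ArcLength I = (fun γ : Immersions I => speed γ.1) ⁻¹' {Jet.const 1} :=
    Set.ext fun γ => mem_arcLength_iff
  rw [this]
  exact isClosed_singleton.preimage hc

/-- The frame is the velocity of `γ` itself: then the tangential component is `1`, the normal one is
`0`, and `γ` is sent to the origin of the chart. -/
theorem exists_arcFrame_of_mem {I : CurveDomain} {γ : Immersions I} (hγ : γ ∈ ArcLength I) :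
    ∃ e : ArcFrame I, γ.1 ∈ e.arcSource := by
  have hunit : ∀ x, Jet.d 0 (velocity 0 γ.1) x ^ 2 + Jet.d 0 (velocity 1 γ.1) x ^ 2 = 1 := fun x => by
    have h1 := d_zero_speedSq γ.1 x
    rw [hγ x, speedSq, map_add, ContinuousMap.add_apply, Jet.d_zero_mul, Jet.d_zero_mul] at h1
    linarith
  obtain ⟨e, h0, h1⟩ := exists_arcFrame hunit (closing_velocity 0 γ.1) (closing_velocity 1 γ.1)
  have hal : e.along γ.1 = Jet.const 1 := Jet.ext_zero fun x => by
    rw [e.along_apply, h0, h1, map_add, ContinuousMap.add_apply, Jet.d_zero_mul, Jet.d_zero_mul,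
      Jet.d_zero_const]
    linear_combination hunit x
  have hac : e.across γ.1 = 0 := Jet.ext_zero fun x => by
    rw [e.across_apply, h0, h1, map_sub, ContinuousMap.sub_apply, Jet.d_zero_mul, Jet.d_zero_mul,
      map_zero, ContinuousMap.zero_apply]
    ring
  have hpair : e.pair (e.toArc γ.1) = 0 := by
    refine Prod.ext ?_ ?_
    · change e.kerProj (e.across γ.1) = 0
      rw [hac, map_zero]
    · change speed γ.1 - Jet.const 1 = 0
      rw [mem_arcLength_iff.1 hγ, sub_self]
  refine ⟨e, ⟨γ.2, ?_, ?_⟩, γ.2, ?_⟩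
  · rw [hal]
    intro x
    rw [Jet.d_zero_const]
    exact one_pos
  · rw [hac, map_zero, norm_zero]
    exact ArcFrame.ε_pos
  · change e.pair (e.toArc γ.1) ∈ e.small
    rw [hpair]
    constructor
    · change gnorm 0 (0 : Jet I.bc) < e.η
      rw [gnorm_zero]
      exact e.η_pos
    · change gnorm 0 (0 : Jet I.bc) < e.η
      rw [gnorm_zero]
      exact e.η_pos

theorem isSliceChart_arcLength {I : CurveDomain} (e : ArcFrame I) (γ : Immersions I) :
    IsSliceChart (immersionAtlas I) (ArcLength I)
      ⟨LinearMap.ker e.κ, Jet I.bc, (inclusionHomeo γ).trans e.arcHomeo⟩ :=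
  isSliceChart_restrict e.isTameFrechetSpace_ker Jet.isTameFrechetSpace e.arcHomeo
    e.tameSmooth_toArc e.tameSmooth_ofArc (fun _ h => h.1.1)
    (fun _ _ => mem_arcLength_iff.trans sub_eq_zero.symm) γ

theorem isTameSubmanifold_arcLength (I : CurveDomain) :
    IsTameSubmanifold (immersionAtlas I) (ArcLength I) :=
  ⟨isClosed_arcLength I, fun γ hγ => by
    obtain ⟨e, he⟩ := exists_arcFrame_of_mem hγ
    exact ⟨_, isSliceChart_arcLength e γ, mem_univ _, he⟩⟩

/-- The last coordinate is the integral of `speed - 1`, that is, the length minus one. Unlike the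
radial chart, this one also straightens the arc length curves. -/
theorem isSliceChart_lengthOne {I : CurveDomain} (e : ArcFrame I) (γ : Immersions I) :
    IsSliceChart (immersionAtlas I) (LengthOne I)
      ⟨LinearMap.ker e.κ × LinearMap.ker (Jet.integral (bc := I.bc)), ℝ,
        (inclusionHomeo γ).trans e.meanHomeo⟩ := by
  refine isSliceChart_restrict (e.isTameFrechetSpace_ker.prod Jet.isTameFrechetSpace_ker_integral)
    isTameFrechetSpace_real e.meanHomeo
    e.tameSmooth_toMean e.tameSmooth_ofMean (fun _ h => h.1.1) (fun η _ => ?_) γ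
  change _ ↔ Jet.integral (speed η.1 - Jet.const 1) = 0
  rw [mem_lengthOne_iff, map_sub, Jet.integral_const, sub_eq_zero]
  rfl

/-- The chart that `meanHomeo` induces on the curves of length one has the mean-free part of `speed
- 1` as second coordinate. On such curves `speed - 1` already has mean zero, so this coordinate
vanishes exactly for unit speed. -/
theorem isTameSubmanifold_arcLength_lengthOne (I : CurveDomain) :
    IsTameSubmanifold (inducedAtlas (immersionAtlas I) (LengthOne I))
      ((Subtype.val : LengthOne I → Immersions I) ⁻¹' ArcLength I) := by
  refine ⟨(isClosed_arcLength I).preimage continuous_subtype_val, fun γ hγ => ?_⟩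
  obtain ⟨e, he⟩ := exists_arcFrame_of_mem hγ
  have hc := isSliceChart_lengthOne e γ.1
  obtain ⟨ψ, h1, h2⟩ := hc.exists_induced γ
  have hF := e.isTameFrechetSpace_ker
  have hG := Jet.isTameFrechetSpace_ker_integral (bc := I.bc)
  refine ⟨⟨LinearMap.ker e.κ, LinearMap.ker (Jet.integral (bc := I.bc)), ψ⟩,
    ⟨⟨hF.prod hG, fun d hd => ?_⟩, hF, hG, fun η hη => ?_⟩, ?_⟩
  · exact (isTameFrechetManifold_inducedAtlas (isTameSubmanifold_lengthOne I)).compatible _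
      ⟨_, hc, ψ, h1, h2, rfl⟩ _ hd
  · have h3 : Jet.meanFree (speed η.1.1 - Jet.const 1) = (ψ η).2.1 :=
      congrArg (fun z => (z.1.2 : Jet I.bc)) (h2 η hη)
    have h4 : length η.1.1 = 1 := mem_lengthOne_iff.1 η.2
    rw [Jet.meanFree_of_mem (by
      rw [LinearMap.mem_ker, map_sub, Jet.integral_const, sub_eq_zero]; exact h4)] at h3
    change η.1 ∈ ArcLength I ↔ (ψ η).2 = 0
    rw [mem_arcLength_iff, ← sub_eq_zero, h3, Submodule.coe_eq_zero]
  · change γ ∈ ψ.source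
    rw [h1]
    exact ⟨mem_univ _, he⟩

/-! ### The tangent space -/

theorem continuous_deriv_apply {I : CurveDomain} (s : Icc (0 : ℝ) 1) :
    Continuous fun γ : CurveSpace I => γ.deriv s :=
  (continuous_eval_const s).comp (continuous_deriv I)

theorem Jet.continuous_d_apply {bc : Option ℝ} [Jet.Unital bc] (s : Icc (0 : ℝ) 1) :
    Continuous fun f : Jet bc => Jet.d 0 f s :=
  (isTameLinear_of_abs_le (l := (ContinuousMap.evalCLM ℝ s).toLinearMap ∘ₗ Jet.d 0) 0 1 zero_le_one
    fun f => by
      rw [Jet.gnorm_zero_eq, one_mul]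
      exact (Jet.d 0 f).norm_coe_le_norm s).continuous

/-- In the slice chart that witnesses tangency, the line through the image of `γ` in the direction
`(y, 0)` pulls back to a path of arc length curves with derivative `w` at `γ`. Differentiating the
constant squared speed along this path gives the claim. -/
theorem inner_eq_zero_of_mem_curveTangent {I : CurveDomain} {γ : Immersions I} (hγ : γ ∈ ArcLength I)
    {w : CurveSpace I} (hw : w ∈ curveTangent I (ArcLength I) γ) (s : Icc (0 : ℝ) 1) :
    inner ℝ (w.deriv s) (γ.1.deriv s) = 0 := by
  obtain ⟨c, hc, hγc, y, hd⟩ := hw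
  have := hc.tame_fst.gradedLC
  have := hc.tame_snd.gradedLC
  have hP0 : c.homeo ((inclusionHomeo γ).symm γ.1) = c.homeo γ := by
    rw [inclusionHomeo_symm_coe]
  have hQ : TameSmooth (fun y => (c.homeo.symm y : CurveSpace I)) c.homeo.target :=
    tameSmooth_chart_symm hc.mem_maximalAtlas
  obtain ⟨DQ, hDQ, hDQs⟩ := hQ.exists_deriv c.homeo.open_target
  have htarget := c.homeo.map_source hγc
  have hcomp := HasDirDeriv.comp c.homeo.open_target hDQ (hDQs 0).isTameOn.1
    (Q := fun f => c.homeo ((inclusionHomeo γ).symm f)) (f := γ.1) (by rw [hP0]; exact htarget) hd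
  have hid := hcomp.congr (Q := fun f => f)
    ((inclusionHomeo γ).symm.trans c.homeo).open_source
    (mem_symm_trans_source.2 ⟨γ.2, hγc⟩) fun f hf => by
      obtain ⟨h1, h2⟩ := mem_symm_trans_source.1 hf
      have h3 := inclusionHomeo_symm_coe γ ⟨f, h1⟩
      change (c.homeo.symm (c.homeo ((inclusionHomeo γ).symm f)) : CurveSpace I) = f
      rw [show (inclusionHomeo γ).symm f = ⟨f, h1⟩ from h3, c.homeo.left_inv h2]
  -- The composite of the chart and its inverse is the identity near `γ`, so the derivative of the
  -- inverse chart sends `(y, 0)` back to `w`.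
  have hw := (hasDirDeriv_linear LinearMap.id γ.1 w).unique hid
  rw [LinearMap.id_apply, hP0] at hw
  have hslice : (c.homeo γ).2 = 0 := (hc.slice γ hγc).1 hγ
  set z := c.homeo γ with hz
  have hline := HasDirDeriv.tendsto_line z (y, (0 : c.G))
  have hη : Tendsto (fun t : ℝ => (c.homeo.symm (z + t • (y, 0)) : CurveSpace I)) (𝓝[≠] 0)
      (𝓝 γ.1) := by
    have h1 := (hQ 0).isTameOn.1.continuousAt (c.homeo.open_target.mem_nhds htarget)
    have h2 := h1.tendsto.comp hline
    rwa [hz, c.homeo.left_inv hγc] at h2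
  have hslope := hDQ z htarget (y, 0)
  rw [← hw] at hslope
  have hslope' := ((continuous_deriv_apply s).tendsto _).comp hslope
  have hsum := (((continuous_deriv_apply s).tendsto _).comp hη).add
    (tendsto_const_nhds (x := γ.1.deriv s))
  have hlim := hslope'.inner hsum (𝕜 := ℝ)
  -- The inner product of the difference quotient of the velocities with their sum is a difference
  -- of squared speeds divided by `t`, hence zero for all small `t ≠ 0`.
  have h0 : inner ℝ (w.deriv s) (γ.1.deriv s + γ.1.deriv s) = 0 := by
    refine tendsto_nhds_unique hlim (tendsto_const_nhds.congr' ?_)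
    filter_upwards [hline.eventually (c.homeo.open_target.mem_nhds htarget)] with t ht
    set η := c.homeo.symm (z + t • (y, 0))
    have hηm : η ∈ ArcLength I := by
      rw [hc.slice η (c.homeo.map_target ht), c.homeo.right_inv ht]
      simp [hslice]
    have h1 : (t⁻¹ • ((η : CurveSpace I) - c.homeo.symm z)).deriv s =
        t⁻¹ • ((η : CurveSpace I).deriv s - γ.1.deriv s) := by
      rw [hz, c.homeo.left_inv hγc, CurveSpace.deriv_smul, CurveSpace.deriv, map_sub]
      rfl
    change 0 = inner ℝ ((t⁻¹ • ((η : CurveSpace I) - c.homeo.symm z)).deriv s)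
      ((η : CurveSpace I).deriv s + γ.1.deriv s)
    rw [h1, real_inner_smul_left, inner_sub_left, inner_add_right, inner_add_right,
      real_inner_self_eq_norm_sq, real_inner_self_eq_norm_sq, hηm s, hγ s,
      real_inner_comm ((η : CurveSpace I).deriv s)]
    ring
  rw [inner_add_right] at h0
  linarith

theorem abs_sqrt_one_add_sub_one_le {a : ℝ} (ha : 0 ≤ a) : |√(1 + a) - 1| ≤ a := by
  have h1 : 1 ≤ √(1 + a) := Real.one_le_sqrt.2 (by linarith)
  have h2 := Real.mul_self_sqrt (by linarith : 0 ≤ 1 + a)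
  rw [abs_of_nonneg (by linarith)]
  nlinarith

/-- Orthogonality gives `|γ' + t w'| = √(1 + t² |w'|²) = 1 + O(t²)`, so the speed coordinate of the
arc length chart has derivative zero in the direction `w`; the other coordinate provides the witness
`y`. -/
theorem mem_curveTangent {I : CurveDomain} {γ : Immersions I} (hγ : γ ∈ ArcLength I)
    {w : CurveSpace I} (hw : ∀ s, inner ℝ (w.deriv s) (γ.1.deriv s) = 0) :
    w ∈ curveTangent I (ArcLength I) γ := by
  obtain ⟨e, he⟩ := exists_arcFrame_of_mem hγ
  have := e.isTameFrechetSpace_ker.gradedLC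
  obtain ⟨DP, hDP, -⟩ := e.tameSmooth_toArc.exists_deriv e.isOpen_arcSource
  have hd := hDP γ.1 he w
  have hz : (DP (γ.1, w)).2 = 0 := Jet.ext_zero fun s => by
    have h1 : Tendsto (fun t : ℝ => t⁻¹ * (‖(γ.1 + t • w).deriv s‖ - 1)) (𝓝[≠] 0)
        (𝓝 (Jet.d 0 (DP (γ.1, w)).2 s)) := by
      have h2 := ((Jet.continuous_d_apply s).tendsto _).comp
        ((continuous_snd.tendsto _).comp hd)
      refine h2.congr' ?_
      filter_upwards [(HasDirDeriv.tendsto_line γ.1 w).eventually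
        ((Immersions I).isOpen.mem_nhds γ.2)] with t ht
      change Jet.d 0 (t⁻¹ • ((speed (γ.1 + t • w) - Jet.const 1) -
        (speed γ.1 - Jet.const 1))) s = _
      rw [map_smul, map_sub, map_sub, map_sub]
      simp only [ContinuousMap.smul_apply, ContinuousMap.sub_apply, smul_eq_mul]
      rw [d_zero_speed ht, d_zero_speed γ.2, hγ s, sub_sub_sub_cancel_right]
    have h3 : Tendsto (fun t : ℝ => t⁻¹ * (‖(γ.1 + t • w).deriv s‖ - 1)) (𝓝[≠] 0) (𝓝 0) := by
      have h4 : Tendsto (fun t : ℝ => |t| * ‖w.deriv s‖ ^ 2) (𝓝[≠] 0) (𝓝 0) := by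
        have : Continuous fun t : ℝ => |t| * ‖w.deriv s‖ ^ 2 := by fun_prop
        simpa using (this.tendsto 0).mono_left nhdsWithin_le_nhds
      refine squeeze_zero_norm' ?_ h4
      filter_upwards [self_mem_nhdsWithin] with t ht
      have ht0 : t ≠ 0 := ht
      have h5 : ‖(γ.1 + t • w).deriv s‖ = √(1 + t ^ 2 * ‖w.deriv s‖ ^ 2) := by
        rw [CurveSpace.deriv_add, CurveSpace.deriv_smul, ContinuousMap.add_apply, ContinuousMap.smul_apply,
          ← Real.sqrt_sq (norm_nonneg _), norm_add_sq_real, real_inner_smul_right,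
          real_inner_comm, hw s, hγ s, norm_smul, mul_pow, Real.norm_eq_abs, sq_abs]
        congr 1
        ring
      rw [h5, norm_mul, norm_inv, Real.norm_eq_abs, Real.norm_eq_abs,
        inv_mul_le_iff₀ (abs_pos.2 ht0), ← mul_assoc, abs_mul_abs_self, ← sq]
      exact abs_sqrt_one_add_sub_one_le (by positivity)
    rw [tendsto_nhds_unique h1 h3, map_zero, ContinuousMap.zero_apply]
  refine ⟨_, isSliceChart_arcLength e γ, ⟨mem_univ _, he⟩, (DP (γ.1, w)).1, ?_⟩
  have h6 : DP (γ.1, w) = ((DP (γ.1, w)).1, 0) := Prod.ext rfl hz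
  rw [h6] at hd
  refine hd.congr e.isOpen_arcSource he fun f hf => ?_
  exact congrArg e.toArc (coe_inclusionHomeo_symm γ hf.1.1).symm

theorem mainTheorem9 (I : CurveDomain) :
    IsTameFrechetManifold (immersionAtlas I) ∧
    IsTameSubmanifold (immersionAtlas I) (ArcLength I) ∧
    (IsTameSubmanifold (immersionAtlas I) (LengthOne I) ∧
      IsTameFrechetManifold (inducedAtlas (immersionAtlas I) (LengthOne I)) ∧
      ArcLength I ⊆ LengthOne I ∧
      IsTameSubmanifold (inducedAtlas (immersionAtlas I) (LengthOne I))
        ((Subtype.val : LengthOne I → Immersions I) ⁻¹' ArcLength I)) ∧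
    ∀ γ ∈ ArcLength I,
      curveTangent I (ArcLength I) γ =
        {w | ∀ s, inner ℝ (w.deriv s) (γ.1.deriv s) = 0} :=
  ⟨isTameFrechetManifold_openAtlas CurveSpace.isTameFrechetSpace, isTameSubmanifold_arcLength I,
    ⟨isTameSubmanifold_lengthOne I,
      isTameFrechetManifold_inducedAtlas (isTameSubmanifold_lengthOne I),
      arcLength_subset_lengthOne I, isTameSubmanifold_arcLength_lengthOne I⟩,
    fun _ hγ => Subset.antisymm (fun _ hw s => inner_eq_zero_of_mem_curveTangent hγ hw s)
      fun _ hw => mem_curveTangent hγ hw⟩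

end
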